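/- **Setting.** Let $S\subset\mathbb C\setminus\{0\}$ be closed and discrete, and let $\operatorname{Star}(S)=\mathbb C\setminus\bigcup_{\alpha\in S}\{r\alpha: r\ge 1\}$. Fix a side $s=\pm1$; the side $s$ of the ray through $p\ne0$ consists of the points near $p$ whose argument is slightly larger ($s=1$), resp. slightly smaller ($s=-1$), than that of $p$. We say that a convergent power series $F$ at $0$ *has only isolated singularities, contained in $S$* (on the side $s$) if - $F$ extends to a holomorphic function (the principal branch) on $\operatorname{Star}(S)$; - for every $p\notin S\cup\{0\}$, the determination of the principal branch on the side $s$ of the ray through $p$ extends holomorphically to a neighbourhood of $p$; - for every $\alpha\in S$, the determination on the side $s$ of the ray through $\alpha$ continues along all paths in some punctured disc centred at $\alpha$; equivalently, in the coordinate $\zeta$ given by $z=\alpha(1-e^{\zeta})$, it becomes a holomorphic function on a half plane $\{\operatorname{Re}\zeta<\rho\}$, the determination on the side $s$ being taken in the strip $|\operatorname{Im}\zeta|<\pi$. (If $\alpha$ is the only point of $S$ on $[0,\alpha]$, the choice of side is irrelevant.) In the coordinate $\zeta$ let $\Sigma_\alpha f(\zeta)=f(\zeta+2\pi i)$ (one positive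 turn around $\alpha$) and $\Delta_\alpha=\Sigma_\alpha-\operatorname{Id}$. The singularity $\alpha$ is *integrable* if $(z-\alpha)F(z)\to0$ as $z\to\alpha$ with $\arg(z-\alpha)$ bounded, i.e. as $\operatorname{Re}\zeta\to-\infty$ with $\operatorname{Im}\zeta$ bounded. For multivalued functions $f$ near $\alpha$ and $g$ near $\beta$ (as above), their integral convolution is the multivalued function near $\gamma=\alpha\beta$ $$ (f\,\bar\star\, g)(z)=-\frac1{2\pi i}\int_\alpha^{z/\beta} f(u)\,g(z/u)\,\frac{du}{u}, $$ an improper integral (at both ends) along the segment $u=\alpha+t(z/\beta-\alpha)$, $0<t<1$. If $z=\gamma(1-e^\zeta)$, the determinations used are those of $f$ at $u=\alpha(1-e^{\xi})$ with $\xi=\zeta+\log t$ and of $g$ at $z/u=\beta(1-e^{\eta})$ with $\eta=\zeta+\log(1-t)-\operatorname{Log}(1-te^\zeta)$. Iterated convolutions are nested to the left: $(\cdots(f_1\bar\star f_2)\bar\star\cdots)\bar\star f_n$. The Hadamard product is the coefficientwise product of power series. **Theorem.** Let $n\ge1$ and let $F_1,\dots,F_n$ be germs of holomorphic functions at $0$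 having only isolated singularities, contained in closed discrete sets $S_1,\dots,S_n\subset\mathbb C\setminus\{0\}$ respectively (on a fixed side $s$), all of them integrable. Then $F_1\odot\cdots\odot F_n$ has only isolated singularities, contained in the product set $S_1\cdots S_n$ (on the side $s$). For every $\gamma\in S_1\cdots S_n$ there are finitely many $(\alpha_1,\dots,\alpha_n)\in S_1\times\cdots\times S_n$ with $\alpha_1\cdots\alpha_n=\gamma$, and there is a punctured disc centred at $\gamma$ (a half plane $\operatorname{Re}\zeta<\rho$) on which, for all these factorizations and all $k\ge0$, the improper integrals in the iterated convolutions $\Delta_{\alpha_1}\Sigma_{\alpha_1}^kF_1\,\bar\star\cdots\bar\star\,\Delta_{\alpha_n}\Sigma_{\alpha_n}^kF_n$ converge, and for every $N\ge1$ $$ (\Sigma_\gamma^N-\operatorname{Id})(F_1\odot\cdots\odot F_n)=\sum_{k=0}^{N-1}\ \sum_{\alpha_1\cdots\alpha_n=\gamma}\Delta_{\alpha_1}\Sigma_{\alpha_1}^kF_1\,\bar\star\cdots\bar\star\,\Delta_{\alpha_n}\Sigma_{\alpha_n}^kF_n . $$ -/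

import Mathlib

open Filter Topology

namespace HadamardMonodromy

noncomputable section

/-! ### Hadamard products, product sets -/

/-- The Hadamard product `F₀ ⊙ F₁ ⊙ ⋯ ⊙ Fₙ` of power series (coefficientwise product). -/
def hadamardProd {n : ℕ} (F : Fin (n + 1) → PowerSeries ℂ) : PowerSeries ℂ :=
  PowerSeries.mk fun k => ∏ j, PowerSeries.coeff k (F j)

/-- The factorizations `α₀ α₁ ⋯ αₙ = γ` with `αⱼ ∈ Sⱼ`. -/
def factorizations {n : ℕ} (S : Fin (n + 1) → Set ℂ) (γ : ℂ) : Set (Fin (n + 1) → ℂ) :=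
  {a | (∀ j, a j ∈ S j) ∧ ∏ j, a j = γ}

/-- The product set `S₀ S₁ ⋯ Sₙ`. -/
def productSet {n : ℕ} (S : Fin (n + 1) → Set ℂ) : Set ℂ :=
  {γ | (factorizations S γ).Nonempty}

/-! ### Principal branches and isolated singularities -/

/-- The star-shaped domain obtained from `ℂ` by removing the radial cuts
`{r α : r ≥ 1}`, `α ∈ S`. -/
def starDomain (S : Set ℂ) : Set ℂ :=
  {z | ∀ t ∈ Set.Icc (0 : ℝ) 1, (t : ℂ) * z ∉ S}

/-- `P` is the principal branch of the germ at `0` with Taylor series `F`: its holomorphic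
continuation to the star domain of `S`. -/
structure IsPrincipalBranch (F : PowerSeries ℂ) (S : Set ℂ) (P : ℂ → ℂ) : Prop where
  differentiableOn : DifferentiableOn ℂ P (starDomain S)
  hasSum : ∀ᶠ z in 𝓝 (0 : ℂ), HasSum (fun k : ℕ => PowerSeries.coeff k F * z ^ k) (P z)

/-- The determination of `P` on the side `s` of the ray through `p` (`s = 1`: arguments slightly
larger than `arg p`; `s = -1`: slightly smaller) extends holomorphically to a neighbourhood
of `p`. -/
def ExtendsAt (s : ℤˣ) (P : ℂ → ℂ) (p : ℂ) : Prop :=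
  ∃ Q : ℂ → ℂ, AnalyticAt ℂ Q p ∧
    ∀ᶠ z in 𝓝 p, 0 < (((s : ℤ) : ℝ)) * (z / p).im → P z = Q z

/-- The universal covering map `ζ ↦ α (1 - exp ζ)` of the punctured discs centred at `α ≠ 0`, from
half planes `{Re ζ < ρ}`. Here `Im ζ` is the argument of `1 - z / α`, with value `0` on the radial
segment from `0` to `α`, and adding `2 π i` to `ζ` is one positive turn around `α`. -/
def chart (α ζ : ℂ) : ℂ := α * (1 - Complex.exp ζ)

/-- `f` is the multivalued function obtained near `α` by continuing, along all paths in a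
punctured disc centred at `α`, the determination of `P` on the side `s` of the ray through `α`,
written in the covering coordinate `ζ`. -/
def IsLocalBranch (s : ℤˣ) (P : ℂ → ℂ) (α : ℂ) (f : ℂ → ℂ) : Prop :=
  ∃ ρ : ℝ, DifferentiableOn ℂ f {ζ | ζ.re < ρ} ∧
    ∀ ζ : ℂ, ζ.re < ρ → |ζ.im| < Real.pi →
      0 < (((s : ℤ) : ℝ)) * (chart α ζ / α).im → P (chart α ζ) = f ζ

/-- The germ at `0` with Taylor series `F` has principal branch `P`, whose determinations on the
side `s` of the rays have only isolated singularities, all contained in the closed discrete set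
`S`; around `α ∈ S` the continuation of `P` is the multivalued function `f α`. (Points of `S` at
which there is no actual singularity are harmless: the monodromy there is trivial.)
If `α` is the only point of `S` on the segment from `0` to `α`, both sides give the same `f α`. -/
structure HasIsolatedSingularities (s : ℤˣ) (F : PowerSeries ℂ) (S : Set ℂ) (P : ℂ → ℂ)
    (f : ℂ → ℂ → ℂ) : Prop where
  zero_notMem : (0 : ℂ) ∉ S
  finite_inter : ∀ R : ℝ, (S ∩ Metric.closedBall 0 R).Finite
  principal : IsPrincipalBranch F S P
  extendsAt : ∀ p : ℂ, p ≠ 0 → p ∉ S → ExtendsAt s P p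
  localBranch : ∀ α ∈ S, IsLocalBranch s P α (f α)

/-- Integrability of the singularity `α`: `(z - α) F(z) → 0` in the sense of Stolz, i.e. when
`z → α` with the argument of `z - α` bounded (on the universal cover of the punctured disc). -/
def IsIntegrableSingularity (α : ℂ) (f : ℂ → ℂ) : Prop :=
  ∀ M : ℝ, Tendsto (fun ζ : ℂ => (chart α ζ - α) * f ζ)
    (comap Complex.re atBot ⊓ 𝓟 {ζ : ℂ | |ζ.im| ≤ M}) (𝓝 0)

/-! ### Monodromy operators -/

/-- `Σ`: continuation along one positive turn around the singularity. -/
def monSigma (f : ℂ → ℂ) : ℂ → ℂ := fun ζ => f (ζ + 2 * Real.pi * Complex.I)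

/-- `Δ = Σ - Id`. -/
def monDelta (f : ℂ → ℂ) : ℂ → ℂ := fun ζ => monSigma f ζ - f ζ

/-! ### Integral convolution -/

/-- The lift of `z / u` for `u` on the segment from `α` to `z / β`, where `z = chart (α * β) ζ` and
`u = chart α (ζ + log t)`; see `segment_eq` and `chart_mul_chart`. -/
def secondLift (ζ : ℂ) (t : ℝ) : ℂ :=
  ζ + (Real.log (1 - t) : ℂ) - Complex.log (1 - t * Complex.exp ζ)

/-- `F(u) G(z / u) du / u` on the segment `u = α + t (z / β - α)`, `0 < t < 1`, which is
parametrized by `u = α (1 - t exp ζ)`. -/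
def convKernel (f g : ℂ → ℂ) (ζ : ℂ) (t : ℝ) : ℂ :=
  f (ζ + (Real.log t : ℂ)) * g (secondLift ζ t) *
    (-Complex.exp ζ / (1 - t * Complex.exp ζ))

/-- The integrals over `[ε, 1 - δ]` whose limit is the improper integral from `α` to `z / β`. -/
def truncatedIntegral (f g : ℂ → ℂ) (ζ : ℂ) (p : ℝ × ℝ) : ℂ :=
  ∫ t in p.1..(1 - p.2), convKernel f g ζ t

/-- Integral convolution of a local function at `α` and a local function at `β`, as a
local function at `α β`:
`-(1 / 2πi) ∫_α^{z/β} F(u) G(z/u) du/u`, with the integral in the improper sense. -/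
def conv (f g : ℂ → ℂ) : ℂ → ℂ := fun ζ =>
  -(1 / (2 * Real.pi * Complex.I)) *
    limUnder (𝓝[>] (0 : ℝ) ×ˢ 𝓝[>] (0 : ℝ)) (truncatedIntegral f g ζ)

/-- The improper integral defining `conv f g ζ` converges. -/
def ConvConverges (f g : ℂ → ℂ) (ζ : ℂ) : Prop :=
  MeasureTheory.LocallyIntegrableOn (convKernel f g ζ) (Set.Ioo 0 1) ∧
    ∃ l : ℂ, Tendsto (truncatedIntegral f g ζ) (𝓝[>] (0 : ℝ) ×ˢ 𝓝[>] (0 : ℝ)) (𝓝 l)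

/-- Iterated convolution `(⋯ (g₀ ⋆ g₁) ⋆ ⋯ ) ⋆ gₙ`. -/
def iterConv : (n : ℕ) → (Fin (n + 1) → ℂ → ℂ) → ℂ → ℂ
  | 0, g => g 0
  | n + 1, g => conv (iterConv n fun j => g j.castSucc) (g (Fin.last (n + 1)))

/-- All improper integrals in the iterated convolution converge on `{Re ζ < ρ}`. -/
def IterConvConverges : (n : ℕ) → (Fin (n + 1) → ℂ → ℂ) → ℝ → Prop
  | 0, _, _ => True
  | n + 1, g, ρ => IterConvConverges n (fun j => g j.castSucc) ρ ∧
      ∀ ζ : ℂ, ζ.re < ρ →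
        ConvConverges (iterConv n fun j => g j.castSucc) (g (Fin.last (n + 1))) ζ

/-- `ζ + log t` is a lift of the point `α + t (z / β - α)` of the segment. -/
theorem segment_eq (α β ζ : ℂ) (hβ : β ≠ 0) (t : ℝ) (ht : 0 < t) :
    chart α (ζ + (Real.log t : ℂ)) = α + t * (chart (α * β) ζ / β - α) := by
  have h : Complex.exp (Real.log t : ℂ) = t := by
    rw [← Complex.ofReal_exp, Real.exp_log ht]
  simp only [chart, Complex.exp_add, h]
  field_simp
  ring

/-- `secondLift ζ t` is a lift of `z / u`. -/
theorem chart_mul_chart (α β ζ : ℂ) (hζ : ζ.re < 0) (t : ℝ) (ht : 0 < t) (ht1 : t < 1) :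
    chart α (ζ + (Real.log t : ℂ)) * chart β (secondLift ζ t) = chart (α * β) ζ := by
  have h : Complex.exp (Real.log t : ℂ) = t := by
    rw [← Complex.ofReal_exp, Real.exp_log ht]
  have h1 : Complex.exp (Real.log (1 - t) : ℂ) = 1 - t := by
    rw [← Complex.ofReal_exp, Real.exp_log (by linarith)]; push_cast; ring
  have hne : 1 - (t : ℂ) * Complex.exp ζ ≠ 0 := by
    intro h0
    have h2 : (t : ℂ) * Complex.exp ζ = 1 := (sub_eq_zero.mp h0).symm
    have h3 := congrArg norm h2
    rw [norm_mul, Complex.norm_exp, Complex.norm_real, Real.norm_of_nonneg ht.le, norm_one] at h3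
    have h4 : Real.exp ζ.re < 1 := by simpa using hζ
    nlinarith [Real.exp_pos ζ.re]
  simp only [chart, secondLift, Complex.exp_add, Complex.exp_sub, h, h1, Complex.exp_log hne]
  generalize Complex.exp ζ = e at *
  have hne' : 1 - e * (t : ℂ) ≠ 0 := by rwa [mul_comm]
  field_simp
  ring

end

end HadamardMonodromy

namespace HadamardMonodromy
open MeasureTheory Set Metric

/-! ### Holomorphic parameter integrals -/

/-! Up to a germ holomorphic at `α`, an integrable singularity at `α` is a derivative of a Cauchy
integral whose density is determined by its monodromy. The Hadamard product of two such Cauchy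
integrals can be computed, because their Taylor coefficients are moments and a product of moments is
a moment of a convolution. The rest of the Hadamard product does not see the point under study.

Local theory. In the coordinate `ζ` the derivation `z d/dz` is `theta`. The monodromy of an
integrable singularity is `theta D` with `D` tending to `0` at the puncture
(`exists_theta_eq_monDelta`). For `p`, `q` vanishing at their punctures the convolution integral `C`
converges absolutely, `theta C = E` vanishes again, and the improper convolution of `theta p` and
`theta q` exists and equals `theta E` (`exists_conv_primitives`). Hence "`theta` of a vanishing
function" is a class stable under convolution, which makes the nested integrals converge.
Conversely, `Δ φ = E` is solved by a Cauchy integral `cauchySolution` with `φ' → 0`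
(`cauchySolution_add_period`, `vanishes_deriv_cauchySolution`), and a function without monodromy and
with an integrable singularity is holomorphic at the point (`exists_analytic_of_periodic`). It
follows that `theta (theta φ)`, for `Δ φ = C`, is integrable with monodromy exactly the convolution
(`theta_theta_cauchySolution`).

Model computation. The Cauchy integral with density `D` on the slit from `α` to `α e ^ τ` is this
`φ` seen downstairs (`slit_radial_eq_cauchySolution`). Its Taylor coefficients are moments of `exp
(-a)`; the product of two moments is a moment of the additive convolution of the densities, which on
`(0, τ]` is the radial restriction of `C` (`radial_conv`, `exists_slit_mul`). The piece on `[τ, 2τ]`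
begins away from `α β`. As `z d/dz` multiplies the `k`-th coefficient by `k`, one Euler operator on
each factor gives two on the product.

Global theory. Several singularities may lie on one ray, so radial cuts do not separate the
contributions at a point `p`. The factors are therefore continued to the complement of thick cuts
that follow the ray for a short while and then bend away from the side `s`
(`exists_bent_extension`). The complement of such cuts is star-shaped along a logarithmic spiral, so
Hadamard's multiplication theorem applies (`exists_hadamard`; its contour is smeared out by a smooth
cutoff and Green's formula). At small scale, `p` is a product of points of the cuts only if both are
starting points `α`, `β` with `α β = p` (`eventually_separated`). Subtracting from each factor its
slit integrals removes the starting points from its singular set (`exists_regular_decomposition`),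
so every term of the product except slit times slit with `α β = p` is holomorphic at `p`. This is
`exists_local_structure`, which contains the theorem for two factors and `N = 1`.

Induction on the number of factors uses linearity of the convolution in its first argument. Powers
of the monodromy come from a telescoping sum and from the fact that a turn applied to both factors
is a turn applied to the convolution (`conv_monSigma`). -/

theorem hasDerivAt_integral_of_differentiableOn {X : Type*} [MeasurableSpace X] {μ : Measure X}
    {Φ : ℂ → X → ℂ} {z₀ : ℂ} {r : ℝ} (hr : 0 < r) {bound : X → ℝ} (hint : Integrable bound μ)
    (hmeas : ∀ z ∈ ball z₀ r, AEStronglyMeasurable (Φ z) μ)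
    (hdiff : ∀ᵐ x ∂μ, DifferentiableOn ℂ (fun z => Φ z x) (ball z₀ r))
    (hbound : ∀ᵐ x ∂μ, ∀ z ∈ ball z₀ r, ‖Φ z x‖ ≤ bound x) :
    Integrable (fun x => deriv (fun z => Φ z x) z₀) μ ∧
      HasDerivAt (fun z => ∫ x, Φ z x ∂μ) (∫ x, deriv (fun z => Φ z x) z₀ ∂μ) z₀ := by
  have hz₀ : z₀ ∈ ball z₀ r := mem_ball_self hr
  -- The derivative is measurable as a limit of difference quotients; the increments `(r / 2) / (n +
  -- 1)` stay inside the ball.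
  have hderiv : AEStronglyMeasurable (fun x => deriv (fun z => Φ z x) z₀) μ := by
    have hlim : Tendsto (fun n : ℕ => (((r / 2) / ((n : ℝ) + 1) : ℝ) : ℂ)) atTop (𝓝[≠] 0) := by
      rw [tendsto_nhdsWithin_iff]
      constructor
      · have h0 : Tendsto (fun n : ℕ => (r / 2) / ((n : ℝ) + 1)) atTop (𝓝 0) :=
          tendsto_const_nhds.div_atTop (tendsto_natCast_atTop_atTop.atTop_add tendsto_const_nhds)
        have := (Complex.continuous_ofReal.tendsto 0).comp h0
        rw [Complex.ofReal_zero] at this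
        exact this
      · refine Eventually.of_forall fun n => ?_
        have : (0 : ℝ) < (r / 2) / ((n : ℝ) + 1) := by positivity
        simp only [mem_compl_iff, mem_singleton_iff]
        exact_mod_cast this.ne'
    refine aestronglyMeasurable_of_tendsto_ae (u := atTop)
      (f := fun (n : ℕ) x => ((((r / 2) / ((n : ℝ) + 1) : ℝ) : ℂ))⁻¹ •
        (Φ (z₀ + (((r / 2) / ((n : ℝ) + 1) : ℝ) : ℂ)) x - Φ z₀ x)) (fun n => ?_) ?_
    · have hmem : z₀ + (((r / 2) / ((n : ℝ) + 1) : ℝ) : ℂ) ∈ ball z₀ r := ?_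
      · exact ((hmeas _ hmem).sub (hmeas _ hz₀)).const_smul ((((r / 2) / ((n : ℝ) + 1) : ℝ) : ℂ))⁻¹
      have h1 : (0 : ℝ) < (r / 2) / ((n : ℝ) + 1) := by positivity
      have h2 : (r / 2) / ((n : ℝ) + 1) ≤ r / 2 :=
        div_le_self (by positivity) (by linarith [n.cast_nonneg (α := ℝ)])
      rw [mem_ball, dist_eq_norm, add_sub_cancel_left, Complex.norm_real, Real.norm_of_nonneg h1.le]
      linarith
    · filter_upwards [hdiff] with x hx
      have := (hx.differentiableAt (ball_mem_nhds _ hr)).hasDerivAt.tendsto_slope_zero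
      exact this.comp hlim
  -- Cauchy's estimate on discs of radius `r / 2` dominates the derivative by `bound / (r / 2)`, so
  -- only `Φ` itself has to be dominated.
  refine hasDerivAt_integral_of_dominated_loc_of_deriv_le (s := ball z₀ (r / 2))
    (F' := fun z x => deriv (fun z => Φ z x) z)
    (bound := fun x => bound x / (r / 2)) (ball_mem_nhds _ (by positivity)) ?_ ?_ hderiv ?_
    (hint.div_const _) ?_
  · filter_upwards [ball_mem_nhds z₀ hr] with z hz using hmeas z hz
  · exact hint.mono' (hmeas _ hz₀) (hbound.mono fun x hx => hx _ hz₀)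
  · filter_upwards [hdiff, hbound] with x hx hb z hz
    have hsub : closedBall z (r / 2) ⊆ ball z₀ r := fun w hw => by
      rw [mem_ball] at hz ⊢
      rw [mem_closedBall] at hw
      linarith [dist_triangle w z z₀]
    refine Complex.norm_deriv_le_of_forall_mem_sphere_norm_le (by positivity) ?_ fun w hw =>
      hb w (hsub (sphere_subset_closedBall hw))
    exact (hx.mono (by rw [closure_ball _ (by positivity)]; exact hsub)).diffContOnCl
  · filter_upwards [hdiff] with x hx z hz
    exact (hx.differentiableAt (isOpen_ball.mem_nhds
      (ball_subset_ball (by linarith) hz))).hasDerivAt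

theorem intervalIntegrable_of_continuousOn_Ioo {f : ℝ → ℂ} {a b M : ℝ} (hab : a ≤ b)
    (hc : ContinuousOn f (Ioo a b)) (hb : ∀ t ∈ Ioo a b, ‖f t‖ ≤ M) :
    IntervalIntegrable f volume a b := by
  rw [intervalIntegrable_iff_integrableOn_Ioo_of_le hab]
  refine Integrable.mono' (integrableOn_const (C := M) (by simp))
    (hc.aestronglyMeasurable measurableSet_Ioo) ?_
  filter_upwards [ae_restrict_mem measurableSet_Ioo] with t ht using hb t ht

theorem hasDerivAt_intervalIntegral_of_bounded {Φ : ℂ → ℝ → ℂ} {z₀ : ℂ} {a b M r : ℝ}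
    (hab : a ≤ b) (hr : 0 < r) (hcont : ∀ z ∈ ball z₀ r, ContinuousOn (Φ z) (Ioo a b))
    (hdiff : ∀ t ∈ Ioo a b, DifferentiableOn ℂ (fun z => Φ z t) (ball z₀ r))
    (hbd : ∀ t ∈ Ioo a b, ∀ z ∈ ball z₀ r, ‖Φ z t‖ ≤ M) :
    IntervalIntegrable (fun t => deriv (fun z => Φ z t) z₀) volume a b ∧
      HasDerivAt (fun z => ∫ t in a..b, Φ z t) (∫ t in a..b, deriv (fun z => Φ z t) z₀) z₀ := by
  rw [intervalIntegrable_iff_integrableOn_Ioo_of_le hab]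
  simp only [intervalIntegral.integral_of_le hab, integral_Ioc_eq_integral_Ioo]
  refine hasDerivAt_integral_of_differentiableOn hr (bound := fun _ => M)
    (integrableOn_const (by simp)) (fun z hz => (hcont z hz).aestronglyMeasurable measurableSet_Ioo)
    ?_ ?_
  · filter_upwards [ae_restrict_mem measurableSet_Ioo] with t ht using hdiff t ht
  · filter_upwards [ae_restrict_mem measurableSet_Ioo] with t ht using hbd t ht

/-! ### Half planes, and functions vanishing at the puncture -/

/-- The half plane `{Re ζ < ρ}`. -/
def halfPlane (ρ : ℝ) : Set ℂ := {ζ | ζ.re < ρ}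

theorem isOpen_halfPlane (ρ : ℝ) : IsOpen (halfPlane ρ) :=
  isOpen_lt Complex.continuous_re continuous_const

/-- `f ζ → 0` as `Re ζ → -∞` with `Im ζ` bounded. -/
def Vanishes (f : ℂ → ℂ) : Prop :=
  ∀ M : ℝ, Tendsto f (comap Complex.re atBot ⊓ 𝓟 {ζ : ℂ | |ζ.im| ≤ M}) (𝓝 0)

theorem vanishes_iff {f : ℂ → ℂ} :
    Vanishes f ↔ ∀ M : ℝ, ∀ ε > 0, ∃ X : ℝ, ∀ ζ : ℂ, ζ.re ≤ X → |ζ.im| ≤ M → ‖f ζ‖ ≤ ε := by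
  refine forall_congr' fun M => ?_
  have hb : (comap Complex.re atBot ⊓ 𝓟 {ζ : ℂ | |ζ.im| ≤ M}).HasBasis (fun _ : ℝ => True)
      fun X => Complex.re ⁻¹' Iic X ∩ {ζ : ℂ | |ζ.im| ≤ M} :=
    (atBot_basis.comap _).inf_principal _
  rw [hb.tendsto_iff Metric.nhds_basis_closedBall]
  simp [and_imp]

theorem Vanishes.congr {f g : ℂ → ℂ} {ρ : ℝ} (hf : Vanishes f)
    (h : ∀ ζ ∈ halfPlane ρ, f ζ = g ζ) : Vanishes g := by
  rw [vanishes_iff] at hf ⊢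
  intro M ε hε
  obtain ⟨X, hX⟩ := hf M ε hε
  refine ⟨min X (ρ - 1), fun ζ h1 h2 => ?_⟩
  rw [← h ζ (by have := h1.trans (min_le_right _ _); simp only [halfPlane, mem_ofPred_eq]; linarith)]
  exact hX ζ (h1.trans (min_le_left _ _)) h2

theorem Vanishes.add {f g : ℂ → ℂ} (hf : Vanishes f) (hg : Vanishes g) :
    Vanishes fun ζ => f ζ + g ζ := fun M => by simpa using (hf M).add (hg M)

theorem Vanishes.sub {f g : ℂ → ℂ} (hf : Vanishes f) (hg : Vanishes g) :
    Vanishes fun ζ => f ζ - g ζ := fun M => by simpa using (hf M).sub (hg M)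

theorem Vanishes.const_mul {f : ℂ → ℂ} (hf : Vanishes f) (c : ℂ) :
    Vanishes fun ζ => c * f ζ := fun M => by simpa using (hf M).const_mul c

theorem vanishes_sum {ι : Type*} {f : ι → ℂ → ℂ} (s : Finset ι) (hf : ∀ i ∈ s, Vanishes (f i)) :
    Vanishes fun ζ => ∑ i ∈ s, f i ζ := fun M => by
  simpa using tendsto_finsetSum s fun i hi => hf i hi M

/-- Boundedness in strips, near the puncture. -/
theorem Vanishes.mul_bounded {f g : ℂ → ℂ} (hf : Vanishes f)
    (hg : ∀ M : ℝ, ∃ B X : ℝ, ∀ ζ : ℂ, ζ.re ≤ X → |ζ.im| ≤ M → ‖g ζ‖ ≤ B) :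
    Vanishes fun ζ => g ζ * f ζ := by
  rw [vanishes_iff] at hf ⊢
  intro M ε hε
  obtain ⟨B, X, hB⟩ := hg M
  obtain ⟨Y, hY⟩ := hf M (ε / (|B| + 1)) (by positivity)
  refine ⟨min X Y, fun ζ h1 h2 => ?_⟩
  rw [norm_mul]
  calc ‖g ζ‖ * ‖f ζ‖ ≤ (|B| + 1) * (ε / (|B| + 1)) := by
        refine mul_le_mul ?_ (hY ζ (h1.trans (min_le_right _ _)) h2) (norm_nonneg _) (by positivity)
        linarith [hB ζ (h1.trans (min_le_left _ _)) h2, le_abs_self B]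
    _ = ε := by field_simp

theorem Vanishes.comp_add {f : ℂ → ℂ} (hf : Vanishes f) (c : ℂ) :
    Vanishes fun ζ => f (ζ + c) := by
  rw [vanishes_iff] at hf ⊢
  intro M ε hε
  obtain ⟨X, hX⟩ := hf (M + |c.im|) ε hε
  refine ⟨X - c.re, fun ζ h1 h2 => hX _ (by simp; linarith) ?_⟩
  simpa using (abs_add_le _ _).trans (by linarith)

theorem vanishes_exp : Vanishes Complex.exp := by
  rw [vanishes_iff]
  intro M ε hε
  refine ⟨Real.log ε, fun ζ h _ => ?_⟩
  rw [Complex.norm_exp]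
  exact (Real.exp_le_exp.mpr h).trans (Real.exp_log hε).le

/-- Cauchy's estimate on unit discs, at the price of a strip wider by one. -/
theorem Vanishes.deriv {f : ℂ → ℂ} {ρ : ℝ} (hf : Vanishes f)
    (hd : DifferentiableOn ℂ f (halfPlane ρ)) : Vanishes (deriv f) := by
  rw [vanishes_iff] at hf ⊢
  intro M ε hε
  obtain ⟨X, hX⟩ := hf (M + 1) ε hε
  refine ⟨min X ρ - 2, fun ζ h1 h2 => ?_⟩
  have hsub : ∀ w ∈ closedBall ζ 1, w.re ≤ ζ.re + 1 ∧ |w.im| ≤ M + 1 := fun w hw => by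
    rw [mem_closedBall, dist_eq_norm] at hw
    have hre := (Complex.abs_re_le_norm (w - ζ)).trans hw
    have him := (Complex.abs_im_le_norm (w - ζ)).trans hw
    simp only [Complex.sub_re, Complex.sub_im] at hre him
    refine ⟨by linarith [(abs_le.mp hre).2], ?_⟩
    have := abs_add_le (w.im - ζ.im) ζ.im
    rw [sub_add_cancel] at this
    linarith
  have := Complex.norm_deriv_le_of_forall_mem_sphere_norm_le (f := f) (c := ζ) (R := 1) (C := ε)
    one_pos ?_ fun w hw => ?_
  · simpa using this
  · refine (hd.mono ?_).diffContOnCl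
    rw [closure_ball _ one_ne_zero]
    intro w hw
    have := (hsub w hw).1
    simp only [halfPlane, mem_ofPred_eq]
    linarith [min_le_right X ρ]
  · have := hsub w (sphere_subset_closedBall hw)
    exact hX w (by linarith [min_le_left X ρ]) this.2

/-- Decay handles the far end of the half strip, compactness the remaining rectangle. -/
theorem Vanishes.exists_bound {f : ℂ → ℂ} {ρ : ℝ} (hf : Vanishes f)
    (hc : ContinuousOn f (halfPlane ρ)) {ρ' : ℝ} (hρ : ρ' < ρ) (M : ℝ) :
    ∃ B : ℝ, 0 ≤ B ∧ ∀ ζ : ℂ, ζ.re ≤ ρ' → |ζ.im| ≤ M → ‖f ζ‖ ≤ B := by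
  obtain ⟨X, hX⟩ := vanishes_iff.mp hf M 1 one_pos
  have hK : IsCompact (Icc X ρ' ×ℂ Icc (-M) M) := isCompact_Icc.reProdIm isCompact_Icc
  obtain ⟨B, hB⟩ := hK.exists_bound_of_continuousOn (hc.mono fun ζ hζ => by
    simp only [Complex.mem_reProdIm, mem_Icc] at hζ
    simp only [halfPlane, mem_ofPred_eq]; linarith)
  refine ⟨max B 1, by positivity, fun ζ h1 h2 => ?_⟩
  rcases le_total ζ.re X with h | h
  · exact (hX ζ h h2).trans (le_max_right _ _)
  · exact (hB ζ ⟨⟨h, h1⟩, abs_le.mp h2⟩).trans (le_max_left _ _)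

/-- The derivation `z d/dz` in the coordinate `ζ`, `z = α (1 - exp ζ)`. -/
noncomputable def theta (f : ℂ → ℂ) : ℂ → ℂ := fun ζ => (1 - Complex.exp (-ζ)) * deriv f ζ

theorem differentiableOn_deriv {f : ℂ → ℂ} {ρ : ℝ} (hf : DifferentiableOn ℂ f (halfPlane ρ)) :
    DifferentiableOn ℂ (deriv f) (halfPlane ρ) := hf.deriv (isOpen_halfPlane ρ)

theorem differentiableOn_theta {f : ℂ → ℂ} {ρ : ℝ} (hf : DifferentiableOn ℂ f (halfPlane ρ)) :
    DifferentiableOn ℂ (theta f) (halfPlane ρ) := by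
  refine DifferentiableOn.mul (Differentiable.differentiableOn ?_) (differentiableOn_deriv hf)
  fun_prop

theorem differentiableAt_of_halfPlane {f : ℂ → ℂ} {ρ : ℝ}
    (hf : DifferentiableOn ℂ f (halfPlane ρ)) {ζ : ℂ} (hζ : ζ.re < ρ) : DifferentiableAt ℂ f ζ :=
  hf.differentiableAt ((isOpen_halfPlane ρ).mem_nhds hζ)

theorem theta_congr {f g : ℂ → ℂ} {ρ : ℝ} (h : ∀ ζ ∈ halfPlane ρ, f ζ = g ζ) :
    ∀ ζ ∈ halfPlane ρ, theta f ζ = theta g ζ := fun ζ hζ => by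
  have : f =ᶠ[𝓝 ζ] g := by
    filter_upwards [(isOpen_halfPlane ρ).mem_nhds hζ] with w hw using h w hw
  rw [theta, theta, this.deriv_eq]

theorem theta_sub {f g : ℂ → ℂ} {ρ : ℝ} (hf : DifferentiableOn ℂ f (halfPlane ρ))
    (hg : DifferentiableOn ℂ g (halfPlane ρ)) {ζ : ℂ} (hζ : ζ.re < ρ) :
    theta (fun ζ => f ζ - g ζ) ζ = theta f ζ - theta g ζ := by
  simp only [theta]
  rw [deriv_fun_sub (differentiableAt_of_halfPlane hf hζ) (differentiableAt_of_halfPlane hg hζ),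
    mul_sub]

theorem theta_const_mul {f : ℂ → ℂ} (c : ℂ) (ζ : ℂ) :
    theta (fun ζ => c * f ζ) ζ = c * theta f ζ := by
  simp only [theta, deriv_const_mul_field]
  ring

theorem theta_comp_add_period (f : ℂ → ℂ) (c ζ : ℂ) (hc : Complex.exp c = 1) :
    theta (fun ζ => f (ζ + c)) ζ = theta f (ζ + c) := by
  simp only [theta]
  rw [deriv_comp_add_const, neg_add, Complex.exp_add, Complex.exp_neg c, hc]
  simp

theorem exp_two_pi_I : Complex.exp (2 * Real.pi * Complex.I) = 1 := Complex.exp_two_pi_mul_I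

theorem theta_monDelta {f : ℂ → ℂ} {ρ : ℝ} (hf : DifferentiableOn ℂ f (halfPlane ρ)) {ζ : ℂ}
    (hζ : ζ.re < ρ) : theta (monDelta f) ζ = monDelta (theta f) ζ := by
  have hs : DifferentiableOn ℂ (fun ζ => f (ζ + 2 * Real.pi * Complex.I)) (halfPlane ρ) :=
    hf.comp (by fun_prop) fun w hw => by simpa [halfPlane] using hw
  have := theta_sub hs hf hζ
  rw [theta_comp_add_period _ _ _ exp_two_pi_I] at this
  exact this

/-- `f` is integrable: `exp ζ * f ζ → 0` in strips. -/
theorem isIntegrableSingularity_iff {α : ℂ} (hα : α ≠ 0) {f : ℂ → ℂ} :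
    IsIntegrableSingularity α f ↔ Vanishes fun ζ => Complex.exp ζ * f ζ := by
  have key : ∀ ζ, (chart α ζ - α) * f ζ = (-α) * (Complex.exp ζ * f ζ) := fun ζ => by
    rw [chart]; ring
  constructor
  · intro h M
    have := (h M).const_mul (-α)⁻¹
    simp only [key, mul_zero] at this
    refine this.congr fun ζ => ?_
    rw [← mul_assoc, inv_mul_cancel₀ (neg_ne_zero.mpr hα), one_mul]
  · intro h M
    simp only [key]
    simpa using (h M).const_mul (-α)

/-! ### The segment from `α` to `z / β` in the covering coordinates -/

theorem norm_exp_lt_one {ζ : ℂ} (hζ : ζ.re < 0) : ‖Complex.exp ζ‖ < 1 := by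
  rw [Complex.norm_exp]; simpa using hζ

theorem norm_mul_exp_lt {ζ : ℂ} (hζ : ζ.re < 0) {t : ℝ} (h0 : 0 < t) :
    ‖(t : ℂ) * Complex.exp ζ‖ < t := by
  rw [norm_mul, Complex.norm_real, Real.norm_of_nonneg h0.le]
  exact mul_lt_of_lt_one_right h0 (norm_exp_lt_one hζ)

theorem re_one_sub_pos {ζ : ℂ} (hζ : ζ.re < 0) {t : ℝ} (h0 : 0 < t) :
    1 - t < (1 - (t : ℂ) * Complex.exp ζ).re := by
  have := (Complex.re_le_norm _).trans_lt (norm_mul_exp_lt hζ h0)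
  rw [Complex.sub_re, Complex.one_re]
  linarith

theorem one_sub_mem_slitPlane {ζ : ℂ} (hζ : ζ.re < 0) {t : ℝ} (h0 : 0 < t) (h1 : t < 1) :
    1 - (t : ℂ) * Complex.exp ζ ∈ Complex.slitPlane :=
  Or.inl (by linarith [re_one_sub_pos hζ h0])

theorem one_sub_ne_zero {ζ : ℂ} (hζ : ζ.re < 0) {t : ℝ} (h0 : 0 < t) (h1 : t < 1) :
    1 - (t : ℂ) * Complex.exp ζ ≠ 0 :=
  Complex.slitPlane_ne_zero (one_sub_mem_slitPlane hζ h0 h1)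

theorem norm_one_sub_gt {ζ : ℂ} (hζ : ζ.re < 0) {t : ℝ} (h0 : 0 < t) :
    1 - t < ‖1 - (t : ℂ) * Complex.exp ζ‖ :=
  (re_one_sub_pos hζ h0).trans_le (Complex.re_le_norm _)

theorem norm_one_sub_ge {ζ : ℂ} {t : ℝ} (h0 : 0 < t) (h1 : t < 1) :
    1 - Real.exp ζ.re ≤ ‖1 - (t : ℂ) * Complex.exp ζ‖ := by
  have h2 := norm_sub_norm_le (1 : ℂ) ((t : ℂ) * Complex.exp ζ)
  rw [norm_one, norm_mul, Complex.norm_real, Real.norm_of_nonneg h0.le, Complex.norm_exp] at h2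
  nlinarith [Real.exp_pos ζ.re]

theorem norm_one_sub_le {ζ : ℂ} (hζ : ζ.re < 0) {t : ℝ} (h0 : 0 < t) (h1 : t < 1) :
    ‖1 - (t : ℂ) * Complex.exp ζ‖ ≤ 2 := by
  have := norm_sub_le (1 : ℂ) ((t : ℂ) * Complex.exp ζ)
  rw [norm_one] at this
  linarith [norm_mul_exp_lt hζ h0]

theorem firstLift_re (ζ : ℂ) (t : ℝ) : (ζ + (Real.log t : ℂ)).re = ζ.re + Real.log t := by
  rw [Complex.add_re, Complex.ofReal_re]

theorem firstLift_im (ζ : ℂ) (t : ℝ) : (ζ + (Real.log t : ℂ)).im = ζ.im := by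
  rw [Complex.add_im, Complex.ofReal_im, add_zero]

theorem firstLift_re_le (ζ : ℂ) {t : ℝ} (h0 : 0 < t) (h1 : t < 1) :
    (ζ + (Real.log t : ℂ)).re ≤ ζ.re := by
  rw [firstLift_re]; linarith [Real.log_nonpos h0.le h1.le]

theorem secondLift_re (ζ : ℂ) (t : ℝ) : (secondLift ζ t).re =
    ζ.re + Real.log (1 - t) - Real.log ‖1 - (t : ℂ) * Complex.exp ζ‖ := by
  rw [secondLift, Complex.sub_re, Complex.add_re, Complex.ofReal_re, Complex.log_re]

/-- As `‖1 - t exp ζ‖ > 1 - t`, the second lift, like the first, never moves to the right of `ζ`: a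
convolution on a half plane uses its factors on the same half plane only. -/
theorem secondLift_re_le {ζ : ℂ} (hζ : ζ.re < 0) {t : ℝ} (h0 : 0 < t) (h1 : t < 1) :
    (secondLift ζ t).re ≤ ζ.re := by
  rw [secondLift_re]
  linarith [Real.log_le_log (by linarith) (norm_one_sub_gt hζ h0).le]

theorem secondLift_re_ge {ζ : ℂ} (hζ : ζ.re < 0) {t : ℝ} (h0 : 0 < t) (h1 : t < 1) :
    ζ.re + Real.log (1 - t) - Real.log 2 ≤ (secondLift ζ t).re := by
  rw [secondLift_re]
  linarith [Real.log_le_log (by linarith [norm_one_sub_gt hζ h0])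
    (norm_one_sub_le hζ h0 h1)]

theorem abs_secondLift_im_le (ζ : ℂ) (t : ℝ) : |(secondLift ζ t).im| ≤ |ζ.im| + Real.pi := by
  rw [secondLift, Complex.sub_im, Complex.add_im, Complex.ofReal_im, add_zero, Complex.log_im]
  exact (abs_sub _ _).trans (by linarith [Complex.abs_arg_le_pi (1 - (t : ℂ) * Complex.exp ζ)])

theorem exp_firstLift (ζ : ℂ) {t : ℝ} (h0 : 0 < t) :
    Complex.exp (ζ + (Real.log t : ℂ)) = t * Complex.exp ζ := by
  rw [Complex.exp_add, ← Complex.ofReal_exp, Real.exp_log h0, mul_comm]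

theorem exp_secondLift {ζ : ℂ} (hζ : ζ.re < 0) {t : ℝ} (h0 : 0 < t) (h1 : t < 1) :
    Complex.exp (secondLift ζ t) =
      Complex.exp ζ * (1 - t) / (1 - (t : ℂ) * Complex.exp ζ) := by
  rw [secondLift, Complex.exp_sub, Complex.exp_add, Complex.exp_log (one_sub_ne_zero hζ h0 h1),
    ← Complex.ofReal_exp, Real.exp_log (by linarith)]
  push_cast; ring

/-- The density `du / (u dt)`. -/
noncomputable def kern (ζ : ℂ) (t : ℝ) : ℂ := -Complex.exp ζ / (1 - t * Complex.exp ζ)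

/-- `z ∂/∂z log u` at fixed `t`. -/
noncomputable def weight (ζ : ℂ) (t : ℝ) : ℂ :=
  t * (1 - Complex.exp ζ) / (1 - t * Complex.exp ζ)

theorem convKernel_eq (p q : ℂ → ℂ) (ζ : ℂ) (t : ℝ) :
    convKernel p q ζ t = p (ζ + (Real.log t : ℂ)) * q (secondLift ζ t) * kern ζ t := rfl

theorem hasDerivAt_firstLift_real (ζ : ℂ) {t : ℝ} (h0 : 0 < t) :
    HasDerivAt (fun t : ℝ => ζ + (Real.log t : ℂ)) (t : ℂ)⁻¹ t := by
  have := ((Real.hasDerivAt_log h0.ne').ofReal_comp).const_add ζ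
  simpa using this

theorem hasDerivAt_one_sub_real (ζ : ℂ) (t : ℝ) :
    HasDerivAt (fun t : ℝ => 1 - (t : ℂ) * Complex.exp ζ) (-Complex.exp ζ) t := by
  have := (((hasDerivAt_id t).ofReal_comp).mul_const (Complex.exp ζ)).const_sub 1
  simpa using this

theorem hasDerivAt_one_sub_complex (ζ : ℂ) (t : ℝ) :
    HasDerivAt (fun ζ : ℂ => 1 - (t : ℂ) * Complex.exp ζ) (-(t * Complex.exp ζ)) ζ :=
  ((Complex.hasDerivAt_exp ζ).const_mul (t : ℂ)).const_sub 1

theorem hasDerivAt_secondLift_real {ζ : ℂ} (hζ : ζ.re < 0) {t : ℝ} (h0 : 0 < t) (h1 : t < 1) :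
    HasDerivAt (secondLift ζ)
      ((Complex.exp ζ - 1) / ((1 - t) * (1 - (t : ℂ) * Complex.exp ζ))) t := by
  have e1 : HasDerivAt (fun t : ℝ => (Real.log (1 - t) : ℂ)) ((-(1 - t)⁻¹ : ℝ) : ℂ) t := by
    have h2 : HasDerivAt (fun t : ℝ => Real.log (1 - t)) (-(1 - t)⁻¹) t := by
      have := (((hasDerivAt_id t).const_sub 1).log (by simp; linarith))
      simpa [div_eq_mul_inv] using this
    exact h2.ofReal_comp
  have e2 := (hasDerivAt_one_sub_real ζ t).clog_real (one_sub_mem_slitPlane hζ h0 h1)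
  refine ((e1.const_add ζ).sub e2).congr_deriv ?_
  have hn := one_sub_ne_zero hζ h0 h1
  have hn1 : (1 - (t : ℂ)) ≠ 0 := by
    rw [← Complex.ofReal_one, ← Complex.ofReal_sub]; exact_mod_cast (by linarith : 1 - t ≠ 0)
  push_cast
  field_simp
  ring

theorem hasDerivAt_secondLift_complex {ζ : ℂ} (hζ : ζ.re < 0) {t : ℝ} (h0 : 0 < t) (h1 : t < 1) :
    HasDerivAt (fun ζ => secondLift ζ t) (1 - (t : ℂ) * Complex.exp ζ)⁻¹ ζ := by
  have e2 := (hasDerivAt_one_sub_complex ζ t).clog (one_sub_mem_slitPlane hζ h0 h1)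
  refine (((hasDerivAt_id ζ).add_const (Real.log (1 - t) : ℂ)).sub e2).congr_deriv ?_
  have hn := one_sub_ne_zero hζ h0 h1
  field_simp
  ring

section Identities

variable {p q : ℂ → ℂ} {ρ : ℝ} {ζ : ℂ} {t : ℝ}

/-- With `z` fixed, `kern ζ t dt` is `du / u`, so differentiation in `t` is `z d/dz` of the factor
times `kern`. The other factor is taken at `z / u` and gets the opposite sign; integration by parts
rests on this pair. -/
theorem hasDerivAt_comp_firstLift_real (hp : DifferentiableOn ℂ p (halfPlane ρ)) (hρ : ρ ≤ 0)
    (hζ : ζ.re < ρ) (h0 : 0 < t) (h1 : t < 1) :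
    HasDerivAt (fun t : ℝ => p (ζ + (Real.log t : ℂ)))
      (theta p (ζ + (Real.log t : ℂ)) * kern ζ t) t := by
  have hd := (differentiableAt_of_halfPlane hp
    ((firstLift_re_le ζ h0 h1).trans_lt hζ)).hasDerivAt.comp t (hasDerivAt_firstLift_real ζ h0)
  refine hd.congr_deriv ?_
  rw [theta, kern, Complex.exp_neg, exp_firstLift ζ h0]
  have hn := one_sub_ne_zero (hζ.trans_le hρ) h0 h1
  have ht : (t : ℂ) ≠ 0 := by exact_mod_cast h0.ne'
  have he := Complex.exp_ne_zero ζ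
  field_simp
  ring

theorem hasDerivAt_comp_secondLift_real (hq : DifferentiableOn ℂ q (halfPlane ρ)) (hρ : ρ ≤ 0)
    (hζ : ζ.re < ρ) (h0 : 0 < t) (h1 : t < 1) :
    HasDerivAt (fun t : ℝ => q (secondLift ζ t)) (-(theta q (secondLift ζ t) * kern ζ t)) t := by
  have hζ0 := hζ.trans_le hρ
  have hd := (differentiableAt_of_halfPlane hq
    ((secondLift_re_le hζ0 h0 h1).trans_lt hζ)).hasDerivAt.comp t
      (hasDerivAt_secondLift_real hζ0 h0 h1)
  refine hd.congr_deriv ?_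
  rw [theta, kern, Complex.exp_neg, exp_secondLift hζ0 h0 h1]
  have hn := one_sub_ne_zero hζ0 h0 h1
  have hn1 : (1 - (t : ℂ)) ≠ 0 := by
    rw [← Complex.ofReal_one, ← Complex.ofReal_sub]; exact_mod_cast (by linarith : 1 - t ≠ 0)
  have he := Complex.exp_ne_zero ζ
  field_simp
  ring

theorem hasDerivAt_comp_firstLift_complex (hp : DifferentiableOn ℂ p (halfPlane ρ))
    (hζ : ζ.re < ρ) (h0 : 0 < t) (h1 : t < 1) :
    HasDerivAt (fun ζ => p (ζ + (Real.log t : ℂ))) (deriv p (ζ + (Real.log t : ℂ))) ζ := by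
  have := (differentiableAt_of_halfPlane hp
    ((firstLift_re_le ζ h0 h1).trans_lt hζ)).hasDerivAt.comp ζ
      ((hasDerivAt_id ζ).add_const (Real.log t : ℂ))
  rw [mul_one] at this
  exact this

theorem hasDerivAt_comp_secondLift_complex (hq : DifferentiableOn ℂ q (halfPlane ρ)) (hρ : ρ ≤ 0)
    (hζ : ζ.re < ρ) (h0 : 0 < t) (h1 : t < 1) :
    HasDerivAt (fun ζ => q (secondLift ζ t))
      (deriv q (secondLift ζ t) * (1 - (t : ℂ) * Complex.exp ζ)⁻¹) ζ :=
  (differentiableAt_of_halfPlane hq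
    ((secondLift_re_le (hζ.trans_le hρ) h0 h1).trans_lt hζ)).hasDerivAt.comp ζ
      (hasDerivAt_secondLift_complex (hζ.trans_le hρ) h0 h1)

/-- With `t` fixed, the derivation `z d/dz` is shared between `u` and `z / u` in the proportion
`weight` to `1 - weight`, because `log u + log (z / u) = log z`. -/
theorem weight_mul_theta (hρ : ρ ≤ 0) (hζ : ζ.re < ρ) (h0 : 0 < t) (h1 : t < 1) :
    (1 - Complex.exp (-ζ)) * deriv p (ζ + (Real.log t : ℂ)) =
      weight ζ t * theta p (ζ + (Real.log t : ℂ)) := by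
  rw [theta, weight, Complex.exp_neg, Complex.exp_neg, exp_firstLift ζ h0]
  have hn := one_sub_ne_zero (hζ.trans_le hρ) h0 h1
  have ht : (t : ℂ) ≠ 0 := by exact_mod_cast h0.ne'
  have he := Complex.exp_ne_zero ζ
  generalize Complex.exp ζ = e at *
  have hn' : 1 - e * (t : ℂ) ≠ 0 := by rwa [mul_comm]
  field_simp
  ring

theorem one_sub_weight_mul_theta (hρ : ρ ≤ 0) (hζ : ζ.re < ρ) (h0 : 0 < t) (h1 : t < 1) :
    (1 - Complex.exp (-ζ)) *
        (deriv q (secondLift ζ t) * (1 - (t : ℂ) * Complex.exp ζ)⁻¹) =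
      (1 - weight ζ t) * theta q (secondLift ζ t) := by
  have hζ0 := hζ.trans_le hρ
  rw [theta, weight, Complex.exp_neg, Complex.exp_neg, exp_secondLift hζ0 h0 h1]
  have hn := one_sub_ne_zero hζ0 h0 h1
  have hn1 : (1 - (t : ℂ)) ≠ 0 := by
    rw [← Complex.ofReal_one, ← Complex.ofReal_sub]; exact_mod_cast (by linarith : 1 - t ≠ 0)
  have he := Complex.exp_ne_zero ζ
  generalize Complex.exp ζ = e at *
  have hn' : 1 - e * (t : ℂ) ≠ 0 := by rwa [mul_comm]
  field_simp
  ring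

theorem hasDerivAt_kern (hζ : ζ.re < 0) (h0 : 0 < t) (h1 : t < 1) :
    HasDerivAt (fun ζ => kern ζ t) (-Complex.exp ζ / (1 - t * Complex.exp ζ) ^ 2) ζ := by
  have hn := one_sub_ne_zero hζ h0 h1
  refine ((Complex.hasDerivAt_exp ζ).neg.div (hasDerivAt_one_sub_complex ζ t) hn).congr_deriv ?_
  field_simp
  simp only [Pi.neg_apply]
  ring

/-- Equality of the mixed derivatives of `log u`: the `t`-derivative of `weight` is `z d/dz` of
`kern`. -/
theorem hasDerivAt_weight (hζ : ζ.re < 0) (h0 : 0 < t) (h1 : t < 1) :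
    HasDerivAt (weight ζ)
      ((1 - Complex.exp (-ζ)) * (-Complex.exp ζ / (1 - t * Complex.exp ζ) ^ 2)) t := by
  have hn := one_sub_ne_zero hζ h0 h1
  have e : HasDerivAt (fun t : ℝ => (t : ℂ) * (1 - Complex.exp ζ)) (1 - Complex.exp ζ) t := by
    simpa using ((hasDerivAt_id t).ofReal_comp).mul_const (1 - Complex.exp ζ)
  refine (e.div (hasDerivAt_one_sub_real ζ t) hn).congr_deriv ?_
  have he := Complex.exp_ne_zero ζ
  rw [Complex.exp_neg]
  field_simp
  ring

end Identities

/-! ### Differentiation of convolution integrals -/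

/-- `p` is bounded along the first lifts of the subinterval `(a, b)`, locally uniformly. -/
def BddFirst (p : ℂ → ℂ) (ρ a b : ℝ) : Prop :=
  ∀ X ρ' M : ℝ, ρ' < ρ → ∃ B : ℝ, 0 ≤ B ∧ ∀ ζ : ℂ, X ≤ ζ.re → ζ.re ≤ ρ' → |ζ.im| ≤ M →
    ∀ t ∈ Ioo a b, ‖p (ζ + (Real.log t : ℂ))‖ ≤ B

/-- `q` is bounded along the second lifts of the subinterval `(a, b)`, locally uniformly. -/
def BddSecond (q : ℂ → ℂ) (ρ a b : ℝ) : Prop :=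
  ∀ X ρ' M : ℝ, ρ' < ρ → ∃ B : ℝ, 0 ≤ B ∧ ∀ ζ : ℂ, X ≤ ζ.re → ζ.re ≤ ρ' → |ζ.im| ≤ M →
    ∀ t ∈ Ioo a b, ‖q (secondLift ζ t)‖ ≤ B

theorem BddFirst.of_vanishes {p : ℂ → ℂ} {ρ a b : ℝ} (hp : ContinuousOn p (halfPlane ρ))
    (hv : Vanishes p) (ha : 0 ≤ a) (hb : b ≤ 1) : BddFirst p ρ a b := fun X ρ' M hρ' => by
  obtain ⟨B, hB0, hB⟩ := hv.exists_bound hp hρ' M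
  refine ⟨B, hB0, fun ζ _ h2 h3 t ht => hB _ ((firstLift_re_le ζ (ha.trans_lt ht.1)
    (ht.2.trans_le hb)).trans h2) ?_⟩
  rwa [firstLift_im]

theorem BddSecond.of_vanishes {q : ℂ → ℂ} {ρ a b : ℝ} (hρ : ρ ≤ 0)
    (hq : ContinuousOn q (halfPlane ρ)) (hv : Vanishes q) (ha : 0 ≤ a) (hb : b ≤ 1) :
    BddSecond q ρ a b := fun X ρ' M hρ' => by
  obtain ⟨B, hB0, hB⟩ := hv.exists_bound hq hρ' (M + Real.pi)
  refine ⟨B, hB0, fun ζ _ h2 h3 t ht => hB _ ((secondLift_re_le (by linarith) (ha.trans_lt ht.1)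
    (ht.2.trans_le hb)).trans h2) ((abs_secondLift_im_le ζ t).trans (by linarith))⟩

theorem exists_bound_rect {p : ℂ → ℂ} {ρ : ℝ} (hp : ContinuousOn p (halfPlane ρ)) {ρ' : ℝ}
    (hρ : ρ' < ρ) (X M : ℝ) :
    ∃ B : ℝ, 0 ≤ B ∧ ∀ ζ : ℂ, X ≤ ζ.re → ζ.re ≤ ρ' → |ζ.im| ≤ M → ‖p ζ‖ ≤ B := by
  have hK : IsCompact (Icc X ρ' ×ℂ Icc (-M) M) := isCompact_Icc.reProdIm isCompact_Icc
  obtain ⟨B, hB⟩ := hK.exists_bound_of_continuousOn (hp.mono fun ζ hζ => by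
    simp only [Complex.mem_reProdIm, mem_Icc] at hζ
    simp only [halfPlane, mem_ofPred_eq]; linarith)
  exact ⟨max B 0, le_max_right _ _, fun ζ h1 h2 h3 =>
    (hB ζ ⟨⟨h1, h2⟩, abs_le.mp h3⟩).trans (le_max_left _ _)⟩

/-- For `a > 0` the lifts stay in a compact rectangle, so no decay is needed. This admits `theta p`,
which may be unbounded at the puncture. -/
theorem BddFirst.of_continuousOn {p : ℂ → ℂ} {ρ a b : ℝ} (hp : ContinuousOn p (halfPlane ρ))
    (ha : 0 < a) (hb : b ≤ 1) : BddFirst p ρ a b := fun X ρ' M hρ' => by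
  obtain ⟨B, hB0, hB⟩ := exists_bound_rect hp hρ' (X + Real.log a) M
  refine ⟨B, hB0, fun ζ h1 h2 h3 t ht => hB _ ?_ ((firstLift_re_le ζ (ha.trans ht.1)
    (ht.2.trans_le hb)).trans h2) (by rwa [firstLift_im])⟩
  rw [firstLift_re]
  linarith [Real.log_le_log ha ht.1.le]

theorem BddSecond.of_continuousOn {q : ℂ → ℂ} {ρ a b : ℝ} (hρ : ρ ≤ 0)
    (hq : ContinuousOn q (halfPlane ρ)) (ha : 0 ≤ a) (hb : b < 1) :
    BddSecond q ρ a b := fun X ρ' M hρ' => by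
  obtain ⟨B, hB0, hB⟩ := exists_bound_rect hq hρ' (X + Real.log (1 - b) - Real.log 2) (M + Real.pi)
  refine ⟨B, hB0, fun ζ h1 h2 h3 t ht => ?_⟩
  have ht0 := ha.trans_lt ht.1
  have ht1 := ht.2.trans hb
  have hζ : ζ.re < 0 := by linarith
  refine hB _ ?_ ((secondLift_re_le hζ ht0 ht1).trans h2)
    ((abs_secondLift_im_le ζ t).trans (by linarith))
  linarith [secondLift_re_ge hζ ht0 ht1, Real.log_le_log (by linarith : 0 < 1 - b)
    (by linarith [ht.2] : 1 - b ≤ 1 - t)]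

theorem norm_kern_le {ζ : ℂ} {ρ' : ℝ} (hρ' : ρ' < 0) (hζ : ζ.re ≤ ρ') {t : ℝ} (h0 : 0 < t)
    (h1 : t < 1) : ‖kern ζ t‖ ≤ Real.exp ζ.re / (1 - Real.exp ρ') := by
  have h2 : Real.exp ρ' < 1 := by simpa using hρ'
  have h3 := norm_one_sub_ge (ζ := ζ) h0 h1
  have h4 := Real.exp_le_exp.mpr hζ
  rw [kern, norm_div, norm_neg, Complex.norm_exp]
  gcongr
  linarith

theorem continuousOn_convKernel {p q : ℂ → ℂ} {ρ : ℝ} (hp : DifferentiableOn ℂ p (halfPlane ρ))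
    (hq : DifferentiableOn ℂ q (halfPlane ρ)) (hρ : ρ ≤ 0) {ζ : ℂ} (hζ : ζ.re < ρ) :
    ContinuousOn (convKernel p q ζ) (Ioo 0 1) := fun t ht => by
  have h1 := (hasDerivAt_comp_firstLift_real hp hρ hζ ht.1 ht.2).continuousAt
  have h2 := (hasDerivAt_comp_secondLift_real hq hρ hζ ht.1 ht.2).continuousAt
  have h3 : ContinuousAt (kern ζ) t :=
    continuousAt_const.div (hasDerivAt_one_sub_real ζ t).continuousAt
      (one_sub_ne_zero (hζ.trans_le hρ) ht.1 ht.2)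
  exact ((h1.mul h2).mul h3).continuousWithinAt

section Half

variable {p q : ℂ → ℂ} {ρ a b : ℝ} {ζ : ℂ}

theorem exists_bound_convKernel (hρ : ρ ≤ 0)
    (ha : 0 ≤ a) (hb : b ≤ 1) (hpb : BddFirst p ρ a b) (hqb : BddSecond q ρ a b)
    (hζ : ζ.re < ρ) : ∃ r > 0, ∃ M, (∀ z ∈ ball ζ r, z.re < ρ) ∧
      ∀ t ∈ Ioo a b, ∀ z ∈ ball ζ r, ‖convKernel p q z t‖ ≤ M := by
  set r := (ρ - ζ.re) / 2 with hr
  have hr0 : 0 < r := by rw [hr]; linarith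
  have hball : ∀ z ∈ ball ζ r, ζ.re - r ≤ z.re ∧ z.re ≤ ζ.re + r ∧ |z.im| ≤ |ζ.im| + r :=
    fun z hz => by
      rw [mem_ball, dist_eq_norm] at hz
      have hre := abs_le.mp ((Complex.abs_re_le_norm (z - ζ)).trans hz.le)
      have him := (Complex.abs_im_le_norm (z - ζ)).trans hz.le
      rw [Complex.sub_re] at hre
      rw [Complex.sub_im] at him
      refine ⟨by linarith, by linarith, ?_⟩
      have := abs_add_le (z.im - ζ.im) ζ.im
      rw [sub_add_cancel] at this
      linarith
  have hlt : ζ.re + r < ρ := by rw [hr]; linarith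
  obtain ⟨B, hB0, hB⟩ := hpb (ζ.re - r) (ζ.re + r) (|ζ.im| + r) hlt
  obtain ⟨B', hB0', hB'⟩ := hqb (ζ.re - r) (ζ.re + r) (|ζ.im| + r) hlt
  refine ⟨r, hr0, B * B' * (1 / (1 - Real.exp (ζ.re + r))), fun z hz => by linarith [hball z hz],
    fun t ht z hz => ?_⟩
  obtain ⟨h1, h2, h3⟩ := hball z hz
  have hlt0 : ζ.re + r < 0 := by linarith
  have he : Real.exp (ζ.re + r) < 1 := by simpa using hlt0
  rw [convKernel_eq, norm_mul, norm_mul]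
  have hk := norm_kern_le hlt0 h2 (ha.trans_lt ht.1) (ht.2.trans_le hb)
  have hk' : ‖kern z t‖ ≤ 1 / (1 - Real.exp (ζ.re + r)) := by
    refine hk.trans ?_
    gcongr
    rw [Real.exp_le_one_iff]; linarith
  exact mul_le_mul (mul_le_mul (hB z h1 h2 h3 t ht) (hB' z h1 h2 h3 t ht) (norm_nonneg _) hB0)
    hk' (norm_nonneg _) (by positivity)

theorem intervalIntegrable_convKernel (hp : DifferentiableOn ℂ p (halfPlane ρ))
    (hq : DifferentiableOn ℂ q (halfPlane ρ)) (hρ : ρ ≤ 0) (ha : 0 ≤ a) (hab : a ≤ b) (hb : b ≤ 1)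
    (hpb : BddFirst p ρ a b) (hqb : BddSecond q ρ a b) (hζ : ζ.re < ρ) :
    IntervalIntegrable (convKernel p q ζ) volume a b := by
  obtain ⟨r, hr, M, -, hM⟩ := exists_bound_convKernel hρ ha hb hpb hqb hζ
  exact intervalIntegrable_of_continuousOn_Ioo hab
    ((continuousOn_convKernel hp hq hρ hζ).mono (Ioo_subset_Ioo ha hb))
    fun t ht => hM t ht ζ (mem_ball_self hr)

theorem hasDerivAt_convKernel (hp : DifferentiableOn ℂ p (halfPlane ρ))
    (hq : DifferentiableOn ℂ q (halfPlane ρ)) (hρ : ρ ≤ 0) (hζ : ζ.re < ρ) {t : ℝ}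
    (h0 : 0 < t) (h1 : t < 1) :
    HasDerivAt (fun z => convKernel p q z t)
      ((deriv p (ζ + (Real.log t : ℂ)) * q (secondLift ζ t) + p (ζ + (Real.log t : ℂ)) *
        (deriv q (secondLift ζ t) * (1 - (t : ℂ) * Complex.exp ζ)⁻¹)) * kern ζ t +
        p (ζ + (Real.log t : ℂ)) * q (secondLift ζ t) *
          (-Complex.exp ζ / (1 - t * Complex.exp ζ) ^ 2)) ζ :=
  ((hasDerivAt_comp_firstLift_complex hp hζ h0 h1).mul
    (hasDerivAt_comp_secondLift_complex hq hρ hζ h0 h1)).mul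
      (hasDerivAt_kern (hζ.trans_le hρ) h0 h1)

theorem hasDerivAt_conv_interval (hp : DifferentiableOn ℂ p (halfPlane ρ))
    (hq : DifferentiableOn ℂ q (halfPlane ρ)) (hρ : ρ ≤ 0) (ha : 0 ≤ a) (hab : a ≤ b) (hb : b ≤ 1)
    (hpb : BddFirst p ρ a b) (hqb : BddSecond q ρ a b) (hζ : ζ.re < ρ) :
    IntervalIntegrable (fun t => deriv (fun z => convKernel p q z t) ζ) volume a b ∧
    HasDerivAt (fun z => ∫ t in a..b, convKernel p q z t)
      (∫ t in a..b, deriv (fun z => convKernel p q z t) ζ) ζ := by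
  obtain ⟨r, hr, M, hre, hM⟩ := exists_bound_convKernel hρ ha hb hpb hqb hζ
  refine hasDerivAt_intervalIntegral_of_bounded hab hr (fun z hz =>
    (continuousOn_convKernel hp hq hρ (hre z hz)).mono (Ioo_subset_Ioo ha hb)) ?_ hM
  exact fun t ht z hz => (hasDerivAt_convKernel hp hq hρ (hre z hz) (ha.trans_lt ht.1)
    (ht.2.trans_le hb)).differentiableAt.differentiableWithinAt

theorem differentiableOn_conv_interval (hp : DifferentiableOn ℂ p (halfPlane ρ))
    (hq : DifferentiableOn ℂ q (halfPlane ρ)) (hρ : ρ ≤ 0) (ha : 0 ≤ a) (hab : a ≤ b) (hb : b ≤ 1)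
    (hpb : BddFirst p ρ a b) (hqb : BddSecond q ρ a b) :
    DifferentiableOn ℂ (fun z => ∫ t in a..b, convKernel p q z t) (halfPlane ρ) := fun _ hζ =>
  (hasDerivAt_conv_interval hp hq hρ ha hab hb hpb hqb
    hζ).2.differentiableAt.differentiableWithinAt

/-- Differentiation, the derivative falling on the second factor. -/
theorem theta_conv_second (hp : DifferentiableOn ℂ p (halfPlane ρ))
    (hq : DifferentiableOn ℂ q (halfPlane ρ)) (hρ : ρ ≤ 0) (ha : 0 ≤ a) (hab : a < b) (hb : b ≤ 1)
    (hpb : BddFirst p ρ a b) (hqb : BddSecond q ρ a b) (hqb' : BddSecond (theta q) ρ a b)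
    (hζ : ζ.re < ρ) {la lb : ℂ}
    (hla : Tendsto (fun t : ℝ => p (ζ + (Real.log t : ℂ)) * q (secondLift ζ t) * weight ζ t)
      (𝓝[>] a) (𝓝 la))
    (hlb : Tendsto (fun t : ℝ => p (ζ + (Real.log t : ℂ)) * q (secondLift ζ t) * weight ζ t)
      (𝓝[<] b) (𝓝 lb)) :
    theta (fun z => ∫ t in a..b, convKernel p q z t) ζ =
      lb - la + ∫ t in a..b, convKernel p (theta q) ζ t := by
  obtain ⟨hi, hd⟩ := hasDerivAt_conv_interval hp hq hρ ha hab.le hb hpb hqb hζ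
  have hi2 := intervalIntegrable_convKernel hp (differentiableOn_theta hq) hρ ha hab.le hb hpb hqb'
    hζ
  -- The integrand of the left side minus the kernel of `p` and `theta q` is the `t`-derivative of
  -- `p q weight`; its boundary limits are `lb` and `la`.
  have hi3 := (hi.const_mul (1 - Complex.exp (-ζ))).sub hi2
  rw [theta, hd.deriv, ← intervalIntegral.integral_const_mul,
    ← intervalIntegral.integral_eq_sub_of_hasDerivAt_of_tendsto hab (fun t ht => ?_) hi3 hla hlb,
    ← intervalIntegral.integral_add hi3 hi2]
  · simp
  · have h0 := ha.trans_lt ht.1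
    have h1 := ht.2.trans_le hb
    refine (((hasDerivAt_comp_firstLift_real hp hρ hζ h0 h1).mul
      (hasDerivAt_comp_secondLift_real hq hρ hζ h0 h1)).mul
        (hasDerivAt_weight (hζ.trans_le hρ) h0 h1)).congr_deriv ?_
    rw [(hasDerivAt_convKernel hp hq hρ hζ h0 h1).deriv, convKernel_eq, Pi.mul_apply]
    linear_combination (-(q (secondLift ζ t) * kern ζ t)) * weight_mul_theta (p := p) hρ hζ h0 h1 -
      (p (ζ + (Real.log t : ℂ)) * kern ζ t) * one_sub_weight_mul_theta (q := q) hρ hζ h0 h1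

/-- Differentiation, the derivative falling on the first factor. -/
theorem theta_conv_first (hp : DifferentiableOn ℂ p (halfPlane ρ))
    (hq : DifferentiableOn ℂ q (halfPlane ρ)) (hρ : ρ ≤ 0) (ha : 0 ≤ a) (hab : a < b) (hb : b ≤ 1)
    (hpb : BddFirst p ρ a b) (hqb : BddSecond q ρ a b) (hpb' : BddFirst (theta p) ρ a b)
    (hζ : ζ.re < ρ) {la lb : ℂ}
    (hla : Tendsto (fun t : ℝ => p (ζ + (Real.log t : ℂ)) * q (secondLift ζ t) *
      (weight ζ t - 1)) (𝓝[>] a) (𝓝 la))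
    (hlb : Tendsto (fun t : ℝ => p (ζ + (Real.log t : ℂ)) * q (secondLift ζ t) *
      (weight ζ t - 1)) (𝓝[<] b) (𝓝 lb)) :
    theta (fun z => ∫ t in a..b, convKernel p q z t) ζ =
      lb - la + ∫ t in a..b, convKernel (theta p) q ζ t := by
  obtain ⟨hi, hd⟩ := hasDerivAt_conv_interval hp hq hρ ha hab.le hb hpb hqb hζ
  have hi2 := intervalIntegrable_convKernel (differentiableOn_theta hp) hq hρ ha hab.le hb hpb' hqb
    hζ
  -- Now the exact derivative is that of `p q (weight - 1)`, which moves `theta` to `p`.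
  have hi3 := (hi.const_mul (1 - Complex.exp (-ζ))).sub hi2
  rw [theta, hd.deriv, ← intervalIntegral.integral_const_mul,
    ← intervalIntegral.integral_eq_sub_of_hasDerivAt_of_tendsto hab (fun t ht => ?_) hi3 hla hlb,
    ← intervalIntegral.integral_add hi3 hi2]
  · simp
  · have h0 := ha.trans_lt ht.1
    have h1 := ht.2.trans_le hb
    refine (((hasDerivAt_comp_firstLift_real hp hρ hζ h0 h1).mul
      (hasDerivAt_comp_secondLift_real hq hρ hζ h0 h1)).mul
        ((hasDerivAt_weight (hζ.trans_le hρ) h0 h1).sub_const 1)).congr_deriv ?_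
    rw [(hasDerivAt_convKernel hp hq hρ hζ h0 h1).deriv, convKernel_eq, Pi.mul_apply]
    linear_combination (-(q (secondLift ζ t) * kern ζ t)) * weight_mul_theta (p := p) hρ hζ h0 h1 -
      (p (ζ + (Real.log t : ℂ)) * kern ζ t) * one_sub_weight_mul_theta (q := q) hρ hζ h0 h1

/-- Integration by parts in the convolution integral. -/
theorem integral_convKernel_by_parts (hp : DifferentiableOn ℂ p (halfPlane ρ))
    (hq : DifferentiableOn ℂ q (halfPlane ρ)) (hρ : ρ ≤ 0) (ha : 0 < a) (hab : a ≤ b) (hb : b < 1)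
    (hζ : ζ.re < ρ) :
    (∫ t in a..b, convKernel (theta p) q ζ t) =
      p (ζ + (Real.log b : ℂ)) * q (secondLift ζ b) -
        p (ζ + (Real.log a : ℂ)) * q (secondLift ζ a) +
        ∫ t in a..b, convKernel p (theta q) ζ t := by
  have hsub : uIcc a b ⊆ Ioo 0 1 := by
    rw [uIcc_of_le hab]; exact fun t ht => ⟨ha.trans_le ht.1, ht.2.trans_lt hb⟩
  have hi1 : IntervalIntegrable (convKernel (theta p) q ζ) volume a b :=
    ((continuousOn_convKernel (differentiableOn_theta hp) hq hρ hζ).mono hsub).intervalIntegrable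
  have hi2 : IntervalIntegrable (convKernel p (theta q) ζ) volume a b :=
    ((continuousOn_convKernel hp (differentiableOn_theta hq) hρ hζ).mono hsub).intervalIntegrable
  rw [← sub_eq_iff_eq_add, ← intervalIntegral.integral_sub hi1 hi2]
  refine intervalIntegral.integral_eq_sub_of_hasDerivAt
    (f := fun t : ℝ => p (ζ + (Real.log t : ℂ)) * q (secondLift ζ t)) (fun t ht => ?_)
    (hi1.sub hi2)
  obtain ⟨h0, h1⟩ := hsub ht
  refine ((hasDerivAt_comp_firstLift_real hp hρ hζ h0 h1).mul
    (hasDerivAt_comp_secondLift_real hq hρ hζ h0 h1)).congr_deriv ?_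
  rw [convKernel_eq, convKernel_eq]
  ring

end Half

/-! ### Convolution of local functions -/

theorem Vanishes.tendsto_firstLift {p : ℂ → ℂ} (hv : Vanishes p) (ζ : ℂ) :
    Tendsto (fun t : ℝ => p (ζ + (Real.log t : ℂ))) (𝓝[>] 0) (𝓝 0) := by
  refine (hv |ζ.im|).comp (tendsto_inf.mpr ⟨tendsto_comap_iff.mpr ?_, tendsto_principal.mpr ?_⟩)
  · have : Tendsto (fun t : ℝ => ζ.re + Real.log t) (𝓝[>] 0) atBot :=
      tendsto_atBot_add_const_left _ _ (Real.tendsto_log_nhdsGT_zero)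
    exact this.congr fun t => (firstLift_re ζ t).symm
  · exact Eventually.of_forall fun t => by
      rw [mem_ofPred_eq, firstLift_im]

theorem Vanishes.tendsto_secondLift {q : ℂ → ℂ} (hv : Vanishes q) {ζ : ℂ} (hζ : ζ.re < 0) :
    Tendsto (fun t : ℝ => q (secondLift ζ t)) (𝓝[<] 1) (𝓝 0) := by
  refine (hv (|ζ.im| + Real.pi)).comp
    (tendsto_inf.mpr ⟨tendsto_comap_iff.mpr ?_, tendsto_principal.mpr ?_⟩)
  · have h1 : Tendsto (fun t : ℝ => 1 - t) (𝓝[<] 1) (𝓝[>] 0) := by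
      refine tendsto_nhdsWithin_iff.mpr ⟨?_, ?_⟩
      · have : ContinuousAt (fun t : ℝ => 1 - t) 1 := by fun_prop
        have h := this.tendsto
        rw [sub_self] at h
        exact h.mono_left nhdsWithin_le_nhds
      · filter_upwards [self_mem_nhdsWithin] with t ht
        simp only [mem_Iio] at ht
        simpa using ht
    have h2 : Tendsto (fun t : ℝ => (ζ.re - Real.log (1 - Real.exp ζ.re)) + Real.log (1 - t))
        (𝓝[<] 1) atBot :=
      tendsto_atBot_add_const_left _ _ (Real.tendsto_log_nhdsGT_zero.comp h1)
    refine tendsto_atBot_mono' _ ?_ h2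
    filter_upwards [Ioo_mem_nhdsLT zero_lt_one] with t ht
    have h3 : Real.exp ζ.re < 1 := by simpa using hζ
    rw [Function.comp_apply, secondLift_re]
    linarith [Real.log_le_log (by linarith) (norm_one_sub_ge (ζ := ζ) ht.1 ht.2)]
  · exact Eventually.of_forall fun t => abs_secondLift_im_le ζ t

theorem tendsto_zero_of_bounded_mul {l : Filter ℝ} {f g : ℝ → ℂ} {B : ℝ}
    (hf : ∀ᶠ t in l, ‖f t‖ ≤ B) (hg : Tendsto g l (𝓝 0)) :
    Tendsto (fun t => f t * g t) l (𝓝 0) := by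
  refine squeeze_zero_norm' (a := fun t => B * ‖g t‖) ?_ (by simpa using hg.norm.const_mul B)
  filter_upwards [hf] with t ht
  rw [norm_mul]
  gcongr

theorem continuousAt_weight {ζ : ℂ} (hζ : ζ.re < 0) {t : ℝ} (h : 0 ≤ t ∧ t ≤ 1) :
    ContinuousAt (weight ζ) t := by
  have hne : 1 - (t : ℂ) * Complex.exp ζ ≠ 0 := by
    intro h0
    have h2 := congrArg norm (sub_eq_zero.mp h0)
    rw [norm_one, norm_mul, Complex.norm_real, Real.norm_of_nonneg h.1] at h2
    nlinarith [norm_exp_lt_one hζ, norm_nonneg (Complex.exp ζ)]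
  unfold weight
  exact ContinuousAt.div (by fun_prop) (by fun_prop) hne

theorem weight_zero (ζ : ℂ) : weight ζ 0 = 0 := by simp [weight]

theorem weight_one {ζ : ℂ} (hζ : ζ.re < 0) : weight ζ 1 = 1 := by
  have : 1 - Complex.exp ζ ≠ 0 := fun h => by
    have := norm_exp_lt_one hζ
    rw [← sub_eq_zero.mp h, norm_one] at this
    exact lt_irrefl _ this
  simp [weight, div_self this]

section Halves

variable {p q : ℂ → ℂ} {ρ : ℝ} {ζ : ℂ}

theorem continuousAt_factors (hp : DifferentiableOn ℂ p (halfPlane ρ))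
    (hq : DifferentiableOn ℂ q (halfPlane ρ)) (hρ : ρ ≤ 0) (hζ : ζ.re < ρ) {t : ℝ} (h0 : 0 < t)
    (h1 : t < 1) :
    ContinuousAt (fun t : ℝ => p (ζ + (Real.log t : ℂ)) * q (secondLift ζ t)) t :=
  (hasDerivAt_comp_firstLift_real hp hρ hζ h0 h1).continuousAt.mul
    (hasDerivAt_comp_secondLift_real hq hρ hζ h0 h1).continuousAt

theorem exists_bound_factors {a b : ℝ} (hpb : BddFirst p ρ a b) (hqb : BddSecond q ρ a b)
    (hζ : ζ.re < ρ) :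
    ∃ B, ∀ t ∈ Ioo a b, ‖p (ζ + (Real.log t : ℂ)) * q (secondLift ζ t)‖ ≤ B := by
  obtain ⟨B, hB0, hB⟩ := hpb ζ.re ζ.re |ζ.im| hζ
  obtain ⟨B', hB0', hB'⟩ := hqb ζ.re ζ.re |ζ.im| hζ
  refine ⟨B * B', fun t ht => ?_⟩
  rw [norm_mul]
  exact mul_le_mul (hB ζ le_rfl le_rfl le_rfl t ht) (hB' ζ le_rfl le_rfl le_rfl t ht)
    (norm_nonneg _) hB0

/-- Near `t = 0` it is `p` that approaches its puncture, where `theta p` need not be bounded; so the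
derivative is put on `q`, whose lifts stay in a compact set for `t ≤ 1 / 2`. The boundary term at
`0` disappears since `weight` vanishes there. On the right half the roles are exchanged and `weight
- 1` vanishes at `1`. -/
theorem theta_left_half (hp : DifferentiableOn ℂ p (halfPlane ρ)) (hpv : Vanishes p)
    (hq : DifferentiableOn ℂ q (halfPlane ρ)) (hρ : ρ ≤ 0) (hζ : ζ.re < ρ) :
    theta (fun z => ∫ t in (0 : ℝ)..(1 / 2), convKernel p q z t) ζ =
      p (ζ + (Real.log (1 / 2) : ℂ)) * q (secondLift ζ (1 / 2)) * weight ζ (1 / 2) +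
        ∫ t in (0 : ℝ)..(1 / 2), convKernel p (theta q) ζ t := by
  have hpb := BddFirst.of_vanishes (a := 0) (b := 1 / 2) hp.continuousOn hpv le_rfl (by norm_num)
  have hqb := BddSecond.of_continuousOn (a := 0) (b := 1 / 2) hρ hq.continuousOn le_rfl
    (by norm_num)
  have hqb' := BddSecond.of_continuousOn (a := 0) (b := 1 / 2) hρ
    (differentiableOn_theta hq).continuousOn le_rfl (by norm_num)
  obtain ⟨B, hB⟩ := exists_bound_factors hpb hqb hζ
  have hζ0 := hζ.trans_le hρ
  rw [theta_conv_second hp hq hρ le_rfl (by norm_num) (by norm_num) hpb hqb hqb' hζ (la := 0)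
    (lb := p (ζ + (Real.log (1 / 2) : ℂ)) * q (secondLift ζ (1 / 2)) * weight ζ (1 / 2)), sub_zero]
  · refine tendsto_zero_of_bounded_mul (B := B) ?_ ?_
    · filter_upwards [Ioo_mem_nhdsGT (by norm_num : (0 : ℝ) < 1 / 2)] with t ht using hB t ht
    · have := (continuousAt_weight hζ0 (t := 0) (by norm_num)).tendsto
      rw [weight_zero] at this
      exact this.mono_left nhdsWithin_le_nhds
  · exact ((continuousAt_factors hp hq hρ hζ (by norm_num) (by norm_num)).mul
      (continuousAt_weight hζ0 (by norm_num))).tendsto.mono_left nhdsWithin_le_nhds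

theorem theta_right_half (hp : DifferentiableOn ℂ p (halfPlane ρ)) (hqv : Vanishes q)
    (hq : DifferentiableOn ℂ q (halfPlane ρ)) (hρ : ρ ≤ 0) (hζ : ζ.re < ρ) :
    theta (fun z => ∫ t in (1 / 2 : ℝ)..1, convKernel p q z t) ζ =
      p (ζ + (Real.log (1 / 2) : ℂ)) * q (secondLift ζ (1 / 2)) * (1 - weight ζ (1 / 2)) +
        ∫ t in (1 / 2 : ℝ)..1, convKernel (theta p) q ζ t := by
  have hqb := BddSecond.of_vanishes (a := 1 / 2) (b := 1) hρ hq.continuousOn hqv (by norm_num)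
    le_rfl
  have hpb := BddFirst.of_continuousOn (a := 1 / 2) (b := 1) hp.continuousOn (by norm_num) le_rfl
  have hpb' := BddFirst.of_continuousOn (a := 1 / 2) (b := 1)
    (differentiableOn_theta hp).continuousOn (by norm_num) le_rfl
  obtain ⟨B, hB⟩ := exists_bound_factors hpb hqb hζ
  have hζ0 := hζ.trans_le hρ
  rw [theta_conv_first hp hq hρ (by norm_num) (by norm_num) le_rfl hpb hqb hpb' hζ (lb := 0)
    (la := p (ζ + (Real.log (1 / 2) : ℂ)) * q (secondLift ζ (1 / 2)) * (weight ζ (1 / 2) - 1))]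
  · ring
  · exact ((continuousAt_factors hp hq hρ hζ (by norm_num) (by norm_num)).mul
      ((continuousAt_weight hζ0 (by norm_num)).sub_const 1)).tendsto.mono_left nhdsWithin_le_nhds
  · refine tendsto_zero_of_bounded_mul (B := B) ?_ ?_
    · filter_upwards [Ioo_mem_nhdsLT (by norm_num : (1 / 2 : ℝ) < 1)] with t ht using hB t ht
    · have := (continuousAt_weight hζ0 (t := 1) (by norm_num)).tendsto
      rw [weight_one hζ0] at this
      simpa using (this.sub_const 1).mono_left nhdsWithin_le_nhds

theorem hasDerivAt_midpoint (hp : DifferentiableOn ℂ p (halfPlane ρ))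
    (hq : DifferentiableOn ℂ q (halfPlane ρ)) (hρ : ρ ≤ 0) (hζ : ζ.re < ρ) :
    HasDerivAt (fun z => p (z + (Real.log (1 / 2) : ℂ)) * q (secondLift z (1 / 2)))
      (deriv p (ζ + (Real.log (1 / 2) : ℂ)) * q (secondLift ζ (1 / 2)) +
        p (ζ + (Real.log (1 / 2) : ℂ)) * (deriv q (secondLift ζ (1 / 2)) *
          (1 - ((1 / 2 : ℝ) : ℂ) * Complex.exp ζ)⁻¹)) ζ :=
  (hasDerivAt_comp_firstLift_complex hp hζ (by norm_num) (by norm_num)).mul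
    (hasDerivAt_comp_secondLift_complex hq hρ hζ (by norm_num) (by norm_num))

theorem theta_midpoint (hp : DifferentiableOn ℂ p (halfPlane ρ))
    (hq : DifferentiableOn ℂ q (halfPlane ρ)) (hρ : ρ ≤ 0) (hζ : ζ.re < ρ) :
    theta (fun z => p (z + (Real.log (1 / 2) : ℂ)) * q (secondLift z (1 / 2))) ζ =
      weight ζ (1 / 2) * theta p (ζ + (Real.log (1 / 2) : ℂ)) * q (secondLift ζ (1 / 2)) +
        (1 - weight ζ (1 / 2)) * p (ζ + (Real.log (1 / 2) : ℂ)) *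
          theta q (secondLift ζ (1 / 2)) := by
  rw [theta, (hasDerivAt_midpoint hp hq hρ hζ).deriv]
  linear_combination q (secondLift ζ (1 / 2)) *
      weight_mul_theta (p := p) hρ hζ (t := 1 / 2) (by norm_num) (by norm_num) +
    p (ζ + (Real.log (1 / 2) : ℂ)) *
      one_sub_weight_mul_theta (q := q) hρ hζ (t := 1 / 2) (by norm_num) (by norm_num)

/-- Convergence of the convolution integral of `theta p` and `theta q`. -/
theorem tendsto_truncatedIntegral (hp : DifferentiableOn ℂ p (halfPlane ρ)) (hpv : Vanishes p)
    (hq : DifferentiableOn ℂ q (halfPlane ρ)) (hqv : Vanishes q) (hρ : ρ ≤ 0) (hζ : ζ.re < ρ) :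
    Tendsto (truncatedIntegral (theta p) (theta q) ζ) (𝓝[>] (0 : ℝ) ×ˢ 𝓝[>] (0 : ℝ))
      (𝓝 (p (ζ + (Real.log (1 / 2) : ℂ)) * theta q (secondLift ζ (1 / 2)) +
          (∫ t in (0 : ℝ)..(1 / 2), convKernel p (theta (theta q)) ζ t) +
        (theta p (ζ + (Real.log (1 / 2) : ℂ)) * q (secondLift ζ (1 / 2)) +
          ∫ t in (1 / 2 : ℝ)..1, convKernel (theta (theta p)) q ζ t))) := by
  have hζ0 := hζ.trans_le hρ
  have hp1 := differentiableOn_theta hp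
  have hq1 := differentiableOn_theta hq
  have hp2 := differentiableOn_theta hp1
  have hq2 := differentiableOn_theta hq1
  have hpb := BddFirst.of_vanishes (a := 0) (b := 1 / 2) hp.continuousOn hpv le_rfl (by norm_num)
  have hqb := BddSecond.of_vanishes (a := 1 / 2) (b := 1) hρ hq.continuousOn hqv (by norm_num)
    le_rfl
  have hq1b := BddSecond.of_continuousOn (a := 0) (b := 1 / 2) hρ hq1.continuousOn le_rfl
    (by norm_num)
  have hq2b := BddSecond.of_continuousOn (a := 0) (b := 1 / 2) hρ hq2.continuousOn le_rfl
    (by norm_num)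
  have hp1b := BddFirst.of_continuousOn (a := 1 / 2) (b := 1) hp1.continuousOn (by norm_num) le_rfl
  have hp2b := BddFirst.of_continuousOn (a := 1 / 2) (b := 1) hp2.continuousOn (by norm_num) le_rfl
  -- Parts move `theta` off the factor that approaches its puncture; the integrand becomes
  -- integrable up to `0`, and the boundary term at `ε` tends to `0` with `p`.
  have hleft : Tendsto (fun ε : ℝ => ∫ t in ε..(1 / 2), convKernel (theta p) (theta q) ζ t) (𝓝[>] 0)
      (𝓝 (p (ζ + (Real.log (1 / 2) : ℂ)) * theta q (secondLift ζ (1 / 2)) +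
          (∫ t in (0 : ℝ)..(1 / 2), convKernel p (theta (theta q)) ζ t))) := by
    have hi := intervalIntegrable_convKernel hp hq2 hρ le_rfl (by norm_num) (by norm_num) hpb hq2b
      hζ
    have hc := intervalIntegral.continuousOn_primitive_interval_left (a := 0) (b := 1 / 2)
      (by
        rw [uIcc_of_le (by norm_num)]
        exact (intervalIntegrable_iff_integrableOn_Icc_of_le (by norm_num)).mp hi)
    have h1 : Tendsto (fun ε : ℝ => ∫ t in ε..(1 / 2), convKernel p (theta (theta q)) ζ t) (𝓝[>] 0)
        (𝓝 (∫ t in (0 : ℝ)..(1 / 2), convKernel p (theta (theta q)) ζ t)) := by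
      have := hc 0 left_mem_uIcc
      rw [uIcc_of_le (by norm_num)] at this
      exact this.tendsto.mono_left (nhdsWithin_le_of_mem
        (mem_of_superset (Ioo_mem_nhdsGT (by norm_num : (0 : ℝ) < 1 / 2)) Ioo_subset_Icc_self))
    obtain ⟨B, -, hB⟩ := hq1b ζ.re ζ.re |ζ.im| hζ
    have h2 : Tendsto (fun t : ℝ => p (ζ + (Real.log t : ℂ)) * theta q (secondLift ζ t)) (𝓝[>] 0)
        (𝓝 0) := by
      simp_rw [mul_comm (p _)]
      refine tendsto_zero_of_bounded_mul (B := B) ?_ (hpv.tendsto_firstLift ζ)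
      filter_upwards [Ioo_mem_nhdsGT (by norm_num : (0 : ℝ) < 1 / 2)] with t ht
      exact hB ζ le_rfl le_rfl le_rfl t ht
    have h3 := (h2.const_sub
      (p (ζ + (Real.log (1 / 2) : ℂ)) * theta q (secondLift ζ (1 / 2)))).add h1
    rw [sub_zero] at h3
    refine h3.congr' ?_
    filter_upwards [Ioo_mem_nhdsGT (by norm_num : (0 : ℝ) < 1 / 2)] with t ht
    exact (integral_convKernel_by_parts hp hq1 hρ ht.1 ht.2.le (by norm_num) hζ).symm
  have hright : Tendsto (fun δ : ℝ => ∫ t in (1 / 2)..(1 - δ), convKernel (theta p) (theta q) ζ t)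
      (𝓝[>] 0) (𝓝 (theta p (ζ + (Real.log (1 / 2) : ℂ)) * q (secondLift ζ (1 / 2)) +
          ∫ t in (1 / 2 : ℝ)..1, convKernel (theta (theta p)) q ζ t)) := by
    have hi := intervalIntegrable_convKernel hp2 hq hρ (by norm_num) (by norm_num) le_rfl hp2b hqb
      hζ
    have hc := intervalIntegral.continuousOn_primitive_interval (a := 1 / 2) (b := 1)
      (by
        rw [uIcc_of_le (by norm_num)]
        exact (intervalIntegrable_iff_integrableOn_Icc_of_le (by norm_num)).mp hi)
    have h1 : Tendsto (fun x : ℝ => ∫ t in (1 / 2)..x, convKernel (theta (theta p)) q ζ t) (𝓝[<] 1)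
        (𝓝 (∫ t in (1 / 2 : ℝ)..1, convKernel (theta (theta p)) q ζ t)) := by
      have := hc 1 right_mem_uIcc
      rw [uIcc_of_le (by norm_num)] at this
      exact this.tendsto.mono_left (nhdsWithin_le_of_mem
        (mem_of_superset (Ioo_mem_nhdsLT (by norm_num : (1 / 2 : ℝ) < 1)) Ioo_subset_Icc_self))
    obtain ⟨B, -, hB⟩ := hp1b ζ.re ζ.re |ζ.im| hζ
    have h2 : Tendsto (fun t : ℝ => theta p (ζ + (Real.log t : ℂ)) * q (secondLift ζ t)) (𝓝[<] 1)
        (𝓝 0) := by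
      refine tendsto_zero_of_bounded_mul (B := B) ?_ (hqv.tendsto_secondLift hζ0)
      filter_upwards [Ioo_mem_nhdsLT (by norm_num : (1 / 2 : ℝ) < 1)] with t ht
      exact hB ζ le_rfl le_rfl le_rfl t ht
    have h3 := (h2.const_sub
      (theta p (ζ + (Real.log (1 / 2) : ℂ)) * q (secondLift ζ (1 / 2)))).add h1
    rw [sub_zero] at h3
    have h4 : Tendsto (fun δ : ℝ => 1 - δ) (𝓝[>] 0) (𝓝[<] 1) := by
      refine tendsto_nhdsWithin_iff.mpr ⟨?_, ?_⟩
      · have : ContinuousAt (fun t : ℝ => 1 - t) 0 := by fun_prop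
        have h := this.tendsto
        rw [sub_zero] at h
        exact h.mono_left nhdsWithin_le_nhds
      · filter_upwards [self_mem_nhdsWithin] with t ht
        simp only [mem_Ioi] at ht
        simpa using ht
    refine (h3.comp h4).congr' ?_
    filter_upwards [Ioo_mem_nhdsGT (by norm_num : (0 : ℝ) < 1 / 2)] with t ht
    have h5 := integral_convKernel_by_parts (a := 1 / 2) (b := 1 - t) hp1 hq hρ (by norm_num)
      (by linarith [ht.2]) (by linarith [ht.1]) hζ
    rw [Function.comp_apply, h5]
    ring
  refine ((hleft.comp tendsto_fst).add (hright.comp tendsto_snd)).congr' ?_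
  filter_upwards [prod_mem_prod (Ioo_mem_nhdsGT (by norm_num : (0 : ℝ) < 1 / 2))
    (Ioo_mem_nhdsGT (by norm_num : (0 : ℝ) < 1 / 2))] with x hx
  have hsub : ∀ a b : ℝ, 0 < a → a ≤ b → b < 1 →
      IntervalIntegrable (convKernel (theta p) (theta q) ζ) volume a b := fun a b h0 h1 h2 =>
    ((continuousOn_convKernel hp1 hq1 hρ hζ).mono (by
      rw [uIcc_of_le h1]
      exact fun t ht => ⟨h0.trans_le ht.1, ht.2.trans_lt h2⟩)).intervalIntegrable
  exact intervalIntegral.integral_add_adjacent_intervals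
    (hsub _ _ hx.1.1 hx.1.2.le (by norm_num))
    (hsub _ _ (by norm_num) (by linarith [hx.2.2]) (by linarith [hx.2.1]))

end Halves

section Conv

variable {p q : ℂ → ℂ} {ρ : ℝ} {ζ : ℂ}

/-- The factor `exp (-ξ)` hidden in `theta` is compensated by the `exp ζ` in `kern`, so only the
derivative of `q`, which vanishes at the puncture, remains. -/
theorem norm_theta_second_mul_kern_le (hζ : ζ.re < 0) {t : ℝ} (h0 : 0 < t) (h1 : t ≤ 1 / 2) :
    ‖theta q (secondLift ζ t) * kern ζ t‖ ≤ 4 * ‖deriv q (secondLift ζ t)‖ := by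
  have ht1 : t < 1 := by linarith
  have hn := one_sub_ne_zero hζ h0 ht1
  have hn1 : (1 - (t : ℂ)) ≠ 0 := by
    rw [← Complex.ofReal_one, ← Complex.ofReal_sub]; exact_mod_cast (by linarith : 1 - t ≠ 0)
  have key : theta q (secondLift ζ t) * kern ζ t =
      (kern ζ t + (1 - (t : ℂ))⁻¹) * deriv q (secondLift ζ t) := by
    rw [theta, kern, Complex.exp_neg, exp_secondLift hζ h0 ht1]
    have he := Complex.exp_ne_zero ζ
    generalize Complex.exp ζ = e at *
    have hn' : 1 - e * (t : ℂ) ≠ 0 := by rwa [mul_comm]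
    field_simp
    ring
  have hk : ‖kern ζ t‖ ≤ 2 := by
    rw [kern, norm_div, norm_neg, div_le_iff₀ (norm_pos_iff.mpr hn)]
    linarith [norm_one_sub_gt hζ h0, norm_exp_lt_one hζ]
  have h2 : ‖(1 - (t : ℂ))⁻¹‖ ≤ 2 := by
    rw [norm_inv, ← Complex.ofReal_one, ← Complex.ofReal_sub, Complex.norm_real,
      Real.norm_of_nonneg (by linarith)]
    exact inv_le_of_inv_le₀ (by norm_num) (by linarith)
  rw [key, norm_mul]
  gcongr
  linarith [norm_add_le (kern ζ t) (1 - (t : ℂ))⁻¹]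

theorem norm_theta_first_mul_kern_le (hζ : ζ.re < 0) {t : ℝ} (h0 : 1 / 2 ≤ t) (h1 : t < 1) :
    ‖theta p (ζ + (Real.log t : ℂ)) * kern ζ t‖ ≤ 2 * ‖deriv p (ζ + (Real.log t : ℂ))‖ := by
  have ht0 : 0 < t := by linarith
  have key : theta p (ζ + (Real.log t : ℂ)) * kern ζ t =
      (t : ℂ)⁻¹ * deriv p (ζ + (Real.log t : ℂ)) := by
    rw [theta, kern, Complex.exp_neg, exp_firstLift ζ ht0]
    have hn := one_sub_ne_zero hζ ht0 h1
    have ht : (t : ℂ) ≠ 0 := by exact_mod_cast ht0.ne'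
    have he := Complex.exp_ne_zero ζ
    generalize Complex.exp ζ = e at *
    have hn' : 1 - e * (t : ℂ) ≠ 0 := by rwa [mul_comm]
    field_simp
    ring
  rw [key, norm_mul, norm_inv, Complex.norm_real, Real.norm_of_nonneg ht0.le]
  gcongr
  exact inv_le_of_inv_le₀ (by norm_num) (by linarith)

theorem norm_integral_Ioo_le {f : ℝ → ℂ} {a b C : ℝ} (hab : a ≤ b) (hb : b - a ≤ 1) (hC : 0 ≤ C)
    (h : ∀ t ∈ Ioo a b, ‖f t‖ ≤ C) : ‖∫ t in a..b, f t‖ ≤ C := by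
  rw [intervalIntegral.integral_of_le hab, integral_Ioc_eq_integral_Ioo]
  refine (norm_setIntegral_le_of_norm_le_const (by simp) h).trans ?_
  simp only [Real.volume_real_Ioo_of_le hab]
  nlinarith

/-- The convolution of `theta p` and `theta q`, for `p` and `q` vanishing at the puncture, converges;
it is `theta E`, with `E` again vanishing at the puncture, and `E` is `theta C`, where `C` is the
(absolutely convergent) convolution of `p` and `q`. -/
theorem exists_conv_primitives (hρ : ρ ≤ 0) (hp : DifferentiableOn ℂ p (halfPlane ρ))
    (hpv : Vanishes p) (hq : DifferentiableOn ℂ q (halfPlane ρ)) (hqv : Vanishes q) :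
    ∃ C E : ℂ → ℂ, DifferentiableOn ℂ C (halfPlane ρ) ∧ Vanishes C ∧
      DifferentiableOn ℂ E (halfPlane ρ) ∧ Vanishes E ∧
      (∀ ζ, C ζ = -(1 / (2 * Real.pi * Complex.I)) * ∫ t in (0 : ℝ)..1, convKernel p q ζ t) ∧
      (∀ ζ ∈ halfPlane ρ, theta C ζ = E ζ) ∧
      ∀ ζ ∈ halfPlane ρ, ConvConverges (theta p) (theta q) ζ ∧
        conv (theta p) (theta q) ζ = theta E ζ := by
  set c : ℂ := -(1 / (2 * Real.pi * Complex.I)) with hc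
  have hp1 := differentiableOn_theta hp
  have hq1 := differentiableOn_theta hq
  have hpb := BddFirst.of_vanishes (a := 0) (b := 1 / 2) hp.continuousOn hpv le_rfl (by norm_num)
  have hpb' := BddFirst.of_vanishes (a := 1 / 2) (b := 1) hp.continuousOn hpv (by norm_num) le_rfl
  have hqb := BddSecond.of_vanishes (a := 1 / 2) (b := 1) hρ hq.continuousOn hqv (by norm_num)
    le_rfl
  have hqb' := BddSecond.of_vanishes (a := 0) (b := 1 / 2) hρ hq.continuousOn hqv le_rfl
    (by norm_num)
  have hq1b := BddSecond.of_continuousOn (a := 0) (b := 1 / 2) hρ hq1.continuousOn le_rfl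
    (by norm_num)
  have hp1b := BddFirst.of_continuousOn (a := 1 / 2) (b := 1) hp1.continuousOn (by norm_num) le_rfl
  set mid : ℂ → ℂ := fun z => p (z + (Real.log (1 / 2) : ℂ)) * q (secondLift z (1 / 2)) with hmid
  set L : ℂ → ℂ := fun z => ∫ t in (0 : ℝ)..(1 / 2), convKernel p (theta q) z t with hL
  set R : ℂ → ℂ := fun z => ∫ t in (1 / 2 : ℝ)..1, convKernel (theta p) q z t with hR
  set L0 : ℂ → ℂ := fun z => ∫ t in (0 : ℝ)..(1 / 2), convKernel p q z t with hL0
  set R0 : ℂ → ℂ := fun z => ∫ t in (1 / 2 : ℝ)..1, convKernel p q z t with hR0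
  have dL : DifferentiableOn ℂ L (halfPlane ρ) :=
    differentiableOn_conv_interval hp hq1 hρ le_rfl (by norm_num) (by norm_num) hpb hq1b
  have dR : DifferentiableOn ℂ R (halfPlane ρ) :=
    differentiableOn_conv_interval hp1 hq hρ (by norm_num) (by norm_num) le_rfl hp1b hqb
  have dL0 : DifferentiableOn ℂ L0 (halfPlane ρ) :=
    differentiableOn_conv_interval hp hq hρ le_rfl (by norm_num) (by norm_num) hpb hqb'
  have dR0 : DifferentiableOn ℂ R0 (halfPlane ρ) :=
    differentiableOn_conv_interval hp hq hρ (by norm_num) (by norm_num) le_rfl hpb' hqb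
  have dmid : DifferentiableOn ℂ mid (halfPlane ρ) := fun z hz =>
    (hasDerivAt_midpoint hp hq hρ hz).differentiableAt.differentiableWithinAt
  have hC : ∀ ζ ∈ halfPlane ρ, (∫ t in (0 : ℝ)..1, convKernel p q ζ t) = L0 ζ + R0 ζ := fun ζ hζ =>
    (intervalIntegral.integral_add_adjacent_intervals
      (intervalIntegrable_convKernel hp hq hρ le_rfl (by norm_num) (by norm_num) hpb hqb' hζ)
      (intervalIntegrable_convKernel hp hq hρ (by norm_num) (by norm_num) le_rfl hpb' hqb
        hζ)).symm
  have hmidv : Vanishes mid := by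
    have h1 := hpv.comp_add (Real.log (1 / 2) : ℂ)
    refine (h1.mul_bounded (g := fun z => q (secondLift z (1 / 2))) fun M => ?_).congr
      (ρ := 0) fun ζ _ => mul_comm _ _
    obtain ⟨B, hB0, hB⟩ := hqv.exists_bound hq.continuousOn (sub_one_lt ρ) (M + Real.pi)
    refine ⟨B, ρ - 1, fun ζ h1 h2 => hB _ ((secondLift_re_le (by linarith) (by norm_num)
      (by norm_num)).trans h1) ((abs_secondLift_im_le _ _).trans (by linarith))⟩
  have hpv' := hpv.deriv hp
  have hqv' := hqv.deriv hq
  have hLv : Vanishes L := by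
    rw [vanishes_iff]
    intro M ε hε
    obtain ⟨X, hX⟩ := vanishes_iff.mp hpv M ε hε
    obtain ⟨Y, hY⟩ := vanishes_iff.mp hqv' (M + Real.pi) (1 / 4) (by norm_num)
    refine ⟨min (min X Y) (-1), fun ζ h1 h2 => norm_integral_Ioo_le (by norm_num) (by norm_num)
      hε.le fun t ht => ?_⟩
    have hX' : ζ.re ≤ X := h1.trans ((min_le_left _ _).trans (min_le_left _ _))
    have hY' : ζ.re ≤ Y := h1.trans ((min_le_left _ _).trans (min_le_right _ _))
    have hζ0 : ζ.re < 0 := by linarith [h1.trans (min_le_right _ _)]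
    have ht1 : t < 1 := by linarith [ht.2]
    rw [convKernel_eq, mul_assoc, norm_mul]
    have e1 := hX (ζ + (Real.log t : ℂ)) ((firstLift_re_le ζ ht.1 ht1).trans hX')
      (by rwa [firstLift_im])
    have e2 := hY (secondLift ζ t) ((secondLift_re_le hζ0 ht.1 ht1).trans hY')
      ((abs_secondLift_im_le _ _).trans (by linarith))
    have e3 := norm_theta_second_mul_kern_le (q := q) hζ0 ht.1 ht.2.le
    calc _ ≤ ε * 1 := mul_le_mul e1 (by linarith) (norm_nonneg _) hε.le
      _ = ε := mul_one _
  have hRv : Vanishes R := by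
    rw [vanishes_iff]
    intro M ε hε
    obtain ⟨X, hX⟩ := vanishes_iff.mp hpv' M (1 / 2) (by norm_num)
    obtain ⟨Y, hY⟩ := vanishes_iff.mp hqv (M + Real.pi) ε hε
    refine ⟨min (min X Y) (-1), fun ζ h1 h2 => norm_integral_Ioo_le (by norm_num) (by norm_num)
      hε.le fun t ht => ?_⟩
    have hX' : ζ.re ≤ X := h1.trans ((min_le_left _ _).trans (min_le_left _ _))
    have hY' : ζ.re ≤ Y := h1.trans ((min_le_left _ _).trans (min_le_right _ _))
    have hζ0 : ζ.re < 0 := by linarith [h1.trans (min_le_right _ _)]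
    have ht0 : 0 < t := by linarith [ht.1]
    rw [convKernel_eq, mul_right_comm, norm_mul]
    have e1 := hX (ζ + (Real.log t : ℂ)) ((firstLift_re_le ζ ht0 ht.2).trans hX')
      (by rwa [firstLift_im])
    have e2 := hY (secondLift ζ t) ((secondLift_re_le hζ0 ht0 ht.2).trans hY')
      ((abs_secondLift_im_le _ _).trans (by linarith))
    have e3 := norm_theta_first_mul_kern_le (p := p) hζ0 ht.1.le ht.2
    calc _ ≤ 1 * ε := mul_le_mul (by linarith) e2 (norm_nonneg _) zero_le_one
      _ = ε := one_mul _
  have hCv : Vanishes fun ζ => ∫ t in (0 : ℝ)..1, convKernel p q ζ t := by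
    rw [vanishes_iff]
    intro M ε hε
    obtain ⟨X, hX⟩ := vanishes_iff.mp hpv M ε hε
    obtain ⟨Y, hY⟩ := vanishes_iff.mp hqv (M + Real.pi) 1 one_pos
    refine ⟨min (min X Y) (-1), fun ζ h1 h2 => norm_integral_Ioo_le (by norm_num) (by norm_num)
      hε.le fun t ht => ?_⟩
    have hX' : ζ.re ≤ X := h1.trans ((min_le_left _ _).trans (min_le_left _ _))
    have hY' : ζ.re ≤ Y := h1.trans ((min_le_left _ _).trans (min_le_right _ _))
    have h1' : ζ.re ≤ -1 := h1.trans (min_le_right _ _)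
    have hζ0 : ζ.re < 0 := by linarith
    rw [convKernel_eq, norm_mul, norm_mul]
    have e1 := hX (ζ + (Real.log t : ℂ)) ((firstLift_re_le ζ ht.1 ht.2).trans hX')
      (by rwa [firstLift_im])
    have e2 := hY (secondLift ζ t) ((secondLift_re_le hζ0 ht.1 ht.2).trans hY')
      ((abs_secondLift_im_le _ _).trans (by linarith))
    have e3 := norm_kern_le (by norm_num : (-1 : ℝ) < 0) h1' ht.1 ht.2
    have e4 : Real.exp (-1) < 1 / 2 := by
      have := Real.exp_one_gt_d9
      rw [Real.exp_neg]
      exact inv_lt_of_inv_lt₀ (by norm_num) (by linarith)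
    have e5 : ‖kern ζ t‖ ≤ 1 := e3.trans (by
      rw [div_le_one (by linarith)]
      linarith [Real.exp_le_exp.mpr h1'])
    calc _ ≤ ε * 1 * 1 := mul_le_mul (mul_le_mul e1 e2 (norm_nonneg _) hε.le) e5 (norm_nonneg _)
          (by positivity)
      _ = ε := by ring
  -- In `theta C` the halves contribute the midpoint value with the weights `weight` and `1 -
  -- weight`, which add up to one copy of `mid`.
  refine ⟨fun ζ => c * ∫ t in (0 : ℝ)..1, convKernel p q ζ t, fun ζ => c * (mid ζ + L ζ + R ζ),
    ?_, hCv.const_mul c, ?_, ((hmidv.add hLv).add hRv).const_mul c, fun ζ => rfl, ?_, ?_⟩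
  · exact (((dL0.add dR0).congr hC).const_mul c)
  · exact ((dmid.add dL).add dR).const_mul c
  · intro ζ hζ
    have : theta (fun ζ => L0 ζ + R0 ζ) ζ = theta L0 ζ + theta R0 ζ := by
      rw [theta, deriv_fun_add (differentiableAt_of_halfPlane dL0 hζ)
        (differentiableAt_of_halfPlane dR0 hζ), mul_add]
      rfl
    rw [theta_const_mul, theta_congr hC ζ hζ, this, theta_left_half hp hpv hq hρ hζ,
      theta_right_half hp hqv hq hρ hζ]
    simp only [hmid, hL, hR]
    ring
  · intro ζ hζ
    have hlim := tendsto_truncatedIntegral hp hpv hq hqv hρ hζ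
    refine ⟨⟨(continuousOn_convKernel hp1 hq1 hρ hζ).locallyIntegrableOn measurableSet_Ioo,
      _, hlim⟩, ?_⟩
    have hadd : theta (fun ζ => mid ζ + L ζ + R ζ) ζ = theta mid ζ + theta L ζ + theta R ζ := by
      have d1 := differentiableAt_of_halfPlane dmid hζ
      have d2 := differentiableAt_of_halfPlane dL hζ
      have d3 := differentiableAt_of_halfPlane dR hζ
      rw [theta, deriv_fun_add (d1.fun_add d2) d3, deriv_fun_add d1 d2, mul_add, mul_add]
      rfl
    -- The weighted midpoint terms of `theta mid`, `theta L` and `theta R` combine to the two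
    -- boundary terms in the limit of the truncated integrals.
    rw [conv, hlim.limUnder_eq, theta_const_mul, hadd, theta_midpoint hp hq hρ hζ,
      theta_left_half hp hpv hq1 hρ hζ, theta_right_half hp1 hqv hq hρ hζ]
    ring

end Conv

/-! ### Primitives vanishing at the puncture -/

/-- The primitive `∫_{-∞}^ξ exp u * Θ u du` along the horizontal half line ending at `ξ`. -/
noncomputable def leftPrimitive (Θ : ℂ → ℂ) (ξ : ℂ) : ℂ :=
  Complex.exp ξ * ∫ t in (0 : ℝ)..1, Θ (ξ + (Real.log t : ℂ))

/-- A left half strip. -/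
def halfStrip (ρ a b : ℝ) : Set ℂ := {ξ | ξ.re < ρ ∧ a < ξ.im ∧ ξ.im < b}

theorem isOpen_halfStrip (ρ a b : ℝ) : IsOpen (halfStrip ρ a b) :=
  (isOpen_lt Complex.continuous_re continuous_const).inter
    ((isOpen_lt continuous_const Complex.continuous_im).inter
      (isOpen_lt Complex.continuous_im continuous_const))

theorem halfStrip_bound {Θ : ℂ → ℂ} {ρ a b : ℝ} (hc : ContinuousOn Θ (halfStrip ρ a b))
    {a' b' ρ' : ℝ} (ha : a < a') (hb : b' < b) (hρ : ρ' < ρ)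
    (hbd : ∃ X B : ℝ, ∀ ξ : ℂ, ξ.re ≤ X → a' ≤ ξ.im → ξ.im ≤ b' → ‖Θ ξ‖ ≤ B) :
    ∃ B : ℝ, ∀ ξ : ℂ, ξ.re ≤ ρ' → a' ≤ ξ.im → ξ.im ≤ b' → ‖Θ ξ‖ ≤ B := by
  obtain ⟨X, B, hB⟩ := hbd
  have hK : IsCompact (Icc X ρ' ×ℂ Icc a' b') := isCompact_Icc.reProdIm isCompact_Icc
  obtain ⟨B', hB'⟩ := hK.exists_bound_of_continuousOn (hc.mono fun ζ hζ => by
    simp only [Complex.mem_reProdIm, mem_Icc] at hζ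
    exact ⟨by linarith, by linarith, by linarith⟩)
  refine ⟨max B B', fun ξ h1 h2 h3 => ?_⟩
  rcases le_total ξ.re X with h | h
  · exact (hB ξ h h2 h3).trans (le_max_left _ _)
  · exact (hB' ξ ⟨⟨h, h1⟩, h2, h3⟩).trans (le_max_right _ _)

theorem continuousOn_firstLift (ξ : ℂ) :
    ContinuousOn (fun t : ℝ => ξ + (Real.log t : ℂ)) (Ioo 0 1) := fun _ ht =>
  (hasDerivAt_firstLift_real ξ ht.1).continuousAt.continuousWithinAt

theorem intervalIntegrable_leftPrimitive {Θ : ℂ → ℂ} {ρ a b : ℝ}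
    (hc : ContinuousOn Θ (halfStrip ρ a b))
    (hbd : ∀ a' b', a < a' → b' < b → ∃ X B : ℝ, ∀ ξ : ℂ, ξ.re ≤ X → a' ≤ ξ.im → ξ.im ≤ b' →
      ‖Θ ξ‖ ≤ B) {ξ : ℂ} (hξ : ξ ∈ halfStrip ρ a b) :
    IntervalIntegrable (fun t : ℝ => Θ (ξ + (Real.log t : ℂ))) volume 0 1 := by
  obtain ⟨h1, h2, h3⟩ := hξ
  obtain ⟨B, hB⟩ := halfStrip_bound hc h2 h3 h1 (hbd _ _ h2 h3)
  refine intervalIntegrable_of_continuousOn_Ioo zero_le_one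
    (hc.comp (continuousOn_firstLift ξ) fun t ht => ?_)
    fun t ht => hB _ (firstLift_re_le ξ ht.1 ht.2) ?_ ?_
  · exact ⟨(firstLift_re_le ξ ht.1 ht.2).trans_lt h1, by rwa [firstLift_im], by rwa [firstLift_im]⟩
  · rw [firstLift_im]
  · rw [firstLift_im]

/-- After differentiation under the integral the integrand is the `t`-derivative of `t Θ(ξ + log
t)`, which tends to `0` at `t = 0` and to `Θ ξ` at `t = 1`. Boundedness of `Θ` towards `-∞` in
closed substrips is all that is required. -/
theorem hasDerivAt_leftPrimitive {Θ : ℂ → ℂ} {ρ a b : ℝ}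
    (hd : DifferentiableOn ℂ Θ (halfStrip ρ a b))
    (hbd : ∀ a' b', a < a' → b' < b → ∃ X B : ℝ, ∀ ξ : ℂ, ξ.re ≤ X → a' ≤ ξ.im → ξ.im ≤ b' →
      ‖Θ ξ‖ ≤ B) {ξ : ℂ} (hξ : ξ ∈ halfStrip ρ a b) :
    HasDerivAt (leftPrimitive Θ) (Complex.exp ξ * Θ ξ) ξ := by
  have hΘi := intervalIntegrable_leftPrimitive hd.continuousOn hbd hξ
  obtain ⟨h1, h2, h3⟩ := id hξ
  set r := min ((ρ - ξ.re) / 2) (min ((ξ.im - a) / 2) ((b - ξ.im) / 2)) with hr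
  have hr0 : 0 < r := lt_min (by linarith) (lt_min (by linarith) (by linarith))
  have hr1 : r ≤ (ρ - ξ.re) / 2 := min_le_left _ _
  have hr2 : r ≤ (ξ.im - a) / 2 := (min_le_right _ _).trans (min_le_left _ _)
  have hr3 : r ≤ (b - ξ.im) / 2 := (min_le_right _ _).trans (min_le_right _ _)
  obtain ⟨B, hB⟩ := halfStrip_bound (ρ' := ξ.re + r) (a' := ξ.im - r) (b' := ξ.im + r)
    hd.continuousOn (by linarith) (by linarith) (by linarith) (hbd _ _ (by linarith) (by linarith))
  have hball : ∀ z ∈ ball ξ r, z.re ≤ ξ.re + r ∧ ξ.im - r ≤ z.im ∧ z.im ≤ ξ.im + r :=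
    fun z hz => by
      rw [mem_ball, dist_eq_norm] at hz
      have hre := abs_le.mp ((Complex.abs_re_le_norm (z - ξ)).trans hz.le)
      have him := abs_le.mp ((Complex.abs_im_le_norm (z - ξ)).trans hz.le)
      rw [Complex.sub_re] at hre
      rw [Complex.sub_im] at him
      exact ⟨by linarith, by linarith, by linarith⟩
  have hmem : ∀ z ∈ ball ξ r, ∀ t ∈ Ioo (0 : ℝ) 1, z + (Real.log t : ℂ) ∈ halfStrip ρ a b :=
    fun z hz t ht => by
      obtain ⟨e1, e2, e3⟩ := hball z hz
      refine ⟨(firstLift_re_le z ht.1 ht.2).trans_lt (by linarith), ?_, ?_⟩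
      · rw [firstLift_im]; linarith
      · rw [firstLift_im]; linarith
  obtain ⟨hi, hder⟩ := hasDerivAt_intervalIntegral_of_bounded
    (Φ := fun z t => Θ (z + (Real.log t : ℂ))) (M := B) zero_le_one hr0
    (fun z hz => hd.continuousOn.comp (continuousOn_firstLift z) (hmem z hz))
    (fun t ht => hd.comp (by fun_prop) fun z hz => hmem z hz t ht)
    (fun t ht z hz => by
      obtain ⟨e1, e2, e3⟩ := hball z hz
      refine hB _ ((firstLift_re_le z ht.1 ht.2).trans e1) ?_ ?_
      · rwa [firstLift_im]
      · rwa [firstLift_im])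
  refine ((Complex.hasDerivAt_exp ξ).mul hder).congr_deriv ?_
  rw [← mul_add, ← intervalIntegral.integral_add hΘi hi]
  congr 1
  have hΘξ : DifferentiableAt ℂ Θ ξ := hd.differentiableAt ((isOpen_halfStrip ρ a b).mem_nhds hξ)
  rw [intervalIntegral.integral_eq_sub_of_hasDerivAt_of_tendsto (fa := 0) (fb := Θ ξ)
    (f := fun t : ℝ => (t : ℂ) * Θ (ξ + (Real.log t : ℂ))) zero_lt_one ?_ (hΘi.add hi)
    ?_ ?_, sub_zero]
  · intro t ht
    have e1 := (hd.differentiableAt ((isOpen_halfStrip ρ a b).mem_nhds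
      (hmem ξ (mem_ball_self hr0) t ht))).hasDerivAt
    have e2 := e1.comp t (hasDerivAt_firstLift_real ξ ht.1)
    have e3 : HasDerivAt (fun t : ℝ => (t : ℂ)) 1 t := by
      simpa using (hasDerivAt_id t).ofReal_comp
    refine (e3.mul e2).congr_deriv ?_
    rw [deriv_comp_add_const]
    have ht0 : (t : ℂ) ≠ 0 := by exact_mod_cast ht.1.ne'
    simp only [Function.comp_apply]
    field_simp
  · simp_rw [mul_comm _ (Θ _)]
    refine tendsto_zero_of_bounded_mul (B := B) ?_ ?_
    · filter_upwards [Ioo_mem_nhdsGT (zero_lt_one' ℝ)] with t ht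
      refine hB _ ((firstLift_re_le ξ ht.1 ht.2).trans (by linarith)) ?_ ?_
      · rw [firstLift_im]; linarith
      · rw [firstLift_im]; linarith
    · exact (Complex.continuous_ofReal.tendsto' 0 0 Complex.ofReal_zero).mono_left
        nhdsWithin_le_nhds
  · have hc : ContinuousAt (fun t : ℝ => (t : ℂ) * Θ (ξ + (Real.log t : ℂ))) 1 := by
      refine Complex.continuous_ofReal.continuousAt.mul ?_
      refine ContinuousAt.comp (g := Θ) ?_ (hasDerivAt_firstLift_real ξ one_pos).continuousAt
      simpa using hΘξ.continuousAt
    have := hc.tendsto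
    simp only [Real.log_one, Complex.ofReal_zero, add_zero, Complex.ofReal_one, one_mul] at this
    exact this.mono_left nhdsWithin_le_nhds

/-- Cauchy's theorem for the region between two horizontal half lines: both values belong to one
primitive of `exp · Θ` on the strip. -/
theorem leftPrimitive_sub {Θ : ℂ → ℂ} {ρ a b : ℝ}
    (hd : DifferentiableOn ℂ Θ (halfStrip ρ a b))
    (hbd : ∀ a' b', a < a' → b' < b → ∃ X B : ℝ, ∀ ξ : ℂ, ξ.re ≤ X → a' ≤ ξ.im → ξ.im ≤ b' →
      ‖Θ ξ‖ ≤ B) {x₀ y₁ y₂ : ℝ} (hx : x₀ < ρ) (hy₁ : a < y₁ ∧ y₁ < b) (hy₂ : a < y₂ ∧ y₂ < b) :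
    ∫ y in y₁..y₂, Complex.I * (Complex.exp (x₀ + y * Complex.I) * Θ (x₀ + y * Complex.I)) =
      leftPrimitive Θ (x₀ + y₂ * Complex.I) - leftPrimitive Θ (x₀ + y₁ * Complex.I) := by
  have hmem : ∀ y ∈ uIcc y₁ y₂, (x₀ : ℂ) + y * Complex.I ∈ halfStrip ρ a b := fun y hy => by
    have h1 : min y₁ y₂ ≤ y := hy.1
    have h2 : y ≤ max y₁ y₂ := hy.2
    refine ⟨by simpa using hx, ?_, ?_⟩
    · simpa using (lt_min hy₁.1 hy₂.1).trans_le h1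
    · simpa using h2.trans_lt (max_lt hy₁.2 hy₂.2)
  have hline : ∀ y : ℝ, HasDerivAt (fun y : ℝ => (x₀ : ℂ) + y * Complex.I) Complex.I y := fun y => by
    simpa using (((hasDerivAt_id y).ofReal_comp).mul_const Complex.I).const_add (x₀ : ℂ)
  refine intervalIntegral.integral_eq_sub_of_hasDerivAt
    (f := fun y : ℝ => leftPrimitive Θ (x₀ + y * Complex.I)) (fun y hy => ?_)
    (ContinuousOn.intervalIntegrable fun y hy => ?_)
  · exact ((hasDerivAt_leftPrimitive hd hbd (hmem y hy)).comp y (hline y)).congr_deriv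
      (mul_comm _ _)
  · have h1 := (hd.differentiableAt
      ((isOpen_halfStrip ρ a b).mem_nhds (hmem y hy))).continuousAt.comp
        (f := fun y : ℝ => (x₀ : ℂ) + y * Complex.I) (x := y) (hline y).continuousAt
    have h2 : ContinuousAt (fun y : ℝ => Complex.exp (x₀ + y * Complex.I)) y := by fun_prop
    exact (continuousAt_const.mul (h2.mul h1)).continuousWithinAt

/-! ### The difference equation `Δ φ = E` -/

/-- The Cauchy kernel in the coordinate `ζ`. -/
noncomputable def cauchyTheta (E : ℂ → ℂ) (ζ ξ : ℂ) : ℂ :=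
  E ξ / (Complex.exp ξ - Complex.exp ζ)

theorem exp_ne_exp_of_im {ξ ζ : ℂ} {n : ℤ} (h1 : 2 * Real.pi * n < ξ.im - ζ.im)
    (h2 : ξ.im - ζ.im < 2 * Real.pi * (n + 1)) : Complex.exp ξ - Complex.exp ζ ≠ 0 := fun h => by
  obtain ⟨k, hk⟩ := Complex.exp_eq_exp_iff_exists_int.mp (sub_eq_zero.mp h)
  have him := congrArg Complex.im hk
  simp at him
  have hpi := Real.pi_pos
  have h3 : (n : ℝ) < k := by nlinarith
  have h4 : (k : ℝ) < n + 1 := by nlinarith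
  have h5 : n < k := by exact_mod_cast h3
  have h6 : k < n + 1 := by exact_mod_cast h4
  omega

theorem norm_exp_sub_exp_ge {ξ ζ : ℂ} (h : ξ.re ≤ ζ.re - 1) :
    Real.exp ζ.re / 2 ≤ ‖Complex.exp ξ - Complex.exp ζ‖ := by
  have h1 := norm_sub_norm_le (Complex.exp ζ) (Complex.exp ξ)
  rw [norm_sub_rev, Complex.norm_exp, Complex.norm_exp] at h1
  have h2 : Real.exp ξ.re ≤ Real.exp ζ.re * Real.exp (-1) := by
    rw [← Real.exp_add]; exact Real.exp_le_exp.mpr (by linarith)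
  have e4 : Real.exp (-1) < 1 / 2 := by
    have := Real.exp_one_gt_d9
    rw [Real.exp_neg]
    exact inv_lt_of_inv_lt₀ (by norm_num) (by linarith)
  nlinarith [Real.exp_pos ζ.re]

theorem cauchyTheta_bounded {E : ℂ → ℂ} (hv : Vanishes E) (ζ : ℂ) (a' b' : ℝ) :
    ∃ X B : ℝ, ∀ ξ : ℂ, ξ.re ≤ X → a' ≤ ξ.im → ξ.im ≤ b' → ‖cauchyTheta E ζ ξ‖ ≤ B := by
  obtain ⟨X, hX⟩ := vanishes_iff.mp hv (max |a'| |b'|) 1 one_pos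
  refine ⟨min X (ζ.re - 1), 1 / (Real.exp ζ.re / 2), fun ξ h1 h2 h3 => ?_⟩
  rw [cauchyTheta, norm_div]
  have := norm_exp_sub_exp_ge (h1.trans (min_le_right _ _))
  have h4 := hX ξ (h1.trans (min_le_left _ _)) (abs_le_max_abs_abs h2 h3)
  have := Real.exp_pos ζ.re
  gcongr

theorem differentiableOn_cauchyTheta {E : ℂ → ℂ} {ρ : ℝ}
    (hE : DifferentiableOn ℂ E (halfPlane ρ)) (ζ : ℂ) :
    DifferentiableOn ℂ (cauchyTheta E ζ) (halfStrip ρ (ζ.im - 2 * Real.pi) ζ.im) := by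
  refine DifferentiableOn.div (hE.mono fun ξ hξ => hξ.1) (by fun_prop) fun ξ hξ => ?_
  refine exp_ne_exp_of_im (n := -1) ?_ ?_
  · push_cast; linarith [hξ.2.1]
  · push_cast; linarith [hξ.2.2]

/-- The solution of the difference equation, with base point on the line `Im ξ = y`. -/
noncomputable def cauchySolutionAux (E : ℂ → ℂ) (x₀ y : ℝ) (ζ : ℂ) : ℂ :=
  -(1 / (2 * Real.pi * Complex.I)) * (leftPrimitive (cauchyTheta E ζ) (x₀ + y * Complex.I) +
    ∫ y' in y..(-Real.pi), Complex.I *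
      (Complex.exp (x₀ + y' * Complex.I) * cauchyTheta E ζ (x₀ + y' * Complex.I)))

/-- The solution of the difference equation. -/
noncomputable def cauchySolution (E : ℂ → ℂ) (x₀ : ℝ) (ζ : ℂ) : ℂ :=
  cauchySolutionAux E x₀ (ζ.im - Real.pi) ζ

theorem norm_exp_line (x₀ y : ℝ) : ‖Complex.exp (x₀ + y * Complex.I)‖ = Real.exp x₀ := by
  rw [Complex.norm_exp]; simp

theorem exp_line_sub_ne_zero {x₀ : ℝ} {ζ : ℂ} (hζ : ζ.re < x₀) (y : ℝ) :
    Complex.exp (x₀ + y * Complex.I) - Complex.exp ζ ≠ 0 := fun h => by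
  have := congrArg norm (sub_eq_zero.mp h)
  rw [norm_exp_line, Complex.norm_exp, Real.exp_eq_exp] at this
  linarith

section Solution

variable {E : ℂ → ℂ} {ρ x₀ : ℝ}

theorem continuous_verticalKernel (hE : ContinuousOn E (halfPlane ρ)) (hx : x₀ < ρ) {ζ : ℂ}
    (hζ : ζ.re < x₀) : Continuous fun y' : ℝ => Complex.I *
      (Complex.exp (x₀ + y' * Complex.I) * cauchyTheta E ζ (x₀ + y' * Complex.I)) := by
  have h1 : Continuous fun y : ℝ => E (x₀ + y * Complex.I) :=
    hE.comp_continuous (by fun_prop) fun y => by simpa [halfPlane] using hx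
  have h2 : Continuous fun y : ℝ => cauchyTheta E ζ (x₀ + y * Complex.I) :=
    h1.div (by fun_prop) fun y => exp_line_sub_ne_zero hζ y
  fun_prop

/-- The contour runs from `-∞` at height `y` to `x₀ + i y` and then vertically to height `-π`. Its
value does not depend on `y` in the open interval of length `2π` below `ζ.im`, because the kernel
has no pole in that strip. So `y` may be frozen locally, and the solution is holomorphic although
its definition lets `y` follow `ζ`. -/
theorem cauchySolution_eq_aux (hE : DifferentiableOn ℂ E (halfPlane ρ)) (hv : Vanishes E)
    (hx : x₀ < ρ) {ζ : ℂ} (hζ : ζ.re < x₀) {y : ℝ} (hy1 : ζ.im - 2 * Real.pi < y) (hy2 : y < ζ.im) :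
    cauchySolution E x₀ ζ = cauchySolutionAux E x₀ y ζ := by
  have hpi := Real.pi_pos
  have hk := continuous_verticalKernel hE.continuousOn hx hζ
  have h := leftPrimitive_sub (differentiableOn_cauchyTheta hE ζ)
    (fun a' b' _ _ => cauchyTheta_bounded hv ζ a' b') hx (y₁ := y) (y₂ := ζ.im - Real.pi)
    ⟨hy1, hy2⟩ ⟨by linarith, by linarith⟩
  rw [cauchySolution, cauchySolutionAux, cauchySolutionAux, ←
    intervalIntegral.integral_add_adjacent_intervals (hk.intervalIntegrable y (ζ.im - Real.pi))
      (hk.intervalIntegrable (ζ.im - Real.pi) (-Real.pi)), h]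
  ring

/-- In `w = exp ξ` a vertical segment of length `2π` is the circle of radius `exp x₀`, which
encloses `exp ζ`. -/
theorem integral_circle_kernel {ζ : ℂ} (hζ : ζ.re < x₀) (a : ℝ) :
    ∫ y in a..(a + 2 * Real.pi), Complex.I * (Complex.exp (x₀ + y * Complex.I) *
      (Complex.exp (x₀ + y * Complex.I) - Complex.exp ζ)⁻¹) = 2 * Real.pi * Complex.I := by
  have h := circleIntegral.integral_sub_inv_of_mem_ball (c := 0) (R := Real.exp x₀)
    (w := Complex.exp ζ) (by
      rw [mem_ball_zero_iff, Complex.norm_exp]; exact Real.exp_lt_exp.mpr hζ)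
  rw [circleIntegral] at h
  have hper : Function.Periodic (fun y : ℝ => Complex.I * (Complex.exp (x₀ + y * Complex.I) *
      (Complex.exp (x₀ + y * Complex.I) - Complex.exp ζ)⁻¹)) (2 * Real.pi) := fun y => by
    have : (x₀ : ℂ) + ((y + 2 * Real.pi : ℝ) : ℂ) * Complex.I =
        x₀ + y * Complex.I + 2 * Real.pi * Complex.I := by push_cast; ring
    simp only [this, Complex.exp_add _ (2 * Real.pi * Complex.I), Complex.exp_two_pi_mul_I, mul_one]
  rw [hper.intervalIntegral_add_eq a 0, zero_add, ← h]
  refine intervalIntegral.integral_congr fun y _ => ?_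
  simp only [deriv_circleMap, circleMap, Complex.ofReal_exp, smul_eq_mul, zero_add,
    Complex.exp_add]
  ring

end Solution

section Solution

variable {E : ℂ → ℂ} {ρ x₀ : ℝ}

theorem dslope_exp_ne_zero {ζ ξ : ℂ} (h1 : -(2 * Real.pi) < ξ.im - ζ.im)
    (h2 : ξ.im - ζ.im < 2 * Real.pi) : dslope Complex.exp ζ ξ ≠ 0 := by
  rcases eq_or_ne ξ ζ with rfl | hne
  · rw [dslope_same, Complex.deriv_exp]; exact Complex.exp_ne_zero _
  · rw [dslope_of_ne _ hne, slope_def_field]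
    refine div_ne_zero (fun h => hne ?_) (sub_ne_zero.mpr hne)
    obtain ⟨k, hk⟩ := Complex.exp_eq_exp_iff_exists_int.mp (sub_eq_zero.mp h)
    have him := congrArg Complex.im hk
    simp at him
    have hpi := Real.pi_pos
    have h3 : (-1 : ℝ) < k := by nlinarith
    have h4 : (k : ℝ) < 1 := by nlinarith
    have h5 : -1 < k := by exact_mod_cast h3
    have h6 : k < 1 := by exact_mod_cast h4
    have h7 : k = 0 := by omega
    rw [hk, h7]; simp

/-- The Cauchy kernel with its pole at `ζ` removed. -/
noncomputable def regularTheta (E : ℂ → ℂ) (ζ ξ : ℂ) : ℂ :=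
  dslope E ζ ξ / dslope Complex.exp ζ ξ

theorem regularTheta_of_ne (E : ℂ → ℂ) {ζ ξ : ℂ} (h : ξ ≠ ζ) :
    regularTheta E ζ ξ = cauchyTheta E ζ ξ - E ζ * (Complex.exp ξ - Complex.exp ζ)⁻¹ := by
  rw [regularTheta, cauchyTheta, dslope_of_ne _ h, dslope_of_ne _ h, slope_def_field,
    slope_def_field, div_div_div_cancel_right₀ (sub_ne_zero.mpr h)]
  ring

theorem differentiableOn_regularTheta (hE : DifferentiableOn ℂ E (halfPlane ρ)) {ζ : ℂ}
    (hζ : ζ.re < ρ) : DifferentiableOn ℂ (regularTheta E ζ)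
      (halfStrip ρ (ζ.im - 2 * Real.pi) (ζ.im + 2 * Real.pi)) := by
  have h1 := (Complex.differentiableOn_dslope ((isOpen_halfPlane ρ).mem_nhds hζ)).mpr hE
  have h2 := (Complex.differentiableOn_dslope (s := univ) (c := ζ) univ_mem).mpr
    Complex.differentiable_exp.differentiableOn
  refine (h1.mono fun ξ hξ => hξ.1).div (h2.mono (subset_univ _)) fun ξ hξ =>
    dslope_exp_ne_zero ?_ ?_
  · linarith [hξ.2.1]
  · linarith [hξ.2.2]

theorem regularTheta_bounded (hv : Vanishes E) (ζ : ℂ) (a' b' : ℝ) :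
    ∃ X B : ℝ, ∀ ξ : ℂ, ξ.re ≤ X → a' ≤ ξ.im → ξ.im ≤ b' → ‖regularTheta E ζ ξ‖ ≤ B := by
  obtain ⟨X, B, hB⟩ := cauchyTheta_bounded hv ζ a' b'
  refine ⟨min X (ζ.re - 1), B + ‖E ζ‖ * (Real.exp ζ.re / 2)⁻¹, fun ξ h1 h2 h3 => ?_⟩
  have hne : ξ ≠ ζ := fun h => by
    rw [h] at h1; linarith [h1.trans (min_le_right _ _)]
  have h4 := hB ξ (h1.trans (min_le_left _ _)) h2 h3
  have h5 := norm_exp_sub_exp_ge (h1.trans (min_le_right _ _))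
  have := Real.exp_pos ζ.re
  rw [regularTheta_of_ne E hne]
  refine (norm_sub_le _ _).trans (add_le_add h4 ?_)
  rw [norm_mul, norm_inv]
  gcongr

/-- On the lines at height `± π` the Cauchy kernel of a constant is integrable and periodic. -/
theorem leftPrimitive_cauchyTheta_top (hE : DifferentiableOn ℂ E (halfPlane ρ)) (hv : Vanishes E)
    {ζ ξ : ℂ} (hξ : ξ.re < ρ) (hζ : ζ.re < ρ)
    (him : ξ.im = ζ.im + Real.pi ∨ ξ.im = ζ.im - Real.pi) :
    leftPrimitive (cauchyTheta E ζ) ξ = leftPrimitive (regularTheta E ζ) ξ +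
      E ζ * leftPrimitive (fun u => (Complex.exp u - Complex.exp ζ)⁻¹) ξ := by
  have hpi := Real.pi_pos
  have hne : ∀ t ∈ Ioo (0 : ℝ) 1,
      Complex.exp (ξ + (Real.log t : ℂ)) - Complex.exp ζ ≠ 0 := fun t _ => by
    rcases him with h | h
    · refine exp_ne_exp_of_im (n := 0) ?_ ?_ <;> rw [firstLift_im] <;> push_cast <;> linarith
    · refine exp_ne_exp_of_im (n := -1) ?_ ?_ <;> rw [firstLift_im] <;> push_cast <;> linarith
  have hmem : ξ ∈ halfStrip ρ (ζ.im - 2 * Real.pi) (ζ.im + 2 * Real.pi) := by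
    refine ⟨hξ, ?_, ?_⟩ <;> rcases him with h | h <;> linarith
  have h1 := intervalIntegrable_leftPrimitive (differentiableOn_regularTheta hE hζ).continuousOn
    (fun a' b' _ _ => regularTheta_bounded hv ζ a' b') hmem
  have h2 : IntervalIntegrable
      (fun t : ℝ => (Complex.exp (ξ + (Real.log t : ℂ)) - Complex.exp ζ)⁻¹) volume 0 1 := by
    refine intervalIntegrable_of_continuousOn_Ioo (M := 1 / Real.exp ζ.re) zero_le_one ?_ ?_
    · exact ((Complex.continuous_exp.comp_continuousOn (continuousOn_firstLift ξ)).sub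
        continuousOn_const).inv₀ hne
    · intro t ht
      -- At distance `π` from the height of `ζ` the exponential is a negative multiple of `exp ζ`,
      -- so the difference cannot be smaller than `exp ζ`.
      have e : Complex.exp (ξ + (Real.log t : ℂ)) - Complex.exp ζ =
          -((Real.exp ((ξ + (Real.log t : ℂ)).re - ζ.re) + 1 : ℝ) : ℂ) * Complex.exp ζ := by
        have h3 : Complex.exp (ξ + (Real.log t : ℂ)) = Complex.exp
            ((((ξ + (Real.log t : ℂ)).re - ζ.re : ℝ) : ℂ) + ζ +
              ((ξ.im - ζ.im : ℝ) : ℂ) * Complex.I) := by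
          congr 1
          apply Complex.ext <;> simp
        have h4 : Complex.exp (((ξ.im - ζ.im : ℝ) : ℂ) * Complex.I) = -1 := by
          rcases him with h | h
          · rw [h, add_sub_cancel_left, Complex.exp_pi_mul_I]
          · rw [h, sub_sub_cancel_left]
            push_cast
            rw [neg_mul, Complex.exp_neg, Complex.exp_pi_mul_I]; norm_num
        rw [h3, Complex.exp_add, h4, Complex.exp_add, ← Complex.ofReal_exp]
        push_cast; ring
      rw [e, norm_inv, norm_mul, norm_neg, Complex.norm_real, Complex.norm_exp,
        Real.norm_of_nonneg (by positivity), ← one_div]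
      gcongr
      have := Real.exp_pos ((ξ + (Real.log t : ℂ)).re - ζ.re)
      have := Real.exp_pos ζ.re
      nlinarith
  have h3 : (∫ t in (0 : ℝ)..1, cauchyTheta E ζ (ξ + (Real.log t : ℂ))) =
      (∫ t in (0 : ℝ)..1, regularTheta E ζ (ξ + (Real.log t : ℂ))) +
        E ζ * ∫ t in (0 : ℝ)..1, (Complex.exp (ξ + (Real.log t : ℂ)) - Complex.exp ζ)⁻¹ := by
    rw [← intervalIntegral.integral_const_mul, ← intervalIntegral.integral_add h1 (h2.const_mul _)]
    rw [intervalIntegral.integral_of_le zero_le_one, intervalIntegral.integral_of_le zero_le_one,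
      integral_Ioc_eq_integral_Ioo, integral_Ioc_eq_integral_Ioo]
    refine setIntegral_congr_fun measurableSet_Ioo fun t ht => ?_
    rw [regularTheta_of_ne E fun h => hne t ht (by rw [h, sub_self])]
    ring
  simp only [leftPrimitive, h3]
  ring

/-- A turn moves the half line from `π` below `ζ` to `π` above it, across the pole, while the kernel
is unchanged. Split the kernel into a regular part and `E ζ` times the kernel of a constant:
Cauchy's theorem relates the regular parts, the half line integrals of the constant kernel agree by
periodicity, and the full circle traversed vertically leaves the residue `E ζ`. -/
theorem cauchySolution_add_period (hE : DifferentiableOn ℂ E (halfPlane ρ)) (hv : Vanishes E)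
    (hx : x₀ < ρ) {ζ : ℂ} (hζ : ζ.re < x₀) : monDelta (cauchySolution E x₀) ζ = E ζ := by
  have hpi := Real.pi_pos
  have hζρ : ζ.re < ρ := hζ.trans hx
  have hk := continuous_verticalKernel hE.continuousOn hx hζ
  have hexp : Complex.exp (ζ + 2 * Real.pi * Complex.I) = Complex.exp ζ := Complex.exp_periodic ζ
  have hK : cauchyTheta E (ζ + 2 * Real.pi * Complex.I) = cauchyTheta E ζ := by
    funext ξ; rw [cauchyTheta, cauchyTheta, hexp]
  have him : (ζ + 2 * Real.pi * Complex.I).im - Real.pi = ζ.im + Real.pi := by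
    simp; ring
  have htop := leftPrimitive_cauchyTheta_top hE hv (ζ := ζ)
    (ξ := x₀ + ((ζ.im + Real.pi : ℝ) : ℂ) * Complex.I) (by simpa using hx) hζρ (Or.inl (by simp))
  have hbot := leftPrimitive_cauchyTheta_top hE hv (ζ := ζ)
    (ξ := x₀ + ((ζ.im - Real.pi : ℝ) : ℂ) * Complex.I) (by simpa using hx) hζρ (Or.inr (by simp))
  have hper : leftPrimitive (fun u => (Complex.exp u - Complex.exp ζ)⁻¹)
      (x₀ + ((ζ.im + Real.pi : ℝ) : ℂ) * Complex.I) =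
      leftPrimitive (fun u => (Complex.exp u - Complex.exp ζ)⁻¹)
        (x₀ + ((ζ.im - Real.pi : ℝ) : ℂ) * Complex.I) := by
    have e : (x₀ : ℂ) + ((ζ.im + Real.pi : ℝ) : ℂ) * Complex.I =
        x₀ + ((ζ.im - Real.pi : ℝ) : ℂ) * Complex.I + 2 * Real.pi * Complex.I := by push_cast; ring
    have e2 : ∀ t : ℝ, Complex.exp ((x₀ : ℂ) + ((ζ.im + Real.pi : ℝ) : ℂ) * Complex.I +
        (Real.log t : ℂ)) = Complex.exp (x₀ + ((ζ.im - Real.pi : ℝ) : ℂ) * Complex.I +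
          (Real.log t : ℂ)) := fun t => by
      rw [e, add_right_comm]; exact Complex.exp_periodic _
    simp only [leftPrimitive, e2]
    congr 1
    rw [e]; exact Complex.exp_periodic _
  have hreg := leftPrimitive_sub (differentiableOn_regularTheta hE hζρ)
    (fun a' b' _ _ => regularTheta_bounded hv ζ a' b') hx (y₁ := ζ.im - Real.pi)
    (y₂ := ζ.im + Real.pi) ⟨by linarith, by linarith⟩ ⟨by linarith, by linarith⟩
  have hcirc := integral_circle_kernel hζ (ζ.im - Real.pi)
  rw [show ζ.im - Real.pi + 2 * Real.pi = ζ.im + Real.pi by ring] at hcirc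
  have hk2 : Continuous fun y : ℝ => Complex.I * (Complex.exp (x₀ + y * Complex.I) *
      (Complex.exp (x₀ + y * Complex.I) - Complex.exp ζ)⁻¹) := by
    have : Continuous fun y : ℝ => (Complex.exp (x₀ + y * Complex.I) - Complex.exp ζ)⁻¹ :=
      Continuous.inv₀ (by fun_prop) fun y => exp_line_sub_ne_zero hζ y
    fun_prop
  have hsplit : (∫ y in (ζ.im - Real.pi)..(ζ.im + Real.pi), Complex.I *
        (Complex.exp (x₀ + y * Complex.I) * regularTheta E ζ (x₀ + y * Complex.I))) =
      (∫ y in (ζ.im - Real.pi)..(ζ.im + Real.pi), Complex.I *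
        (Complex.exp (x₀ + y * Complex.I) * cauchyTheta E ζ (x₀ + y * Complex.I))) -
        E ζ * (2 * Real.pi * Complex.I) := by
    rw [← hcirc, ← intervalIntegral.integral_const_mul,
      ← intervalIntegral.integral_sub (hk.intervalIntegrable _ _)
        ((hk2.const_mul (E ζ)).intervalIntegrable _ _)]
    refine intervalIntegral.integral_congr fun y _ => ?_
    rw [regularTheta_of_ne E fun h => exp_line_sub_ne_zero hζ y (by rw [h, sub_self])]
    ring
  have hadj := intervalIntegral.integral_add_adjacent_intervals
    (hk.intervalIntegrable (μ := volume) (ζ.im - Real.pi) (ζ.im + Real.pi))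
    (hk.intervalIntegrable (ζ.im + Real.pi) (-Real.pi))
  have h2pi : (2 * Real.pi * Complex.I : ℂ) ≠ 0 := Complex.two_pi_I_ne_zero
  rw [monDelta, monSigma, cauchySolution, cauchySolution, cauchySolutionAux, cauchySolutionAux, him,
    hK, ← hadj, htop, hbot, hper]
  rw [hsplit] at hreg
  have hinv : 1 / (2 * Real.pi * Complex.I) * (2 * Real.pi * Complex.I) = 1 :=
    one_div_mul_cancel h2pi
  linear_combination (1 / (2 * Real.pi * Complex.I)) * hreg + E ζ * hinv

/-- The part of the solution along the horizontal half line. -/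
noncomputable def rayIntegral (E : ℂ → ℂ) (x₀ y : ℝ) (ζ : ℂ) : ℂ :=
  ∫ t in (0 : ℝ)..1, E (x₀ + y * Complex.I + (Real.log t : ℂ)) /
    (t * Complex.exp (x₀ + y * Complex.I) - Complex.exp ζ)

theorem leftPrimitive_cauchyTheta (E : ℂ → ℂ) (ζ ξ : ℂ) :
    leftPrimitive (cauchyTheta E ζ) ξ = Complex.exp ξ * ∫ t in (0 : ℝ)..1,
      E (ξ + (Real.log t : ℂ)) / (t * Complex.exp ξ - Complex.exp ζ) := by
  rw [leftPrimitive]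
  congr 1
  rw [intervalIntegral.integral_of_le zero_le_one, intervalIntegral.integral_of_le zero_le_one,
    integral_Ioc_eq_integral_Ioo, integral_Ioc_eq_integral_Ioo]
  refine setIntegral_congr_fun measurableSet_Ioo fun t ht => ?_
  simp only [cauchyTheta]
  rw [exp_firstLift ξ ht.1]

/-- For `|Im ζ| < π` the base line may be taken at height `-π`, where the vertical part of the
contour has length zero. This is the form that matches Cauchy integrals along a slit. -/
theorem cauchySolution_eq_ray (hE : DifferentiableOn ℂ E (halfPlane ρ)) (hv : Vanishes E)
    (hx : x₀ < ρ) {ζ : ℂ} (hζ : ζ.re < x₀) (h : |ζ.im| < Real.pi) :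
    cauchySolution E x₀ ζ = -(1 / (2 * Real.pi * Complex.I)) *
      (Complex.exp (x₀ + (-Real.pi : ℝ) * Complex.I) * rayIntegral E x₀ (-Real.pi) ζ) := by
  obtain ⟨h1, h2⟩ := abs_lt.mp h
  rw [cauchySolution_eq_aux hE hv hx hζ (y := -Real.pi) (by linarith) (by linarith),
    cauchySolutionAux, intervalIntegral.integral_same, add_zero, leftPrimitive_cauchyTheta]
  rfl

end Solution

section Solution

variable {E : ℂ → ℂ} {ρ x₀ : ℝ}

/-- The points of the ray at height `η - π` are opposite to the direction of `exp (i η)`; projected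
to this direction, the two terms add up instead of cancelling. -/
theorem norm_ray_sub_ge (x₀ η : ℝ) (z : ℂ) (t : ℝ) :
    t * Real.exp x₀ + Real.exp z.re * Real.cos (z.im - η) ≤
      ‖(t : ℂ) * Complex.exp (x₀ + ((η - Real.pi : ℝ) : ℂ) * Complex.I) - Complex.exp z‖ := by
  have e : (t : ℂ) * Complex.exp (x₀ + ((η - Real.pi : ℝ) : ℂ) * Complex.I) - Complex.exp z =
      -(Complex.exp ((η : ℂ) * Complex.I) * ((t * Real.exp x₀ : ℝ) +
        Complex.exp (z - η * Complex.I))) := by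
    rw [mul_add, ← Complex.exp_add, Complex.exp_add]
    have h1 : Complex.exp (((η - Real.pi : ℝ) : ℂ) * Complex.I) =
        -Complex.exp ((η : ℂ) * Complex.I) := by
      push_cast
      rw [sub_mul, Complex.exp_sub, Complex.exp_pi_mul_I, div_neg, div_one]
    rw [h1]
    push_cast
    rw [show (η : ℂ) * Complex.I + (z - η * Complex.I) = z by ring]
    ring
  rw [e, norm_neg, norm_mul, Complex.norm_exp_ofReal_mul_I, one_mul]
  refine le_trans (le_of_eq ?_) (Complex.re_le_norm _)
  rw [Complex.add_re, Complex.ofReal_re, Complex.exp_re]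
  simp

theorem cos_ge_of_abs_le_one {x : ℝ} (h : |x| ≤ 1) : 1 / 2 ≤ Real.cos x := by
  have := Real.one_sub_sq_div_two_le_cos (x := x)
  have h2 : x ^ 2 ≤ 1 := (sq_le_one_iff_abs_le_one x).mpr h
  linarith

theorem continuousOn_rayIntegrand (hE : ContinuousOn E (halfPlane ρ)) (hx : x₀ < ρ) {η : ℝ} {z : ℂ}
    (hz : |z.im - η| ≤ 1) :
    ContinuousOn (fun t : ℝ => E (x₀ + ((η - Real.pi : ℝ) : ℂ) * Complex.I + (Real.log t : ℂ)) /
      (t * Complex.exp (x₀ + ((η - Real.pi : ℝ) : ℂ) * Complex.I) - Complex.exp z)) (Ioo 0 1) := by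
  refine ContinuousOn.div (hE.comp (continuousOn_firstLift _) fun t ht => ?_)
    (Continuous.continuousOn (by fun_prop)) fun t ht => ?_
  · refine (firstLift_re_le _ ht.1 ht.2).trans_lt ?_
    simpa using hx
  · have h1 := norm_ray_sub_ge x₀ η z t
    have h2 := cos_ge_of_abs_le_one hz
    have h3 := Real.exp_pos z.re
    have h4 : 0 < t * Real.exp x₀ := mul_pos ht.1 (Real.exp_pos _)
    exact norm_pos_iff.mp (by nlinarith)

theorem hasDerivAt_rayIntegral (hE : DifferentiableOn ℂ E (halfPlane ρ)) (hv : Vanishes E)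
    (hx : x₀ < ρ) (ζ : ℂ) :
    HasDerivAt (rayIntegral E x₀ (ζ.im - Real.pi))
      (∫ t in (0 : ℝ)..1, E (x₀ + ((ζ.im - Real.pi : ℝ) : ℂ) * Complex.I + (Real.log t : ℂ)) *
        (Complex.exp ζ / (t * Complex.exp (x₀ + ((ζ.im - Real.pi : ℝ) : ℂ) * Complex.I) -
          Complex.exp ζ) ^ 2)) ζ := by
  obtain ⟨B, hB0, hB⟩ := hv.exists_bound hE.continuousOn hx |ζ.im - Real.pi|
  have him : ∀ z ∈ ball ζ 1, |z.im - ζ.im| ≤ 1 ∧ ζ.re - 1 ≤ z.re := fun z hz => by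
    rw [mem_ball, dist_eq_norm] at hz
    have h1 := (Complex.abs_im_le_norm (z - ζ)).trans hz.le
    have h2 := abs_le.mp ((Complex.abs_re_le_norm (z - ζ)).trans hz.le)
    rw [Complex.sub_re] at h2
    exact ⟨by simpa using h1, by linarith⟩
  have hden : ∀ z ∈ ball ζ 1, ∀ t ∈ Ioo (0 : ℝ) 1, Real.exp (ζ.re - 1) / 2 ≤
      ‖(t : ℂ) * Complex.exp (x₀ + ((ζ.im - Real.pi : ℝ) : ℂ) * Complex.I) - Complex.exp z‖ :=
    fun z hz t ht => by
      have h1 := norm_ray_sub_ge x₀ ζ.im z t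
      have h2 := cos_ge_of_abs_le_one (him z hz).1
      have h3 := Real.exp_le_exp.mpr (him z hz).2
      have h5 := Real.exp_pos (ζ.re - 1)
      have h4 : 0 < t * Real.exp x₀ := mul_pos ht.1 (Real.exp_pos _)
      nlinarith
  have hne : ∀ z ∈ ball ζ 1, ∀ t ∈ Ioo (0 : ℝ) 1,
      (t : ℂ) * Complex.exp (x₀ + ((ζ.im - Real.pi : ℝ) : ℂ) * Complex.I) - Complex.exp z ≠ 0 :=
    fun z hz t ht => norm_pos_iff.mp ((by positivity : (0 : ℝ) < Real.exp (ζ.re - 1) / 2).trans_le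
      (hden z hz t ht))
  refine (hasDerivAt_intervalIntegral_of_bounded (M := B / (Real.exp (ζ.re - 1) / 2)) zero_le_one
    one_pos (fun z hz => continuousOn_rayIntegrand hE.continuousOn hx (him z hz).1) (fun t ht =>
      ?_) fun t ht z hz => ?_).2.congr_deriv ?_
  · exact DifferentiableOn.div (differentiableOn_const _) (by fun_prop) fun z hz => hne z hz t ht
  · rw [norm_div]
    have h1 := hB (x₀ + ((ζ.im - Real.pi : ℝ) : ℂ) * Complex.I + (Real.log t : ℂ))
      ((firstLift_re_le _ ht.1 ht.2).trans (by simp)) (by rw [firstLift_im]; simp)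
    have h2 := hden z hz t ht
    gcongr
  · rw [intervalIntegral.integral_of_le zero_le_one, intervalIntegral.integral_of_le zero_le_one,
      integral_Ioc_eq_integral_Ioo, integral_Ioc_eq_integral_Ioo]
    refine setIntegral_congr_fun measurableSet_Ioo fun t ht => ?_
    have hn := hne ζ (mem_ball_self one_pos) t ht
    have := ((hasDerivAt_const ζ (E (x₀ + ((ζ.im - Real.pi : ℝ) : ℂ) * Complex.I +
      (Real.log t : ℂ)))).fun_div ((Complex.hasDerivAt_exp ζ).const_sub
        ((t : ℂ) * Complex.exp (x₀ + ((ζ.im - Real.pi : ℝ) : ℂ) * Complex.I))) hn)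
    rw [this.deriv]
    ring

theorem hasDerivAt_verticalIntegral (hE : ContinuousOn E (halfPlane ρ)) (hx : x₀ < ρ) {ζ : ℂ}
    (hζ : ζ.re < x₀) (a b : ℝ) :
    HasDerivAt (fun z => ∫ y in a..b, Complex.I *
        (Complex.exp (x₀ + y * Complex.I) * cauchyTheta E z (x₀ + y * Complex.I)))
      (∫ y in a..b, Complex.I * (Complex.exp (x₀ + y * Complex.I) * (E (x₀ + y * Complex.I) *
        (Complex.exp ζ / (Complex.exp (x₀ + y * Complex.I) - Complex.exp ζ) ^ 2)))) ζ := by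
  wlog hab : a ≤ b generalizing a b
  · simp_rw [intervalIntegral.integral_symm b a]
    exact (this b a (le_of_not_ge hab)).neg
  set r := (x₀ - ζ.re) / 2 with hr
  have hr0 : 0 < r := by rw [hr]; linarith
  have hre : ∀ z ∈ ball ζ r, z.re ≤ ζ.re + r := fun z hz => by
    rw [mem_ball, dist_eq_norm] at hz
    have h2 := abs_le.mp ((Complex.abs_re_le_norm (z - ζ)).trans hz.le)
    rw [Complex.sub_re] at h2
    linarith
  have hlt : ζ.re + r < x₀ := by rw [hr]; linarith
  have hEc : Continuous fun y : ℝ => E (x₀ + y * Complex.I) :=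
    hE.comp_continuous (by fun_prop) fun y => by simpa [halfPlane] using hx
  obtain ⟨B, hB⟩ := isCompact_Icc.exists_bound_of_continuousOn (s := Icc a b) hEc.continuousOn
  have hgap : 0 < Real.exp x₀ - Real.exp (ζ.re + r) := sub_pos.mpr (Real.exp_lt_exp.mpr hlt)
  refine (hasDerivAt_intervalIntegral_of_bounded (r := r)
    (M := Real.exp x₀ * (|B| / (Real.exp x₀ - Real.exp (ζ.re + r)))) hab hr0
    (fun z hz => (continuous_verticalKernel hE hx ((hre z hz).trans_lt hlt)).continuousOn)
    (fun y _ => ?_) fun y hy z hz => ?_).2.congr_deriv ?_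
  · refine DifferentiableOn.const_mul (DifferentiableOn.const_mul
      (DifferentiableOn.div (differentiableOn_const _) (by fun_prop) fun z hz => ?_) _) _
    exact exp_line_sub_ne_zero ((hre z hz).trans_lt hlt) y
  · rw [norm_mul, norm_mul, Complex.norm_I, one_mul, norm_exp_line, cauchyTheta, norm_div]
    have h1 := (hB y (Ioo_subset_Icc_self hy)).trans (le_abs_self B)
    have h2 := norm_sub_norm_le (Complex.exp (x₀ + y * Complex.I)) (Complex.exp z)
    rw [norm_exp_line, Complex.norm_exp] at h2
    have h3 := Real.exp_le_exp.mpr (hre z hz)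
    gcongr
    linarith
  · refine intervalIntegral.integral_congr fun y _ => ?_
    have hn := exp_line_sub_ne_zero hζ y
    have := (((hasDerivAt_const ζ (E (x₀ + y * Complex.I))).fun_div
      ((Complex.hasDerivAt_exp ζ).const_sub (Complex.exp (x₀ + y * Complex.I))) hn).const_mul
        (Complex.exp (x₀ + y * Complex.I))).const_mul Complex.I
    simp only [cauchyTheta]
    rw [this.deriv]
    ring

theorem hasDerivAt_cauchySolution (hE : DifferentiableOn ℂ E (halfPlane ρ)) (hv : Vanishes E)
    (hx : x₀ < ρ) {ζ : ℂ} (hζ : ζ.re < x₀) :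
    HasDerivAt (cauchySolution E x₀) (-(1 / (2 * Real.pi * Complex.I)) *
      (Complex.exp (x₀ + ((ζ.im - Real.pi : ℝ) : ℂ) * Complex.I) *
        (∫ t in (0 : ℝ)..1, E (x₀ + ((ζ.im - Real.pi : ℝ) : ℂ) * Complex.I + (Real.log t : ℂ)) *
        (Complex.exp ζ / (t * Complex.exp (x₀ + ((ζ.im - Real.pi : ℝ) : ℂ) * Complex.I) -
          Complex.exp ζ) ^ 2)) +
      ∫ y in (ζ.im - Real.pi)..(-Real.pi), Complex.I *
        (Complex.exp (x₀ + y * Complex.I) * (E (x₀ + y * Complex.I) *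
        (Complex.exp ζ / (Complex.exp (x₀ + y * Complex.I) - Complex.exp ζ) ^ 2))))) ζ := by
  have hpi := Real.pi_gt_three
  have h := (((hasDerivAt_rayIntegral hE hv hx ζ).const_mul
    (Complex.exp (x₀ + ((ζ.im - Real.pi : ℝ) : ℂ) * Complex.I))).fun_add
    (hasDerivAt_verticalIntegral hE.continuousOn hx hζ (ζ.im - Real.pi) (-Real.pi))).const_mul
      (-(1 / (2 * Real.pi * Complex.I)))
  -- The base line is frozen at `ζ.im - π`, which is admissible for all `z` at distance less than
  -- `1` from `ζ`.
  refine h.congr_of_eventuallyEq ?_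
  filter_upwards [ball_mem_nhds ζ one_pos, (isOpen_halfPlane x₀).mem_nhds hζ] with z hz hz'
  rw [mem_ball, dist_eq_norm] at hz
  have h1 := abs_lt.mp ((Complex.abs_im_le_norm (z - ζ)).trans_lt hz)
  rw [Complex.sub_im] at h1
  rw [cauchySolution_eq_aux hE hv hx hz' (y := ζ.im - Real.pi) (by linarith) (by linarith),
    cauchySolutionAux, leftPrimitive_cauchyTheta]
  rfl

theorem differentiableOn_cauchySolution (hE : DifferentiableOn ℂ E (halfPlane ρ)) (hv : Vanishes E)
    (hx : x₀ < ρ) : DifferentiableOn ℂ (cauchySolution E x₀) (halfPlane x₀) := fun _ hζ =>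
  (hasDerivAt_cauchySolution hE hv hx hζ).differentiableAt.differentiableWithinAt

/-- The primitive `-w / (t a + w)` varies by at most one. Thus the kernel of the differentiated
Cauchy integral has mass bounded independently of `w`. -/
theorem integral_poisson_le {a w : ℝ} (ha : 0 < a) (hw : 0 < w) :
    (∫ t in (0 : ℝ)..1, a * w / (t * a + w) ^ 2) ≤ 1 := by
  have hpos : ∀ t ∈ uIcc (0 : ℝ) 1, 0 < t * a + w := fun t ht => by
    rw [uIcc_of_le zero_le_one] at ht
    have := mul_nonneg ht.1 ha.le
    linarith
  have hd : ∀ t ∈ uIcc (0 : ℝ) 1,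
      HasDerivAt (fun t => -w / (t * a + w)) (a * w / (t * a + w) ^ 2) t := fun t ht => by
    have h2 : HasDerivAt (fun t : ℝ => t * a + w) a t := by
      simpa using ((hasDerivAt_id t).mul_const a).add_const w
    refine ((hasDerivAt_const t (-w)).fun_div h2 (hpos t ht).ne').congr_deriv ?_
    ring
  have hi : IntervalIntegrable (fun t : ℝ => a * w / (t * a + w) ^ 2) volume 0 1 :=
    ContinuousOn.intervalIntegrable (ContinuousOn.div (by fun_prop) (by fun_prop) fun t ht =>
      pow_ne_zero 2 (hpos t ht).ne')
  rw [intervalIntegral.integral_eq_sub_of_hasDerivAt hd hi]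
  have h1 : -w / (1 * a + w) ≤ 0 := div_nonpos_of_nonpos_of_nonneg (by linarith) (by linarith)
  have h2 : -w / (0 * a + w) = -1 := by rw [zero_mul, zero_add, neg_div, div_self hw.ne']
  rw [h2]; linarith

theorem norm_rayKernel_le (E : ℂ → ℂ) (x₀ : ℝ) (ζ : ℂ) {t : ℝ} (ht0 : 0 < t) :
    ‖Complex.exp (x₀ + ((ζ.im - Real.pi : ℝ) : ℂ) * Complex.I) *
      (E (x₀ + ((ζ.im - Real.pi : ℝ) : ℂ) * Complex.I + (Real.log t : ℂ)) * (Complex.exp ζ /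
        (t * Complex.exp (x₀ + ((ζ.im - Real.pi : ℝ) : ℂ) * Complex.I) - Complex.exp ζ) ^ 2))‖ ≤
      ‖E (x₀ + ((ζ.im - Real.pi : ℝ) : ℂ) * Complex.I + (Real.log t : ℂ))‖ *
        (Real.exp x₀ * Real.exp ζ.re / (t * Real.exp x₀ + Real.exp ζ.re) ^ 2) := by
  have hden := norm_ray_sub_ge x₀ ζ.im ζ t
  rw [sub_self, Real.cos_zero, mul_one] at hden
  rw [norm_mul, norm_mul, norm_div, norm_pow, norm_exp_line, Complex.norm_exp]
  generalize ζ.im - Real.pi = y at *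
  set m := ‖E (x₀ + (y : ℂ) * Complex.I + (Real.log t : ℂ))‖
  have hpos : 0 < t * Real.exp x₀ + Real.exp ζ.re := by positivity
  have hm : 0 ≤ Real.exp x₀ * Real.exp ζ.re := by positivity
  have hm0 : 0 ≤ m := norm_nonneg _
  calc _ = m * (Real.exp x₀ * Real.exp ζ.re /
        ‖(t : ℂ) * Complex.exp (x₀ + (y : ℂ) * Complex.I) - Complex.exp ζ‖ ^ 2) := by ring
    _ ≤ _ := mul_le_mul_of_nonneg_left (div_le_div_of_nonneg_left hm (by positivity)
        (pow_le_pow_left₀ hpos.le hden 2)) hm0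

/-- Split at `x₀ + log t = X`. Closer to the puncture `E` is at most `ε` against a kernel of mass at
most one; farther away `t ≥ exp (X - x₀)` and the kernel is of order `exp ζ.re`. -/
theorem norm_rayDeriv_le {ζ : ℂ} {B X ε : ℝ} (hB0 : 0 ≤ B) (hε : 0 ≤ ε)
    (hB : ∀ z : ℂ, z.re ≤ x₀ → z.im = ζ.im - Real.pi → ‖E z‖ ≤ B)
    (hX : ∀ z : ℂ, z.re ≤ X → z.im = ζ.im - Real.pi → ‖E z‖ ≤ ε) :
    ‖Complex.exp (x₀ + ((ζ.im - Real.pi : ℝ) : ℂ) * Complex.I) *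
      ∫ t in (0 : ℝ)..1, E (x₀ + ((ζ.im - Real.pi : ℝ) : ℂ) * Complex.I + (Real.log t : ℂ)) *
        (Complex.exp ζ / (t * Complex.exp (x₀ + ((ζ.im - Real.pi : ℝ) : ℂ) * Complex.I) -
          Complex.exp ζ) ^ 2)‖ ≤
      ε + B / (Real.exp x₀ * Real.exp (X - x₀) ^ 2) * Real.exp ζ.re := by
  have ha0 := Real.exp_pos x₀
  have hw0 := Real.exp_pos ζ.re
  have hτ0 := Real.exp_pos (X - x₀)
  have hker := fun t => norm_rayKernel_le E x₀ ζ (t := t)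
  rw [← intervalIntegral.integral_const_mul]
  set a := Real.exp x₀ with ha
  set w := Real.exp ζ.re with hw
  set τ := Real.exp (X - x₀) with hτ
  set y := ζ.im - Real.pi with hy
  have hint2 : IntervalIntegrable (fun t : ℝ => ε * (a * w / (t * a + w) ^ 2)) volume 0 1 := by
    refine ContinuousOn.intervalIntegrable (ContinuousOn.mul continuousOn_const
      (ContinuousOn.div (by fun_prop) (by fun_prop) fun t ht => ?_))
    rw [uIcc_of_le zero_le_one] at ht
    have := mul_nonneg ht.1 ha0.le
    positivity
  have hint : IntervalIntegrable (fun t : ℝ => ε * (a * w / (t * a + w) ^ 2) +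
      B / (a * τ ^ 2) * w) volume 0 1 := hint2.add intervalIntegrable_const
  refine (intervalIntegral.norm_integral_le_of_norm_le zero_le_one
    (ae_of_all _ fun t ht => (hker t ht.1).trans ?_) hint).trans ?_
  · have ht0 : 0 < t := ht.1
    have hpos : 0 < t * a + w := by positivity
    have him : (x₀ + (y : ℂ) * Complex.I + (Real.log t : ℂ)).im = y := by
      rw [firstLift_im]; simp
    have hq : 0 ≤ a * w / (t * a + w) ^ 2 := by positivity
    rcases le_total (x₀ + Real.log t) X with hc | hc
    · have h3 := hX (x₀ + (y : ℂ) * Complex.I + (Real.log t : ℂ))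
        (by rw [firstLift_re]; simpa using hc) him
      have h4 : 0 ≤ B / (a * τ ^ 2) * w := by positivity
      exact (mul_le_mul_of_nonneg_right h3 hq).trans (le_add_of_nonneg_right h4)
    · have h3 := hB (x₀ + (y : ℂ) * Complex.I + (Real.log t : ℂ)) (by
        rw [firstLift_re]
        have := Real.log_nonpos ht0.le ht.2
        simpa using this) him
      have h5 : τ ≤ t := by
        rw [hτ, ← Real.exp_log ht0]; exact Real.exp_le_exp.mpr (by linarith)
      have h6 : a * w / (t * a + w) ^ 2 ≤ w / (a * τ ^ 2) := by
        have h7 : τ * a ≤ t * a + w :=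
          (mul_le_mul_of_nonneg_right h5 ha0.le).trans (le_add_of_nonneg_right hw0.le)
        have h8 : (τ * a) ^ 2 ≤ (t * a + w) ^ 2 := pow_le_pow_left₀ (by positivity) h7 2
        calc a * w / (t * a + w) ^ 2 ≤ a * w / (τ * a) ^ 2 :=
              div_le_div_of_nonneg_left (by positivity) (by positivity) h8
          _ = w / (a * τ ^ 2) := by field_simp
      calc _ ≤ B * (w / (a * τ ^ 2)) := mul_le_mul h3 h6 hq hB0
        _ = B / (a * τ ^ 2) * w := by ring
        _ ≤ _ := le_add_of_nonneg_left (mul_nonneg hε hq)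
  · rw [intervalIntegral.integral_add hint2 intervalIntegrable_const,
      intervalIntegral.integral_const_mul]
    have := mul_le_mul_of_nonneg_left (integral_poisson_le ha0 hw0) hε
    simp only [intervalIntegral.integral_const, sub_zero, one_smul]
    linarith

theorem norm_verticalDeriv_le {ζ : ℂ} {B L : ℝ} (hB0 : 0 ≤ B)
    (hw : Real.exp ζ.re ≤ Real.exp x₀ / 2) (hL : |ζ.im| ≤ L)
    (hB : ∀ z : ℂ, z.re ≤ x₀ → |z.im| ≤ L + Real.pi → ‖E z‖ ≤ B) :
    ‖∫ y in (ζ.im - Real.pi)..(-Real.pi), Complex.I *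
        (Complex.exp (x₀ + y * Complex.I) * (E (x₀ + y * Complex.I) *
        (Complex.exp ζ / (Complex.exp (x₀ + y * Complex.I) - Complex.exp ζ) ^ 2)))‖ ≤
      4 * B / Real.exp x₀ * L * Real.exp ζ.re := by
  have hpi := Real.pi_pos
  have ha0 := Real.exp_pos x₀
  have hw0 := Real.exp_pos ζ.re
  have hL0 : 0 ≤ L := (abs_nonneg _).trans hL
  have hlen : |(-Real.pi) - (ζ.im - Real.pi)| ≤ L := by
    rw [show -Real.pi - (ζ.im - Real.pi) = -ζ.im by ring, abs_neg]
    exact hL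
  have hζ := abs_le.mp hL
  refine (intervalIntegral.norm_integral_le_of_norm_le_const
    (C := 4 * B / Real.exp x₀ * Real.exp ζ.re) fun u hu => ?_).trans ?_
  · have huM : |u| ≤ L + Real.pi := by
      have h3 := uIoc_subset_uIcc hu
      rw [mem_uIcc] at h3
      rw [abs_le]
      rcases h3 with h3 | h3 <;> constructor <;> linarith
    have h3 := hB (x₀ + (u : ℂ) * Complex.I) (by simp) (by simpa using huM)
    have h4 := norm_sub_norm_le (Complex.exp (x₀ + u * Complex.I)) (Complex.exp ζ)
    rw [norm_exp_line, Complex.norm_exp] at h4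
    have h5 : Real.exp x₀ / 2 ≤ ‖Complex.exp (x₀ + u * Complex.I) - Complex.exp ζ‖ := by linarith
    rw [norm_mul, norm_mul, norm_mul, norm_div, norm_pow, Complex.norm_I, one_mul, norm_exp_line,
      Complex.norm_exp]
    calc _ ≤ Real.exp x₀ * (B * (Real.exp ζ.re / (Real.exp x₀ / 2) ^ 2)) := by gcongr
      _ = 4 * B / Real.exp x₀ * Real.exp ζ.re := by field_simp; ring
  · calc _ ≤ 4 * B / Real.exp x₀ * Real.exp ζ.re * L :=
          mul_le_mul_of_nonneg_left hlen (by positivity)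
      _ = _ := by ring

/-- The kernel of the derivative concentrates near the puncture, where `E` is small, and the
vertical segment contributes a term of order `exp ζ.re`. The solution itself need not vanish, but a
vanishing derivative is what integrability of `theta φ` requires. -/
theorem vanishes_deriv_cauchySolution (hE : DifferentiableOn ℂ E (halfPlane ρ)) (hv : Vanishes E)
    (hx : x₀ < ρ) : Vanishes (deriv (cauchySolution E x₀)) := by
  have hpi := Real.pi_pos
  rw [vanishes_iff]
  intro M ε hε
  obtain ⟨B, hB0, hB⟩ := hv.exists_bound hE.continuousOn hx (|M| + Real.pi)
  obtain ⟨X, hX⟩ := vanishes_iff.mp hv (|M| + Real.pi) (ε / 2) (by positivity)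
  have ha0 := Real.exp_pos x₀
  set K := B / (Real.exp x₀ * Real.exp (X - x₀) ^ 2) + 4 * B / Real.exp x₀ * |M| with hK
  have hK0 : 0 ≤ K := by positivity
  obtain ⟨Y, hY⟩ := vanishes_iff.mp vanishes_exp 0 (ε / (2 * (K + 1))) (by positivity)
  refine ⟨min Y (x₀ - 1), fun ζ h1 h2 => ?_⟩
  have hζY : ζ.re ≤ Y := h1.trans (min_le_left _ _)
  have hζx : ζ.re ≤ x₀ - 1 := h1.trans (min_le_right _ _)
  have hM : |ζ.im| ≤ |M| := h2.trans (le_abs_self M)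
  have hwε : Real.exp ζ.re ≤ ε / (2 * (K + 1)) := by
    have := hY (ζ.re : ℂ) (by simpa using hζY) (by simp)
    rwa [Complex.norm_exp, Complex.ofReal_re] at this
  have hwa : Real.exp ζ.re ≤ Real.exp x₀ / 2 := by
    have e4 : Real.exp (-1) ≤ 1 / 2 := by
      have := Real.exp_one_gt_d9
      rw [Real.exp_neg, one_div]
      exact inv_anti₀ (by norm_num) (by linarith)
    calc Real.exp ζ.re ≤ Real.exp (x₀ + -1) := Real.exp_le_exp.mpr (by linarith)
      _ = Real.exp x₀ * Real.exp (-1) := Real.exp_add _ _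
      _ ≤ Real.exp x₀ * (1 / 2) := mul_le_mul_of_nonneg_left e4 ha0.le
      _ = _ := by ring
  rw [(hasDerivAt_cauchySolution hE hv hx (by linarith)).deriv, norm_mul]
  have hyM : |ζ.im - Real.pi| ≤ |M| + Real.pi := by
    have := abs_sub ζ.im Real.pi
    rw [abs_of_pos hpi] at this
    linarith
  have hray := norm_rayDeriv_le (x₀ := x₀) (ζ := ζ) hB0 (half_pos hε).le
    (fun z hz hz' => hB z hz (by rwa [hz'])) (fun z hz hz' => hX z hz (by rwa [hz']))
  have hvert := norm_verticalDeriv_le hB0 hwa hM hB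
  have hc : ‖-(1 / (2 * Real.pi * Complex.I))‖ ≤ 1 := by
    rw [norm_neg, norm_div, norm_one, norm_mul, norm_mul, Complex.norm_I, Complex.norm_real,
      Real.norm_of_nonneg hpi.le, div_le_one (by norm_num; positivity)]
    norm_num
    linarith [Real.pi_gt_three]
  have hfin : K * Real.exp ζ.re ≤ ε / 2 := by
    calc K * Real.exp ζ.re ≤ (K + 1) * (ε / (2 * (K + 1))) := by gcongr; linarith
      _ = ε / 2 := by field_simp
  have hsum := (norm_add_le _ _).trans (add_le_add hray hvert)
  rw [← one_mul ε]
  refine mul_le_mul hc (hsum.trans ?_) (norm_nonneg _) zero_le_one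
  rw [hK, add_mul] at hfin
  linarith

end Solution

/-! ### Primitives of the monodromy, and local functions with prescribed monodromy. -/

section LocalSolution

variable {ρ x₀ : ℝ}

theorem exp_sub_one_ne_zero_of_re_neg {ζ : ℂ} (h : ζ.re < 0) : Complex.exp ζ - 1 ≠ 0 := fun h0 => by
  have h1 := congrArg norm (sub_eq_zero.mp h0)
  rw [Complex.norm_exp, norm_one, Real.exp_eq_one_iff] at h1
  exact h.ne h1

/-- The monodromy of an integrable singularity is `z d/dz` of a function vanishing at the
singularity. -/
theorem exists_theta_eq_monDelta {f : ℂ → ℂ} (hρ : ρ ≤ 0) (hf : DifferentiableOn ℂ f (halfPlane ρ))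
    (hv : Vanishes fun ζ => Complex.exp ζ * f ζ) :
    ∃ D : ℂ → ℂ, DifferentiableOn ℂ D (halfPlane ρ) ∧ Vanishes D ∧
      ∀ ζ ∈ halfPlane ρ, theta D ζ = monDelta f ζ := by
  -- `g = f / (1 - exp (-u))`; the denominator is periodic, so `theta D = Δ f` amounts to `D' = Δ
  -- g`. The integral of `g` over one period is such a primitive, and it vanishes because
  -- integrability of `f` says that `g` does.
  set g : ℂ → ℂ := fun u => (Complex.exp u - 1)⁻¹ * (Complex.exp u * f u) with hg
  have hgd : DifferentiableOn ℂ g (halfPlane ρ) :=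
    DifferentiableOn.mul (DifferentiableOn.inv (by fun_prop) fun ζ hζ =>
      exp_sub_one_ne_zero_of_re_neg (lt_of_lt_of_le hζ hρ))
      (DifferentiableOn.mul (by fun_prop) hf)
  have hgv : Vanishes g := hv.mul_bounded fun M => by
    obtain ⟨X, hX⟩ := vanishes_iff.mp vanishes_exp M (1 / 2) (by norm_num)
    refine ⟨2, X, fun ζ h1 h2 => ?_⟩
    have h3 := hX ζ h1 h2
    have h4 := norm_sub_norm_le (1 : ℂ) (Complex.exp ζ)
    rw [norm_one, norm_sub_rev] at h4
    rw [norm_inv]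
    exact inv_le_of_inv_le₀ (by norm_num) (by linarith)
  have hre : ∀ (ζ : ℂ) (t : ℝ), (ζ + t * (2 * Real.pi * Complex.I)).re = ζ.re := fun ζ t => by simp
  have hline : ∀ ζ ∈ halfPlane ρ, Continuous fun t : ℝ => g (ζ + t * (2 * Real.pi * Complex.I)) :=
    fun ζ hζ => hgd.continuousOn.comp_continuous (by fun_prop) fun t => by
      simpa only [halfPlane, mem_ofPred_eq, hre] using hζ
  have hder : ∀ ζ ∈ halfPlane ρ, HasDerivAt (fun z => ∫ t in (0 : ℝ)..1,
      2 * Real.pi * Complex.I * g (z + t * (2 * Real.pi * Complex.I)))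
      (monDelta g ζ) ζ := fun ζ hζ => by
    set r := (ρ - ζ.re) / 2 with hr
    have hr0 : 0 < r := by have : ζ.re < ρ := hζ; rw [hr]; linarith
    have hball : ∀ z ∈ ball ζ r, z.re ≤ ρ - r ∧ |z.im| ≤ |ζ.im| + r := fun z hz => by
      rw [mem_ball, dist_eq_norm] at hz
      have h2 := abs_le.mp ((Complex.abs_re_le_norm (z - ζ)).trans hz.le)
      have h3 := (Complex.abs_im_le_norm (z - ζ)).trans hz.le
      rw [Complex.sub_re] at h2
      rw [Complex.sub_im] at h3
      have h4 := abs_sub_abs_le_abs_sub z.im ζ.im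
      constructor <;> linarith
    have hmem : ∀ z ∈ ball ζ r, z ∈ halfPlane ρ := fun z hz =>
      show z.re < ρ by linarith [(hball z hz).1]
    obtain ⟨B, hB0, hB⟩ := hgv.exists_bound hgd.continuousOn (show ρ - r < ρ by linarith)
      (|ζ.im| + r + 2 * Real.pi)
    have hpi := Real.pi_pos
    refine (hasDerivAt_intervalIntegral_of_bounded (Φ := fun z t => 2 * Real.pi * Complex.I *
      g (z + t * (2 * Real.pi * Complex.I))) (M := 2 * Real.pi * B) zero_le_one hr0
      (fun z hz => (continuous_const.mul (hline z (hmem z hz))).continuousOn) (fun t ht => ?_)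
      fun t ht z hz => ?_).2.congr_deriv ?_
    · refine DifferentiableOn.const_mul (hgd.comp (by fun_prop) fun z hz => ?_) _
      simpa only [halfPlane, mem_ofPred_eq, hre] using hmem z hz
    · rw [norm_mul, norm_mul, norm_mul, Complex.norm_I, mul_one, Complex.norm_real,
        Real.norm_of_nonneg hpi.le, Complex.norm_ofNat]
      have h1 : |(z + t * (2 * Real.pi * Complex.I)).im| ≤ |ζ.im| + r + 2 * Real.pi := by
        have e : (z + t * (2 * Real.pi * Complex.I)).im = z.im + t * (2 * Real.pi) := by simp
        rw [e]
        refine (abs_add_le _ _).trans (add_le_add (hball z hz).2 ?_)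
        rw [abs_of_nonneg (mul_nonneg ht.1.le (by positivity))]
        exact mul_le_of_le_one_left (by positivity) ht.2.le
      have h2 := hB _ (by rw [hre]; exact (hball z hz).1) h1
      gcongr
    · have hd : ∀ t ∈ uIcc (0 : ℝ) 1, HasDerivAt (fun t : ℝ => g (ζ + t * (2 * Real.pi * Complex.I)))
          (deriv (fun z => 2 * Real.pi * Complex.I * g (z + t * (2 * Real.pi * Complex.I))) ζ) t := by
        intro t _
        have hm : ζ + t * (2 * Real.pi * Complex.I) ∈ halfPlane ρ := by
          simpa only [halfPlane, mem_ofPred_eq, hre] using hζ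
        have hd := (differentiableAt_of_halfPlane hgd hm).hasDerivAt
        have h1 : HasDerivAt (fun t : ℝ => ζ + t * (2 * Real.pi * Complex.I))
            (2 * Real.pi * Complex.I) t := by
          simpa using (Complex.ofRealCLM.hasDerivAt.mul_const (2 * Real.pi * Complex.I)).const_add ζ
        refine (hd.scomp t h1).congr_deriv ?_
        have h2 := (hd.comp_add_const ζ (t * (2 * Real.pi * Complex.I))).const_mul
          (2 * Real.pi * Complex.I)
        rw [h2.deriv, smul_eq_mul]
      have hc : Continuous fun t : ℝ =>
          deriv (fun z => 2 * Real.pi * Complex.I * g (z + t * (2 * Real.pi * Complex.I))) ζ := by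
        have h2 : ∀ t : ℝ,
            deriv (fun z => 2 * Real.pi * Complex.I * g (z + t * (2 * Real.pi * Complex.I))) ζ =
            2 * Real.pi * Complex.I * deriv g (ζ + t * (2 * Real.pi * Complex.I)) := fun t => by
          have hm : ζ + t * (2 * Real.pi * Complex.I) ∈ halfPlane ρ := by
            simpa only [halfPlane, mem_ofPred_eq, hre] using hζ
          exact (((differentiableAt_of_halfPlane hgd hm).hasDerivAt.comp_add_const ζ _).const_mul
            (2 * Real.pi * Complex.I)).deriv
        simp only [h2]
        exact continuous_const.mul ((differentiableOn_deriv hgd).continuousOn.comp_continuous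
          (by fun_prop) fun t => by simpa only [halfPlane, mem_ofPred_eq, hre] using hζ)
      rw [intervalIntegral.integral_eq_sub_of_hasDerivAt hd (hc.intervalIntegrable 0 1)]
      simp [monDelta, monSigma]
  refine ⟨fun z => ∫ t in (0 : ℝ)..1, 2 * Real.pi * Complex.I *
    g (z + t * (2 * Real.pi * Complex.I)),
    fun ζ hζ => (hder ζ hζ).differentiableAt.differentiableWithinAt, ?_, fun ζ hζ => ?_⟩
  · rw [vanishes_iff]
    intro M ε hε
    have hpi := Real.pi_pos
    obtain ⟨X, hX⟩ := vanishes_iff.mp hgv (M + 2 * Real.pi) (ε / (2 * Real.pi)) (by positivity)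
    refine ⟨X, fun ζ h1 h2 => ?_⟩
    refine (intervalIntegral.norm_integral_le_of_norm_le_const (C := ε) fun t ht => ?_).trans ?_
    · rw [uIoc_of_le zero_le_one] at ht
      have h3 : |(ζ + t * (2 * Real.pi * Complex.I)).im| ≤ M + 2 * Real.pi := by
        have e : (ζ + t * (2 * Real.pi * Complex.I)).im = ζ.im + t * (2 * Real.pi) := by simp
        rw [e]
        refine (abs_add_le _ _).trans (add_le_add h2 ?_)
        rw [abs_of_nonneg (mul_nonneg ht.1.le (by positivity))]
        exact mul_le_of_le_one_left (by positivity) ht.2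
      have h4 := hX _ (by rw [hre]; exact h1) h3
      rw [norm_mul, norm_mul, norm_mul, Complex.norm_I, mul_one, Complex.norm_real,
        Real.norm_of_nonneg hpi.le, Complex.norm_ofNat]
      calc _ ≤ 2 * Real.pi * (ε / (2 * Real.pi)) := by gcongr
        _ = ε := by field_simp
    · simp
  · have h1 : Complex.exp ζ - 1 ≠ 0 := exp_sub_one_ne_zero_of_re_neg (lt_of_lt_of_le hζ hρ)
    have h2 : Complex.exp (ζ + 2 * Real.pi * Complex.I) = Complex.exp ζ := Complex.exp_periodic ζ
    rw [theta, (hder ζ hζ).deriv]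
    simp only [monDelta, monSigma, hg, h2]
    rw [Complex.exp_neg]
    have h3 := Complex.exp_ne_zero ζ
    generalize Complex.exp ζ = e at *
    field_simp

/-- A function of `exp ζ` without monodromy and with an integrable singularity is analytic. -/
theorem exists_analytic_of_periodic {k : ℂ → ℂ} (hk : DifferentiableOn ℂ k (halfPlane ρ))
    (hp : ∀ ζ ∈ halfPlane ρ, monDelta k ζ = 0) (hv : Vanishes fun ζ => Complex.exp ζ * k ζ) :
    ∃ R : ℂ → ℂ, DifferentiableOn ℂ R (ball 0 (Real.exp ρ)) ∧
      ∀ ζ ∈ halfPlane ρ, k ζ = R (Complex.exp ζ) := by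
  have hper : ∀ ζ ∈ halfPlane ρ, k (ζ + 2 * Real.pi * Complex.I) = k ζ := fun ζ hζ =>
    sub_eq_zero.mp (hp ζ hζ)
  have hnat : ∀ (n : ℕ), ∀ ζ ∈ halfPlane ρ, k (ζ + n * (2 * Real.pi * Complex.I)) = k ζ := by
    intro n
    induction n with
    | zero => simp
    | succ n ih =>
      intro ζ hζ
      rw [← ih ζ hζ, ← hper (ζ + n * (2 * Real.pi * Complex.I)) (by simpa [halfPlane] using hζ)]
      push_cast; ring_nf
  have hint : ∀ (n : ℤ), ∀ ζ ∈ halfPlane ρ, k (ζ + n * (2 * Real.pi * Complex.I)) = k ζ := by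
    intro n ζ hζ
    obtain ⟨m, rfl | rfl⟩ := n.eq_nat_or_neg
    · exact_mod_cast hnat m ζ hζ
    · have := hnat m (ζ + ((-(m : ℤ) : ℤ) : ℂ) * (2 * Real.pi * Complex.I))
        (by simpa [halfPlane] using hζ)
      rw [← this]
      push_cast; ring_nf
  have hexp : ∀ ζ ∈ halfPlane ρ, ∀ ξ : ℂ, Complex.exp ξ = Complex.exp ζ → k ξ = k ζ := by
    intro ζ hζ ξ h
    obtain ⟨n, rfl⟩ := Complex.exp_eq_exp_iff_exists_int.mp h
    exact hint n ζ hζ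
  set R₀ : ℂ → ℂ := fun w => k (Complex.log w) with hR₀
  have hlog : ∀ w : ℂ, w ≠ 0 → w ∈ ball (0 : ℂ) (Real.exp ρ) → Complex.log w ∈ halfPlane ρ :=
    fun w hw hb => by
      rw [mem_ball_zero_iff] at hb
      change (Complex.log w).re < ρ
      rw [Complex.log_re, Real.log_lt_iff_lt_exp (norm_pos_iff.mpr hw)]
      exact hb
  have hR₀e : ∀ ζ ∈ halfPlane ρ, R₀ (Complex.exp ζ) = k ζ := fun ζ hζ =>
    hexp ζ hζ _ (Complex.exp_log (Complex.exp_ne_zero _))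
  have hR₀d : DifferentiableOn ℂ R₀ (ball 0 (Real.exp ρ) \ {0}) := by
    rintro w ⟨hwb, hw0⟩
    rw [mem_singleton_iff] at hw0
    have hnb : ball (0 : ℂ) (Real.exp ρ) \ {0} ∈ 𝓝 w :=
      (isOpen_ball.sdiff isClosed_singleton).mem_nhds ⟨hwb, hw0⟩
    -- The principal logarithm jumps on the negative axis; near `w` it is replaced by a continuous
    -- branch, which periodicity of `k` allows.
    have h1 : HasDerivAt (fun v : ℂ => Complex.log w + Complex.log (v / w)) (1 / w) w := by
      have h2 : HasDerivAt (fun v : ℂ => v / w) (1 / w) w := (hasDerivAt_id w).div_const w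
      simpa [div_self hw0] using (h2.clog (by simp [div_self hw0])).const_add (Complex.log w)
    have h3 : Complex.log w + Complex.log (w / w) = Complex.log w := by simp [div_self hw0]
    have h4 : DifferentiableAt ℂ (fun v : ℂ => k (Complex.log w + Complex.log (v / w))) w := by
      refine DifferentiableAt.comp (g := k) w ?_ h1.differentiableAt
      rw [h3]
      exact differentiableAt_of_halfPlane hk (hlog w hw0 hwb)
    refine (h4.congr_of_eventuallyEq ?_).differentiableWithinAt
    filter_upwards [hnb] with v hv
    refine (hexp _ (hlog v hv.2 hv.1) _ ?_).symm
    rw [Complex.exp_add, Complex.exp_log hw0, Complex.exp_log (div_ne_zero hv.2 hw0),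
      Complex.exp_log hv.2]
    field_simp
  have hnhds : ball (0 : ℂ) (Real.exp ρ) ∈ 𝓝 (0 : ℂ) := ball_mem_nhds _ (Real.exp_pos _)
  have hlim : Tendsto (fun w => w * R₀ w) (𝓝[≠] 0) (𝓝 0) := by
    rw [Metric.tendsto_nhds]
    intro ε hε
    obtain ⟨X, hX⟩ := vanishes_iff.mp hv Real.pi (ε / 2) (by positivity)
    filter_upwards [nhdsWithin_le_nhds (ball_mem_nhds (0 : ℂ) (Real.exp_pos X)),
      self_mem_nhdsWithin] with w hw hw0
    rw [mem_ball_zero_iff] at hw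
    have h := hX (Complex.log w) (by
      rw [Complex.log_re]
      exact ((Real.log_lt_iff_lt_exp (norm_pos_iff.mpr hw0)).mpr hw).le)
      (by rw [Complex.log_im]; exact Complex.abs_arg_le_pi w)
    rw [Complex.exp_log hw0] at h
    rw [dist_zero_right]
    linarith
  -- Integrability reads `w R₀(w) → 0`, the hypothesis of the removable singularity theorem.
  have ho : (fun w => R₀ w - R₀ 0) =o[𝓝[≠] 0] fun w : ℂ => (w - 0)⁻¹ := by
    rw [Asymptotics.isLittleO_iff_tendsto' (by
      filter_upwards [self_mem_nhdsWithin] with w hw h0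
      simp at h0; exact absurd h0 hw)]
    have h2 : Tendsto (fun w : ℂ => w * R₀ 0) (𝓝[≠] 0) (𝓝 0) := by
      have : Tendsto (fun w : ℂ => w * R₀ 0) (𝓝 0) (𝓝 (0 * R₀ 0)) :=
        (continuous_id.mul continuous_const).tendsto 0
      rw [zero_mul] at this
      exact this.mono_left nhdsWithin_le_nhds
    have := hlim.sub h2
    rw [sub_zero] at this
    refine this.congr fun w => ?_
    rw [sub_zero, div_inv_eq_mul]; ring
  refine ⟨_, Complex.differentiableOn_update_limUnder_of_isLittleO hnhds hR₀d ho, fun ζ hζ => ?_⟩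
  rw [Function.update_of_ne (Complex.exp_ne_zero ζ), hR₀e ζ hζ]

/-- A function with vanishing derivative grows at most linearly. -/
theorem vanishes_exp_mul_of_deriv {φ : ℂ → ℂ} (hφ : DifferentiableOn ℂ φ (halfPlane ρ))
    (hv : Vanishes (deriv φ)) : Vanishes fun ζ => Complex.exp ζ * φ ζ := by
  rw [vanishes_iff]
  intro M ε hε
  obtain ⟨X₁, hX₁⟩ := vanishes_iff.mp hv M 1 one_pos
  set X := min X₁ (ρ - 1) with hX
  have hXρ : X < ρ := (min_le_right _ _).trans_lt (by linarith)
  have hK : IsCompact (Icc X X ×ℂ Icc (-M) M) := isCompact_Icc.reProdIm isCompact_Icc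
  obtain ⟨B, hB⟩ := hK.exists_bound_of_continuousOn (hφ.continuousOn.mono fun ζ hζ => by
    simp only [Complex.mem_reProdIm, mem_Icc] at hζ
    simp only [halfPlane, mem_ofPred_eq]; linarith)
  have hgrow : ∀ ζ : ℂ, ζ.re ≤ X → |ζ.im| ≤ M → ‖φ ζ‖ ≤ |B| + (X - ζ.re) := by
    intro ζ h1 h2
    set ξ : ℂ := ⟨X, ζ.im⟩ with hξ
    have hconv : Convex ℝ {w : ℂ | w.re ≤ X ∧ |w.im| ≤ M} := by
      simp only [abs_le]
      exact (convex_halfSpace_re_le X).inter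
        ((convex_halfSpace_im_ge (-M)).inter (convex_halfSpace_im_le M))
    have h3 := hconv.norm_image_sub_le_of_norm_deriv_le (𝕜 := ℂ) (f := φ) (C := 1) (x := ξ) (y := ζ)
      (fun w hw => differentiableAt_of_halfPlane hφ (lt_of_le_of_lt hw.1 hXρ))
      (fun w hw => hX₁ w (hw.1.trans (min_le_left _ _)) hw.2) ⟨le_rfl, h2⟩ ⟨h1, h2⟩
    have h4 : ‖ζ - ξ‖ = X - ζ.re := by
      have : ζ - ξ = ((ζ.re - X : ℝ) : ℂ) := by apply Complex.ext <;> simp [hξ]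
      rw [this, Complex.norm_real, Real.norm_of_nonpos (by linarith)]; ring
    rw [h4, one_mul] at h3
    have h5 := (hB ξ (by simp [Complex.mem_reProdIm, hξ, abs_le.mp h2])).trans (le_abs_self B)
    have h6 := norm_sub_norm_le (φ ζ) (φ ξ)
    linarith
  have hlim : Tendsto (fun x : ℝ => Real.exp x * (|B| + (X - x))) atBot (𝓝 0) := by
    have h1 := Real.tendsto_pow_mul_exp_neg_atTop_nhds_zero 1
    have h2 := Real.tendsto_exp_neg_atTop_nhds_zero.const_mul (|B| + X)
    have h3 := (h2.add h1).comp tendsto_neg_atBot_atTop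
    rw [mul_zero, add_zero] at h3
    refine h3.congr fun x => ?_
    simp; ring
  obtain ⟨Y, hY⟩ := (eventually_atBot.mp ((tendsto_order.mp hlim).2 ε hε))
  refine ⟨min X Y, fun ζ h1 h2 => ?_⟩
  rw [norm_mul, Complex.norm_exp]
  have h3 := hgrow ζ (h1.trans (min_le_left _ _)) h2
  exact (mul_le_mul_of_nonneg_left h3 (Real.exp_pos _).le).trans
    (hY _ (h1.trans (min_le_right _ _))).le

/-- `exp ζ * theta φ = (exp ζ - 1) φ'`, with a bounded factor. -/
theorem vanishes_exp_mul_theta {φ : ℂ → ℂ} (hv : Vanishes (deriv φ)) :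
    Vanishes fun ζ => Complex.exp ζ * theta φ ζ := by
  have h : (fun ζ => Complex.exp ζ * theta φ ζ) = fun ζ => (Complex.exp ζ - 1) * deriv φ ζ := by
    funext ζ
    rw [theta, Complex.exp_neg]
    have := Complex.exp_ne_zero ζ
    field_simp
  rw [h]
  refine hv.mul_bounded fun M => ?_
  obtain ⟨X, hX⟩ := vanishes_iff.mp vanishes_exp M 1 one_pos
  refine ⟨2, X, fun ζ h1 h2 => (norm_sub_le _ _).trans ?_⟩
  rw [norm_one]
  linarith [hX ζ h1 h2]

/-- If `R` is analytic at `0`, then `z d/dz R` has an integrable singularity. -/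
theorem vanishes_exp_mul_theta_comp_exp {R : ℂ → ℂ} {r : ℝ}
    (hR : DifferentiableOn ℂ R (ball 0 (Real.exp r))) :
    Vanishes fun ζ => Complex.exp ζ * theta (fun ζ => R (Complex.exp ζ)) ζ := by
  refine vanishes_exp_mul_theta ?_
  have hd : ∀ ζ ∈ halfPlane r, deriv R (Complex.exp ζ) * Complex.exp ζ =
      deriv (fun ζ => R (Complex.exp ζ)) ζ := fun ζ hζ => by
    have h1 : Complex.exp ζ ∈ ball (0 : ℂ) (Real.exp r) := by
      rw [mem_ball_zero_iff, Complex.norm_exp]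
      exact Real.exp_lt_exp.mpr hζ
    exact ((hR.differentiableAt (isOpen_ball.mem_nhds h1)).hasDerivAt.comp ζ
      (Complex.hasDerivAt_exp ζ)).deriv.symm
  refine Vanishes.congr (ρ := r) (vanishes_exp.mul_bounded
    (g := fun ζ => deriv R (Complex.exp ζ)) fun M => ?_) hd
  have hc : ContinuousOn (deriv R) (closedBall 0 (Real.exp (r - 1))) :=
    (hR.deriv isOpen_ball).continuousOn.mono (closedBall_subset_ball (Real.exp_lt_exp.mpr (by linarith)))
  obtain ⟨B, hB⟩ := (isCompact_closedBall _ _).exists_bound_of_continuousOn hc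
  refine ⟨B, r - 1, fun ζ h1 _ => hB _ ?_⟩
  rw [mem_closedBall_zero_iff, Complex.norm_exp]
  exact Real.exp_le_exp.mpr h1

/-- The second `z d/dz`-derivative of the Cauchy transform of the convolution of two primitives
has an integrable singularity, with monodromy the convolution. -/
theorem theta_theta_cauchySolution {C E : ℂ → ℂ} (hC : DifferentiableOn ℂ C (halfPlane ρ))
    (hCv : Vanishes C) (hE : DifferentiableOn ℂ E (halfPlane ρ)) (hEv : Vanishes E)
    (hCE : ∀ ζ ∈ halfPlane ρ, theta C ζ = E ζ) (hx : x₀ < ρ) :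
    DifferentiableOn ℂ (theta (theta (cauchySolution C x₀))) (halfPlane x₀) ∧
      Vanishes (fun ζ => Complex.exp ζ * theta (theta (cauchySolution C x₀)) ζ) ∧
      ∀ ζ ∈ halfPlane x₀, monDelta (theta (theta (cauchySolution C x₀))) ζ = theta E ζ := by
  have hφC := differentiableOn_cauchySolution hC hCv hx
  have hφE := differentiableOn_cauchySolution hE hEv hx
  have hθ := differentiableOn_theta hφC
  have hΔ : ∀ ζ ∈ halfPlane x₀, monDelta (theta (cauchySolution C x₀)) ζ = E ζ := fun ζ hζ => by
    rw [← theta_monDelta hφC hζ, ← hCE ζ (lt_trans hζ hx)]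
    exact theta_congr (fun w hw => cauchySolution_add_period hC hCv hx hw) ζ hζ
  refine ⟨differentiableOn_theta hθ, ?_, fun ζ hζ => ?_⟩
  -- Applying `theta` twice to the solution for `C` would directly cost a second factor `exp (-ζ)`.
  -- But `theta` of that solution and the solution for `E` both have monodromy `E`, so they differ
  -- by a function holomorphic in `exp ζ`, and one `theta` of each piece is integrable.
  · have hk : DifferentiableOn ℂ (fun ζ => theta (cauchySolution C x₀) ζ - cauchySolution E x₀ ζ)
        (halfPlane x₀) := hθ.sub hφE
    obtain ⟨R, hR, hRe⟩ := exists_analytic_of_periodic hk (fun ζ hζ => by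
      have h1 := hΔ ζ hζ
      have h2 := cauchySolution_add_period hE hEv hx hζ
      simp only [monDelta, monSigma] at h1 h2 ⊢
      linear_combination h1 - h2) (by
      have h1 := (vanishes_exp_mul_theta (vanishes_deriv_cauchySolution hC hCv hx)).sub
        (vanishes_exp_mul_of_deriv hφE (vanishes_deriv_cauchySolution hE hEv hx))
      simpa only [mul_sub] using h1)
    have h1 := (vanishes_exp_mul_theta (vanishes_deriv_cauchySolution hE hEv hx)).add
      (vanishes_exp_mul_theta_comp_exp hR)
    refine h1.congr (ρ := x₀) fun ζ hζ => ?_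
    rw [← mul_add, ← theta_congr hRe ζ hζ, theta_sub hθ hφE hζ]
    ring
  · rw [← theta_monDelta hθ hζ]
    exact theta_congr (fun w hw => hΔ w hw) ζ hζ

end LocalSolution

/-! ### Linearity, periodicity and stability of the convolution. -/

section ConvProperties

variable {ρ : ℝ}

theorem convKernel_congr {f f' g g' : ℂ → ℂ} (hρ : ρ ≤ 0) (hf : ∀ ζ ∈ halfPlane ρ, f ζ = f' ζ)
    (hg : ∀ ζ ∈ halfPlane ρ, g ζ = g' ζ) {ζ : ℂ} (hζ : ζ.re < ρ) {t : ℝ} (ht : t ∈ Ioo (0 : ℝ) 1) :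
    convKernel f g ζ t = convKernel f' g' ζ t := by
  rw [convKernel, convKernel, hf _ ((firstLift_re_le ζ ht.1 ht.2).trans_lt hζ),
    hg _ ((secondLift_re_le (hζ.trans_le hρ) ht.1 ht.2).trans_lt hζ)]

theorem eventually_truncation : ∀ᶠ p : ℝ × ℝ in 𝓝[>] (0 : ℝ) ×ˢ 𝓝[>] (0 : ℝ),
    uIcc p.1 (1 - p.2) ⊆ Ioo (0 : ℝ) 1 := by
  have h : ∀ᶠ x : ℝ in 𝓝[>] (0 : ℝ), x ∈ Ioo (0 : ℝ) (1 / 2) := Ioo_mem_nhdsGT (by norm_num)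
  filter_upwards [h.prod_mk h] with p hp
  rw [uIcc_of_le (by linarith [hp.1.2, hp.2.2])]
  intro t ht
  exact ⟨hp.1.1.trans_le ht.1, ht.2.trans_lt (by linarith [hp.2.1])⟩

theorem truncatedIntegral_eventuallyEq {f f' g g' : ℂ → ℂ} {ζ : ℂ}
    (h : ∀ t ∈ Ioo (0 : ℝ) 1, convKernel f g ζ t = convKernel f' g' ζ t) :
    truncatedIntegral f g ζ =ᶠ[𝓝[>] (0 : ℝ) ×ˢ 𝓝[>] (0 : ℝ)] truncatedIntegral f' g' ζ := by
  filter_upwards [eventually_truncation] with p hp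
  exact intervalIntegral.integral_congr fun t ht => h t (hp ht)

theorem limUnder_congr {ι : Type*} {l : Filter ι} {u v : ι → ℂ} (h : u =ᶠ[l] v) :
    limUnder l u = limUnder l v := by
  rw [limUnder, limUnder, Filter.map_congr h]

theorem conv_congr {f f' g g' : ℂ → ℂ} (hρ : ρ ≤ 0) (hf : ∀ ζ ∈ halfPlane ρ, f ζ = f' ζ)
    (hg : ∀ ζ ∈ halfPlane ρ, g ζ = g' ζ) {ζ : ℂ} (hζ : ζ.re < ρ) :
    conv f g ζ = conv f' g' ζ := by
  rw [conv, conv, limUnder_congr (truncatedIntegral_eventuallyEq fun t ht =>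
    convKernel_congr hρ hf hg hζ ht)]

theorem ConvConverges.congr {f f' g g' : ℂ → ℂ} (hρ : ρ ≤ 0) (hf : ∀ ζ ∈ halfPlane ρ, f ζ = f' ζ)
    (hg : ∀ ζ ∈ halfPlane ρ, g ζ = g' ζ) {ζ : ℂ} (hζ : ζ.re < ρ) (h : ConvConverges f g ζ) :
    ConvConverges f' g' ζ := by
  have hk := fun t ht => convKernel_congr hρ hf hg hζ (t := t) ht
  obtain ⟨h1, l, h2⟩ := h
  refine ⟨fun t ht => ?_, l, h2.congr' (truncatedIntegral_eventuallyEq hk)⟩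
  obtain ⟨u, hu, hi⟩ := h1 t ht
  refine ⟨u ∩ Ioo 0 1, inter_mem hu self_mem_nhdsWithin, (hi.mono_set inter_subset_left).congr ?_⟩
  exact ae_restrict_of_ae_restrict_of_subset inter_subset_right
    ((ae_restrict_mem measurableSet_Ioo).mono hk)

/-- Local integrability of each kernel exchanges the sum with the truncated integrals, convergence
exchanges it with the limit; both are part of `ConvConverges`. -/
theorem conv_sum {ι : Type*} {s : Finset ι} {f : ι → ℂ → ℂ} {g : ℂ → ℂ} {ζ : ℂ}
    (h : ∀ i ∈ s, ConvConverges (f i) g ζ) :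
    conv (fun ζ => ∑ i ∈ s, f i ζ) g ζ = ∑ i ∈ s, conv (f i) g ζ := by
  have h1 : Tendsto (truncatedIntegral (fun ζ => ∑ i ∈ s, f i ζ) g ζ)
      (𝓝[>] (0 : ℝ) ×ˢ 𝓝[>] (0 : ℝ)) (𝓝 (∑ i ∈ s,
        limUnder (𝓝[>] (0 : ℝ) ×ˢ 𝓝[>] (0 : ℝ)) (truncatedIntegral (f i) g ζ))) := by
    have h3 : ∀ i ∈ s, Tendsto (truncatedIntegral (f i) g ζ) (𝓝[>] (0 : ℝ) ×ˢ 𝓝[>] (0 : ℝ))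
        (𝓝 (limUnder (𝓝[>] (0 : ℝ) ×ˢ 𝓝[>] (0 : ℝ)) (truncatedIntegral (f i) g ζ))) :=
      fun i hi => tendsto_nhds_limUnder (h i hi).2
    have h2 := tendsto_finsetSum s h3
    refine h2.congr' ?_
    filter_upwards [eventually_truncation] with p hp
    simp only [truncatedIntegral]
    rw [← intervalIntegral.integral_finsetSum fun i hi => ?_]
    · refine intervalIntegral.integral_congr fun t _ => ?_
      simp only [convKernel, Finset.sum_mul]
    · exact (((h i hi).1.integrableOn_compact_subset hp isCompact_uIcc).intervalIntegrable)
  rw [conv, h1.limUnder_eq, Finset.mul_sum]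
  rfl

/-- `exp ζ` is unchanged by a turn, so the segment is the same and both lifts shift by `2 π i`. -/
theorem conv_monSigma (f g : ℂ → ℂ) : conv (monSigma f) (monSigma g) = monSigma (conv f g) := by
  funext ζ
  have h : ∀ t, convKernel (monSigma f) (monSigma g) ζ t =
      convKernel f g (ζ + 2 * Real.pi * Complex.I) t := fun t => by
    have h2 : Complex.exp (ζ + 2 * Real.pi * Complex.I) = Complex.exp ζ := Complex.exp_periodic ζ
    simp only [convKernel, monSigma, secondLift, h2]
    congr 3 <;> ring_nf
  simp only [conv, monSigma]
  congr 2
  funext p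
  simp only [truncatedIntegral, h]

theorem convConverges_monSigma {f g : ℂ → ℂ} {ζ : ℂ} :
    ConvConverges (monSigma f) (monSigma g) ζ ↔
      ConvConverges f g (ζ + 2 * Real.pi * Complex.I) := by
  have h : convKernel (monSigma f) (monSigma g) ζ =
      convKernel f g (ζ + 2 * Real.pi * Complex.I) := by
    funext t
    have h2 : Complex.exp (ζ + 2 * Real.pi * Complex.I) = Complex.exp ζ := Complex.exp_periodic ζ
    simp only [convKernel, monSigma, secondLift, h2]
    congr 3 <;> ring_nf
  have h' : truncatedIntegral (monSigma f) (monSigma g) ζ =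
      truncatedIntegral f g (ζ + 2 * Real.pi * Complex.I) := by
    funext p
    simp only [truncatedIntegral, h]
  rw [ConvConverges, ConvConverges, h, h']

/-- `d` is `z d/dz` of a function vanishing at the singularity. -/
def HasVanishingPrimitive (ρ : ℝ) (d : ℂ → ℂ) : Prop :=
  ∃ D : ℂ → ℂ, DifferentiableOn ℂ D (halfPlane ρ) ∧ Vanishes D ∧ ∀ ζ ∈ halfPlane ρ, d ζ = theta D ζ

theorem halfPlane_mono {ρ ρ' : ℝ} (h : ρ' ≤ ρ) : halfPlane ρ' ⊆ halfPlane ρ := fun _ hζ =>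
  lt_of_lt_of_le hζ h

theorem HasVanishingPrimitive.mono {ρ' : ℝ} {d : ℂ → ℂ} (hd : HasVanishingPrimitive ρ d)
    (h : ρ' ≤ ρ) : HasVanishingPrimitive ρ' d := by
  obtain ⟨D, h1, h2, h3⟩ := hd
  exact ⟨D, h1.mono (halfPlane_mono h), h2, fun ζ hζ => h3 ζ (halfPlane_mono h hζ)⟩

theorem HasVanishingPrimitive.convConverges {d e : ℂ → ℂ} (hρ : ρ ≤ 0)
    (hd : HasVanishingPrimitive ρ d) (he : HasVanishingPrimitive ρ e) :
    ∀ ζ ∈ halfPlane ρ, ConvConverges d e ζ := by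
  obtain ⟨D, h1, h2, h3⟩ := hd
  obtain ⟨E, k1, k2, k3⟩ := he
  obtain ⟨_, _, _, _, _, _, _, _, h⟩ := exists_conv_primitives hρ h1 h2 k1 k2
  exact fun ζ hζ => (h ζ hζ).1.congr hρ (fun w hw => (h3 w hw).symm) (fun w hw => (k3 w hw).symm) hζ

/-- The stability that allows convolutions to be iterated without shrinking the half plane. -/
theorem HasVanishingPrimitive.conv {d e : ℂ → ℂ} (hρ : ρ ≤ 0)
    (hd : HasVanishingPrimitive ρ d) (he : HasVanishingPrimitive ρ e) :
    HasVanishingPrimitive ρ (conv d e) := by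
  obtain ⟨D, h1, h2, h3⟩ := hd
  obtain ⟨E, k1, k2, k3⟩ := he
  obtain ⟨_, E', _, _, hE, hE', _, _, h⟩ := exists_conv_primitives hρ h1 h2 k1 k2
  exact ⟨E', hE, hE', fun ζ hζ => (conv_congr hρ h3 k3 hζ).trans (h ζ hζ).2⟩

theorem hasVanishingPrimitive_monDelta {f : ℂ → ℂ} (hρ : ρ ≤ 0)
    (hf : DifferentiableOn ℂ f (halfPlane ρ)) (hv : Vanishes fun ζ => Complex.exp ζ * f ζ) :
    HasVanishingPrimitive ρ (monDelta f) := by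
  obtain ⟨D, h1, h2, h3⟩ := exists_theta_eq_monDelta hρ hf hv
  exact ⟨D, h1, h2, fun ζ hζ => (h3 ζ hζ).symm⟩

end ConvProperties

/-! ### Taylor series -/

/-- `P` is near `0` the sum of the power series with coefficients `a`. -/
def HasTaylor (a : ℕ → ℂ) (P : ℂ → ℂ) : Prop :=
  ∀ᶠ z in 𝓝 (0 : ℂ), HasSum (fun k : ℕ => a k * z ^ k) (P z)

section Taylor

variable {a b : ℕ → ℂ} {P Q : ℂ → ℂ}

theorem HasTaylor.congr (h : HasTaylor a P) (hQ : P =ᶠ[𝓝 0] Q) : HasTaylor a Q := by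
  filter_upwards [h, hQ] with z h1 h2
  rwa [← h2]

theorem HasTaylor.eventuallyEq (h : HasTaylor a P) (h' : HasTaylor a Q) : P =ᶠ[𝓝 0] Q := by
  filter_upwards [h, h'] with z h1 h2 using h1.unique h2

theorem HasTaylor.add (h : HasTaylor a P) (h' : HasTaylor b Q) :
    HasTaylor (fun k => a k + b k) fun z => P z + Q z := by
  filter_upwards [h, h'] with z h1 h2
  simpa only [add_mul] using h1.add h2

theorem HasTaylor.sub (h : HasTaylor a P) (h' : HasTaylor b Q) :
    HasTaylor (fun k => a k - b k) fun z => P z - Q z := by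
  filter_upwards [h, h'] with z h1 h2
  simpa only [sub_mul] using h1.sub h2

theorem hasTaylor_sum {ι : Type*} {s : Finset ι} {a : ι → ℕ → ℂ} {P : ι → ℂ → ℂ}
    (h : ∀ i ∈ s, HasTaylor (a i) (P i)) :
    HasTaylor (fun k => ∑ i ∈ s, a i k) fun z => ∑ i ∈ s, P i z := by
  have h1 := (eventually_all_finset s).mpr h
  filter_upwards [h1] with z hz
  simpa only [Finset.sum_mul] using hasSum_sum hz

theorem HasTaylor.hasFPowerSeriesAt (h : HasTaylor a P) :
    HasFPowerSeriesAt P (FormalMultilinearSeries.ofScalars ℂ a) 0 := by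
  rw [hasFPowerSeriesAt_iff]
  filter_upwards [h] with z hz
  simpa [mul_comm] using hz

theorem HasTaylor.euler (h : HasTaylor a P) : HasTaylor (fun k => k * a k) fun z => z * deriv P z := by
  obtain ⟨r, hr⟩ := h.hasFPowerSeriesAt
  filter_upwards [eball_mem_nhds (0 : ℂ) hr.r_pos] with z hz
  have h1 := (hr.fderiv.hasSum hz).mapL (ContinuousLinearMap.apply ℂ ℂ z)
  have h2 : ∀ n : ℕ, (ContinuousLinearMap.apply ℂ ℂ z)
      ((FormalMultilinearSeries.ofScalars ℂ a).derivSeries n fun _ => z) =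
      ((n + 1 : ℕ) : ℂ) * a (n + 1) * z ^ (n + 1) := fun n => by
    rw [ContinuousLinearMap.apply_apply, FormalMultilinearSeries.derivSeries_apply_diag]
    simp [FormalMultilinearSeries.ofScalars]
    ring
  simp only [h2, ContinuousLinearMap.apply_apply, zero_add, fderiv_eq_smul_deriv, smul_eq_mul] at h1
  rw [← hasSum_nat_add_iff' 1]
  simpa using h1

end Taylor

/-! ### Uniqueness and gluing along curves -/

section Curves

variable {a : ℕ → ℂ} {c : ℝ → ℂ}

/-- Identity theorem on the connected curve `c t * z`: analyticity on the curve is enough, whatever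
the domains of `P` and `Q`. -/
theorem eq_of_hasTaylor {P Q : ℂ → ℂ} (hP : HasTaylor a P) (hQ : HasTaylor a Q) {z : ℂ}
    (hc : ContinuousOn c (Icc 0 1)) (hc0 : c 0 = 0) (hc1 : c 1 = 1)
    (hPa : ∀ t ∈ Icc (0 : ℝ) 1, AnalyticAt ℂ P (c t * z))
    (hQa : ∀ t ∈ Icc (0 : ℝ) 1, AnalyticAt ℂ Q (c t * z)) : P z = Q z := by
  have hpre : IsPreconnected ((fun t => c t * z) '' Icc (0 : ℝ) 1) :=
    isPreconnected_Icc.image _ (hc.mul continuousOn_const)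
  have h1 := AnalyticOnNhd.eqOn_of_preconnected_of_eventuallyEq (𝕜 := ℂ) (f := P) (g := Q)
    (by rintro _ ⟨t, ht, rfl⟩; exact hPa t ht) (by rintro _ ⟨t, ht, rfl⟩; exact hQa t ht)
    hpre (z₀ := 0) ⟨0, by simp, by simp [hc0]⟩ (hP.eventuallyEq hQ)
  exact h1 ⟨1, by simp, by simp [hc1]⟩

/-- Define `H z` as the value at `z` of any continuation along `c t * z`. It is independent of the
choice by uniqueness along the curve, and a continuation for `z` also serves nearby endpoints, by
compactness of the curve. Nothing is assumed on the shape of `D`. -/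
theorem exists_of_forall_curve {D : Set ℂ} (hc : ContinuousOn c (Icc 0 1)) (hc0 : c 0 = 0)
    (hc1 : c 1 = 1) (h0 : (0 : ℂ) ∈ D)
    (h : ∀ z ∈ D, ∃ (Q : ℂ → ℂ) (O : Set ℂ), IsOpen O ∧ (∀ t ∈ Icc (0 : ℝ) 1, c t * z ∈ O) ∧
      DifferentiableOn ℂ Q O ∧ HasTaylor a Q) :
    ∃ H : ℂ → ℂ, (∀ z ∈ D, AnalyticAt ℂ H z) ∧ HasTaylor a H := by
  classical
  set good : ℂ → (ℂ → ℂ) → Prop := fun z Q => ∃ O : Set ℂ, IsOpen O ∧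
    (∀ t ∈ Icc (0 : ℝ) 1, c t * z ∈ O) ∧ DifferentiableOn ℂ Q O ∧ HasTaylor a Q with hgood
  have hopen : ∀ z Q, good z Q → ∀ᶠ w in 𝓝 z, good w Q := by
    rintro z Q ⟨O, hO, hz, hd, ht⟩
    have : ∀ᶠ w in 𝓝 z, ∀ t ∈ Icc (0 : ℝ) 1, c t * w ∈ O := by
      have hK : IsCompact (c '' Icc (0 : ℝ) 1) := isCompact_Icc.image_of_continuousOn hc
      have := hK.eventually_forall_of_forall_eventually (x₀ := z)
        (P := fun w u => u * w ∈ O) (by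
          rintro _ ⟨t, ht, rfl⟩
          have hcont : Continuous fun q : ℂ × ℂ => q.2 * q.1 := by fun_prop
          exact hcont.continuousAt.eventually (hO.mem_nhds (hz t ht)))
      filter_upwards [this] with w hw t ht using hw _ ⟨t, ht, rfl⟩
    filter_upwards [this] with w hw using ⟨O, hO, hw, hd, ht⟩
  have huniq : ∀ z Q Q', good z Q → good z Q' → Q z = Q' z := by
    rintro z Q Q' ⟨O, hO, hz, hd, ht⟩ ⟨O', hO', hz', hd', ht'⟩
    exact eq_of_hasTaylor ht ht' hc hc0 hc1
      (fun t h => hd.analyticAt (hO.mem_nhds (hz t h)))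
      (fun t h => hd'.analyticAt (hO'.mem_nhds (hz' t h)))
  set H : ℂ → ℂ := fun z => if hz : ∃ Q, good z Q then hz.choose z else 0 with hH
  have hHe : ∀ z Q, good z Q → H =ᶠ[𝓝 z] Q := fun z Q hQ => by
    filter_upwards [hopen z Q hQ] with w hw
    have hex : ∃ Q, good w Q := ⟨Q, hw⟩
    simp only [hH, hex, dif_pos]
    exact huniq w _ _ hex.choose_spec hw
  refine ⟨H, fun z hz => ?_, ?_⟩
  · obtain ⟨Q, O, hO, h1, h2, h3⟩ := h z hz
    have h4 : AnalyticAt ℂ Q z := h2.analyticAt (hO.mem_nhds (by simpa [hc1] using h1 1 (by simp)))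
    exact h4.congr (hHe z Q ⟨O, hO, h1, h2, h3⟩).symm
  · obtain ⟨Q, O, hO, h1, h2, h3⟩ := h 0 h0
    exact h3.congr (hHe 0 Q ⟨O, hO, h1, h2, h3⟩).symm

end Curves

/-! ### Coefficients as integrals along a cycle -/

section Representation

/-- `L` can be surrounded, inside the domain of `G`, by a (smeared) cycle representing the Taylor
coefficients of `G`. -/
structure IsCycleRep (L : Set ℂ) (b : ℕ → ℂ) (K : Set (ℝ × ℝ)) (m v : ℝ × ℝ → ℂ) : Prop where
  compact : IsCompact K
  continuousOn : ContinuousOn m K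
  continuous : Continuous v
  ne_zero : ∀ p, v p ≠ 0
  inv_notMem : ∀ p ∈ K, (v p)⁻¹ ∉ L
  coeff : ∀ k, b k = ∫ p in K, m p * v p ^ k

/-- Integrate `m(p) F(z v(p))` over `K`; expanding `F` at small `z` turns the moments `b k` of the
cycle into the coefficients `a k * b k`. The integrand is defined when no `z v(p)` is in `A`, and `z
v(p) = α` would put `z / α = (v p)⁻¹` in `L`. -/
theorem IsCycleRep.exists_hadamard {L : Set ℂ} {a b : ℕ → ℂ} {K : Set (ℝ × ℝ)} {m v : ℝ × ℝ → ℂ}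
    (h : IsCycleRep L b K m v) {A : Set ℂ} (hA : IsClosed A) (hA0 : (0 : ℂ) ∉ A) {F : ℂ → ℂ}
    (hF : DifferentiableOn ℂ F Aᶜ) (hFa : HasTaylor a F) :
    ∃ (Q : ℂ → ℂ) (O : Set ℂ), IsOpen O ∧ (∀ z, (∀ α ∈ A, z / α ∈ L) → z ∈ O) ∧
      DifferentiableOn ℂ Q O ∧ HasTaylor (fun k => a k * b k) Q := by
  have hKm : MeasurableSet K := h.compact.measurableSet
  set O : Set ℂ := {z | ∀ p ∈ K, z * v p ∈ Aᶜ} with hO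
  have hOopen : IsOpen O := by
    rw [isOpen_iff_mem_nhds]
    intro z hz
    refine h.compact.eventually_forall_of_forall_eventually (x₀ := z)
      (P := fun w p => w * v p ∈ Aᶜ) fun p hp => ?_
    have hcont : Continuous fun q : ℂ × (ℝ × ℝ) => q.1 * v q.2 :=
      continuous_fst.mul (h.continuous.comp continuous_snd)
    exact hcont.continuousAt.eventually (hA.isOpen_compl.mem_nhds (hz p hp))
  have hcontF : ∀ z ∈ O, ContinuousOn (fun p => m p * F (z * v p)) K := fun z hz =>
    h.continuousOn.mul (hF.continuousOn.comp (Continuous.continuousOn (by have := h.continuous; fun_prop)) hz)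
  refine ⟨fun z => ∫ p in K, m p * F (z * v p), O, hOopen, fun z hz p hp hmem => ?_, ?_, ?_⟩
  · have h0 : z ≠ 0 := fun h0 => hA0 (by simpa [h0] using hmem)
    refine h.inv_notMem p hp ?_
    have := hz _ hmem
    rwa [div_mul_cancel_left₀ h0] at this
  · intro z hz
    obtain ⟨r, hr0, hr⟩ := nhds_basis_closedBall.mem_iff.mp (hOopen.mem_nhds hz)
    obtain ⟨B, hB⟩ := ((isCompact_closedBall z r).prod h.compact).exists_bound_of_continuousOn
      (f := fun q : ℂ × (ℝ × ℝ) => m q.2 * F (q.1 * v q.2)) (by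
        refine ContinuousOn.mul (h.continuousOn.comp continuousOn_snd fun q hq => hq.2) ?_
        refine hF.continuousOn.comp (Continuous.continuousOn ?_) fun q hq => hr hq.1 _ hq.2
        exact continuous_fst.mul (h.continuous.comp continuous_snd))
    have hsub : ∀ w ∈ ball z r, w ∈ O := fun w hw => hr (ball_subset_closedBall hw)
    refine (hasDerivAt_integral_of_differentiableOn (μ := volume.restrict K) (bound := fun _ => B)
      (Φ := fun z p => m p * F (z * v p)) hr0
      (integrableOn_const (by exact h.compact.measure_lt_top.ne))
      (fun w hw => (hcontF w (hsub w hw)).aestronglyMeasurable hKm) ?_ ?_).2.differentiableAt.differentiableWithinAt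
    · filter_upwards [ae_restrict_mem hKm] with p hp
      refine DifferentiableOn.const_mul (hF.comp (by fun_prop) fun w hw => hsub w hw p hp) _
    · filter_upwards [ae_restrict_mem hKm] with p hp w hw
      exact hB (w, p) ⟨ball_subset_closedBall hw, hp⟩
  · obtain ⟨V, hV⟩ := h.compact.exists_bound_of_continuousOn h.continuous.continuousOn
    obtain ⟨M, hM⟩ := h.compact.exists_bound_of_continuousOn h.continuousOn
    obtain ⟨r, hr0, hr⟩ := Metric.eventually_nhds_iff_ball.mp hFa
    have hsum : Summable fun k : ℕ => ‖a k‖ * (r / 2) ^ k := by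
      have := (hr ((r / 2 : ℝ) : ℂ) (by
        rw [mem_ball_zero_iff, Complex.norm_real, Real.norm_of_nonneg (by positivity)]
        linarith)).summable.norm
      simpa [norm_mul, norm_pow, abs_of_pos hr0] using this
    have hev : ∀ᶠ z in 𝓝 (0 : ℂ), ‖z‖ * (|V| + 1) < r / 2 := by
      have : Continuous fun z : ℂ => ‖z‖ * (|V| + 1) := by fun_prop
      exact this.continuousAt.eventually_lt continuousAt_const (by simpa using by positivity)
    filter_upwards [hev] with z hz
    have hzv : ∀ p ∈ K, ‖z * v p‖ ≤ r / 2 := fun p hp => by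
      rw [norm_mul]
      refine le_trans (mul_le_mul_of_nonneg_left ?_ (norm_nonneg _)) hz.le
      linarith [hV p hp, le_abs_self V]
    have hbd : ∀ k : ℕ, ∀ p ∈ K, ‖m p * (a k * (z * v p) ^ k)‖ ≤ |M| * (‖a k‖ * (r / 2) ^ k) := by
      intro k p hp
      rw [norm_mul, norm_mul, norm_pow]
      have h1 := (hM p hp).trans (le_abs_self M)
      have h2 := hzv p hp
      gcongr
    have key := hasSum_integral_of_dominated_convergence (μ := volume.restrict K)
      (F := fun (k : ℕ) p => m p * (a k * (z * v p) ^ k)) (f := fun p => m p * F (z * v p))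
      (fun k _ => |M| * (‖a k‖ * (r / 2) ^ k)) (fun k => ContinuousOn.aestronglyMeasurable
        (h.continuousOn.mul (Continuous.continuousOn (by have := h.continuous; fun_prop))) hKm)
      (fun k => (ae_restrict_mem hKm).mono fun p hp => hbd k p hp)
      (ae_of_all _ fun _ => hsum.mul_left _)
      (integrableOn_const (by exact h.compact.measure_lt_top.ne))
      ((ae_restrict_mem hKm).mono fun p hp => (hr _ (by
        rw [mem_ball_zero_iff]; linarith [hzv p hp])).mul_left _)
    have hterm : ∀ k : ℕ, ∫ p in K, m p * (a k * (z * v p) ^ k) = a k * b k * z ^ k := fun k => by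
      rw [h.coeff k, mul_right_comm, ← integral_const_mul]
      refine integral_congr_ae (ae_of_all _ fun p => ?_)
      simp only [mul_pow]
      ring
    simpa only [hterm] using key

theorem integral_exp_period {x₀ : ℝ} (j k : ℕ) :
    (∫ y in (0 : ℝ)..2 * Real.pi, Complex.exp (x₀ + y * Complex.I) ^ j *
      Complex.exp (-(x₀ + y * Complex.I)) ^ k) = if j = k then 2 * (Real.pi : ℂ) else 0 := by
  have h : ∀ y : ℝ, Complex.exp (x₀ + y * Complex.I) ^ j * Complex.exp (-(x₀ + y * Complex.I)) ^ k =
      Complex.exp (((j : ℂ) - k) * x₀) * Complex.exp ((((j : ℂ) - k) * Complex.I) * y) := fun y => by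
    rw [← Complex.exp_nat_mul, ← Complex.exp_nat_mul, ← Complex.exp_add, ← Complex.exp_add]
    congr 1; ring
  simp only [h]
  rw [intervalIntegral.integral_const_mul]
  split_ifs with hjk
  · simp [hjk]
  · have h1 : ((j : ℂ) - k) * Complex.I ≠ 0 :=
      mul_ne_zero (sub_ne_zero.mpr (by exact_mod_cast hjk)) Complex.I_ne_zero
    rw [integral_exp_mul_complex h1]
    have h2 : Complex.exp (((j : ℂ) - k) * Complex.I * ((2 * Real.pi : ℝ) : ℂ)) = 1 := by
      rw [Complex.exp_eq_one_iff]
      exact ⟨(j : ℤ) - k, by push_cast; ring⟩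
    rw [h2]
    simp

/-- Instead of choosing a contour between `L` and `B`, take a smooth cutoff `χ`, equal to `1` near
`L` and to `0` near `B` and outside a large disc. Apply Green's formula to `χ G z⁻ᵏ` in logarithmic
coordinates on a rectangle of height `2π`. The horizontal sides cancel by periodicity, `χ = 0` on
the right side, and `χ = 1` on the left side, which gives Cauchy's formula for `b k`. The area
integral lives where `χ` is not locally constantly `0` or `1`: this is the smeared cycle. -/
theorem exists_isCycleRep {L B : Set ℂ} (hL : IsCompact L) (hL0 : (0 : ℂ) ∈ L) (hB : IsClosed B)
    (hLB : Disjoint L B) {G : ℂ → ℂ} (hG : DifferentiableOn ℂ G Bᶜ) {b : ℕ → ℂ}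
    (hGb : HasTaylor b G) : ∃ K m v, IsCycleRep L b K m v := by
  obtain ⟨R, hR⟩ := hL.isBounded.subset_ball (0 : ℂ)
  have hR0 : 0 < R := by simpa using hR hL0
  have hB' : IsClosed (B ∪ {z : ℂ | R ≤ ‖z‖}) := hB.union (isClosed_le continuous_const continuous_norm)
  have hd : Disjoint (B ∪ {z : ℂ | R ≤ ‖z‖}) L := by
    refine Disjoint.union_left hLB.symm (Set.disjoint_left.mpr fun z hz hz' => ?_)
    have := hR hz'
    rw [mem_ball_zero_iff] at this
    exact absurd hz (not_le.mpr this)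
  obtain ⟨χ, hχ0, hχ1, -⟩ := exists_contMDiffMap_zero_one_nhds_of_isClosed
    (modelWithCornersSelf ℝ ℂ) (n := 1) hB' hL.isClosed hd
  obtain ⟨U, hUo, hBU, hU⟩ := eventually_nhdsSet_iff_exists.mp hχ0
  obtain ⟨V, hVo, hLV, hV⟩ := eventually_nhdsSet_iff_exists.mp hχ1
  have hχd : ContDiff ℝ 1 (χ : ℂ → ℝ) := χ.contMDiff.contDiff
  set X : ℂ → ℂ := fun w => ((χ (Complex.exp w) : ℝ) : ℂ) with hX
  have hXd : ContDiff ℝ 1 X :=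
    Complex.ofRealCLM.contDiff.comp (hχd.comp Complex.contDiff_exp)
  -- `q` is `2 i` times the `∂̄`-derivative of `X`; multiplication by the holomorphic `h k` commutes
  -- with `∂̄`.
  set q : ℂ → ℂ := fun w => Complex.I * fderiv ℝ X w 1 - fderiv ℝ X w Complex.I with hq
  have hqc : Continuous q := by
    have := hXd.continuous_fderiv one_ne_zero
    fun_prop
  have hXU : ∀ w, Complex.exp w ∈ U → X =ᶠ[𝓝 w] fun _ => 0 := fun w hw => by
    filter_upwards [Complex.continuous_exp.continuousAt.preimage_mem_nhds (hUo.mem_nhds hw)] with u hu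
    simp [hX, hU _ hu]
  have hXV : ∀ w, Complex.exp w ∈ V → X =ᶠ[𝓝 w] fun _ => 1 := fun w hw => by
    filter_upwards [Complex.continuous_exp.continuousAt.preimage_mem_nhds (hVo.mem_nhds hw)] with u hu
    simp [hX, hV _ hu]
  have hqU : ∀ w, Complex.exp w ∈ U → q w = 0 := fun w hw => by
    simp [hq, (hXU w hw).fderiv_eq]
  have hqV : ∀ w, Complex.exp w ∈ V → q w = 0 := fun w hw => by
    simp [hq, (hXV w hw).fderiv_eq]
  have hGd : ∀ w, Complex.exp w ∉ U → DifferentiableAt ℂ (fun w => G (Complex.exp w)) w :=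
    fun w hw => DifferentiableAt.comp (g := G) w
      (hG.differentiableAt (hB.isOpen_compl.mem_nhds fun h => hw (hBU (Or.inl h))))
      Complex.differentiableAt_exp
  set h : ℕ → ℂ → ℂ := fun k w => G (Complex.exp w) * Complex.exp (-w) ^ k with hh
  have hhd : ∀ k w, Complex.exp w ∉ U → DifferentiableAt ℂ (h k) w := fun k w hw =>
    (hGd w hw).mul (by fun_prop)
  have hfd : ∀ k w, DifferentiableAt ℝ (fun w => X w * h k w) w ∧
      Complex.I * fderiv ℝ (fun w => X w * h k w) w 1 -
        fderiv ℝ (fun w => X w * h k w) w Complex.I = q w * h k w := by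
    intro k w
    by_cases hw : Complex.exp w ∈ U
    · have h1 : (fun w => X w * h k w) =ᶠ[𝓝 w] fun _ => 0 :=
        (hXU w hw).mono fun u hu => by simp [hu]
      refine ⟨(differentiableAt_const (0 : ℂ)).congr_of_eventuallyEq h1, ?_⟩
      simp [h1.fderiv_eq, hqU w hw]
    · have h1 := (hXd.differentiable one_ne_zero w).hasFDerivAt
      have h2 := (hhd k w hw).hasDerivAt.hasFDerivAt.restrictScalars ℝ
      have h3 := h1.mul h2
      refine ⟨h3.differentiableAt, ?_⟩
      have h4 : fderiv ℝ (fun w => X w * h k w) w = _ := h3.fderiv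
      rw [h4]
      simp [hq]
      ring
  have hqh : ∀ k, Continuous fun w => q w * h k w := fun k => by
    rw [continuous_iff_continuousAt]
    intro w
    by_cases hw : Complex.exp w ∈ U
    · have h1 : (fun w => q w * h k w) =ᶠ[𝓝 w] fun _ => 0 := by
        filter_upwards [Complex.continuous_exp.continuousAt.preimage_mem_nhds (hUo.mem_nhds hw)]
          with u hu
        rw [hqU u hu, zero_mul]
      exact continuousAt_const.congr h1.symm
    · exact hqc.continuousAt.mul (hhd k w hw).continuousAt
  obtain ⟨r, hr0, hr⟩ := Metric.eventually_nhds_iff_ball.mp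
    (hGb.and (hVo.mem_nhds (hLV hL0)))
  set x₀ := Real.log (r / 2) with hx₀
  set x₁ := max x₀ (Real.log R) with hx₁
  have hx : x₀ ≤ x₁ := le_max_left _ _
  have hpi := Real.pi_pos
  have hnorm : ∀ y : ℝ, Complex.exp (x₀ + y * Complex.I) ∈ ball (0 : ℂ) r := fun y => by
    rw [mem_ball_zero_iff, norm_exp_line, hx₀, Real.exp_log (by positivity)]
    linarith
  have hleft : ∀ k, (∫ y in (0 : ℝ)..2 * Real.pi,
      X (x₀ + y * Complex.I) * h k (x₀ + y * Complex.I)) = 2 * Real.pi * b k := by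
    intro k
    have hsum : Summable fun j : ℕ => ‖b j‖ * (r / 2) ^ j := by
      have := (hr ((r / 2 : ℝ) : ℂ) (by
        rw [mem_ball_zero_iff, Complex.norm_real, Real.norm_of_nonneg (by positivity)]
        linarith)).1.summable.norm
      simpa [norm_mul, norm_pow, abs_of_pos hr0] using this
    have key := intervalIntegral.hasSum_integral_of_dominated_convergence (a := 0)
      (b := 2 * Real.pi) (μ := volume) (F := fun (j : ℕ) (y : ℝ) =>
        b j * (Complex.exp (x₀ + y * Complex.I) ^ j * Complex.exp (-(x₀ + y * Complex.I)) ^ k))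
      (f := fun y : ℝ => X (x₀ + y * Complex.I) * h k (x₀ + y * Complex.I))
      (fun j _ => ‖b j‖ * (r / 2) ^ j * Real.exp (-x₀) ^ k)
      (fun j => Continuous.aestronglyMeasurable (by fun_prop))
      (fun j => ae_of_all _ fun y _ => by
        rw [norm_mul, norm_mul, norm_pow, norm_pow, norm_exp_line, Complex.norm_exp, hx₀,
          Real.exp_log (by positivity)]
        simp [mul_assoc])
      (ae_of_all _ fun y _ => hsum.mul_right _) (by simp)
      (ae_of_all _ fun y _ => by
        obtain ⟨h1, h2⟩ := hr _ (hnorm y)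
        have h3 := h1.mul_right (Complex.exp (-(x₀ + y * Complex.I)) ^ k)
        simp only [mul_assoc] at h3
        have h4 : X (x₀ + y * Complex.I) = 1 := (hXV _ h2).eq_of_nhds
        simpa only [h4, one_mul, hh] using h3)
    simp only [intervalIntegral.integral_const_mul, integral_exp_period] at key
    have h5 : (fun j => b j * if j = k then 2 * (Real.pi : ℂ) else 0) =
        fun j => if j = k then 2 * Real.pi * b k else 0 := by
      funext j
      split_ifs with hjk
      · rw [hjk]; ring
      · simp
    rw [h5] at key
    exact key.unique (hasSum_ite_eq k _)
  have hright : ∀ k, ∀ y : ℝ, X (x₁ + y * Complex.I) * h k (x₁ + y * Complex.I) = 0 := by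
    intro k y
    have h1 : Complex.exp (x₁ + y * Complex.I) ∈ U := hBU (Or.inr (by
      change R ≤ ‖_‖
      rw [norm_exp_line, ← Real.exp_log hR0]
      exact Real.exp_le_exp.mpr (le_max_right _ _)))
    rw [(hXU _ h1).eq_of_nhds, zero_mul]
  have hgreen : ∀ k, (∫ x in x₀..x₁, ∫ y in (0 : ℝ)..2 * Real.pi,
      q (x + y * Complex.I) * h k (x + y * Complex.I)) =
      -(2 * Real.pi * Complex.I) * b k := by
    intro k
    have h1 := Complex.integral_boundary_rect_of_differentiableOn_real (fun w => X w * h k w)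
      (x₀ : ℂ) (x₁ + (2 * Real.pi : ℝ) * Complex.I)
      (fun w _ => (hfd k w).1.differentiableWithinAt) (by
        simp only [smul_eq_mul, (hfd k _).2]
        exact (hqh k).continuousOn.integrableOn_compact (isCompact_uIcc.reProdIm isCompact_uIcc))
    simp only [smul_eq_mul, (hfd k _).2] at h1
    have e1 : (x₁ + (2 * Real.pi : ℝ) * Complex.I : ℂ).re = x₁ := by simp
    have e2 : (x₁ + (2 * Real.pi : ℝ) * Complex.I : ℂ).im = 2 * Real.pi := by simp
    rw [e1, e2, Complex.ofReal_re, Complex.ofReal_im] at h1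
    rw [← h1, hleft k]
    simp only [hright k, intervalIntegral.integral_zero]
    have hper : ∀ x : ℝ, X (x + (2 * Real.pi : ℝ) * Complex.I) *
        h k (x + (2 * Real.pi : ℝ) * Complex.I) =
        X (x + (0 : ℝ) * Complex.I) * h k (x + (0 : ℝ) * Complex.I) := fun x => by
      have e3 : Complex.exp (x + (2 * Real.pi : ℝ) * Complex.I) = Complex.exp (x + (0 : ℝ) * Complex.I) := by
        rw [Complex.exp_eq_exp_iff_exists_int]
        exact ⟨1, by push_cast; ring⟩
      simp only [hX, hh, Complex.exp_neg, e3]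
    simp only [hper]
    ring
  set K : Set (ℝ × ℝ) := (Icc x₀ x₁ ×ˢ Icc 0 (2 * Real.pi)) ∩
    {p | Complex.exp (p.1 + p.2 * Complex.I) ∉ U ∪ V} with hK
  have hKclosed : IsClosed {p : ℝ × ℝ | Complex.exp (p.1 + p.2 * Complex.I) ∉ U ∪ V} :=
    (hUo.union hVo).isClosed_compl.preimage (by fun_prop)
  refine ⟨K, fun p => -(1 / (2 * Real.pi * Complex.I)) * (q (p.1 + p.2 * Complex.I) *
    G (Complex.exp (p.1 + p.2 * Complex.I))), fun p => Complex.exp (-(p.1 + p.2 * Complex.I)),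
    (isCompact_Icc.prod isCompact_Icc).inter_right hKclosed, ?_, by fun_prop,
    fun p => Complex.exp_ne_zero _, fun p hp => ?_, fun k => ?_⟩
  · refine continuousOn_const.mul (ContinuousOn.mul (Continuous.continuousOn ?_) ?_)
    · exact hqc.comp (by fun_prop)
    · refine hG.continuousOn.comp (Continuous.continuousOn (by fun_prop)) fun p hp h1 => ?_
      exact hp.2 (Or.inl (hBU (Or.inl h1)))
  · rw [Complex.exp_neg, inv_inv]
    exact fun h1 => hp.2 (Or.inr (hLV h1))
  · have hc : Continuous fun p : ℝ × ℝ => q (p.1 + p.2 * Complex.I) * h k (p.1 + p.2 * Complex.I) :=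
      (hqh k).comp (by fun_prop)
    have h1 : (∫ p in K, q (p.1 + p.2 * Complex.I) * h k (p.1 + p.2 * Complex.I)) =
        ∫ p in Icc x₀ x₁ ×ˢ Icc 0 (2 * Real.pi),
          q (p.1 + p.2 * Complex.I) * h k (p.1 + p.2 * Complex.I) := by
      refine (setIntegral_eq_of_subset_of_forall_sdiff_eq_zero
        (measurableSet_Icc.prod measurableSet_Icc) inter_subset_left fun p hp => ?_).symm
      have h2 : Complex.exp (p.1 + p.2 * Complex.I) ∈ U ∪ V := by
        by_contra h3
        exact hp.2 ⟨hp.1, h3⟩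
      rcases h2 with h2 | h2
      · rw [hqU _ h2, zero_mul]
      · rw [hqV _ h2, zero_mul]
    have h2 := hgreen k
    rw [intervalIntegral.integral_of_le hx, ← integral_Icc_eq_integral_Ioc] at h2
    simp only [intervalIntegral.integral_of_le (show (0 : ℝ) ≤ 2 * Real.pi by positivity),
      ← integral_Icc_eq_integral_Ioc] at h2
    rw [← setIntegral_prod (fun p : ℝ × ℝ => q (p.1 + p.2 * Complex.I) * h k (p.1 + p.2 * Complex.I))
      (hc.continuousOn.integrableOn_compact (isCompact_Icc.prod isCompact_Icc)),
      ← Measure.volume_eq_prod, ← h1] at h2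
    have h3 : ∀ p : ℝ × ℝ, -(1 / (2 * Real.pi * Complex.I)) * (q (p.1 + p.2 * Complex.I) *
        G (Complex.exp (p.1 + p.2 * Complex.I))) * Complex.exp (-(p.1 + p.2 * Complex.I)) ^ k =
        -(1 / (2 * Real.pi * Complex.I)) *
          (q (p.1 + p.2 * Complex.I) * h k (p.1 + p.2 * Complex.I)) := fun p => by
      simp only [hh]; ring
    simp only [h3]
    rw [integral_const_mul, h2]
    have := Complex.two_pi_I_ne_zero
    field_simp

end Representation

/-! ### The Hadamard product on a star domain -/

/-- The complement of `A` is star-shaped with respect to the curve `c`. -/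
def CurveStar (c : ℝ → ℂ) (A : Set ℂ) : Prop :=
  ∀ t ∈ Icc (0 : ℝ) 1, ∀ z, c t * z ∈ A → z ∈ A

theorem isCompact_inv_union {A : Set ℂ} (hA : IsClosed A) (hA0 : (0 : ℂ) ∉ A) :
    IsCompact {u : ℂ | u = 0 ∨ u⁻¹ ∈ A} := by
  obtain ⟨r, hr0, hr⟩ := Metric.isOpen_iff.mp hA.isOpen_compl 0 hA0
  refine (isCompact_closedBall (0 : ℂ) r⁻¹).of_isClosed_subset ?_ ?_
  · rw [← isOpen_compl_iff, isOpen_iff_mem_nhds]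
    intro u hu
    simp only [mem_compl_iff, mem_ofPred_eq, not_or] at hu
    filter_upwards [isOpen_ne.mem_nhds hu.1,
      (continuousAt_inv₀ hu.1).preimage_mem_nhds (hA.isOpen_compl.mem_nhds hu.2)] with w h1 h2
    simp only [mem_compl_iff, mem_ofPred_eq, not_or]
    exact ⟨h1, h2⟩
  · rintro u (rfl | hu)
    · simp [hr0.le]
    · rw [mem_closedBall_zero_iff]
      have h1 : r ≤ ‖u⁻¹‖ := by
        by_contra h
        exact hr (mem_ball_zero_iff.mpr (not_le.mp h)) hu
      rw [norm_inv] at h1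
      exact le_inv_of_le_inv₀ hr0 h1

/-- Hadamard's theorem: the Hadamard product of functions holomorphic off `A` and `B` is
holomorphic off the product set. -/
theorem exists_hadamard {A B : Set ℂ} (hA : IsClosed A) (hA0 : (0 : ℂ) ∉ A) (hB : IsClosed B)
    (hB0 : (0 : ℂ) ∉ B) {c : ℝ → ℂ} (hc : ContinuousOn c (Icc 0 1)) (hc0 : c 0 = 0) (hc1 : c 1 = 1)
    (hst : CurveStar c A) {F G : ℂ → ℂ} (hF : DifferentiableOn ℂ F Aᶜ)
    (hG : DifferentiableOn ℂ G Bᶜ) {a b : ℕ → ℂ} (hFa : HasTaylor a F) (hGb : HasTaylor b G) :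
    ∃ H : ℂ → ℂ, (∀ z, (∀ α ∈ A, ∀ β ∈ B, α * β ≠ z) → AnalyticAt ℂ H z) ∧
      HasTaylor (fun k => a k * b k) H := by
  refine exists_of_forall_curve (D := {z | ∀ α ∈ A, ∀ β ∈ B, α * β ≠ z}) hc hc0 hc1
    (fun α hα β hβ h => ?_) fun z hz => ?_
  · rcases mul_eq_zero.mp h with rfl | rfl
    exacts [hA0 hα, hB0 hβ]
  -- `L` consists of `0` and the quotients `c t * z / α` with `α ∈ A`. If such a quotient were some
  -- `β ∈ B`, then `z` would be `(α / c t) * β`, and `α / c t` lies in `A` because the complement of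
  -- `A` is star-shaped along `c`.
  set L : Set ℂ := (fun q : ℂ × ℂ => q.1 * z * q.2) ''
    ((c '' Icc 0 1) ×ˢ {u : ℂ | u = 0 ∨ u⁻¹ ∈ A}) with hL
  have hLc : IsCompact L := ((isCompact_Icc.image_of_continuousOn hc).prod
    (isCompact_inv_union hA hA0)).image (by fun_prop)
  have hL0 : (0 : ℂ) ∈ L := ⟨(c 0, 0), ⟨⟨0, by simp, rfl⟩, Or.inl rfl⟩, by simp⟩
  have hLB : Disjoint L B := by
    rw [Set.disjoint_left]
    rintro _ ⟨⟨_, u⟩, ⟨⟨t, ht, rfl⟩, hu⟩, rfl⟩ hβ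
    simp only at hβ hu
    rcases hu with rfl | hu
    · exact hB0 (by simpa using hβ)
    · have hne : c t * z * u ≠ 0 := fun h => hB0 (h ▸ hβ)
      have hct : c t ≠ 0 := left_ne_zero_of_mul (left_ne_zero_of_mul hne)
      have hu0 : u ≠ 0 := right_ne_zero_of_mul hne
      refine hz ((c t)⁻¹ * u⁻¹) (hst t ht _ ?_) _ hβ ?_
      · rwa [mul_inv_cancel_left₀ hct]
      · field_simp
  obtain ⟨K, m, v, hrep⟩ := exists_isCycleRep hLc hL0 hB hLB hG hGb
  obtain ⟨Q, O, hO, h1, h2, h3⟩ := hrep.exists_hadamard hA hA0 hF hFa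
  refine ⟨Q, O, hO, fun t ht => h1 _ fun α hα => ?_, h2, h3⟩
  exact ⟨(c t, α⁻¹), ⟨⟨t, ht, rfl⟩, Or.inr (by rwa [inv_inv])⟩, by simp [div_eq_mul_inv]⟩

/-! ### Closed discrete sets -/

section Discrete

variable {S : Set ℂ}

theorem exists_isolated (hS : ∀ R : ℝ, (S ∩ closedBall 0 R).Finite) (p : ℂ) :
    ∃ r > 0, ∀ α ∈ S, α ≠ p → r ≤ dist α p := by
  have h1 : ((S ∩ closedBall 0 (‖p‖ + 1)) \ {p}).Finite := (hS _).subset sdiff_subset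
  obtain ⟨r, hr0, hr⟩ := Metric.isOpen_iff.mp h1.isClosed.isOpen_compl p (by simp)
  refine ⟨min r 1, by positivity, fun α hα hne => ?_⟩
  by_contra! hlt
  refine hr (mem_ball.mpr (hlt.trans_le (min_le_left _ _))) ⟨⟨hα, ?_⟩, hne⟩
  rw [mem_closedBall_zero_iff]
  have h2 := norm_le_norm_add_norm_sub p α
  rw [dist_eq_norm, norm_sub_rev] at hlt
  have h3 := hlt.trans_le (min_le_right _ _)
  linarith

theorem isClosed_of_finite_inter (hS : ∀ R : ℝ, (S ∩ closedBall 0 R).Finite) : IsClosed S := by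
  rw [← isOpen_compl_iff, Metric.isOpen_iff]
  intro p hp
  obtain ⟨r, hr0, hr⟩ := exists_isolated hS p
  refine ⟨r, hr0, fun z hz hzS => ?_⟩
  have := hr z hzS fun h => hp (h ▸ hzS)
  exact absurd (mem_ball.mp hz) (not_lt.mpr this)

theorem isOpen_starDomain (hS : IsClosed S) : IsOpen (starDomain S) := by
  rw [isOpen_iff_mem_nhds]
  intro z hz
  refine isCompact_Icc.eventually_forall_of_forall_eventually (x₀ := z)
    (P := fun w t => ((t : ℝ) : ℂ) * w ∉ S) fun t ht => ?_
  have hcont : Continuous fun q : ℂ × ℝ => (q.2 : ℂ) * q.1 := by fun_prop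
  have h1 : Tendsto (fun q : ℂ × ℝ => (q.2 : ℂ) * q.1) (𝓝 (z, t)) (𝓝 ((t : ℂ) * z)) :=
    hcont.tendsto (z, t)
  exact h1.eventually (hS.isOpen_compl.mem_nhds (hz t ht))

theorem exists_norm_lower_bound (hS : ∀ R : ℝ, (S ∩ closedBall 0 R).Finite) (h0 : (0 : ℂ) ∉ S) :
    ∃ r > 0, ∀ α ∈ S, r ≤ ‖α‖ := by
  obtain ⟨r, hr0, hr⟩ := exists_isolated hS 0
  exact ⟨r, hr0, fun α hα => by simpa using hr α hα fun h => h0 (h ▸ hα)⟩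

end Discrete

/-! ### Gluing along a ray -/

section Ray

variable {σ : ℝ}

/-- Two discs centred on the real axis that meet have a convex intersection which reaches the half
plane `σ Im > 0`; there both local functions equal `p`, hence they agree on the whole intersection.
-/
theorem exists_glue_real (hσ : σ = 1 ∨ σ = -1) {I : Set ℝ} {r : ℝ → ℝ} {q : ℝ → ℂ → ℂ} {p : ℂ → ℂ}
    (h1 : ∀ x ∈ I, ∀ x' ∈ I, x ≠ x' →
      AnalyticOnNhd ℂ (q x) (ball (x : ℂ) (r x) ∩ ball (x' : ℂ) (r x')))
    (h2 : ∀ x ∈ I, ∀ Z ∈ ball (x : ℂ) (r x), 0 < σ * Z.im → q x Z = p Z) :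
    ∃ Q : ℂ → ℂ, ∀ x ∈ I, EqOn Q (q x) (ball (x : ℂ) (r x)) := by
  classical
  have hcons : ∀ x ∈ I, ∀ x' ∈ I, ∀ Z ∈ ball (x : ℂ) (r x) ∩ ball (x' : ℂ) (r x'),
      q x Z = q x' Z := by
    intro x hx x' hx' Z hZ
    by_cases hne : x = x'
    · rw [hne]
    set O := ball (x : ℂ) (r x) ∩ ball (x' : ℂ) (r x') with hO
    have hOo : IsOpen O := isOpen_ball.inter isOpen_ball
    have hproj : ∀ y : ℝ, dist (Z.re : ℂ) y ≤ dist Z y := fun y => by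
      rw [dist_eq_norm, dist_eq_norm, ← Complex.ofReal_sub, Complex.norm_real, Real.norm_eq_abs]
      simpa using Complex.abs_re_le_norm (Z - y)
    have hre : (Z.re : ℂ) ∈ O := ⟨(hproj x).trans_lt hZ.1, (hproj x').trans_lt hZ.2⟩
    have hcont : Continuous fun δ : ℝ => (Z.re : ℂ) + (σ * δ : ℝ) * Complex.I := by fun_prop
    have hev : ∀ᶠ δ : ℝ in 𝓝[>] 0, (Z.re : ℂ) + (σ * δ : ℝ) * Complex.I ∈ O :=
      nhdsWithin_le_nhds (hcont.continuousAt.eventually (hOo.mem_nhds (by simpa using hre)))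
    obtain ⟨δ, hδO, hδ0⟩ := (hev.and self_mem_nhdsWithin).exists
    set z₁ := (Z.re : ℂ) + (σ * δ : ℝ) * Complex.I with hz₁
    have him : 0 < σ * z₁.im := by
      have : 0 < δ := hδ0
      rcases hσ with rfl | rfl <;> simp [hz₁, this]
    have hpos : IsOpen {Z : ℂ | 0 < σ * Z.im} := isOpen_lt continuous_const (by fun_prop)
    have heq : q x =ᶠ[𝓝 z₁] q x' := by
      filter_upwards [hOo.mem_nhds hδO, hpos.mem_nhds him] with Y h3 h4
      rw [h2 x hx Y h3.1 h4, h2 x' hx' Y h3.2 h4]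
    exact (h1 x hx x' hx' hne).eqOn_of_preconnected_of_eventuallyEq
      (by rw [inter_comm]; exact h1 x' hx' x hx (Ne.symm hne))
      ((convex_ball _ _).inter (convex_ball _ _)).isPreconnected hδO heq hZ
  refine ⟨fun Z => if h : ∃ x ∈ I, Z ∈ ball (x : ℂ) (r x) then q h.choose Z else 0,
    fun x hx Z hZ => ?_⟩
  have hex : ∃ x ∈ I, Z ∈ ball (x : ℂ) (r x) := ⟨x, hx, hZ⟩
  simp only [hex, dif_pos]
  exact hcons _ hex.choose_spec.1 x hx Z ⟨hex.choose_spec.2, hZ⟩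

/-- The branch of the logarithm with cut `{r i σ : r ≥ 0}`. -/
noncomputable def sideLog (σ : ℝ) (v : ℂ) : ℂ :=
  Complex.log (Complex.I * σ * v) - Complex.I * σ * (Real.pi / 2)

theorem exp_side (hσ : σ = 1 ∨ σ = -1) :
    Complex.exp (Complex.I * σ * (Real.pi / 2)) = Complex.I * σ := by
  rcases hσ with rfl | rfl
  · rw [Complex.ofReal_one, mul_one, mul_comm, Complex.exp_pi_div_two_mul_I]
  · rw [Complex.ofReal_neg, Complex.ofReal_one,
      show Complex.I * -1 * (Real.pi / 2) = -(Real.pi / 2 * Complex.I) by ring, Complex.exp_neg,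
      Complex.exp_pi_div_two_mul_I]
    simp

theorem sideLog_eq_log (hσ : σ = 1 ∨ σ = -1) {v : ℂ} (hv : σ * v.im < 0 ∨ 0 < v.re) :
    sideLog σ v = Complex.log v := by
  have hv0 : v ≠ 0 := by
    rintro rfl
    simp at hv
  have hpi := Real.pi_pos
  have h1 : Complex.I * σ * v =
      Complex.exp (Complex.log v + Complex.I * σ * (Real.pi / 2)) := by
    rw [Complex.exp_add, Complex.exp_log hv0, exp_side hσ, mul_comm]
  have him : (Complex.log v + Complex.I * σ * (Real.pi / 2)).im = v.arg + σ * (Real.pi / 2) := by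
    rw [Complex.add_im, Complex.log_im]
    simp [Complex.mul_im, Complex.mul_re]
  have hr : -Real.pi < v.arg + σ * (Real.pi / 2) ∧ v.arg + σ * (Real.pi / 2) ≤ Real.pi := by
    have h2 := Complex.neg_pi_lt_arg v
    have h3 := Complex.arg_le_pi v
    rcases hv with hv | hv
    · rcases hσ with rfl | rfl
      · have := Complex.arg_neg_iff.mpr (by linarith : v.im < 0)
        constructor <;> linarith
      · have := Complex.arg_nonneg_iff.mpr (by linarith : 0 ≤ v.im)
        constructor <;> linarith
    · have h4 := abs_lt.mp (Complex.abs_arg_lt_pi_div_two_iff.mpr (Or.inl hv))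
      rcases hσ with rfl | rfl <;> constructor <;> linarith
  rw [sideLog, h1, Complex.log_exp (by rw [him]; exact hr.1) (by rw [him]; exact hr.2)]
  ring

theorem sideLog_re (hσ : σ = 1 ∨ σ = -1) (v : ℂ) : (sideLog σ v).re = Real.log ‖v‖ := by
  rw [sideLog, Complex.sub_re, Complex.log_re]
  have h1 : ‖Complex.I * σ * v‖ = ‖v‖ := by
    rw [norm_mul, norm_mul, Complex.norm_I, Complex.norm_real]
    rcases hσ with rfl | rfl <;> simp
  rw [h1]
  simp [Complex.mul_re, Complex.mul_im]

theorem analyticAt_sideLog (hσ : σ = 1 ∨ σ = -1) {v : ℂ} (hv : v.re = 0 → σ * v.im < 0) :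
    AnalyticAt ℂ (sideLog σ) v := by
  have hm : Complex.I * σ * v ∈ Complex.slitPlane := by
    rw [Complex.mem_slitPlane_iff]
    have e1 : (Complex.I * σ * v).re = -(σ * v.im) := by simp [Complex.mul_re, Complex.mul_im]
    have e2 : (Complex.I * σ * v).im = σ * v.re := by simp [Complex.mul_re, Complex.mul_im]
    rw [e1, e2]
    by_cases h : v.re = 0
    · exact Or.inl (by linarith [hv h])
    · refine Or.inr (mul_ne_zero ?_ h)
      rcases hσ with rfl | rfl <;> norm_num
  unfold sideLog
  exact (((analyticAt_const.mul analyticAt_id).clog hm)).sub analyticAt_const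

/-- The determination on the side `σ` crosses the ray everywhere: at a point of `S` through its
local branch, written with the logarithm `sideLog`, elsewhere by `ExtendsAt`. Each point of `S` then
only leaves a cut perpendicular to the ray, on the opposite side. Compactness of the segment gives a
uniform width `δ`. -/
theorem exists_ray_extension {s : ℤˣ} {F : PowerSeries ℂ} {S : Set ℂ} {P : ℂ → ℂ} {f : ℂ → ℂ → ℂ}
    (hF : HasIsolatedSingularities s F S P f) (hσ : (((s : ℤ) : ℝ)) = σ) {u : ℂ} (hu : u ≠ 0)
    {r₀ R : ℝ} (hr₀ : 0 < r₀) :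
    ∃ (Q : ℂ → ℂ) (δ : ℝ), 0 < δ ∧
      (∀ Z : ℂ, Z.re ∈ Icc r₀ R → |Z.im| < δ → (u * Z.re ∈ S → 0 < σ * Z.im) →
        AnalyticAt ℂ Q (u * Z)) ∧
      (∀ Z : ℂ, Z.re ∈ Icc r₀ R → |Z.im| < δ → 0 < σ * Z.im → Q (u * Z) = P (u * Z)) ∧
      ∀ x ∈ Icc r₀ R, u * x ∈ S → ∃ η > 0, ∀ Z ∈ ball (x : ℂ) η, Z.re < x →
        Q (u * Z) = f (u * x) (Complex.log (1 - Z / x)) := by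
  have hσ' : σ = 1 ∨ σ = -1 := by
    rcases Int.units_eq_one_or s with rfl | rfl
    · left; simpa using hσ.symm
    · right; simpa using hσ.symm
  have hloc : ∀ x ∈ Icc r₀ R, ∃ (r : ℝ) (q : ℂ → ℂ), 0 < r ∧
      (∀ y : ℝ, u * y ∈ S → y ≠ x → r ≤ |y - x|) ∧
      (∀ Z ∈ ball (x : ℂ) r, 0 < σ * Z.im → q Z = P (u * Z)) ∧
      (∀ Z ∈ ball (x : ℂ) r, (u * x ∈ S → Z.re = x → 0 < σ * Z.im) → AnalyticAt ℂ q Z) ∧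
      (u * x ∈ S → ∀ Z ∈ ball (x : ℂ) r, Z.re < x → q Z = f (u * x) (Complex.log (1 - Z / x))) := by
    intro x hx
    have hx0 : 0 < x := hr₀.trans_le hx.1
    have hxc : (x : ℂ) ≠ 0 := by exact_mod_cast hx0.ne'
    obtain ⟨r₁, hr₁, hiso⟩ := exists_isolated hF.finite_inter (u * x)
    have hiso' : ∀ y : ℝ, u * y ∈ S → y ≠ x → r₁ / ‖u‖ ≤ |y - x| := fun y hy hne => by
      have h1 := hiso _ hy fun h => hne (by
        have := mul_left_cancel₀ hu h
        exact_mod_cast this)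
      rw [dist_eq_norm, ← mul_sub, norm_mul, ← Complex.ofReal_sub, Complex.norm_real,
        Real.norm_eq_abs] at h1
      rwa [div_le_iff₀' (norm_pos_iff.mpr hu)]
    have hr₁' : 0 < r₁ / ‖u‖ := div_pos hr₁ (norm_pos_iff.mpr hu)
    by_cases hxS : u * x ∈ S
    · obtain ⟨ρ, hfd, hfP⟩ := hF.localBranch _ hxS
      set r := min (r₁ / ‖u‖) (x * Real.exp ρ) with hr
      have hre : ∀ Z ∈ ball (x : ℂ) r, Z ≠ x → Real.log ‖1 - Z / x‖ < ρ := fun Z hZ hne => by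
        have h1 : 1 - Z / x = -(Z - x) / x := by field_simp; ring
        have h2 : ‖1 - Z / x‖ < Real.exp ρ := by
          rw [h1, norm_div, norm_neg, Complex.norm_real, Real.norm_of_nonneg hx0.le,
            div_lt_iff₀' hx0, ← dist_eq_norm]
          exact (mem_ball.mp hZ).trans_le (min_le_right _ _)
        rw [Real.log_lt_iff_lt_exp]
        · exact h2
        · rw [h1, norm_pos_iff]
          exact div_ne_zero (neg_ne_zero.mpr (sub_ne_zero.mpr hne)) hxc
      have him : ∀ Z : ℂ, (1 - Z / x).im = -(Z.im / x) := fun Z => by simp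
      have hre' : ∀ Z : ℂ, (1 - Z / x).re = (x - Z.re) / x := fun Z => by
        have : (1 - Z / x).re = 1 - Z.re / x := by simp
        rw [this]; field_simp
      refine ⟨r, fun Z => f (u * x) (sideLog σ (1 - Z / x)), by positivity, fun y hy hne =>
        (min_le_left _ _).trans (hiso' y hy hne), fun Z hZ hZσ => ?_, fun Z hZ hZc => ?_,
        fun _ Z hZ hlt => ?_⟩
      · have hne : Z ≠ x := by rintro rfl; simp at hZσ
        have h1 : σ * (1 - Z / x).im < 0 := by
          rw [him, mul_neg, neg_lt_zero, ← mul_div_assoc]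
          exact div_pos hZσ hx0
        have hv0 : 1 - Z / x ≠ 0 := by rintro h0; rw [h0] at h1; simp at h1
        have hch : chart (u * x) (Complex.log (1 - Z / x)) = u * Z := by
          rw [chart, Complex.exp_log hv0]; field_simp; ring
        change f (u * x) (sideLog σ (1 - Z / x)) = P (u * Z)
        rw [sideLog_eq_log hσ' (Or.inl h1), ← hch]
        refine (hfP _ ?_ ?_ ?_).symm
        · rw [Complex.log_re]; exact hre Z hZ hne
        · rw [Complex.log_im, abs_lt]
          refine ⟨Complex.neg_pi_lt_arg _, (Complex.arg_le_pi _).lt_of_ne fun h => ?_⟩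
          have := (Complex.arg_eq_pi_iff.mp h).2
          rw [this] at h1; simp at h1
        · rw [hch, hσ, show u * Z / (u * x) = Z / x by field_simp, Complex.div_ofReal_im]
          rw [← mul_div_assoc]
          exact div_pos hZσ hx0
      · have hne : Z ≠ x := by
          rintro rfl
          have := hZc hxS (by simp)
          simp at this
        have hzero : (1 - Z / x).re = 0 → σ * (1 - Z / x).im < 0 := fun h0 => by
          rw [hre', div_eq_zero_iff] at h0
          have h1 : Z.re = x := by
            rcases h0 with h0 | h0
            · linarith
            · exact absurd h0 hx0.ne'
          rw [him, mul_neg, neg_lt_zero, ← mul_div_assoc]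
          exact div_pos (hZc hxS h1) hx0
        have h3 := analyticAt_sideLog hσ' hzero
        have h4 : AnalyticAt ℂ (f (u * x)) (sideLog σ (1 - Z / x)) :=
          hfd.analyticAt ((isOpen_halfPlane ρ).mem_nhds (by
            change (sideLog σ (1 - Z / x)).re < ρ
            rw [sideLog_re hσ']; exact hre Z hZ hne))
        have h5 : AnalyticAt ℂ (fun Z : ℂ => 1 - Z / x) Z := by fun_prop (disch := exact hxc)
        exact (AnalyticAt.fun_comp (g := f (u * x)) (f := sideLog σ) h4 h3).fun_comp
          (f := fun Z : ℂ => 1 - Z / x) h5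
      · change f (u * x) (sideLog σ (1 - Z / x)) = _
        rw [sideLog_eq_log hσ' (Or.inr (by rw [hre']; exact div_pos (by linarith) hx0))]
    · obtain ⟨q, hq, hqP⟩ := hF.extendsAt (u * x) (mul_ne_zero hu hxc) hxS
      have hcont : Continuous fun Z : ℂ => u * Z := by fun_prop
      obtain ⟨r₂, hr₂, h2⟩ := Metric.eventually_nhds_iff_ball.mp
        ((hcont.tendsto (x : ℂ)).eventually (hq.eventually_analyticAt.and hqP))
      refine ⟨min (r₁ / ‖u‖) r₂, fun Z => q (u * Z), by positivity, fun y hy hne =>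
        (min_le_left _ _).trans (hiso' y hy hne), fun Z hZ hZσ => ?_, fun Z hZ _ => ?_,
        fun h => absurd h hxS⟩
      · refine ((h2 Z (ball_subset_ball (min_le_right _ _) hZ)).2 ?_).symm
        rw [hσ, show u * Z / (u * x) = Z / x by field_simp, Complex.div_ofReal_im, ← mul_div_assoc]
        exact div_pos hZσ hx0
      · exact (h2 Z (ball_subset_ball (min_le_right _ _) hZ)).1.fun_comp (by fun_prop)
  choose! r q hr0 hriso hqP hqA hqf using hloc
  obtain ⟨Q, hQ⟩ := exists_glue_real (I := Icc r₀ R) (r := r) (q := q) (p := fun Z => P (u * Z)) hσ'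
    (fun x hx x' hx' hne Z hZ => hqA x hx Z hZ.1 fun hxS hre => by
      have h1 := hriso x' hx' x hxS hne
      have h2 := hZ.2
      rw [mem_ball, dist_eq_norm] at h2
      have h3 := Complex.abs_re_le_norm (Z - x')
      rw [Complex.sub_re, Complex.ofReal_re, hre] at h3
      linarith) fun x hx Z hZ hZσ => hqP x hx Z hZ hZσ
  have hQA : ∀ x ∈ Icc r₀ R, ∀ Z ∈ ball (x : ℂ) (r x), (u * x ∈ S → Z.re = x → 0 < σ * Z.im) →
      AnalyticAt ℂ Q Z := fun x hx Z hZ h =>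
    (hqA x hx Z hZ h).congr ((hQ x hx).eventuallyEq_of_mem (isOpen_ball.mem_nhds hZ)).symm
  have hK : IsCompact ((fun x : ℝ => (x : ℂ)) '' Icc r₀ R) :=
    isCompact_Icc.image Complex.continuous_ofReal
  obtain ⟨δ, hδ0, hδ⟩ := hK.exists_thickening_subset_open
    (t := ⋃ x ∈ Icc r₀ R, ball (x : ℂ) (r x)) (isOpen_biUnion fun _ _ => isOpen_ball) (by
      rintro _ ⟨x, hx, rfl⟩
      exact mem_biUnion hx (mem_ball_self (hr0 x hx)))
  have hmem : ∀ Z : ℂ, Z.re ∈ Icc r₀ R → |Z.im| < δ → ∃ x ∈ Icc r₀ R, Z ∈ ball (x : ℂ) (r x) := by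
    intro Z h1 h2
    have := hδ (mem_thickening_iff.mpr ⟨(Z.re : ℂ), ⟨Z.re, h1, rfl⟩, by
      have e : Z - (Z.re : ℂ) = (Z.im : ℂ) * Complex.I := by apply Complex.ext <;> simp
      rw [dist_eq_norm, e, norm_mul, Complex.norm_I, mul_one, Complex.norm_real]
      exact h2⟩)
    simpa using this
  refine ⟨fun z => Q (z / u), δ, hδ0, fun Z h1 h2 h3 => ?_, fun Z h1 h2 h3 => ?_, fun x hx hxS => ?_⟩
  · obtain ⟨x, hx, hZ⟩ := hmem Z h1 h2
    have h4 : AnalyticAt ℂ Q (u * Z / u) := by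
      rw [mul_div_cancel_left₀ _ hu]
      exact hQA x hx Z hZ fun hxS he => h3 (by rwa [he])
    exact AnalyticAt.fun_comp (g := Q) (f := fun z => z / u) h4 (by fun_prop (disch := exact hu))
  · obtain ⟨x, hx, hZ⟩ := hmem Z h1 h2
    change Q (u * Z / u) = _
    rw [mul_div_cancel_left₀ _ hu, hQ x hx hZ, hqP x hx Z hZ h3]
  · refine ⟨r x, hr0 x hx, fun Z hZ hlt => ?_⟩
    change Q (u * Z / u) = _
    rw [mul_div_cancel_left₀ _ hu, hQ x hx hZ, hqf x hx hxS Z hZ hlt]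

end Ray

/-! ### Bent cuts -/

section Bent

variable {σ ε R : ℝ} {S : Set ℂ}

/-- Logarithms of the points of the bent cut starting at `1`. -/
def cutLog (σ ε : ℝ) : Set ℂ :=
  {w | 0 ≤ w.re ∧ σ * w.im ≤ 0 ∧ -ε ≤ σ * w.im + ε ^ 2 * w.re ∧ σ * w.im + ε ^ 2 * w.re ≤ ε ^ 3}

/-- Cuts from the points of `S` of modulus `< R` to the circle of radius `R`: they follow the ray
for a while and are then bent away from the side `σ`. -/
def bentCuts (σ ε R : ℝ) (S : Set ℂ) : Set ℂ :=
  {z | R ≤ ‖z‖ ∨ ∃ α ∈ S, ‖α‖ < R ∧ ∃ w ∈ cutLog σ ε, z = α * Complex.exp w}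

/-- The logarithmic spiral `t ^ (1 - i σ ε ^ 2)`. -/
noncomputable def spiral (σ ε : ℝ) (t : ℝ) : ℂ := (t : ℂ) ^ (1 - (σ * ε ^ 2 : ℝ) * Complex.I)

theorem isClosed_cutLog (σ ε : ℝ) : IsClosed (cutLog σ ε) := by
  have e : IsClosed ({w : ℂ | 0 ≤ w.re} ∩ ({w : ℂ | σ * w.im ≤ 0} ∩
      ({w : ℂ | -ε ≤ σ * w.im + ε ^ 2 * w.re} ∩ {w : ℂ | σ * w.im + ε ^ 2 * w.re ≤ ε ^ 3}))) := ?_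
  · exact e
  refine IsClosed.inter ?_ (IsClosed.inter ?_ (IsClosed.inter ?_ ?_))
  · exact isClosed_le continuous_const (by fun_prop)
  · exact isClosed_le (by fun_prop) continuous_const
  · exact isClosed_le continuous_const (by fun_prop)
  · exact isClosed_le (by fun_prop) continuous_const

theorem one_sub_mul_I_re (κ : ℝ) : (1 - (κ : ℂ) * Complex.I).re = 1 := by simp

theorem one_sub_mul_I_im (κ : ℝ) : (1 - (κ : ℂ) * Complex.I).im = -κ := by simp

theorem continuous_spiral (σ ε : ℝ) : Continuous (spiral σ ε) :=
  Complex.continuous_ofReal_cpow_const (by rw [one_sub_mul_I_re]; exact one_pos)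

theorem spiral_exponent_ne_zero (σ ε : ℝ) : (1 - (σ * ε ^ 2 : ℝ) * Complex.I : ℂ) ≠ 0 := fun h => by
  have := congrArg Complex.re h
  rw [one_sub_mul_I_re] at this
  exact one_ne_zero this

theorem spiral_zero (σ ε : ℝ) : spiral σ ε 0 = 0 := by
  rw [spiral, Complex.ofReal_zero, Complex.zero_cpow (spiral_exponent_ne_zero σ ε)]

theorem spiral_one (σ ε : ℝ) : spiral σ ε 1 = 1 := by simp [spiral]

theorem spiral_eq_exp (σ ε : ℝ) {t : ℝ} (ht : 0 < t) : spiral σ ε t =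
    Complex.exp ((Real.log t : ℂ) * (1 - (σ * ε ^ 2 : ℝ) * Complex.I)) := by
  rw [spiral, Complex.cpow_def_of_ne_zero (by exact_mod_cast ht.ne'), Complex.ofReal_log ht.le]

theorem zero_notMem_bentCuts (hR : 0 < R) (h0 : (0 : ℂ) ∉ S) : (0 : ℂ) ∉ bentCuts σ ε R S := by
  rintro (h | ⟨α, hα, -, w, -, h⟩)
  · rw [norm_zero] at h; linarith
  · rcases mul_eq_zero.mp h.symm with h | h
    · exact h0 (h ▸ hα)
    · exact Complex.exp_ne_zero w h

theorem norm_mul_exp (α w : ℂ) : ‖α * Complex.exp w‖ = ‖α‖ * Real.exp w.re := by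
  rw [norm_mul, Complex.norm_exp]

/-- Dividing by the spiral adds `x (1 - i σ ε²)` with `x ≥ 0` to the logarithm. This leaves `σ Im w
+ ε² Re w` unchanged, increases `Re w` and decreases `σ Im w`, so `cutLog` is mapped into itself. -/
theorem curveStar_bentCuts (hσ : σ = 1 ∨ σ = -1) (hR : 0 < R) (h0 : (0 : ℂ) ∉ S) :
    CurveStar (spiral σ ε) (bentCuts σ ε R S) := by
  intro t ht z hz
  rcases ht.1.eq_or_lt with rfl | ht0
  · rw [spiral_zero, zero_mul] at hz
    exact absurd hz (zero_notMem_bentCuts hR h0)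
  have hx : 0 ≤ -Real.log t := neg_nonneg.mpr (Real.log_nonpos ht.1 ht.2)
  set x := -Real.log t with hxdef
  have hzx : z = spiral σ ε t * z * Complex.exp (x * (1 - (σ * ε ^ 2 : ℝ) * Complex.I)) := by
    rw [spiral_eq_exp σ ε ht0, mul_right_comm, ← Complex.exp_add, hxdef]
    push_cast
    rw [neg_mul, add_neg_cancel, Complex.exp_zero, one_mul]
  have hre : (x * (1 - (σ * ε ^ 2 : ℝ) * Complex.I) : ℂ).re = x := by
    rw [Complex.re_ofReal_mul, one_sub_mul_I_re, mul_one]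
  have him : (x * (1 - (σ * ε ^ 2 : ℝ) * Complex.I) : ℂ).im = -(x * (σ * ε ^ 2)) := by
    rw [Complex.im_ofReal_mul, one_sub_mul_I_im, mul_neg]
  have hσ2 : σ * σ = 1 := by rcases hσ with rfl | rfl <;> norm_num
  rcases hz with hz | ⟨α, hα, hαR, w, hw, hz⟩
  · left
    rw [hzx, norm_mul_exp, hre]
    exact hz.trans (le_mul_of_one_le_right (norm_nonneg _) (Real.one_le_exp hx))
  · right
    refine ⟨α, hα, hαR, w + x * (1 - (σ * ε ^ 2 : ℝ) * Complex.I), ?_, ?_⟩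
    · obtain ⟨h1, h2, h3, h4⟩ := hw
      have e : σ * (w.im + -(x * (σ * ε ^ 2))) = σ * w.im - x * ε ^ 2 := by
        linear_combination (-(x * ε ^ 2)) * hσ2
      have h5 : 0 ≤ x * ε ^ 2 := by positivity
      simp only [cutLog, mem_ofPred_eq, Complex.add_re, Complex.add_im, hre, him, e]
      refine ⟨by linarith, by linarith, ?_, ?_⟩ <;> linarith
    · rw [hzx, hz, Complex.exp_add, mul_assoc]

theorem re_le_of_norm_lt {r : ℝ} (hr : 0 < r) {α w : ℂ} (hα : r ≤ ‖α‖)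
    (h : ‖α * Complex.exp w‖ < R) : w.re < Real.log (R / r) := by
  rw [norm_mul_exp] at h
  have hR : 0 < R := lt_of_le_of_lt (by positivity) h
  rw [Real.lt_log_iff_exp_lt (by positivity), lt_div_iff₀ hr]
  have := mul_le_mul_of_nonneg_right hα (Real.exp_pos w.re).le
  linarith

theorem isCompact_rectangle (a b c d : ℝ) :
    IsCompact {w : ℂ | (a ≤ w.re ∧ w.re ≤ b) ∧ c ≤ w.im ∧ w.im ≤ d} := by
  have : {w : ℂ | (a ≤ w.re ∧ w.re ≤ b) ∧ c ≤ w.im ∧ w.im ≤ d} = Icc a b ×ℂ Icc c d := by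
    ext w; simp [Complex.mem_reProdIm]
  rw [this]
  exact isCompact_Icc.reProdIm isCompact_Icc

theorem abs_im_of_side (hσ : σ = 1 ∨ σ = -1) (w : ℂ) : |w.im| = |σ * w.im| := by
  rcases hσ with rfl | rfl <;> simp

theorem finite_inter_ball (hS : ∀ R : ℝ, (S ∩ closedBall 0 R).Finite) (R : ℝ) :
    {α ∈ S | ‖α‖ < R}.Finite :=
  (hS R).subset fun α h => ⟨h.1, by simpa using h.2.le⟩

theorem isClosed_bentCuts (hσ : σ = 1 ∨ σ = -1) (hS : ∀ R : ℝ, (S ∩ closedBall 0 R).Finite)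
    (h0 : (0 : ℂ) ∉ S) : IsClosed (bentCuts σ ε R S) := by
  obtain ⟨r, hr, hrS⟩ := exists_norm_lower_bound hS h0
  set X := Real.log (R / r) with hX
  set C : Set ℂ := cutLog σ ε ∩ {w : ℂ | (0 ≤ w.re ∧ w.re ≤ X) ∧
    -(ε + ε ^ 2 * |X| + |ε ^ 3|) ≤ w.im ∧ w.im ≤ ε + ε ^ 2 * |X| + |ε ^ 3|} with hC
  have hCc : IsCompact C := (isCompact_rectangle _ _ _ _).inter_left (isClosed_cutLog σ ε)
  have e : bentCuts σ ε R S = {z | R ≤ ‖z‖} ∪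
      ⋃ α ∈ {α ∈ S | ‖α‖ < R}, (fun w => α * Complex.exp w) '' C := by
    ext z
    simp only [bentCuts, mem_ofPred_eq, mem_union, mem_iUnion, mem_image, exists_prop]
    constructor
    · rintro (h | ⟨α, hα, hαR, w, hw, rfl⟩)
      · exact Or.inl h
      · rcases le_or_gt R ‖α * Complex.exp w‖ with h | h
        · exact Or.inl h
        · have h1 := re_le_of_norm_lt hr (hrS α hα) h
          obtain ⟨h2, h3, h4, h5⟩ := hw
          have h6 : ε ^ 2 * w.re ≤ ε ^ 2 * |X| :=
            mul_le_mul_of_nonneg_left (h1.le.trans (le_abs_self X)) (sq_nonneg ε)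
          have h7 : |w.im| ≤ ε + ε ^ 2 * |X| := by
            rw [abs_im_of_side hσ, abs_of_nonpos h3]; linarith
          have h8 := abs_le.mp h7
          have h9 := abs_nonneg (ε ^ 3)
          exact Or.inr ⟨α, ⟨hα, hαR⟩, w, ⟨⟨h2, h3, h4, h5⟩, ⟨h2, h1.le⟩, by linarith, by linarith⟩, rfl⟩
    · rintro (h | ⟨α, ⟨hα, hαR⟩, w, hw, rfl⟩)
      · exact Or.inl h
      · exact Or.inr ⟨α, hα, hαR, w, hw.1, rfl⟩
  rw [e]
  refine (isClosed_le continuous_const continuous_norm).union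
    ((finite_inter_ball hS R).isClosed_biUnion fun α _ => ?_)
  exact (hCc.image (by fun_prop)).isClosed

/-- The complex number `c` is not close to, but different from, a real number or `1` at scale `ε`
in logarithmic coordinates. -/
def Gap (ε : ℝ) (c : ℂ) : Prop :=
  ∀ w : ℂ, Complex.exp w = c → |w.im| ≤ 4 * ε → w.im = 0 ∧ (|w.re| ≤ 4 * ε → w.re = 0)

/-- A logarithm with small imaginary part is the principal one, a fixed number whose coordinates
either vanish or exceed `4 ε` for small `ε`. -/
theorem eventually_gap (c : ℂ) : ∀ᶠ ε in 𝓝[>] (0 : ℝ), Gap ε c := by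
  have key : ∀ x : ℝ, ∀ᶠ ε in 𝓝[>] (0 : ℝ), |x| ≤ 4 * ε → x = 0 := fun x => by
    by_cases hx : x = 0
    · simp [hx]
    · have hx' : 0 < |x| / 4 := by positivity
      filter_upwards [Ioo_mem_nhdsGT hx'] with ε hε h
      linarith [hε.2]
  have hpi : 0 < Real.pi / 4 := by positivity
  filter_upwards [key (Complex.log c).im, key (Complex.log c).re, Ioo_mem_nhdsGT hpi]
    with ε h1 h2 h3 w hw him
  have h4 : Complex.log c = w := by
    rw [← hw]
    have := abs_le.mp him
    exact Complex.log_exp (by linarith [h3.2]) (by linarith [h3.2])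
  rw [h4] at h1 h2
  exact ⟨h1 him, h2⟩

theorem eventually_gap_finite {Φ : Set ℂ} (hΦ : Φ.Finite) :
    ∀ᶠ ε in 𝓝[>] (0 : ℝ), ∀ α ∈ Φ, ∀ β ∈ Φ, Gap ε (β / α) := by
  rw [eventually_all_finite hΦ]
  intro α _
  rw [eventually_all_finite hΦ]
  exact fun β _ => eventually_gap _

end Bent

/-! ### The branch on the complement of the bent cuts. -/

section Extension

variable {σ ε R r : ℝ} {S : Set ℂ} {δ : ℂ → ℝ}

/-- The direction of `α`. -/
noncomputable def rayDir (α : ℂ) : ℂ := α / (‖α‖ : ℂ)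

theorem rayDir_mul_norm {α : ℂ} (hα : α ≠ 0) : rayDir α * (‖α‖ : ℂ) = α :=
  div_mul_cancel₀ _ (by exact_mod_cast (norm_pos_iff.mpr hα).ne')

theorem rayDir_ne_zero {α : ℂ} (hα : α ≠ 0) : rayDir α ≠ 0 :=
  div_ne_zero hα (by exact_mod_cast (norm_pos_iff.mpr hα).ne')

theorem norm_rayDir {α : ℂ} (hα : α ≠ 0) : ‖rayDir α‖ = 1 := by
  rw [rayDir, norm_div, Complex.norm_real, norm_norm, div_self (norm_pos_iff.mpr hα).ne']

theorem rayDir_mul_exp {α v : ℂ} (hv : v.im = 0) : rayDir (α * Complex.exp v) = rayDir α := by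
  have h1 : Complex.exp v = (Real.exp v.re : ℂ) := by
    rw [Complex.ofReal_exp]; congr 1; apply Complex.ext <;> simp [hv]
  rw [rayDir, norm_mul_exp, h1, rayDir, Complex.ofReal_mul,
    mul_div_mul_right _ _ (by exact_mod_cast (Real.exp_pos _).ne')]

/-- The scale `ε` is small enough for the construction of the bent branch. -/
structure IsSmallScale (σ ε R r : ℝ) (S : Set ℂ) (δ : ℂ → ℝ) : Prop where
  side : σ = 1 ∨ σ = -1
  pos : 0 < ε
  le : ε ≤ 1 / 4
  r_pos : 0 < r
  lower : ∀ α ∈ S, r ≤ ‖α‖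
  log_le : ε * Real.log (R / r) ≤ 1
  gap : ∀ α ∈ S, ‖α‖ < R → ∀ β ∈ S, ‖β‖ < R → Gap ε (β / α)
  depth : ∀ α ∈ S, ‖α‖ < R → 2 * R * ε < δ (rayDir α)

/-- `z = α exp w` lies in the region between a ray and the bent cut. -/
structure IsUnder (σ ε R : ℝ) (S : Set ℂ) (z α w : ℂ) : Prop where
  mem : α ∈ S
  norm_lt : ‖α‖ < R
  norm_lt' : ‖z‖ < R
  eq : z = α * Complex.exp w
  lt_re : ε < w.re
  lt_im : -(ε ^ 2 * (w.re - ε)) < σ * w.im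
  im_le : σ * w.im ≤ 0

namespace IsSmallScale

theorem ne_zero (h : IsSmallScale σ ε R r S δ) {α : ℂ} (hα : α ∈ S) : α ≠ 0 :=
  norm_pos_iff.mp (h.r_pos.trans_le (h.lower α hα))

theorem re_le (h : IsSmallScale σ ε R r S δ) {z α w : ℂ} (hu : IsUnder σ ε R S z α w) :
    ε ^ 2 * w.re ≤ ε := by
  have h1 := re_le_of_norm_lt h.r_pos (h.lower α hu.mem) (hu.eq ▸ hu.norm_lt')
  have h2 : ε * w.re ≤ 1 := (mul_le_mul_of_nonneg_left h1.le h.pos.le).trans h.log_le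
  have h3 := mul_le_mul_of_nonneg_left h2 h.pos.le
  linarith [h3, sq ε]

theorem abs_im_le (h : IsSmallScale σ ε R r S δ) {z α w : ℂ} (hu : IsUnder σ ε R S z α w) :
    |w.im| ≤ ε := by
  rw [abs_im_of_side h.side, abs_of_nonpos hu.im_le]
  have h1 := h.re_le hu
  have h2 := hu.lt_im
  have h3 : 0 < ε ^ 2 * ε := by have := h.pos; positivity
  rw [mul_sub] at h2
  linarith

/-- The two logarithmic coordinates of `z` differ by a logarithm of `α / β` with small imaginary
part; the gap condition makes it real. -/
theorem same_ray (h : IsSmallScale σ ε R r S δ) {z α w β w' : ℂ} (hu : IsUnder σ ε R S z α w)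
    (hβ : β ∈ S) (hβR : ‖β‖ < R) (hz : z = β * Complex.exp w') (hw' : |w'.im| ≤ 2 * ε) :
    rayDir α = rayDir β ∧ w'.im = w.im := by
  have h1 : Complex.exp (w' - w) = α / β := by
    rw [Complex.exp_sub, div_eq_div_iff (Complex.exp_ne_zero w) (h.ne_zero hβ), ← hu.eq, hz, mul_comm]
  have h2 := h.abs_im_le hu
  have h3 : |(w' - w).im| ≤ 4 * ε := by
    rw [Complex.sub_im]
    have := abs_sub w'.im w.im
    linarith [h.pos]
  have h4 := (h.gap β hβ hβR α hu.mem hu.norm_lt (w' - w) h1 h3).1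
  have h5 : α = β * Complex.exp (w' - w) := by rw [h1, mul_div_cancel₀ _ (h.ne_zero hβ)]
  refine ⟨by rw [h5, rayDir_mul_exp h4], ?_⟩
  rw [Complex.sub_im] at h4
  linarith

/-- Passage from logarithmic coordinates at `β` to the linear coordinate along its ray, in which ray
extensions are expressed. -/
theorem ray_coord (h : IsSmallScale σ ε R r S δ) {β w : ℂ} (hβ : β ∈ S) (hβR : ‖β‖ < R)
    (hw : |w.im| ≤ 2 * ε) (hre : -1 / 2 ≤ w.re) (hz : ‖β * Complex.exp w‖ < R) :
    rayDir β * ((‖β‖ : ℂ) * Complex.exp w) = β * Complex.exp w ∧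
      ((‖β‖ : ℂ) * Complex.exp w).re ∈ Icc (r / 4) R ∧
      |((‖β‖ : ℂ) * Complex.exp w).im| < δ (rayDir β) ∧
      (0 < σ * w.im → 0 < σ * ((‖β‖ : ℂ) * Complex.exp w).im) := by
  have hβ0 := h.ne_zero hβ
  have hr := h.lower β hβ
  have hr0 := h.r_pos
  have hε := h.le
  have e1 : ((‖β‖ : ℂ) * Complex.exp w).re = ‖β‖ * (Real.exp w.re * Real.cos w.im) := by
    rw [Complex.re_ofReal_mul, Complex.exp_re]
  have e2 : ((‖β‖ : ℂ) * Complex.exp w).im = ‖β‖ * Real.exp w.re * Real.sin w.im := by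
    rw [Complex.im_ofReal_mul, Complex.exp_im]; ring
  have hw1 : |w.im| ≤ 1 / 2 := by linarith
  have hcos := cos_ge_of_abs_le_one (hw1.trans (by norm_num))
  have hexp : 1 / 2 ≤ Real.exp w.re := by
    have := Real.add_one_le_exp w.re
    linarith
  rw [norm_mul_exp] at hz
  refine ⟨by rw [← mul_assoc, rayDir_mul_norm hβ0], ⟨?_, ?_⟩, ?_, fun h1 => ?_⟩
  · rw [e1]
    calc r / 4 = r * (1 / 2 * (1 / 2)) := by ring
      _ ≤ _ := by gcongr
  · rw [e1, ← mul_assoc]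
    exact (mul_le_of_le_one_right (by positivity) (Real.cos_le_one _)).trans hz.le
  · rw [e2, abs_mul, abs_of_nonneg (by positivity)]
    refine lt_of_le_of_lt ?_ (h.depth β hβ hβR)
    have h1 : |Real.sin w.im| ≤ 2 * ε := (Real.abs_sin_le_abs).trans hw
    calc _ ≤ R * (2 * ε) :=
          mul_le_mul hz.le h1 (abs_nonneg _) ((by positivity : 0 ≤ ‖β‖ * Real.exp w.re).trans hz.le)
      _ = _ := by ring
  · rw [e2]
    have hb := abs_le.mp hw1
    have hpi := Real.pi_gt_three
    have h2 : 0 < σ * Real.sin w.im := by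
      rcases h.side with hs | hs <;> rw [hs] at h1 ⊢
      · have := Real.sin_pos_of_pos_of_lt_pi (by linarith : 0 < w.im) (by linarith)
        linarith
      · have := Real.sin_neg_of_neg_of_neg_pi_lt (by linarith : w.im < 0) (by linarith)
        linarith
    have h3 : 0 < ‖β‖ * Real.exp w.re := by have := norm_pos_iff.mpr hβ0; positivity
    calc 0 < ‖β‖ * Real.exp w.re * (σ * Real.sin w.im) := mul_pos h3 h2
      _ = _ := by ring

end IsSmallScale

/-- The branch on the complement of the bent cuts. -/
noncomputable def bentBranch (σ ε R : ℝ) (S : Set ℂ) (P : ℂ → ℂ) (Q : ℂ → ℂ → ℂ) (z : ℂ) : ℂ :=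
  open Classical in
  if h : ∃ α w, IsUnder σ ε R S z α w then Q (rayDir h.choose) z else P z

/-- `Q u` continues `P` across the ray with direction `u`. -/
structure IsRayExtension (σ r R : ℝ) (S : Set ℂ) (P : ℂ → ℂ) (f : ℂ → ℂ → ℂ) (u : ℂ) (Q : ℂ → ℂ)
    (δ : ℝ) : Prop where
  pos : 0 < δ
  analytic : ∀ Z : ℂ, Z.re ∈ Icc (r / 4) R → |Z.im| < δ → (u * Z.re ∈ S → 0 < σ * Z.im) →
    AnalyticAt ℂ Q (u * Z)
  eq : ∀ Z : ℂ, Z.re ∈ Icc (r / 4) R → |Z.im| < δ → 0 < σ * Z.im → Q (u * Z) = P (u * Z)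
  eq_local : ∀ x ∈ Icc (r / 4) R, u * x ∈ S → ∃ η > 0, ∀ Z ∈ ball (x : ℂ) η, Z.re < x →
    Q (u * Z) = f (u * x) (Complex.log (1 - Z / x))

section Branch

variable {P : ℂ → ℂ} {f Q : ℂ → ℂ → ℂ}

/-- The choice in `bentBranch` is harmless, since all starting points above `z` have the same
direction. -/
theorem bentBranch_of_under (h : IsSmallScale σ ε R r S δ) {z α w : ℂ}
    (hu : IsUnder σ ε R S z α w) : bentBranch σ ε R S P Q z = Q (rayDir α) z := by
  have hex : ∃ α w, IsUnder σ ε R S z α w := ⟨α, w, hu⟩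
  rw [bentBranch, dif_pos hex]
  obtain ⟨w', hw'⟩ := hex.choose_spec
  rw [(h.same_ray hw' hu.mem hu.norm_lt hu.eq ((h.abs_im_le hu).trans (by linarith [h.pos]))).1]

theorem bentBranch_of_side (h : IsSmallScale σ ε R r S δ)
    (hQ : ∀ u, u ≠ 0 → IsRayExtension σ r R S P f u (Q u) (δ u)) {z β w : ℂ}
    (hβ : β ∈ S) (hβR : ‖β‖ < R) (hz : z = β * Complex.exp w) (hzR : ‖z‖ < R)
    (hw : |w.im| ≤ 2 * ε) (hre : -1 / 2 ≤ w.re) (hσ : 0 < σ * w.im) :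
    bentBranch σ ε R S P Q z = Q (rayDir β) z := by
  have hnu : ¬∃ α w, IsUnder σ ε R S z α w := by
    rintro ⟨α, w', hu⟩
    have h1 := (h.same_ray hu hβ hβR hz hw).2
    have h2 := hu.im_le
    rw [← h1] at h2
    linarith
  rw [bentBranch, dif_neg hnu]
  obtain ⟨e, h1, h2, h3⟩ := h.ray_coord hβ hβR hw hre (hz ▸ hzR)
  have := (hQ _ (rayDir_ne_zero (h.ne_zero hβ))).eq _ h1 h2 (h3 hσ)
  rw [e, ← hz] at this
  exact this.symm

theorem neg_log_cos_le {y : ℝ} (hy : |y| ≤ 1) : 0 ≤ -Real.log (Real.cos y) ∧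
    -Real.log (Real.cos y) ≤ y ^ 2 := by
  have h1 := cos_ge_of_abs_le_one hy
  have h2 := Real.one_sub_sq_div_two_le_cos (x := y)
  constructor
  · exact neg_nonneg.mpr (Real.log_nonpos (by linarith) (Real.cos_le_one y))
  · have h3 := Real.one_sub_inv_le_log_of_pos (by linarith : 0 < Real.cos y)
    have h4 : (Real.cos y)⁻¹ - 1 ≤ y ^ 2 := by
      have hc : 0 < Real.cos y := by linarith
      rw [inv_eq_one_div, div_sub_one hc.ne', div_le_iff₀ hc]
      have := mul_le_mul_of_nonneg_left h1 (sq_nonneg y)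
      linarith
    linarith

/-- Near `z₀` the branch is `Q`: nearby points are either still under the cut, or just across the
ray on the side `σ`, where `Q = P`. The perpendicular cuts of `Q` are absorbed by the thickness of
the bent cuts. -/
theorem differentiableAt_bentBranch_of_under (h : IsSmallScale σ ε R r S δ)
    (hQ : ∀ u, u ≠ 0 → IsRayExtension σ r R S P f u (Q u) (δ u)) {z₀ α w : ℂ}
    (hu : IsUnder σ ε R S z₀ α w) (hz₀ : z₀ ∉ bentCuts σ ε R S) :
    DifferentiableAt ℂ (bentBranch σ ε R S P Q) z₀ := by
  have hε := h.pos
  have hα0 := h.ne_zero hu.mem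
  have hz0 : z₀ ≠ 0 := by rw [hu.eq]; exact mul_ne_zero hα0 (Complex.exp_ne_zero w)
  have him := h.abs_im_le hu
  have heq : bentBranch σ ε R S P Q =ᶠ[𝓝 z₀] Q (rayDir α) := by
    set W : ℂ → ℂ := fun z => w + Complex.log (z / z₀) with hW
    have hW0 : W z₀ = w := by simp [hW, div_self hz0]
    have hWc : ContinuousAt W z₀ := by
      refine continuousAt_const.add (ContinuousAt.clog (by fun_prop) ?_)
      rw [div_self hz0]; exact Complex.one_mem_slitPlane
    have hWt : Tendsto W (𝓝 z₀) (𝓝 w) := by rw [← hW0]; exact hWc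
    have hre : Tendsto (fun z => (W z).re) (𝓝 z₀) (𝓝 w.re) :=
      (Complex.continuous_re.tendsto w).comp hWt
    have him' : Tendsto (fun z => (W z).im) (𝓝 z₀) (𝓝 w.im) :=
      (Complex.continuous_im.tendsto w).comp hWt
    have h1 : Tendsto (fun z => ε ^ 2 * ((W z).re - ε) + σ * (W z).im) (𝓝 z₀)
        (𝓝 (ε ^ 2 * (w.re - ε) + σ * w.im)) :=
      ((hre.sub_const ε).const_mul _).add (him'.const_mul σ)
    have hpos : 0 < ε ^ 2 * (w.re - ε) + σ * w.im := by linarith [hu.lt_im]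
    filter_upwards [hre.eventually (lt_mem_nhds hu.lt_re), h1.eventually (lt_mem_nhds hpos),
      him'.abs.eventually (gt_mem_nhds (by linarith : |w.im| < 2 * ε)),
      continuous_norm.continuousAt.eventually (gt_mem_nhds hu.norm_lt'), isOpen_ne.mem_nhds hz0]
      with z k1 k2 k3 k4 k5
    have k6 : z = α * Complex.exp (W z) := by
      rw [hW, Complex.exp_add, ← mul_assoc, ← hu.eq, Complex.exp_log (div_ne_zero k5 hz0)]
      field_simp
    rcases le_or_gt (σ * (W z).im) 0 with k7 | k7
    · exact bentBranch_of_under h ⟨hu.mem, hu.norm_lt, k4, k6, k1, by linarith, k7⟩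
    · exact bentBranch_of_side h hQ hu.mem hu.norm_lt k6 k4 k3.le (by linarith) k7
  refine DifferentiableAt.congr_of_eventuallyEq (AnalyticAt.differentiableAt ?_) heq
  have hre0 : -1 / 2 ≤ w.re := by linarith [hu.lt_re]
  obtain ⟨e, h1, h2, -⟩ := h.ray_coord hu.mem hu.norm_lt (him.trans (by linarith)) hre0
    (hu.eq ▸ hu.norm_lt')
  rw [hu.eq, ← e]
  -- If the foot of the perpendicular from `z₀` to the ray is in `S`, then `z₀` has logarithmic
  -- coordinate `-log (cos y) + i y` relative to it, with `y = w.im`. As `-log (cos y) ≤ y² ≤ ε`,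
  -- this point is in `cutLog`, contrary to the choice of `z₀`.
  refine (hQ _ (rayDir_ne_zero hα0)).analytic _ h1 h2 fun hS => absurd ?_ hz₀
  set Z := (‖α‖ : ℂ) * Complex.exp w with hZ
  have hle := h.le
  have hy : |w.im| ≤ 1 := by linarith
  have hcos := cos_ge_of_abs_le_one hy
  have hcpos : 0 < Real.cos w.im := by linarith
  obtain ⟨l1, l2⟩ := neg_log_cos_le hy
  have hre : Z.re = ‖α‖ * (Real.exp w.re * Real.cos w.im) := by
    rw [hZ, Complex.re_ofReal_mul, Complex.exp_re]
  have hnz : ‖z₀‖ = ‖α‖ * Real.exp w.re := by rw [hu.eq, norm_mul_exp]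
  have hZre : 0 ≤ Z.re := by rw [hre]; positivity
  refine Or.inr ⟨rayDir α * Z.re, hS, ?_, ⟨-Real.log (Real.cos w.im), w.im⟩, ⟨l1, hu.im_le, ?_, ?_⟩, ?_⟩
  · rw [norm_mul, norm_rayDir hα0, one_mul, Complex.norm_real, Real.norm_of_nonneg hZre, hre,
      ← mul_assoc, ← hnz]
    exact (mul_le_of_le_one_right (norm_nonneg _) (Real.cos_le_one _)).trans_lt hu.norm_lt'
  · have k1 : 0 ≤ ε ^ 2 * -Real.log (Real.cos w.im) := by positivity
    have k2 : -ε ≤ σ * w.im := by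
      rw [abs_im_of_side h.side] at him
      exact (abs_le.mp him).1
    change -ε ≤ σ * w.im + ε ^ 2 * -Real.log (Real.cos w.im)
    linarith
  · have k1 : w.im ^ 2 ≤ ε := by
      rw [← sq_abs]
      calc |w.im| ^ 2 ≤ ε ^ 2 := by gcongr
        _ ≤ ε := by nlinarith
    have k2 : ε ^ 2 * -Real.log (Real.cos w.im) ≤ ε ^ 2 * ε :=
      mul_le_mul_of_nonneg_left (l2.trans k1) (sq_nonneg ε)
    change σ * w.im + ε ^ 2 * -Real.log (Real.cos w.im) ≤ ε ^ 3
    linarith [hu.im_le, pow_succ ε 2]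
  · have k1 : Complex.exp ⟨-Real.log (Real.cos w.im), w.im⟩ =
        (Real.cos w.im : ℂ)⁻¹ * Complex.exp (w.im * Complex.I) := by
      have k2 : (⟨-Real.log (Real.cos w.im), w.im⟩ : ℂ) =
          ((-Real.log (Real.cos w.im) : ℝ) : ℂ) + w.im * Complex.I := by
        apply Complex.ext <;> simp
      rw [k2, Complex.exp_add, ← Complex.ofReal_exp, Real.exp_neg, Real.exp_log hcpos,
        Complex.ofReal_inv]
    have k3 : Complex.exp w = (Real.exp w.re : ℂ) * Complex.exp (w.im * Complex.I) := by
      rw [Complex.ofReal_exp, ← Complex.exp_add, Complex.re_add_im]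
    have k4 : (Real.cos w.im : ℂ) ≠ 0 := by exact_mod_cast hcpos.ne'
    have k5 := rayDir_mul_norm hα0
    rw [hu.eq, k1, k3, hre]
    rw [show rayDir α * ((‖α‖ * (Real.exp w.re * Real.cos w.im) : ℝ) : ℂ) *
        ((Real.cos w.im : ℂ)⁻¹ * Complex.exp (w.im * Complex.I)) = rayDir α * (‖α‖ : ℂ) *
        ((Real.exp w.re : ℂ) * Complex.exp (w.im * Complex.I)) *
          ((Real.cos w.im : ℂ) * (Real.cos w.im : ℂ)⁻¹) by push_cast; ring,
      k5, mul_inv_cancel₀ k4, mul_one]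

theorem isClosed_closure_under (σ ε R r : ℝ) (hS : ∀ R : ℝ, (S ∩ closedBall 0 R).Finite)
    (hσ : σ = 1 ∨ σ = -1) :
    IsClosed {z | ∃ α ∈ S, ‖α‖ < R ∧ ∃ w : ℂ, (ε ≤ w.re ∧ w.re ≤ Real.log (R / r)) ∧
      -(ε ^ 2 * (w.re - ε)) ≤ σ * w.im ∧ σ * w.im ≤ 0 ∧ z = α * Complex.exp w} := by
  set X := Real.log (R / r) with hX
  set c := ε ^ 2 * (|X| + |ε|) with hc
  set C : Set ℂ := {w : ℂ | -(ε ^ 2 * (w.re - ε)) ≤ σ * w.im} ∩ ({w : ℂ | σ * w.im ≤ 0} ∩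
    {w : ℂ | (ε ≤ w.re ∧ w.re ≤ X) ∧ -c ≤ w.im ∧ w.im ≤ c}) with hC
  have hCc : IsCompact C := by
    refine ((isCompact_rectangle _ _ _ _).inter_left ?_).inter_left ?_
    · exact isClosed_le (by fun_prop) continuous_const
    · exact isClosed_le (by fun_prop) (by fun_prop)
  have e : {z | ∃ α ∈ S, ‖α‖ < R ∧ ∃ w : ℂ, (ε ≤ w.re ∧ w.re ≤ X) ∧
      -(ε ^ 2 * (w.re - ε)) ≤ σ * w.im ∧ σ * w.im ≤ 0 ∧ z = α * Complex.exp w} =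
      ⋃ α ∈ {α ∈ S | ‖α‖ < R}, (fun w => α * Complex.exp w) '' C := by
    ext z
    simp only [mem_ofPred_eq, mem_iUnion, mem_image, exists_prop]
    constructor
    · rintro ⟨α, hα, hαR, w, h1, h2, h3, rfl⟩
      have h4 : |w.im| ≤ c := by
        rw [abs_im_of_side hσ, abs_of_nonpos h3, hc]
        have h5 : w.re - ε ≤ |X| + |ε| := by linarith [le_abs_self X, neg_abs_le ε, h1.2]
        have := mul_le_mul_of_nonneg_left h5 (sq_nonneg ε)
        linarith
      exact ⟨α, ⟨hα, hαR⟩, w, ⟨h2, h3, h1, abs_le.mp h4⟩, rfl⟩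
    · rintro ⟨α, ⟨hα, hαR⟩, w, ⟨h2, h3, h1, -⟩, rfl⟩
      exact ⟨α, hα, hαR, w, h1, h2, h3, rfl⟩
  rw [e]
  exact (finite_inter_ball hS R).isClosed_biUnion fun α _ => (hCc.image (by fun_prop)).isClosed

/-- The closure of the region under the cuts adds, inside the disc, only points of the cuts, so the
branch is `P` near `z₀`. Moreover `z₀` is in the star domain: directly behind a point of `S` on its
ray, `z₀` would be on the cut at logarithmic distance at most `ε`, and under it beyond. -/
theorem differentiableAt_bentBranch_of_not_under (h : IsSmallScale σ ε R r S δ)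
    (hS : ∀ R : ℝ, (S ∩ closedBall 0 R).Finite) (hP : DifferentiableOn ℂ P (starDomain S)) {z₀ : ℂ}
    (hu : ¬∃ α w, IsUnder σ ε R S z₀ α w) (hz₀ : z₀ ∉ bentCuts σ ε R S) :
    DifferentiableAt ℂ (bentBranch σ ε R S P Q) z₀ := by
  have hε := h.pos
  have hzR : ‖z₀‖ < R := not_le.mp fun h1 => hz₀ (Or.inl h1)
  have hnot : z₀ ∉ {z | ∃ α ∈ S, ‖α‖ < R ∧ ∃ w : ℂ, (ε ≤ w.re ∧ w.re ≤ Real.log (R / r)) ∧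
      -(ε ^ 2 * (w.re - ε)) ≤ σ * w.im ∧ σ * w.im ≤ 0 ∧ z = α * Complex.exp w} := by
    rintro ⟨α, hα, hαR, w, ⟨h1, h2⟩, h3, h4, h5⟩
    rcases h3.eq_or_lt with h6 | h6
    · refine hz₀ (Or.inr ⟨α, hα, hαR, w, ⟨by linarith, h4, ?_, ?_⟩, h5⟩)
      · have : 0 ≤ ε ^ 3 := by positivity
        linarith [pow_succ ε 2]
      · linarith [pow_succ ε 2]
    · rcases h1.eq_or_lt with h7 | h7
      · rw [← h7] at h6; linarith
      · exact hu ⟨α, w, hα, hαR, hzR, h5, h7, h6, h4⟩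
  have heq : bentBranch σ ε R S P Q =ᶠ[𝓝 z₀] P := by
    filter_upwards [(isClosed_closure_under σ ε R r hS h.side).isOpen_compl.mem_nhds hnot] with z hz
    refine dif_neg ?_
    rintro ⟨α, w, hu⟩
    exact hz ⟨α, hu.mem, hu.norm_lt, w, ⟨hu.lt_re.le, (re_le_of_norm_lt h.r_pos (h.lower α hu.mem)
      (hu.eq ▸ hu.norm_lt')).le⟩, hu.lt_im.le, hu.im_le, hu.eq⟩
  refine DifferentiableAt.congr_of_eventuallyEq (hP.differentiableAt
    ((isOpen_starDomain (isClosed_of_finite_inter hS)).mem_nhds fun t ht hα => ?_)) heq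
  have ht0 : 0 < t := ht.1.lt_of_ne fun h0 => by
    have := h.ne_zero hα
    simp [← h0] at this
  have hx : 0 ≤ -Real.log t := neg_nonneg.mpr (Real.log_nonpos ht.1 ht.2)
  have hαR : ‖(t : ℂ) * z₀‖ < R := by
    rw [norm_mul, Complex.norm_real, Real.norm_of_nonneg ht.1]
    exact (mul_le_of_le_one_left (norm_nonneg _) ht.2).trans_lt hzR
  have he : z₀ = (t : ℂ) * z₀ * Complex.exp ((-Real.log t : ℝ) : ℂ) := by
    rw [← Complex.ofReal_exp, Real.exp_neg, Real.exp_log ht0]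
    have : (t : ℂ) ≠ 0 := by exact_mod_cast ht0.ne'
    push_cast
    field_simp
  rcases le_or_gt (-Real.log t) ε with h1 | h1
  · refine hz₀ (Or.inr ⟨_, hα, hαR, _, ⟨hx, ?_, ?_, ?_⟩, he⟩) <;>
      simp only [Complex.ofReal_re, Complex.ofReal_im, mul_zero, zero_add, le_refl]
    · have : 0 ≤ ε ^ 2 * -Real.log t := by positivity
      linarith
    · have := mul_le_mul_of_nonneg_left h1 (sq_nonneg ε)
      linarith [pow_succ ε 2]
  · refine hu ⟨_, _, hα, hαR, hzR, he, h1, ?_, ?_⟩ <;>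
      simp only [Complex.ofReal_re, Complex.ofReal_im, mul_zero, le_refl]
    have : 0 < ε ^ 2 * (-Real.log t - ε) := mul_pos (by positivity) (by linarith)
    linarith

theorem differentiableOn_bentBranch (h : IsSmallScale σ ε R r S δ)
    (hS : ∀ R : ℝ, (S ∩ closedBall 0 R).Finite) (hP : DifferentiableOn ℂ P (starDomain S))
    (hQ : ∀ u, u ≠ 0 → IsRayExtension σ r R S P f u (Q u) (δ u)) :
    DifferentiableOn ℂ (bentBranch σ ε R S P Q) (bentCuts σ ε R S)ᶜ := fun z hz => by
  refine DifferentiableAt.differentiableWithinAt ?_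
  by_cases hu : ∃ α w, IsUnder σ ε R S z α w
  · obtain ⟨α, w, hu⟩ := hu
    exact differentiableAt_bentBranch_of_under h hQ hu hz
  · exact differentiableAt_bentBranch_of_not_under h hS hP hu hz

theorem hasTaylor_bentBranch (h : IsSmallScale σ ε R r S δ) {a : ℕ → ℂ} (hP : HasTaylor a P) :
    HasTaylor a (bentBranch σ ε R S P Q) := by
  refine hP.congr ?_
  filter_upwards [ball_mem_nhds (0 : ℂ) h.r_pos] with z hz
  rw [bentBranch, dif_neg]
  rintro ⟨α, w, hu⟩
  rw [mem_ball_zero_iff, hu.eq, norm_mul_exp] at hz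
  have h1 := h.lower α hu.mem
  have h2 : 1 ≤ Real.exp w.re := Real.one_le_exp (by linarith [hu.lt_re, h.pos])
  have h3 := mul_le_mul_of_nonneg_left h2 (norm_nonneg α)
  linarith

end Branch

end Extension

/-! ### Local branches at the starting points of the bent cuts. -/

section LocalBranch

variable {σ ε R r : ℝ} {S : Set ℂ} {δ : ℂ → ℝ} {P : ℂ → ℂ} {f Q : ℂ → ℂ → ℂ}

theorem one_sub_exp_im (ζ : ℂ) : (1 - Complex.exp ζ).im = -(Real.exp ζ.re * Real.sin ζ.im) := by
  simp [Complex.exp_im]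

theorem chart_div {α : ℂ} (hα : α ≠ 0) (ζ : ℂ) : chart α ζ / α = 1 - Complex.exp ζ := by
  rw [chart, mul_div_cancel_left₀ _ hα]

/-- A local branch agrees with the principal branch on the whole slit disc if the latter is
holomorphic there. -/
theorem eq_of_isLocalBranch {s : ℤˣ} {α : ℂ} {g : ℂ → ℂ} (hσ : (((s : ℤ) : ℝ)) = σ) (hα : α ≠ 0)
    (hg : IsLocalBranch s P α g) {ρ : ℝ}
    (hP : ∀ ζ : ℂ, ζ.re < ρ → |ζ.im| < Real.pi → AnalyticAt ℂ P (chart α ζ)) :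
    ∃ ρ' : ℝ, ∀ ζ : ℂ, ζ.re < ρ' → |ζ.im| < Real.pi → P (chart α ζ) = g ζ := by
  have hσ' : σ = 1 ∨ σ = -1 := by
    rcases Int.units_eq_one_or s with rfl | rfl
    · left; simpa using hσ.symm
    · right; simpa using hσ.symm
  have hpi := Real.pi_pos
  obtain ⟨ρ₁, hd, hgP⟩ := hg
  set ρ' := min ρ ρ₁ with hρ'
  set U : Set ℂ := {ζ | ζ.re < ρ'} ∩ ({ζ | -Real.pi < ζ.im} ∩ {ζ | ζ.im < Real.pi}) with hU
  have hmem : ∀ ζ ∈ U, ζ.re < ρ ∧ ζ.re < ρ₁ ∧ |ζ.im| < Real.pi := fun ζ hζ =>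
    ⟨lt_of_lt_of_le hζ.1 (min_le_left _ _), lt_of_lt_of_le hζ.1 (min_le_right _ _),
      abs_lt.mpr hζ.2⟩
  have hUc : Convex ℝ U := (convex_halfSpace_re_lt _).inter
    ((convex_halfSpace_im_gt _).inter (convex_halfSpace_im_lt _))
  have hUo : IsOpen U := (isOpen_lt (by fun_prop) continuous_const).inter
    ((isOpen_lt continuous_const (by fun_prop)).inter (isOpen_lt (by fun_prop) continuous_const))
  set ζ₁ : ℂ := ⟨ρ' - 1, -(σ * (Real.pi / 2))⟩ with hζ₁
  have hζ₁U : ζ₁ ∈ U := by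
    refine ⟨?_, ?_, ?_⟩
    · change ρ' - 1 < ρ'; linarith
    · change -Real.pi < -(σ * (Real.pi / 2))
      rcases hσ' with rfl | rfl <;> linarith
    · change -(σ * (Real.pi / 2)) < Real.pi
      rcases hσ' with rfl | rfl <;> linarith
  have hpos : 0 < σ * (1 - Complex.exp ζ₁).im := by
    rw [one_sub_exp_im]
    have := Real.exp_pos ζ₁.re
    change 0 < σ * -(Real.exp ζ₁.re * Real.sin (-(σ * (Real.pi / 2))))
    rcases hσ' with rfl | rfl <;> simp [Real.exp_pos]
  have hopen : IsOpen {ζ : ℂ | 0 < σ * (1 - Complex.exp ζ).im} :=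
    isOpen_lt continuous_const (by fun_prop)
  have hcd : ∀ ζ, AnalyticAt ℂ (chart α) ζ := fun ζ => by
    unfold chart
    fun_prop
  have h1 : EqOn (fun ζ => P (chart α ζ)) g U := by
    refine AnalyticOnNhd.eqOn_of_preconnected_of_eventuallyEq (𝕜 := ℂ) (fun ζ hζ => ?_)
      (fun ζ hζ => hd.analyticAt ((isOpen_halfPlane ρ₁).mem_nhds (hmem ζ hζ).2.1))
      hUc.isPreconnected hζ₁U ?_
    · exact (hP ζ (hmem ζ hζ).1 (hmem ζ hζ).2.2).fun_comp (hcd ζ)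
    · filter_upwards [hUo.mem_nhds hζ₁U, hopen.mem_nhds hpos] with ζ h2 h3
      refine hgP ζ (hmem ζ h2).2.1 (hmem ζ h2).2.2 ?_
      rwa [hσ, chart_div hα]
  exact ⟨ρ', fun ζ h2 h3 => h1 ⟨h2, abs_lt.mp h3⟩⟩

theorem exists_small_log {τ : ℝ} (hτ : 0 < τ) : ∃ η > 0, ∀ v : ℂ, ‖v‖ < η →
    ‖Complex.log (1 - v)‖ < τ ∧ 1 - v ≠ 0 := by
  have h1 : Tendsto (fun v : ℂ => Complex.log (1 - v)) (𝓝 0) (𝓝 0) := by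
    have : ContinuousAt (fun v : ℂ => Complex.log (1 - v)) 0 :=
      ContinuousAt.clog (by fun_prop) (by simp)
    simpa [ContinuousAt] using this
  obtain ⟨η, hη, h2⟩ := Metric.eventually_nhds_iff_ball.mp
    ((h1.norm.eventually (gt_mem_nhds (by simpa using hτ))))
  refine ⟨min η 1, by positivity, fun v hv => ⟨h2 v (mem_ball_zero_iff.mpr
    (hv.trans_le (min_le_left _ _))), fun h0 => ?_⟩⟩
  rw [← sub_eq_zero.mp h0, norm_one] at hv
  exact absurd (hv.trans_le (min_le_right _ _)) (lt_irrefl _)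

theorem sign_im_log (hσ : σ = 1 ∨ σ = -1) {v : ℂ} (h : σ * v.im ≤ 0) :
    σ * (Complex.log v).im ≤ 0 ∨ v.im = 0 := by
  rw [Complex.log_im]
  rcases hσ with rfl | rfl
  · rcases (by linarith : v.im ≤ 0).eq_or_lt with h1 | h1
    · exact Or.inr h1
    · left; linarith [Complex.arg_neg_iff.mpr h1]
  · left
    linarith [Complex.arg_nonneg_iff.mpr (by linarith : 0 ≤ v.im)]

/-- If some `β ∈ S` precedes `α` on its ray, then near `α` the points with `σ Im ≤ 0` are under the
cut of `β`, where the branch is the ray extension and hence `f α`; on the side `σ` the branch is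
`P`, which is `f α` by definition. Otherwise a slit disc at `α` lies in the star domain, `P = f α`
on all of it, and off the cuts no point of it is under a cut. -/
theorem bentBranch_chart {s : ℤˣ} (hσ : (((s : ℤ) : ℝ)) = σ) (h : IsSmallScale σ ε R r S δ)
    (hS : ∀ R : ℝ, (S ∩ closedBall 0 R).Finite) (hP : DifferentiableOn ℂ P (starDomain S))
    (hQ : ∀ u, u ≠ 0 → IsRayExtension σ r R S P f u (Q u) (δ u)) {α : ℂ} (hα : α ∈ S)
    (hαR : ‖α‖ < R) (hf : IsLocalBranch s P α (f α)) :
    ∃ ρ : ℝ, ∀ ζ : ℂ, ζ.re < ρ → |ζ.im| < Real.pi → chart α ζ ∉ bentCuts σ ε R S →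
      bentBranch σ ε R S P Q (chart α ζ) = f α ζ := by
  have hε := h.pos
  have hε1 := h.le
  have hα0 := h.ne_zero hα
  have hn0 : 0 < ‖α‖ := norm_pos_iff.mpr hα0
  have hτ : 0 < ε ^ 3 / 2 := by positivity
  have hε3 : ε ^ 3 ≤ ε := by
    calc ε ^ 3 ≤ ε ^ 1 := pow_le_pow_of_le_one hε.le (by linarith) (by norm_num)
      _ = ε := pow_one ε
  have hτε : ε ^ 3 / 2 ≤ ε := by linarith
  obtain ⟨η₁, hη₁, hlog⟩ := exists_small_log hτ
  have hsrc : ‖α‖ ∈ Icc (r / 4) R := ⟨by linarith [h.lower α hα, h.r_pos], hαR.le⟩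
  have hu0 := rayDir_ne_zero hα0
  have huα := rayDir_mul_norm hα0
  obtain ⟨η₂, hη₂, hQloc⟩ := (hQ _ hu0).eq_local ‖α‖ hsrc (by rwa [huα])
  set η := min η₁ (min (η₂ / ‖α‖) ((R - ‖α‖) / ‖α‖)) with hη
  have hη0 : 0 < η := by
    have : 0 < R - ‖α‖ := by linarith
    positivity
  have hv : ∀ ζ : ℂ, ζ.re < Real.log η → ‖Complex.exp ζ‖ < η := fun ζ hζ => by
    rw [Complex.norm_exp]
    exact (Real.lt_log_iff_exp_lt hη0).mp hζ
  have hL : ∀ ζ : ℂ, ζ.re < Real.log η → ‖Complex.log (1 - Complex.exp ζ)‖ < ε ^ 3 / 2 ∧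
      1 - Complex.exp ζ ≠ 0 := fun ζ hζ => hlog _ ((hv ζ hζ).trans_le (min_le_left _ _))
  have hreL : ∀ ζ : ℂ, ζ.re < Real.log η →
      |(Complex.log (1 - Complex.exp ζ)).re| < ε ^ 3 / 2 ∧
      |(Complex.log (1 - Complex.exp ζ)).im| < ε ^ 3 / 2 := fun ζ hζ =>
    ⟨(Complex.abs_re_le_norm _).trans_lt (hL ζ hζ).1, (Complex.abs_im_le_norm _).trans_lt (hL ζ hζ).1⟩
  have hch : ∀ ζ : ℂ, ζ.re < Real.log η →
      chart α ζ = α * Complex.exp (Complex.log (1 - Complex.exp ζ)) := fun ζ hζ => by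
    rw [chart, Complex.exp_log (hL ζ hζ).2]
  have hnlt : ∀ ζ : ℂ, ζ.re < Real.log η → ‖chart α ζ‖ < R := fun ζ hζ => by
    have h1 := (hv ζ hζ).trans_le ((min_le_right _ _).trans (min_le_right _ _))
    rw [lt_div_iff₀ hn0] at h1
    have h2 : ‖1 - Complex.exp ζ‖ ≤ 1 + ‖Complex.exp ζ‖ := by
      simpa using norm_sub_le (1 : ℂ) (Complex.exp ζ)
    rw [chart, norm_mul]
    have h3 := mul_le_mul_of_nonneg_left h2 hn0.le
    linarith
  have hreal : ∀ ζ : ℂ, ζ.re < Real.log η → |ζ.im| < Real.pi →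
      (Complex.log (1 - Complex.exp ζ)).im = 0 → (Complex.log (1 - Complex.exp ζ)).re < 0 := by
    intro ζ hζ hζπ him
    by_contra! hre
    have e1 : 1 - Complex.exp ζ = (Real.exp (Complex.log (1 - Complex.exp ζ)).re : ℂ) := by
      rw [Complex.ofReal_exp]
      conv_lhs => rw [← Complex.exp_log (hL ζ hζ).2]
      congr 1
      apply Complex.ext <;> simp [him]
    have e2 : (1 - Complex.exp ζ).im = 0 := by rw [e1, Complex.ofReal_im]
    have e3 : 1 ≤ (1 - Complex.exp ζ).re := by
      rw [e1, Complex.ofReal_re]; exact Real.one_le_exp hre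
    rw [one_sub_exp_im, neg_eq_zero] at e2
    have e4 : Real.sin ζ.im = 0 := (mul_eq_zero.mp e2).resolve_left (Real.exp_pos _).ne'
    have e5 : ζ.im = 0 :=
      (Real.sin_eq_zero_iff_of_lt_of_lt (abs_lt.mp hζπ).1 (abs_lt.mp hζπ).2).mp e4
    have e6 : (1 - Complex.exp ζ).re = 1 - Real.exp ζ.re := by simp [Complex.exp_re, e5]
    rw [e6] at e3
    linarith [Real.exp_pos ζ.re]
  have hoff : ∀ ζ : ℂ, ζ.re < Real.log η → |ζ.im| < Real.pi → chart α ζ ∉ bentCuts σ ε R S →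
      σ * (Complex.log (1 - Complex.exp ζ)).im ≤ 0 → (Complex.log (1 - Complex.exp ζ)).re < 0 := by
    intro ζ hζ _ hA him
    by_contra! hre
    refine hA (Or.inr ⟨α, hα, hαR, _, ⟨hre, him, ?_, ?_⟩, hch ζ hζ⟩)
    · have h1 := (hreL ζ hζ).2.le
      rw [abs_im_of_side h.side] at h1
      have h2 := (abs_le.mp h1).1
      have h3 : 0 ≤ ε ^ 2 * (Complex.log (1 - Complex.exp ζ)).re := by positivity
      linarith
    · have h1 := (abs_le.mp ((hreL ζ hζ).1.le.trans hτε)).2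
      have h2 := mul_le_mul_of_nonneg_left h1 (sq_nonneg ε)
      linarith [pow_succ ε 2]
  by_cases hcol : ∃ β ∈ S, ‖β‖ < R ∧ ∃ y : ℝ, 0 < y ∧ α = β * Complex.exp y
  · obtain ⟨β, hβ, hβR, y, hy0, hy⟩ := hcol
    have hy4 : 4 * ε < y := by
      by_contra! hle
      have h1 := (h.gap β hβ hβR α hα hαR (y : ℂ) (by
        rw [hy, mul_div_cancel_left₀ _ (h.ne_zero hβ)]) (by simp; positivity)).2 (by
          rw [Complex.ofReal_re, abs_of_pos hy0]; exact hle)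
      rw [Complex.ofReal_re] at h1
      linarith
    have huβ : rayDir β = rayDir α := by rw [hy, rayDir_mul_exp (Complex.ofReal_im y)]
    obtain ⟨ρ₀, -, hfP⟩ := hf
    refine ⟨min ρ₀ (Real.log η), fun ζ h1 h2 hA => ?_⟩
    have hζ : ζ.re < Real.log η := h1.trans_le (min_le_right _ _)
    set w := Complex.log (1 - Complex.exp ζ) with hw
    have hzβ : chart α ζ = β * Complex.exp (w + y) := by
      rw [hch ζ hζ, Complex.exp_add, mul_comm (Complex.exp w), ← mul_assoc, ← hy]
    have hre := abs_lt.mp (hreL ζ hζ).1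
    have him := (hreL ζ hζ).2
    rcases le_or_gt (σ * w.im) 0 with h3 | h3
    · have h4 : IsUnder σ ε R S (chart α ζ) β (w + y) := by
        refine ⟨hβ, hβR, hnlt ζ hζ, hzβ, ?_, ?_, ?_⟩
        · rw [Complex.add_re, Complex.ofReal_re]; linarith [hre.1]
        · rw [Complex.add_re, Complex.ofReal_re, Complex.add_im, Complex.ofReal_im, add_zero]
          rw [abs_im_of_side h.side] at him
          have h5 : ε ^ 2 * ε ≤ ε ^ 2 * (w.re + y - ε) :=
            mul_le_mul_of_nonneg_left (by linarith [hre.1]) (sq_nonneg ε)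
          linarith [(abs_lt.mp him).1, pow_succ ε 2]
        · simpa using h3
      rw [bentBranch_of_under h h4, huβ]
      have h5 := hoff ζ hζ h2 hA h3
      have h6 := hv ζ hζ
      have h7 := hQloc ((‖α‖ : ℂ) * (1 - Complex.exp ζ)) (by
        rw [mem_ball, dist_eq_norm, show (‖α‖ : ℂ) * (1 - Complex.exp ζ) - ‖α‖ =
          -((‖α‖ : ℂ) * Complex.exp ζ) by ring, norm_neg, norm_mul, Complex.norm_real, norm_norm]
        have := h6.trans_le ((min_le_right _ _).trans (min_le_left _ _))
        rwa [lt_div_iff₀' hn0] at this) (by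
        rw [Complex.re_ofReal_mul]
        have h8 : ‖1 - Complex.exp ζ‖ < 1 := by
          rw [← Complex.exp_log (hL ζ hζ).2, Complex.norm_exp, Real.exp_lt_one_iff]
          exact h5
        exact mul_lt_of_lt_one_right hn0 ((Complex.re_le_norm _).trans_lt h8))
      rw [← mul_assoc, huα, mul_div_cancel_left₀ _ (by exact_mod_cast hn0.ne'), sub_sub_cancel,
        Complex.log_exp (abs_lt.mp h2).1 (abs_lt.mp h2).2.le] at h7
      exact h7
    · have h4 : ¬∃ β w, IsUnder σ ε R S (chart α ζ) β w := by
        rintro ⟨β', w', hu⟩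
        have h5 := (h.same_ray hu hα hαR (hch ζ hζ) (by linarith)).2
        have h6 := hu.im_le
        rw [← h5] at h6
        linarith
      rw [bentBranch, dif_neg h4]
      refine hfP ζ (h1.trans_le (min_le_left _ _)) h2 ?_
      rw [hσ, chart_div hα0]
      by_contra! h5
      rcases sign_im_log h.side h5 with h6 | h6
      · linarith
      · have h7 : (1 - Complex.exp ζ).re < 0 ∨ w.im = 0 := by
          rcases lt_or_ge (1 - Complex.exp ζ).re 0 with h7 | h7
          · exact Or.inl h7
          · right
            rw [hw, Complex.log_im, Complex.arg_eq_zero_iff]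
            exact ⟨h7, h6⟩
        rcases h7 with h7 | h7
        · have h8 : w.im = Real.pi := by
            rw [hw, Complex.log_im, Complex.arg_eq_pi_iff]; exact ⟨h7, h6⟩
          rw [h8, abs_of_pos Real.pi_pos] at him
          linarith [Real.pi_gt_three]
        · rw [h7] at h3; simp at h3
  · push Not at hcol
    have hstar : ∀ ζ : ℂ, ζ.re < Real.log η → |ζ.im| < Real.pi → chart α ζ ∈ starDomain S := by
      intro ζ hζ hζπ t ht hβ
      set w := Complex.log (1 - Complex.exp ζ) with hw
      have ht0 : 0 < t := ht.1.lt_of_ne fun h0 => by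
        have := h.ne_zero hβ
        simp [← h0] at this
      have hβR : ‖(t : ℂ) * chart α ζ‖ < R := by
        rw [norm_mul, Complex.norm_real, Real.norm_of_nonneg ht.1]
        exact (mul_le_of_le_one_left (norm_nonneg _) ht.2).trans_lt (hnlt ζ hζ)
      have he : (t : ℂ) * chart α ζ = α * Complex.exp (w + (Real.log t : ℝ)) := by
        rw [hch ζ hζ, Complex.exp_add, ← Complex.ofReal_exp, Real.exp_log ht0]; ring
      have him : (w + (Real.log t : ℝ)).im = w.im := by simp
      have h1 := (h.gap α hα hαR _ hβ hβR (w + (Real.log t : ℝ))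
        (by rw [he, mul_div_cancel_left₀ _ hα0]) (by rw [him]; linarith [(hreL ζ hζ).2])).1
      rw [him] at h1
      have h2 := hreal ζ hζ hζπ h1
      refine hcol _ hβ hβR (-(w.re + Real.log t)) ?_ ?_
      · linarith [Real.log_nonpos ht.1 ht.2]
      · rw [he, mul_assoc, ← Complex.exp_add]
        have h3 : w + (Real.log t : ℝ) + ((-(w.re + Real.log t) : ℝ) : ℂ) = 0 := by
          apply Complex.ext <;> simp [h1]
        rw [h3, Complex.exp_zero, mul_one]
    obtain ⟨ρ', hρ'⟩ := eq_of_isLocalBranch hσ hα0 hf (ρ := Real.log η) fun ζ h1 h2 =>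
      hP.analyticAt ((isOpen_starDomain (isClosed_of_finite_inter hS)).mem_nhds (hstar ζ h1 h2))
    refine ⟨min ρ' (Real.log η), fun ζ h1 h2 hA => ?_⟩
    have hζ : ζ.re < Real.log η := h1.trans_le (min_le_right _ _)
    rw [bentBranch, dif_neg, hρ' ζ (h1.trans_le (min_le_left _ _)) h2]
    rintro ⟨β, w, hu⟩
    obtain ⟨h3, h4⟩ := h.same_ray hu hα hαR (hch ζ hζ) (by linarith [(hreL ζ hζ).2])
    have h5 := hoff ζ hζ h2 hA (by rw [h4]; exact hu.im_le)
    refine hcol β hu.mem hu.norm_lt (w.re - (Complex.log (1 - Complex.exp ζ)).re) ?_ ?_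
    · linarith [hu.lt_re]
    · have h6 := (hch ζ hζ).symm.trans hu.eq
      have h7 : w = Complex.log (1 - Complex.exp ζ) +
          ((w.re - (Complex.log (1 - Complex.exp ζ)).re : ℝ) : ℂ) := by
        apply Complex.ext <;> simp [h4]
      rw [h7, Complex.exp_add, mul_comm (Complex.exp _), ← mul_assoc] at h6
      exact mul_right_cancel₀ (Complex.exp_ne_zero (Complex.log (1 - Complex.exp ζ))) h6

/-- Continuation to the complement of the bent cuts. -/
theorem exists_bent_extension {s : ℤˣ} (hσ : (((s : ℤ) : ℝ)) = σ) {F : PowerSeries ℂ}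
    (hF : HasIsolatedSingularities s F S P f) {R : ℝ} (hR : 0 < R) :
    ∀ᶠ ε in 𝓝[>] (0 : ℝ), ∃ F' : ℂ → ℂ, DifferentiableOn ℂ F' (bentCuts σ ε R S)ᶜ ∧
      HasTaylor (fun k => PowerSeries.coeff k F) F' ∧
      ∀ α ∈ S, ‖α‖ < R → ∃ ρ : ℝ, ∀ ζ : ℂ, ζ.re < ρ → |ζ.im| < Real.pi →
        chart α ζ ∉ bentCuts σ ε R S → F' (chart α ζ) = f α ζ := by
  have hσ' : σ = 1 ∨ σ = -1 := by
    rcases Int.units_eq_one_or s with rfl | rfl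
    · left; simpa using hσ.symm
    · right; simpa using hσ.symm
  obtain ⟨r, hr, hrS⟩ := exists_norm_lower_bound hF.finite_inter hF.zero_notMem
  have hray : ∀ u : ℂ, u ≠ 0 → ∃ (Q : ℂ → ℂ) (δ : ℝ), IsRayExtension σ r R S P f u Q δ := by
    intro u hu
    obtain ⟨Q, δ, h1, h2, h3, h4⟩ := exists_ray_extension hF hσ hu (R := R)
      (by positivity : 0 < r / 4)
    exact ⟨Q, δ, h1, h2, h3, h4⟩
  choose! Q δ hQ using hray
  have hfin := finite_inter_ball hF.finite_inter R
  have h1 : ∀ᶠ ε in 𝓝[>] (0 : ℝ), ∀ α ∈ {α ∈ S | ‖α‖ < R}, 2 * R * ε < δ (rayDir α) := by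
    rw [eventually_all_finite hfin]
    intro α hα
    have hα0 : α ≠ 0 := fun h0 => hF.zero_notMem (h0 ▸ hα.1)
    have hδ := (hQ _ (rayDir_ne_zero hα0)).pos
    filter_upwards [Ioo_mem_nhdsGT (by positivity : 0 < δ (rayDir α) / (2 * R))] with ε hε
    have := hε.2
    rwa [lt_div_iff₀' (by positivity)] at this
  filter_upwards [eventually_gap_finite hfin, h1,
    Ioo_mem_nhdsGT (by norm_num : (0 : ℝ) < 1 / 4),
    Ioo_mem_nhdsGT (by positivity : 0 < 1 / (|Real.log (R / r)| + 1))] with ε hgap hdep hε hlog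
  have hlog' : ε * Real.log (R / r) ≤ 1 := by
    have h2 := hlog.2
    rw [lt_div_iff₀ (by positivity)] at h2
    have h3 := mul_le_mul_of_nonneg_left (le_abs_self (Real.log (R / r))) hlog.1.le
    linarith [hlog.1]
  have h : IsSmallScale σ ε R r S δ := ⟨hσ', hε.1, hε.2.le, hr, hrS, hlog',
    fun α hα hαR β hβ hβR => hgap α ⟨hα, hαR⟩ β ⟨hβ, hβR⟩, fun α hα hαR => hdep α ⟨hα, hαR⟩⟩
  exact ⟨bentBranch σ ε R S P Q,
    differentiableOn_bentBranch h hF.finite_inter hF.principal.differentiableOn hQ,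
    hasTaylor_bentBranch h hF.principal.hasSum, fun α hα hαR =>
      bentBranch_chart hσ h hF.finite_inter hF.principal.differentiableOn hQ hα hαR
        (hF.localBranch α hα)⟩

end LocalBranch

/-! ### Cauchy integrals along radial slits -/

section Slit

variable {x₁ x₂ τ : ℝ} {ψ : ℝ → ℂ}

/-- A Cauchy type integral along the slit `exp [x₁, x₂]`. -/
noncomputable def slit (x₁ x₂ : ℝ) (ψ : ℝ → ℂ) (w : ℂ) : ℂ :=
  -(1 / (2 * Real.pi * Complex.I)) * ∫ a in x₁..x₂, ψ a / (1 - w * Complex.exp (-a))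

/-- Taylor coefficients of `slit x₁ x₂ ψ`. -/
noncomputable def slitCoeff (x₁ x₂ : ℝ) (ψ : ℝ → ℂ) (k : ℕ) : ℂ :=
  -(1 / (2 * Real.pi * Complex.I)) * ∫ a in x₁..x₂, ψ a * Complex.exp (-a) ^ k

/-- The slit `exp [x₁, x₂]`. -/
def slitSet (x₁ x₂ : ℝ) : Set ℂ := (fun a : ℝ => Complex.exp a) '' Icc x₁ x₂

theorem isClosed_slitSet (x₁ x₂ : ℝ) : IsClosed (slitSet x₁ x₂) :=
  (isCompact_Icc.image (by fun_prop)).isClosed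

theorem one_sub_mul_exp_neg_ne_zero {w : ℂ} (hw : w ∉ slitSet x₁ x₂) {a : ℝ}
    (ha : a ∈ Icc x₁ x₂) : 1 - w * Complex.exp (-a) ≠ 0 := fun h => by
  refine hw ⟨a, ha, ?_⟩
  have h1 := (sub_eq_zero.mp h).symm
  rw [Complex.exp_neg] at h1
  exact (mul_inv_eq_one₀ (Complex.exp_ne_zero _)).mp h1 |>.symm

theorem differentiableOn_slit (hx : x₁ ≤ x₂) (hψ : IntervalIntegrable ψ volume x₁ x₂) :
    DifferentiableOn ℂ (slit x₁ x₂ ψ) (slitSet x₁ x₂)ᶜ := by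
  intro w₀ hw₀
  obtain ⟨r, hr, hrs⟩ := Metric.nhds_basis_closedBall.mem_iff.mp
    ((isClosed_slitSet x₁ x₂).isOpen_compl.mem_nhds hw₀)
  have hne : ∀ w ∈ closedBall w₀ r, ∀ a ∈ Icc x₁ x₂, 1 - w * Complex.exp (-a) ≠ 0 :=
    fun w hw a ha => one_sub_mul_exp_neg_ne_zero (hrs hw) ha
  obtain ⟨B, hB⟩ := ((isCompact_closedBall w₀ r).prod (isCompact_Icc (a := x₁) (b := x₂))
    ).exists_bound_of_continuousOn
      (f := fun p : ℂ × ℝ => (1 - p.1 * Complex.exp (-p.2))⁻¹)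
      (ContinuousOn.inv₀ (by fun_prop) fun p hp => hne p.1 hp.1 p.2 hp.2)
  have hψ' : Integrable ψ (volume.restrict (Ioc x₁ x₂)) :=
    (intervalIntegrable_iff_integrableOn_Ioc_of_le hx).mp hψ
  have hmem : ∀ᵐ a ∂(volume.restrict (Ioc x₁ x₂)), a ∈ Ioc x₁ x₂ :=
    ae_restrict_mem measurableSet_Ioc
  have h1 := (hasDerivAt_integral_of_differentiableOn (μ := volume.restrict (Ioc x₁ x₂))
    (Φ := fun w a => ψ a / (1 - w * Complex.exp (-a))) (z₀ := w₀) hr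
    (bound := fun a => ‖ψ a‖ * B) (hψ'.norm.mul_const B) (fun w hw => ?_) ?_ ?_).2
  · have h2 : slit x₁ x₂ ψ = fun w => -(1 / (2 * Real.pi * Complex.I)) *
        ∫ a in Ioc x₁ x₂, ψ a / (1 - w * Complex.exp (-a)) := by
      funext w
      rw [slit, intervalIntegral.integral_of_le hx]
    rw [h2]
    exact (h1.differentiableAt.const_mul _).differentiableWithinAt
  · refine hψ'.aestronglyMeasurable.div₀ ?_
    exact (Measurable.aestronglyMeasurable (by fun_prop))
  · filter_upwards [hmem] with a ha
    exact DifferentiableOn.div (by fun_prop) (by fun_prop)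
      fun w hw => hne w (ball_subset_closedBall hw) a (Ioc_subset_Icc_self ha)
  · filter_upwards [hmem] with a ha w hw
    rw [div_eq_mul_inv, norm_mul]
    exact mul_le_mul_of_nonneg_left
      (hB (w, a) ⟨ball_subset_closedBall hw, Ioc_subset_Icc_self ha⟩) (norm_nonneg _)

theorem norm_exp_neg_le_one {a : ℝ} (ha : 0 ≤ a) : ‖Complex.exp (-a : ℂ)‖ ≤ 1 := by
  rw [Complex.norm_exp]; simpa using ha

theorem hasTaylor_slit (h0 : 0 ≤ x₁) (hx : x₁ ≤ x₂) (hψ : IntervalIntegrable ψ volume x₁ x₂) :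
    HasTaylor (slitCoeff x₁ x₂ ψ) (slit x₁ x₂ ψ) := by
  filter_upwards [ball_mem_nhds (0 : ℂ) (by norm_num : (0 : ℝ) < 1 / 2)] with w hw
  have hw' : ‖w‖ ≤ 1 / 2 := (mem_ball_zero_iff.mp hw).le
  have hψ' : Integrable ψ (volume.restrict (Ioc x₁ x₂)) :=
    (intervalIntegrable_iff_integrableOn_Ioc_of_le hx).mp hψ
  have hmem : ∀ᵐ a ∂(volume.restrict (Ioc x₁ x₂)), a ∈ Ioc x₁ x₂ :=
    ae_restrict_mem measurableSet_Ioc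
  have hle : ∀ a ∈ Ioc x₁ x₂, ‖w * Complex.exp (-a)‖ ≤ 1 / 2 := fun a ha => by
    rw [norm_mul]
    nlinarith [norm_exp_neg_le_one (h0.trans ha.1.le), norm_nonneg w,
      norm_nonneg (Complex.exp (-a : ℂ))]
  have hgeo : HasSum (fun n : ℕ => (1 / 2 : ℝ) ^ n) 2 := hasSum_geometric_two
  have key := hasSum_integral_of_dominated_convergence (μ := volume.restrict (Ioc x₁ x₂))
    (F := fun (n : ℕ) a => ψ a * (w * Complex.exp (-a)) ^ n)
    (f := fun a => ψ a / (1 - w * Complex.exp (-a)))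
    (fun n a => ‖ψ a‖ * (1 / 2) ^ n)
    (fun n => hψ'.aestronglyMeasurable.mul (Measurable.aestronglyMeasurable (by fun_prop)))
    (fun n => by
      filter_upwards [hmem] with a ha
      rw [norm_mul, norm_pow]
      exact mul_le_mul_of_nonneg_left (pow_le_pow_left₀ (norm_nonneg _) (hle a ha) n)
        (norm_nonneg _))
    (Eventually.of_forall fun a => hgeo.summable.mul_left _)
    (by simpa only [tsum_mul_left] using hψ'.norm.mul_const _)
    (by
      filter_upwards [hmem] with a ha
      exact (hasSum_geometric_of_norm_lt_one ((hle a ha).trans_lt (by norm_num))).mul_left _)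
  have h2 := key.mul_left (-(1 / (2 * Real.pi * Complex.I)))
  rw [slit, intervalIntegral.integral_of_le hx]
  have h3 : ∀ k, slitCoeff x₁ x₂ ψ k * w ^ k = -(1 / (2 * Real.pi * Complex.I)) *
      ∫ a in Ioc x₁ x₂, ψ a * (w * Complex.exp (-a)) ^ k := fun k => by
    rw [slitCoeff, intervalIntegral.integral_of_le hx, mul_assoc, ← integral_mul_const]
    congr 2
    funext a
    rw [mul_pow]
    ring
  simpa only [h3] using h2

theorem HasTaylor.comp_div {a : ℕ → ℂ} {P : ℂ → ℂ} (h : HasTaylor a P) (α : ℂ) :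
    HasTaylor (fun k => a k * (α ^ k)⁻¹) fun z => P (z / α) := by
  have h1 : Tendsto (fun z : ℂ => z / α) (𝓝 0) (𝓝 0) := by
    have : Tendsto (fun z : ℂ => z / α) (𝓝 0) (𝓝 (0 / α)) := tendsto_id.div_const α
    simpa using this
  filter_upwards [h1.eventually h] with z hz
  convert hz using 2 with k
  rw [div_pow]; ring

/-- Products of moments are moments of convolutions. -/
theorem exists_moment_mul {ψ₁ ψ₂ : ℝ → ℂ} (hτ : 0 ≤ τ) (h1 : IntervalIntegrable ψ₁ volume 0 τ)
    (h2 : IntervalIntegrable ψ₂ volume 0 τ) :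
    ∃ Ψ : ℝ → ℂ, Integrable Ψ ∧
      (∀ b ∈ Ioc 0 τ, Ψ b = ∫ a in (0 : ℝ)..b, ψ₁ a * ψ₂ (b - a)) ∧
      ∀ k : ℕ, (∫ a in (0 : ℝ)..τ, ψ₁ a * Complex.exp (-a) ^ k) *
        (∫ a in (0 : ℝ)..τ, ψ₂ a * Complex.exp (-a) ^ k) =
          ∫ b in (0 : ℝ)..(2 * τ), Ψ b * Complex.exp (-b) ^ k := by
  set L := ContinuousLinearMap.mul ℂ ℂ with hL
  set g : (ℝ → ℂ) → ℕ → ℝ → ℂ := fun ψ k => (Ioc 0 τ).indicator fun a => ψ a * Complex.exp (-a) ^ k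
    with hg
  have hgi : ∀ ψ : ℝ → ℂ, IntervalIntegrable ψ volume 0 τ → ∀ k, Integrable (g ψ k) := by
    intro ψ hψ k
    rw [hg, integrable_indicator_iff measurableSet_Ioc,
      ← intervalIntegrable_iff_integrableOn_Ioc_of_le hτ]
    exact hψ.mul_continuousOn (by fun_prop)
  have hgm : ∀ ψ : ℝ → ℂ, ∀ k, ∫ a, g ψ k a = ∫ a in (0 : ℝ)..τ, ψ a * Complex.exp (-a) ^ k := by
    intro ψ k
    rw [intervalIntegral.integral_of_le hτ, ← integral_indicator measurableSet_Ioc]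
  -- The densities are truncated to `(0, τ]`. The factor `exp (-b) ^ k` splits multiplicatively over
  -- `b = a + (b - a)`, so one `Ψ` serves all `k`; for `b ≤ τ` the truncation is not felt.
  set Ψ : ℝ → ℂ := fun b => ∫ a, g ψ₁ 0 a * g ψ₂ 0 (b - a) with hΨ
  have hconv : ∀ k b, (MeasureTheory.convolution (g ψ₁ k) (g ψ₂ k) L volume) b =
      Ψ b * Complex.exp (-b) ^ k := by
    intro k b
    rw [convolution_def, hΨ, ← integral_mul_const]
    congr 1
    funext a
    simp only [hg, hL, ContinuousLinearMap.mul_apply']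
    by_cases ha : a ∈ Ioc 0 τ
    · by_cases hb : b - a ∈ Ioc 0 τ
      · simp only [indicator_of_mem ha, indicator_of_mem hb, pow_zero, mul_one]
        have : Complex.exp (-b) = Complex.exp (-a) * Complex.exp (-(b - a : ℝ)) := by
          rw [← Complex.exp_add]; congr 1; push_cast; ring
        rw [this]
        push_cast
        ring
      · simp [indicator_of_notMem hb]
    · simp [indicator_of_notMem ha]
  have hΨ0 : ∀ b, b ∉ Ioc 0 (2 * τ) → Ψ b = 0 := by
    intro b hb
    rw [hΨ]
    refine integral_eq_zero_of_ae (Eventually.of_forall fun a => ?_)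
    simp only [hg, Pi.zero_apply]
    by_cases ha : a ∈ Ioc 0 τ
    · by_cases hb' : b - a ∈ Ioc 0 τ
      · exact absurd ⟨by linarith [ha.1, hb'.1], by linarith [ha.2, hb'.2]⟩ hb
      · simp [indicator_of_notMem hb']
    · simp [indicator_of_notMem ha]
  refine ⟨Ψ, ?_, fun b hb => ?_, fun k => ?_⟩
  · refine ((hgi ψ₁ h1 0).integrable_convolution L (hgi ψ₂ h2 0)).congr
      (Eventually.of_forall fun b => ?_)
    rw [hconv]; simp
  · rw [intervalIntegral.integral_of_le hb.1.le, integral_Ioc_eq_integral_Ioo,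
      ← integral_indicator measurableSet_Ioo]
    refine integral_congr_ae (Eventually.of_forall fun a => ?_)
    simp only [hg, pow_zero, mul_one]
    by_cases ha : a ∈ Ioo 0 b
    · rw [indicator_of_mem (show a ∈ Ioc 0 τ from ⟨ha.1, by linarith [ha.2, hb.2]⟩),
        indicator_of_mem (show b - a ∈ Ioc 0 τ from ⟨by linarith [ha.2], by linarith [ha.1, hb.2]⟩),
        indicator_of_mem ha]
    · rw [indicator_of_notMem ha]
      by_cases ha1 : a ∈ Ioc 0 τ
      · rw [indicator_of_notMem (s := Ioc 0 τ) (a := b - a), mul_zero]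
        exact fun h => ha ⟨ha1.1, by linarith [h.1]⟩
      · rw [indicator_of_notMem ha1, zero_mul]
  · rw [← hgm, ← hgm]
    have h3 := integral_convolution (μ := volume) (ν := volume) L (hgi ψ₁ h1 k) (hgi ψ₂ h2 k)
    rw [hL, ContinuousLinearMap.mul_apply'] at h3
    rw [← h3, intervalIntegral.integral_of_le (by linarith)]
    refine Eq.trans ?_ (setIntegral_eq_integral_of_forall_compl_eq_zero fun b hb => ?_).symm
    · exact integral_congr_ae (Eventually.of_forall fun b => hconv k b)
    · rw [hΨ0 b hb, zero_mul]

end Slit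

/-! ### Densities on the radial cut. -/

section Radial

variable {ρ τ b : ℝ} {D p q : ℂ → ℂ}

/-- The restriction of a function on the covering of the punctured disc to the radial cut,
in logarithmic coordinates. -/
noncomputable def radial (D : ℂ → ℂ) (a : ℝ) : ℂ :=
  D ((Real.log (Real.exp a - 1) : ℂ) + (-Real.pi : ℝ) * Complex.I)

theorem radial_re (x y : ℝ) : ((x : ℂ) + (y : ℂ) * Complex.I).re = x := by simp

theorem radial_im (x y : ℝ) : ((x : ℂ) + (y : ℂ) * Complex.I).im = y := by simp

theorem log_exp_sub_one_le {a b : ℝ} (ha : 0 < a) (hab : a ≤ b) :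
    Real.log (Real.exp a - 1) ≤ Real.log (Real.exp b - 1) :=
  Real.log_le_log (by linarith [Real.add_one_lt_exp ha.ne'])
    (by linarith [Real.exp_le_exp.mpr hab])

theorem intervalIntegrable_radial (hD : DifferentiableOn ℂ D (halfPlane ρ)) (hv : Vanishes D)
    (hτ : 0 ≤ τ) (hρ : Real.log (Real.exp τ - 1) < ρ) :
    IntervalIntegrable (radial D) volume 0 τ := by
  obtain ⟨B, -, hB⟩ := hv.exists_bound hD.continuousOn hρ Real.pi
  have hle : ∀ a ∈ Ioo 0 τ, Real.log (Real.exp a - 1) ≤ Real.log (Real.exp τ - 1) := fun a ha =>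
    log_exp_sub_one_le ha.1 ha.2.le
  refine intervalIntegrable_of_continuousOn_Ioo (M := B) hτ ?_ fun a ha => hB _ ?_ ?_
  · refine hD.continuousOn.comp ?_ fun a ha => ?_
    · refine ContinuousOn.add (Complex.continuous_ofReal.comp_continuousOn
        (ContinuousOn.log (by fun_prop) fun a ha => ?_)) continuousOn_const
      linarith [Real.add_one_lt_exp ha.1.ne', ha.1]
    · change (_ : ℂ).re < ρ
      rw [radial_re]
      exact (hle a ha).trans_lt hρ
  · rw [radial_re]; exact hle a ha
  · rw [radial_im, abs_neg, abs_of_pos Real.pi_pos]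

/-- Over the cut, where `exp ζ = 1 - exp b`, this is the substitution `u = exp a` on the segment `u
= 1 - t exp ζ`. -/
theorem integral_radial_substitution (hb : 0 < b) (g : ℝ → ℂ) :
    ∫ t in (0 : ℝ)..1, g t = ∫ a in (0 : ℝ)..b, ((Real.exp a / (Real.exp b - 1) : ℝ) : ℂ) *
      g ((Real.exp a - 1) / (Real.exp b - 1)) := by
  have hb' : 0 < Real.exp b - 1 := by linarith [Real.add_one_lt_exp hb.ne']
  have hinj : InjOn (fun a => (Real.exp a - 1) / (Real.exp b - 1)) (Ioo 0 b) := fun x _ y _ h => by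
    have h1 := (div_left_inj' hb'.ne').mp h
    exact Real.exp_injective (by linarith)
  have himg : (fun a => (Real.exp a - 1) / (Real.exp b - 1)) '' Ioo 0 b = Ioo 0 1 := by
    ext t
    constructor
    · rintro ⟨a, ha, rfl⟩
      have h1 := Real.add_one_lt_exp ha.1.ne'
      have h2 := Real.exp_lt_exp.mpr ha.2
      exact ⟨div_pos (by linarith [ha.1]) hb', (div_lt_one hb').mpr (by linarith)⟩
    · intro ht
      have h1 : 0 < t * (Real.exp b - 1) := mul_pos ht.1 hb'
      refine ⟨Real.log (1 + t * (Real.exp b - 1)), ⟨Real.log_pos (by linarith), ?_⟩, ?_⟩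
      · rw [Real.log_lt_iff_lt_exp (by linarith)]
        nlinarith [ht.2]
      · simp only
        rw [Real.exp_log (by linarith)]
        field_simp
        ring
  have hder : ∀ a ∈ Ioo 0 b, HasDerivWithinAt (fun a => (Real.exp a - 1) / (Real.exp b - 1))
      (Real.exp a / (Real.exp b - 1)) (Ioo 0 b) a := fun a _ =>
    (((Real.hasDerivAt_exp a).sub_const 1).div_const _).hasDerivWithinAt
  have key := integral_image_eq_integral_abs_deriv_smul measurableSet_Ioo hder hinj g
  rw [himg] at key
  rw [intervalIntegral.integral_of_le zero_le_one, intervalIntegral.integral_of_le hb.le,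
    integral_Ioc_eq_integral_Ioo, integral_Ioc_eq_integral_Ioo, key]
  refine integral_congr_ae (Eventually.of_forall fun a => ?_)
  simp only
  rw [abs_of_pos (div_pos (Real.exp_pos a) hb'), Complex.real_smul]

theorem exp_log_exp_sub_one (hb : 0 < b) :
    Complex.exp ((Real.log (Real.exp b - 1) : ℂ) + (-Real.pi : ℝ) * Complex.I) =
      1 - Complex.exp b := by
  have hb' : 0 < Real.exp b - 1 := by linarith [Real.add_one_lt_exp hb.ne']
  have h1 : Complex.exp (((-Real.pi : ℝ) : ℂ) * Complex.I) = -1 := by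
    rw [Complex.ofReal_neg, neg_mul, Complex.exp_neg, Complex.exp_pi_mul_I]; norm_num
  rw [Complex.exp_add, h1, ← Complex.ofReal_exp, Real.exp_log hb']
  push_cast
  ring

/-- A Cauchy integral along a slit as a solution of the difference equation. -/
theorem slit_radial_eq_cauchySolution (hD : DifferentiableOn ℂ D (halfPlane ρ)) (hv : Vanishes D)
    (hτ : 0 < τ) (hρ : Real.log (Real.exp τ - 1) < ρ) {ζ : ℂ}
    (hζ : ζ.re < Real.log (Real.exp τ - 1)) (him : |ζ.im| < Real.pi) :
    slit 0 τ (radial D) (1 - Complex.exp ζ) =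
      cauchySolution D (Real.log (Real.exp τ - 1)) ζ := by
  have hτ' : 0 < Real.exp τ - 1 := by linarith [Real.add_one_lt_exp hτ.ne']
  rw [cauchySolution_eq_ray hD hv hρ hζ him, slit, rayIntegral, integral_radial_substitution hτ,
    exp_log_exp_sub_one hτ]
  congr 1
  rw [← intervalIntegral.integral_const_mul]
  rw [intervalIntegral.integral_of_le hτ.le, intervalIntegral.integral_of_le hτ.le]
  refine setIntegral_congr_fun (measurableSet_Ioc (a := (0 : ℝ)) (b := τ)) fun a ha => ?_
  have ha' : 0 < Real.exp a - 1 := by linarith [Real.add_one_lt_exp ha.1.ne', ha.1]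
  have h1 : ((Real.log (Real.exp τ - 1) : ℝ) : ℂ) + (-Real.pi : ℝ) * Complex.I +
      (Real.log ((Real.exp a - 1) / (Real.exp τ - 1)) : ℂ) =
      (Real.log (Real.exp a - 1) : ℂ) + (-Real.pi : ℝ) * Complex.I := by
    rw [Real.log_div ha'.ne' hτ'.ne']
    push_cast
    ring
  simp only [h1, radial]
  have h2 : (Complex.exp τ - 1) ≠ 0 := by
    have : ((Real.exp τ - 1 : ℝ) : ℂ) ≠ 0 := by exact_mod_cast hτ'.ne'
    simpa using this
  have h3 : 1 - (1 - Complex.exp ζ) * Complex.exp (-a) =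
      (Complex.exp a - 1 + Complex.exp ζ) * Complex.exp (-a) := by
    rw [Complex.exp_neg]
    field_simp
    ring
  have h4 : ((Real.exp a - 1) / (Real.exp τ - 1) : ℝ) * (1 - Complex.exp τ) - Complex.exp ζ =
      -(Complex.exp a - 1 + Complex.exp ζ) := by
    push_cast
    field_simp
    ring
  rw [h3, h4, Complex.exp_neg]
  push_cast
  generalize Complex.exp a - 1 + Complex.exp ζ = e
  by_cases he : e = 0
  · simp [he]
  · field_simp
    ring

/-- On the radial cut, the convolution is an additive convolution. -/
theorem radial_conv {C : ℂ → ℂ} (hC : ∀ ζ, C ζ = -(1 / (2 * Real.pi * Complex.I)) *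
      ∫ t in (0 : ℝ)..1, convKernel p q ζ t) (hb : 0 < b) :
    radial C b = -(1 / (2 * Real.pi * Complex.I)) *
      ∫ a in (0 : ℝ)..b, radial p a * radial q (b - a) := by
  have hb' : 0 < Real.exp b - 1 := by linarith [Real.add_one_lt_exp hb.ne']
  rw [radial, hC, integral_radial_substitution hb]
  congr 1
  rw [intervalIntegral.integral_of_le hb.le, intervalIntegral.integral_of_le hb.le,
    integral_Ioc_eq_integral_Ioo, integral_Ioc_eq_integral_Ioo]
  refine setIntegral_congr_fun measurableSet_Ioo fun a ha => ?_
  have ha' : 0 < Real.exp a - 1 := by linarith [Real.add_one_lt_exp ha.1.ne', ha.1]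
  have hba : 0 < Real.exp (b - a) - 1 := by
    linarith [Real.add_one_lt_exp (sub_pos.mpr ha.2).ne', ha.2]
  have h1 : ((Real.log (Real.exp b - 1) : ℝ) : ℂ) + (-Real.pi : ℝ) * Complex.I +
      (Real.log ((Real.exp a - 1) / (Real.exp b - 1)) : ℂ) =
      (Real.log (Real.exp a - 1) : ℂ) + (-Real.pi : ℝ) * Complex.I := by
    rw [Real.log_div ha'.ne' hb'.ne']
    push_cast
    ring
  have h2 : (Complex.exp b - 1) ≠ 0 := by
    have : ((Real.exp b - 1 : ℝ) : ℂ) ≠ 0 := by exact_mod_cast hb'.ne'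
    simpa using this
  have h3 : 1 - ((Real.exp a - 1) / (Real.exp b - 1) : ℝ) * (1 - Complex.exp b) =
      Complex.exp a := by
    push_cast
    field_simp
    ring
  -- Here `z / u = exp (b - a)`, and its lift lies over the same edge `Im = -π` of the cut.
  have h4 : secondLift ((Real.log (Real.exp b - 1) : ℂ) + (-Real.pi : ℝ) * Complex.I)
      ((Real.exp a - 1) / (Real.exp b - 1)) =
      (Real.log (Real.exp (b - a) - 1) : ℂ) + (-Real.pi : ℝ) * Complex.I := by
    have h5 : 1 - (Real.exp a - 1) / (Real.exp b - 1) =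
        Real.exp a * (Real.exp (b - a) - 1) / (Real.exp b - 1) := by
      rw [Real.exp_sub]
      field_simp
      ring
    rw [secondLift, exp_log_exp_sub_one hb, h3, h5,
      Real.log_div (mul_pos (Real.exp_pos a) hba).ne' hb'.ne',
      Real.log_mul (Real.exp_pos a).ne' hba.ne', Real.log_exp, ← Complex.ofReal_exp,
      ← Complex.ofReal_log (Real.exp_pos a).le, Real.log_exp]
    push_cast
    ring
  simp only [convKernel, h1, h4, exp_log_exp_sub_one hb, h3, radial]
  push_cast
  have h6 : Complex.exp a ≠ 0 := Complex.exp_ne_zero _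
  field_simp
  ring

/-- The Hadamard product of two Cauchy integrals along slits. -/
theorem exists_slit_mul (hτ : 0 < τ) (hρ : Real.log (Real.exp τ - 1) < ρ)
    (hp : DifferentiableOn ℂ p (halfPlane ρ)) (hpv : Vanishes p)
    (hq : DifferentiableOn ℂ q (halfPlane ρ)) (hqv : Vanishes q) {C : ℂ → ℂ}
    (hC : ∀ ζ, C ζ = -(1 / (2 * Real.pi * Complex.I)) *
      ∫ t in (0 : ℝ)..1, convKernel p q ζ t) :
    ∃ Ψ : ℝ → ℂ, IntervalIntegrable Ψ volume τ (2 * τ) ∧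
      ∀ k, slitCoeff 0 τ (radial p) k * slitCoeff 0 τ (radial q) k =
        slitCoeff 0 τ (radial C) k + slitCoeff τ (2 * τ) Ψ k := by
  obtain ⟨Ψ, h1, h2, h3⟩ := exists_moment_mul hτ.le (intervalIntegrable_radial hp hpv hτ.le hρ)
    (intervalIntegrable_radial hq hqv hτ.le hρ)
  set κ : ℂ := -(1 / (2 * Real.pi * Complex.I)) with hκ
  have hint : ∀ x y, IntervalIntegrable (fun b => κ * Ψ b) volume x y := fun x y =>
    (h1.intervalIntegrable).const_mul κ
  -- Of the two prefactors `κ`, one belongs to the density (it is the factor in `C`) and one to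
  -- `slitCoeff`. The integral over `[τ, 2τ]` is the part of the convolution that is not `C`.
  refine ⟨fun b => κ * Ψ b, hint _ _, fun k => ?_⟩
  have h4 : slitCoeff 0 τ (radial C) k =
      κ * ∫ b in (0 : ℝ)..τ, (κ * Ψ b) * Complex.exp (-b) ^ k := by
    rw [slitCoeff, intervalIntegral.integral_of_le hτ.le, intervalIntegral.integral_of_le hτ.le]
    congr 1
    refine setIntegral_congr_fun measurableSet_Ioc fun b hb => ?_
    rw [radial_conv hC hb.1, h2 b hb]
  rw [h4, slitCoeff, slitCoeff, slitCoeff, ← mul_add,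
    intervalIntegral.integral_add_adjacent_intervals
      ((hint _ _).mul_continuousOn (by fun_prop)) ((hint _ _).mul_continuousOn (by fun_prop))]
  rw [mul_mul_mul_comm, h3 k, mul_assoc]
  simp only [mul_assoc κ, intervalIntegral.integral_const_mul]
  rfl

end Radial

/-! ### The Euler operator on slit integrals. -/

section Euler

variable {x₁ x₂ τ ρ : ℝ} {ψ : ℝ → ℂ} {α : ℂ}

/-- The Euler operator `z d/dz`. -/
noncomputable def euler (g : ℂ → ℂ) : ℂ → ℂ := fun z => z * deriv g z

theorem analyticAt_euler {g : ℂ → ℂ} {z : ℂ} (hg : AnalyticAt ℂ g z) : AnalyticAt ℂ (euler g) z :=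
  analyticAt_id.mul hg.deriv

theorem analyticAt_chart (α ζ : ℂ) : AnalyticAt ℂ (chart α) ζ := by
  unfold chart
  fun_prop

/-- In the coordinate `ζ`, the Euler operator becomes `theta`. -/
theorem euler_chart (hα : α ≠ 0) {U : Set ℂ} (hU : IsOpen U) {g φ : ℂ → ℂ}
    (hg : ∀ w ∈ U, AnalyticAt ℂ g (chart α w)) (h : ∀ w ∈ U, g (chart α w) = φ w) :
    ∀ w ∈ U, euler g (chart α w) = theta φ w := by
  intro w hw
  have h1 : (fun w => g (chart α w)) =ᶠ[𝓝 w] φ := by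
    filter_upwards [hU.mem_nhds hw] with v hv using h v hv
  have h2 : HasDerivAt (chart α) (α * -Complex.exp w) w := by
    have := ((Complex.hasDerivAt_exp w).const_sub 1).const_mul α
    exact this
  have h3 : HasDerivAt (fun w => g (chart α w)) (deriv g (chart α w) * (α * -Complex.exp w)) w :=
    (hg w hw).differentiableAt.hasDerivAt.comp w h2
  rw [theta, ← h1.deriv_eq, h3.deriv, euler, Complex.exp_neg, chart]
  have := Complex.exp_ne_zero w
  field_simp
  ring

/-- A Cauchy integral along the slit from `α` to `α e^τ`. -/
noncomputable def slitAt (α : ℂ) (x₁ x₂ : ℝ) (ψ : ℝ → ℂ) (z : ℂ) : ℂ := slit x₁ x₂ ψ (z / α)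

theorem analyticAt_slitAt (hx : x₁ ≤ x₂) (hψ : IntervalIntegrable ψ volume x₁ x₂) {z : ℂ}
    (hz : z / α ∉ slitSet x₁ x₂) : AnalyticAt ℂ (slitAt α x₁ x₂ ψ) z := by
  have h1 : AnalyticAt ℂ (slit x₁ x₂ ψ) (z / α) := (differentiableOn_slit hx hψ).analyticAt
    ((isClosed_slitSet x₁ x₂).isOpen_compl.mem_nhds hz)
  exact AnalyticAt.fun_comp (g := slit x₁ x₂ ψ) (f := fun z => z / α) h1 (by fun_prop)

theorem hasTaylor_euler_slitAt (h0 : 0 ≤ x₁) (hx : x₁ ≤ x₂)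
    (hψ : IntervalIntegrable ψ volume x₁ x₂) (α : ℂ) :
    HasTaylor (fun k => k * (slitCoeff x₁ x₂ ψ k * (α ^ k)⁻¹)) (euler (slitAt α x₁ x₂ ψ)) :=
  ((hasTaylor_slit h0 hx hψ).comp_div α).euler

theorem notMem_slitSet_of_abs_im_lt {ζ : ℂ} (h : |ζ.im| < Real.pi) (h0 : 0 ≤ x₁) :
    1 - Complex.exp ζ ∉ slitSet x₁ x₂ := by
  rintro ⟨a, ha, h1⟩
  have h2 : Complex.exp ζ = ((1 - Real.exp a : ℝ) : ℂ) := by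
    push_cast
    linear_combination h1
  have h3 : (Complex.exp ζ).arg = ζ.im := by
    rw [← Complex.log_im, Complex.log_exp (abs_lt.mp h).1 (abs_lt.mp h).2.le]
  rcases (Real.one_le_exp (h0.trans ha.1)).lt_or_eq with h4 | h4
  · rw [h2, Complex.arg_ofReal_of_neg (by linarith)] at h3
    rw [← h3, abs_of_pos Real.pi_pos] at h
    exact lt_irrefl _ h
  · rw [h2, ← h4] at h3
    exact Complex.exp_ne_zero ζ (by rw [h2, ← h4]; simp)

theorem isOpen_strip (x : ℝ) : IsOpen {ζ : ℂ | ζ.re < x ∧ |ζ.im| < Real.pi} :=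
  (isOpen_lt Complex.continuous_re continuous_const).inter
    (isOpen_lt (continuous_abs.comp Complex.continuous_im) continuous_const)

theorem slitAt_chart {D : ℂ → ℂ} (hα : α ≠ 0) (hD : DifferentiableOn ℂ D (halfPlane ρ))
    (hv : Vanishes D) (hτ : 0 < τ) (hρ : Real.log (Real.exp τ - 1) < ρ) :
    ∀ ζ ∈ {ζ : ℂ | ζ.re < Real.log (Real.exp τ - 1) ∧ |ζ.im| < Real.pi},
      AnalyticAt ℂ (slitAt α 0 τ (radial D)) (chart α ζ) ∧
      slitAt α 0 τ (radial D) (chart α ζ) = cauchySolution D (Real.log (Real.exp τ - 1)) ζ :=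
  fun ζ hζ => by
  refine ⟨analyticAt_slitAt hτ.le (intervalIntegrable_radial hD hv hτ.le hρ) ?_, ?_⟩
  · rw [chart_div hα]; exact notMem_slitSet_of_abs_im_lt hζ.2 le_rfl
  · rw [slitAt, chart_div hα, slit_radial_eq_cauchySolution hD hv hτ hρ hζ.1 hζ.2]

theorem euler_slitAt_chart {D : ℂ → ℂ} (hα : α ≠ 0) (hD : DifferentiableOn ℂ D (halfPlane ρ))
    (hv : Vanishes D) (hτ : 0 < τ) (hρ : Real.log (Real.exp τ - 1) < ρ) :
    ∀ ζ ∈ {ζ : ℂ | ζ.re < Real.log (Real.exp τ - 1) ∧ |ζ.im| < Real.pi},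
      euler (slitAt α 0 τ (radial D)) (chart α ζ) =
        theta (cauchySolution D (Real.log (Real.exp τ - 1))) ζ :=
  euler_chart hα (isOpen_strip _) (fun w hw => (slitAt_chart hα hD hv hτ hρ w hw).1)
    fun w hw => (slitAt_chart hα hD hv hτ hρ w hw).2

theorem euler_euler_slitAt_chart {D : ℂ → ℂ} (hα : α ≠ 0)
    (hD : DifferentiableOn ℂ D (halfPlane ρ))
    (hv : Vanishes D) (hτ : 0 < τ) (hρ : Real.log (Real.exp τ - 1) < ρ) :
    ∀ ζ ∈ {ζ : ℂ | ζ.re < Real.log (Real.exp τ - 1) ∧ |ζ.im| < Real.pi},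
      euler (euler (slitAt α 0 τ (radial D))) (chart α ζ) =
        theta (theta (cauchySolution D (Real.log (Real.exp τ - 1)))) ζ :=
  euler_chart hα (isOpen_strip _)
    (fun w hw => analyticAt_euler (slitAt_chart hα hD hv hτ hρ w hw).1)
    (euler_slitAt_chart hα hD hv hτ hρ)

end Euler

/-! ### Removal of singularities by subtracting slit integrals. -/

section Regular

/-- Removing finitely many points from the singular set by local analytic extension. -/
theorem exists_glue_finite {A Φ : Set ℂ} (hA : IsClosed A) (hΦ : Φ.Finite) {F : ℂ → ℂ}
    (hF : DifferentiableOn ℂ F Aᶜ)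
    (h : ∀ α ∈ Φ, ∃ Q : ℂ → ℂ, AnalyticAt ℂ Q α ∧ ∀ᶠ z in 𝓝 α, z ∉ A → F z = Q z) :
    ∃ (K : Set ℂ) (G : ℂ → ℂ), IsClosed K ∧ K ⊆ A ∧ (∀ α ∈ Φ, α ∉ K) ∧
      DifferentiableOn ℂ G Kᶜ ∧ ∀ z ∉ A, G z = F z := by
  classical
  choose! Q hQ hQF using h
  obtain ⟨U, hU, hUd⟩ := hΦ.t2_separation
  have hV : ∀ α ∈ Φ, ∃ V ⊆ U α, IsOpen V ∧ α ∈ V ∧ ∀ z ∈ V, AnalyticAt ℂ (Q α) z ∧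
      (z ∉ A → F z = Q α z) := fun α hα => by
    have h1 := ((hQ α hα).eventually_analyticAt.and (hQF α hα)).and
      ((hU α).2.mem_nhds (hU α).1)
    obtain ⟨V, hV, hVo, hαV⟩ := _root_.mem_nhds_iff.mp h1
    exact ⟨V, fun z hz => (hV hz).2, hVo, hαV, fun z hz => (hV hz).1⟩
  choose! V hVU hVo hαV hVQ using hV
  refine ⟨A \ ⋃ α ∈ Φ, V α, fun z => if h : z ∈ A ∧ ∃ α ∈ Φ, z ∈ V α then Q h.2.choose z else F z,
    ?_, sdiff_subset, fun α hα h => h.2 (mem_biUnion hα (hαV α hα)), fun z hz => ?_, fun z hz => ?_⟩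
  · exact hA.inter (isOpen_biUnion hVo).isClosed_compl
  · by_cases hzV : ∃ α ∈ Φ, z ∈ V α
    · obtain ⟨α, hα, hzα⟩ := hzV
      refine DifferentiableAt.differentiableWithinAt ?_
      refine (hVQ α hα z hzα).1.differentiableAt.congr_of_eventuallyEq ?_
      filter_upwards [(hVo α hα).mem_nhds hzα] with w hw
      split_ifs with h
      · have h2 := h.2.choose_spec
        have h3 : h.2.choose = α := by
          by_contra hne
          exact (hUd h2.1 hα hne).le_bot ⟨hVU _ h2.1 h2.2, hVU α hα hw⟩
        rw [h3]
      · have hwA : w ∉ A := fun hwA => h ⟨hwA, α, hα, hw⟩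
        exact (hVQ α hα w hw).2 hwA
    · have hzA : z ∉ A := fun hzA => hz ⟨hzA, by simpa using hzV⟩
      refine DifferentiableAt.differentiableWithinAt ?_
      refine (hF.differentiableAt (hA.isOpen_compl.mem_nhds hzA)).congr_of_eventuallyEq ?_
      filter_upwards [hA.isOpen_compl.mem_nhds hzA] with w hw
      rw [dif_neg fun h => hw h.1]
  · simp only
    rw [dif_neg fun h => hz h.1]

end Regular

section Regular

variable {A : Set ℂ} {F' : ℂ → ℂ} {ρ τ : ℝ}

/-- Subtracting a Cauchy integral with the same monodromy makes the singularity removable. -/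
theorem exists_local_regular {α : ℂ} (hα : α ≠ 0) {f D : ℂ → ℂ}
    (hcut : ∀ x ∈ Icc 0 τ, α * Complex.exp (x : ℝ) ∈ A)
    (hf : DifferentiableOn ℂ f (halfPlane ρ)) (hfv : Vanishes fun ζ => Complex.exp ζ * f ζ)
    (hD : DifferentiableOn ℂ D (halfPlane ρ)) (hDv : Vanishes D)
    (hfD : ∀ ζ ∈ halfPlane ρ, theta D ζ = monDelta f ζ) (hτ : 0 < τ)
    (hρ : Real.log (Real.exp τ - 1) < ρ)
    (hbr : ∃ ρ' : ℝ, ∀ ζ : ℂ, ζ.re < ρ' → |ζ.im| < Real.pi → chart α ζ ∉ A →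
      F' (chart α ζ) = f ζ) :
    ∃ Q : ℂ → ℂ, AnalyticAt ℂ Q α ∧
      ∀ᶠ z in 𝓝 α, z ∉ A → F' z - euler (slitAt α 0 τ (radial D)) z = Q z := by
  set x₀ := Real.log (Real.exp τ - 1) with hx₀
  set φ := cauchySolution D x₀ with hφ
  have hφd : DifferentiableOn ℂ φ (halfPlane x₀) := differentiableOn_cauchySolution hD hDv hρ
  have hsub : halfPlane x₀ ⊆ halfPlane ρ := halfPlane_mono hρ.le
  -- `Δ (theta φ) = theta (Δ φ) = theta D = Δ f`, so the difference has no monodromy, and both terms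
  -- are integrable.
  obtain ⟨Q, hQ, hkQ⟩ := exists_analytic_of_periodic (ρ := x₀) (k := fun ζ => f ζ - theta φ ζ)
    ((hf.mono hsub).sub (differentiableOn_theta hφd)) (fun ζ hζ => by
      have h1 : monDelta (fun ζ => f ζ - theta φ ζ) ζ = monDelta f ζ - monDelta (theta φ) ζ := by
        simp only [monDelta, monSigma]
        ring
      rw [h1, ← theta_monDelta hφd hζ, theta_congr (g := D)
        (fun w hw => cauchySolution_add_period hD hDv hρ hw) ζ hζ, hfD ζ (hsub hζ), sub_self]) (by
      have h1 := hfv.sub (vanishes_exp_mul_theta (vanishes_deriv_cauchySolution hD hDv hρ))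
      simpa only [mul_sub] using h1)
  obtain ⟨ρ', hbr⟩ := hbr
  have hQ0 : AnalyticAt ℂ Q (1 - α / α) := by
    rw [div_self hα, sub_self]
    exact hQ.analyticAt (ball_mem_nhds _ (Real.exp_pos _))
  refine ⟨fun z => Q (1 - z / α), AnalyticAt.fun_comp (g := Q) (f := fun z => 1 - z / α) hQ0
    (by fun_prop), ?_⟩
  have hlim : Tendsto (fun z : ℂ => 1 - z / α) (𝓝 α) (𝓝 0) := by
    have : ContinuousAt (fun z : ℂ => 1 - z / α) α := by fun_prop
    simpa [ContinuousAt, hα] using this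
  have hpos : 0 < min (Real.exp (min x₀ ρ')) (Real.exp τ - 1) :=
    lt_min (Real.exp_pos _) (by linarith [Real.add_one_lt_exp hτ.ne'])
  filter_upwards [hlim (ball_mem_nhds (0 : ℂ) hpos)] with z hz hzA
  have hz' : ‖1 - z / α‖ < min (Real.exp (min x₀ ρ')) (Real.exp τ - 1) := mem_ball_zero_iff.mp hz
  have hne : 1 - z / α ≠ 0 := fun h => hzA <| by
    have h1 : z = α := by
      have := (sub_eq_zero.mp h).symm
      rwa [div_eq_one_iff_eq hα] at this
    simpa [h1] using hcut 0 ⟨le_rfl, hτ.le⟩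
  set ζ := Complex.log (1 - z / α) with hζ
  have hexp : Complex.exp ζ = 1 - z / α := Complex.exp_log hne
  have hch : chart α ζ = z := by
    rw [chart, hexp]
    field_simp
    ring
  have hre : ζ.re < min x₀ ρ' := by
    rw [hζ, Complex.log_re, Real.log_lt_iff_lt_exp (norm_pos_iff.mpr hne)]
    exact hz'.trans_le (min_le_left _ _)
  -- Imaginary part `π` would place `z` on the slit itself, which is contained in `A`.
  have him : |ζ.im| < Real.pi := by
    refine lt_of_le_of_ne (abs_le.mpr ⟨(Complex.neg_pi_lt_log_im _).le, Complex.log_im_le_pi _⟩) ?_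
    intro h
    have h1 : ζ.im = Real.pi := by
      rcases (abs_eq Real.pi_pos.le).mp h with h1 | h1
      · exact h1
      · exact absurd h1 (Complex.neg_pi_lt_log_im _).ne'
    rw [hζ, Complex.log_im, Complex.arg_eq_pi_iff] at h1
    have h2 : z / α = ((1 + ‖1 - z / α‖ : ℝ) : ℂ) := by
      have h3 : ‖1 - z / α‖ = -(1 - z / α).re := by
        rw [← Complex.abs_re_eq_norm.mpr h1.2, abs_of_neg h1.1]
      apply Complex.ext
      · rw [h3, Complex.ofReal_re, Complex.sub_re, Complex.one_re]; ring
      · have := h1.2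
        rw [Complex.sub_im, Complex.one_im] at this
        rw [Complex.ofReal_im]; linarith
    have h4 : 0 ≤ ‖1 - z / α‖ := norm_nonneg _
    have h5 : z = α * Complex.exp (Real.log (1 + ‖1 - z / α‖) : ℝ) := by
      rw [← Complex.ofReal_exp, Real.exp_log (by linarith), ← h2]
      field_simp
    rw [h5] at hzA
    refine hzA (hcut _ ⟨Real.log_nonneg (by linarith), ?_⟩)
    rw [Real.log_le_iff_le_exp (by linarith)]
    linarith [hz'.trans_le (min_le_right _ _)]
  have h1 := hbr ζ (hre.trans_le (min_le_right _ _)) him (by rwa [hch])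
  have h2 := euler_slitAt_chart hα hD hDv hτ hρ ζ ⟨hre.trans_le (min_le_left _ _), him⟩
  rw [hch] at h1 h2
  rw [h1, h2, ← hexp]
  exact hkQ ζ (hre.trans_le (min_le_left _ _))

/-- All slit integrals are subtracted at once: at `α` the slits of the other points are holomorphic
by `hsep`, and its own slit makes the singularity removable. -/
theorem exists_regular_part (hA : IsClosed A) (h0A : (0 : ℂ) ∉ A)
    (hF' : DifferentiableOn ℂ F' Aᶜ) {a : ℕ → ℂ} (hFa : HasTaylor a F') {I : Finset ℂ}
    {f D : ℂ → ℂ → ℂ}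
    (hcut : ∀ α ∈ I, ∀ x ∈ Icc 0 τ, α * Complex.exp (x : ℝ) ∈ A)
    (hsep : ∀ α ∈ I, ∀ β ∈ I, ∀ x ∈ Icc 0 τ, α = β * Complex.exp (x : ℝ) → α = β)
    (hf : ∀ α ∈ I, DifferentiableOn ℂ (f α) (halfPlane ρ))
    (hfv : ∀ α ∈ I, Vanishes fun ζ => Complex.exp ζ * f α ζ)
    (hD : ∀ α ∈ I, DifferentiableOn ℂ (D α) (halfPlane ρ)) (hDv : ∀ α ∈ I, Vanishes (D α))
    (hfD : ∀ α ∈ I, ∀ ζ ∈ halfPlane ρ, theta (D α) ζ = monDelta (f α) ζ) (hτ : 0 < τ)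
    (hρ : Real.log (Real.exp τ - 1) < ρ)
    (hbr : ∀ α ∈ I, ∃ ρ' : ℝ, ∀ ζ : ℂ, ζ.re < ρ' → |ζ.im| < Real.pi → chart α ζ ∉ A →
      F' (chart α ζ) = f α ζ) :
    ∃ (K : Set ℂ) (G : ℂ → ℂ), IsClosed K ∧ K ⊆ A ∧ (∀ α ∈ I, α ∉ K) ∧
      DifferentiableOn ℂ G Kᶜ ∧
      HasTaylor (fun k => a k - ∑ α ∈ I, k * (slitCoeff 0 τ (radial (D α)) k * (α ^ k)⁻¹)) G := by
  classical
  have h0 : ∀ α ∈ I, α ≠ 0 := fun α hα h => h0A <| by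
    simpa [h] using hcut α hα 0 ⟨le_rfl, hτ.le⟩
  have hint : ∀ α ∈ I, IntervalIntegrable (radial (D α)) volume 0 τ := fun α hα =>
    intervalIntegrable_radial (hD α hα) (hDv α hα) hτ.le hρ
  have hslit : ∀ α ∈ I, ∀ z, (∀ x ∈ Icc 0 τ, z ≠ α * Complex.exp (x : ℝ)) →
      AnalyticAt ℂ (euler (slitAt α 0 τ (radial (D α)))) z := fun α hα z hz =>
    analyticAt_euler <| analyticAt_slitAt hτ.le (hint α hα) <| by
      rintro ⟨x, hx, h1⟩
      refine hz x hx ?_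
      simp only at h1
      rw [h1, mul_div_cancel₀ _ (h0 α hα)]
  have hFd : DifferentiableOn ℂ
      (fun z => F' z - ∑ α ∈ I, euler (slitAt α 0 τ (radial (D α))) z) Aᶜ := by
    refine hF'.sub (DifferentiableOn.fun_sum fun α hα z hz => ?_)
    exact (hslit α hα z fun x hx h => hz (h ▸ hcut α hα x hx)).differentiableAt.differentiableWithinAt
  obtain ⟨K, G, hK, hKA, hIK, hG, hGF⟩ := exists_glue_finite hA I.finite_toSet hFd fun α hα => by
    obtain ⟨Q, hQ, hQF⟩ := exists_local_regular (h0 α hα) (hcut α hα) (hf α hα) (hfv α hα)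
      (hD α hα) (hDv α hα) (hfD α hα) hτ hρ (hbr α hα)
    refine ⟨fun z => Q z - ∑ β ∈ I.erase α, euler (slitAt β 0 τ (radial (D β))) z,
      hQ.sub ?_, ?_⟩
    · refine Finset.analyticAt_fun_sum _ fun β hβ => ?_
      have hβ' := Finset.mem_erase.mp hβ
      exact hslit β hβ'.2 α fun x hx h => hβ'.1 (hsep α hα β hβ'.2 x hx h).symm
    · filter_upwards [hQF] with z hz hzA
      rw [← Finset.add_sum_erase I _ hα, ← hz hzA]
      ring
  refine ⟨K, G, hK, hKA, hIK, hG, ?_⟩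
  refine (hFa.sub (hasTaylor_sum fun α hα =>
    hasTaylor_euler_slitAt le_rfl hτ.le (hint α hα) α)).congr ?_
  filter_upwards [hA.isOpen_compl.mem_nhds h0A] with z hz
  exact (hGF z hz).symm

end Regular

/-! ### Separating a point from the product of the cuts. -/

section Separation

variable {σ ε R r : ℝ} {S T : Set ℂ} {p : ℂ}

theorem le_norm_of_mem_bentCuts (hrR : r ≤ R) (hrS : ∀ α ∈ S, r ≤ ‖α‖) {a : ℂ}
    (ha : a ∈ bentCuts σ ε R S) : r ≤ ‖a‖ := by
  rcases ha with h | ⟨α, hα, -, w, hw, rfl⟩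
  · exact hrR.trans h
  · rw [norm_mul_exp]
    have h1 := Real.one_le_exp hw.1
    have h2 := hrS α hα
    nlinarith [norm_nonneg α]

theorem exists_of_mem_bentCuts {a : ℂ} (ha : a ∈ bentCuts σ ε R S) (h : ‖a‖ < R) :
    ∃ α ∈ S, ‖α‖ < R ∧ ∃ w ∈ cutLog σ ε, a = α * Complex.exp w :=
  ha.resolve_left (not_le.mpr h)

/-- A point of the product of the cuts, slightly on the side `σ` of the ray through `p`. -/
theorem eq_zero_of_mul_eq (hσ : σ = 1 ∨ σ = -1) (hp : p ≠ 0) (hε : 0 < ε) (hr : 0 < r)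
    (hlog : ε * Real.log (R / r) ≤ 1 / 2) {α β w w' v : ℂ} (hα : r ≤ ‖α‖) (hβ : r ≤ ‖β‖)
    (hw : w ∈ cutLog σ ε) (hw' : w' ∈ cutLog σ ε) (hαw : ‖α * Complex.exp w‖ < R)
    (hβw : ‖β * Complex.exp w'‖ < R) (hgap : Gap ε (α * β / p)) (hv : |v.im| ≤ ε)
    (hv' : 0 ≤ σ * v.im)
    (h : α * Complex.exp w * (β * Complex.exp w') = p * Complex.exp v) :
    v.im = 0 ∧ (v = 0 → w = 0 ∧ w' = 0) := by
  -- Each cut deviates by at most `3 ε / 2` and `v` by `ε`: together the `4 ε` of `Gap`.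
  have him : ∀ {α w : ℂ}, r ≤ ‖α‖ → w ∈ cutLog σ ε → ‖α * Complex.exp w‖ < R →
      -(3 / 2 * ε) ≤ σ * w.im := fun {α w} hα hw hR => by
    have h1 := re_le_of_norm_lt hr hα hR
    nlinarith [hw.2.2.1, mul_le_mul_of_nonneg_left h1.le hε.le]
  have e1 := him hα hw hαw
  have e2 := him hβ hw' hβw
  have hexp : Complex.exp (v - w - w') = α * β / p := by
    rw [Complex.exp_sub, Complex.exp_sub, div_div, div_eq_div_iff
      (mul_ne_zero (Complex.exp_ne_zero _) (Complex.exp_ne_zero _)) hp]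
    linear_combination -h
  rw [abs_im_of_side hσ] at hv
  have hle := (abs_le.mp hv).2
  have hsum : σ * (v - w - w').im = σ * v.im - σ * w.im - σ * w'.im := by
    simp only [Complex.sub_im]; ring
  have hn1 := hw.2.1
  have hn2 := hw'.2.1
  -- The logarithm of `α β / p` is real, so `σ Im v`, `-σ Im w` and `-σ Im w'` add up to zero. All
  -- three are nonnegative, because cuts bend away from the side `σ`; hence each vanishes.
  have h4 := hgap _ hexp (by
    rw [abs_im_of_side hσ, hsum]
    exact abs_le.mpr ⟨by linarith, by linarith⟩)
  rw [h4.1, mul_zero] at hsum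
  have hσ0 : σ ≠ 0 := by rcases hσ with rfl | rfl <;> norm_num
  have hz : ∀ {x : ℝ}, σ * x = 0 → x = 0 := fun h => (mul_eq_zero.mp h).resolve_left hσ0
  refine ⟨hz (by linarith), fun hv0 => ?_⟩
  have i1 : σ * w.im = 0 := by linarith
  have i2 : σ * w'.im = 0 := by linarith
  -- On the ray itself a cut has logarithmic length at most `ε`, so the real part of the logarithm
  -- is again within the gap and must vanish.
  have r1 : w.re ≤ ε := by
    have := hw.2.2.2
    rw [i1, zero_add] at this
    exact le_of_mul_le_mul_left (by linarith [pow_succ ε 2]) (by positivity : 0 < ε ^ 2)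
  have r2 : w'.re ≤ ε := by
    have := hw'.2.2.2
    rw [i2, zero_add] at this
    exact le_of_mul_le_mul_left (by linarith [pow_succ ε 2]) (by positivity : 0 < ε ^ 2)
  have h5 : (v - w - w').re = -(w.re + w'.re) := by simp [hv0]; ring
  have n1 := hw.1
  have n2 := hw'.1
  have h6 := h4.2 (by rw [h5, abs_neg, abs_of_nonneg (by linarith)]; linarith)
  rw [h5] at h6
  exact ⟨Complex.ext (by simp; linarith) (by simpa using hz i1),
    Complex.ext (by simp; linarith) (by simpa using hz i2)⟩

/-- The cuts at scale `ε` separate `p` from the product of the cuts. -/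
structure Separated (σ ε R : ℝ) (S T : Set ℂ) (p : ℂ) : Prop where
  eq_zero : ∀ α ∈ S, ‖α‖ < R → ∀ β ∈ T, ‖β‖ < R → ∀ w ∈ cutLog σ ε, ∀ w' ∈ cutLog σ ε,
    α * Complex.exp w * (β * Complex.exp w') = p → w = 0 ∧ w' = 0
  mem : ∀ a ∈ bentCuts σ ε R S, ∀ b ∈ bentCuts σ ε R T, a * b = p →
    (a ∈ S ∧ ‖a‖ < R) ∧ b ∈ T ∧ ‖b‖ < R
  side : ∀ᶠ z in 𝓝 p, 0 < σ * (z / p).im → ∀ t ∈ Icc (0 : ℝ) 1, ∀ a ∈ bentCuts σ ε R S,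
    ∀ b ∈ bentCuts σ ε R T, a * b ≠ t * z

/-- Near `p`, and on the radial segments below such points, a product of two cut points only
involves the bent parts of the cuts, not the outside of the disc. For `t z` with `z` strictly on the
side `σ` the logarithm has `σ Im > 0`, whereas a product of cut points would force the imaginary
part to vanish. -/
theorem eventually_separated (hσ : σ = 1 ∨ σ = -1)
    (hS : ∀ R : ℝ, (S ∩ closedBall 0 R).Finite) (hS0 : (0 : ℂ) ∉ S)
    (hT : ∀ R : ℝ, (T ∩ closedBall 0 R).Finite) (hT0 : (0 : ℂ) ∉ T) (hp : p ≠ 0) :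
    ∃ R > 0, (∀ α ∈ S, ∀ β ∈ T, α * β = p → ‖α‖ < R ∧ ‖β‖ < R) ∧
      ∀ᶠ ε in 𝓝[>] (0 : ℝ), Separated σ ε R S T p := by
  obtain ⟨r₁, hr₁, hrS⟩ := exists_norm_lower_bound hS hS0
  obtain ⟨r₂, hr₂, hrT⟩ := exists_norm_lower_bound hT hT0
  set r := min (min r₁ r₂) 1 with hr
  have hr0 : 0 < r := by positivity
  have hr1 : r ≤ 1 := min_le_right _ _
  replace hrS : ∀ α ∈ S, r ≤ ‖α‖ := fun α hα =>
    ((min_le_left _ _).trans (min_le_left _ _)).trans (hrS α hα)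
  replace hrT : ∀ α ∈ T, r ≤ ‖α‖ := fun α hα =>
    ((min_le_left _ _).trans (min_le_right _ _)).trans (hrT α hα)
  -- Two numbers of modulus at least `r` with product of modulus at most `‖p‖ + 1` both have modulus
  -- less than `R`.
  set R := (‖p‖ + 1) / r + 1 with hR
  have hq : 0 ≤ (‖p‖ + 1) / r := by positivity
  have hR0 : 0 < R := by linarith
  have hrR : r ≤ R := by linarith
  have hlt : ∀ {a b : ℂ}, r ≤ ‖a‖ → r ≤ ‖b‖ → ‖a * b‖ ≤ ‖p‖ + 1 → ‖a‖ < R ∧ ‖b‖ < R := by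
    intro a b ha hb hab
    rw [norm_mul] at hab
    have h1 : ‖a‖ ≤ (‖p‖ + 1) / r := by rw [le_div_iff₀ hr0]; nlinarith [norm_nonneg a]
    have h2 : ‖b‖ ≤ (‖p‖ + 1) / r := by rw [le_div_iff₀ hr0]; nlinarith [norm_nonneg b]
    exact ⟨by linarith, by linarith⟩
  refine ⟨R, hR0, fun α hα β hβ h => hlt (hrS α hα) (hrT β hβ) (by rw [h]; linarith), ?_⟩
  have hgap : ∀ᶠ ε in 𝓝[>] (0 : ℝ), ∀ α ∈ {α ∈ S | ‖α‖ < R}, ∀ β ∈ {β ∈ T | ‖β‖ < R},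
      Gap ε (α * β / p) := by
    rw [eventually_all_finite (finite_inter_ball hS R)]
    intro α _
    rw [eventually_all_finite (finite_inter_ball hT R)]
    exact fun β _ => eventually_gap _
  filter_upwards [hgap, self_mem_nhdsWithin,
    Ioo_mem_nhdsGT (by positivity : 0 < 1 / (2 * (|Real.log (R / r)| + 1)))] with ε hgap hε hε'
  replace hε : 0 < ε := hε
  have hlog : ε * Real.log (R / r) ≤ 1 / 2 := by
    have h2 := hε'.2
    rw [lt_div_iff₀ (by positivity)] at h2
    have h3 := mul_le_mul_of_nonneg_left (le_abs_self (Real.log (R / r))) hε.le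
    linarith
  have hcore : ∀ {a b v : ℂ}, a ∈ bentCuts σ ε R S → b ∈ bentCuts σ ε R T → |v.im| ≤ ε →
      0 ≤ σ * v.im → a * b = p * Complex.exp v → ‖a * b‖ ≤ ‖p‖ + 1 →
      v.im = 0 ∧ (v = 0 → (a ∈ S ∧ ‖a‖ < R) ∧ b ∈ T ∧ ‖b‖ < R) := by
    intro a b v ha hb hv hv' h hab
    obtain ⟨haR, hbR⟩ := hlt (le_norm_of_mem_bentCuts hrR hrS ha)
      (le_norm_of_mem_bentCuts hrR hrT hb) hab
    obtain ⟨α, hα, hαR, w, hw, rfl⟩ := exists_of_mem_bentCuts ha haR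
    obtain ⟨β, hβ, hβR, w', hw', rfl⟩ := exists_of_mem_bentCuts hb hbR
    obtain ⟨h1, h2⟩ := eq_zero_of_mul_eq hσ hp hε hr0 hlog (hrS α hα) (hrT β hβ) hw hw' haR hbR
      (hgap α ⟨hα, hαR⟩ β ⟨hβ, hβR⟩) hv hv' h
    refine ⟨h1, fun hv0 => ?_⟩
    obtain ⟨rfl, rfl⟩ := h2 hv0
    simpa using ⟨⟨hα, hαR⟩, hβ, hβR⟩
  refine ⟨fun α hα hαR β hβ hβR w hw w' hw' h => ?_, fun a ha b hb h => ?_, ?_⟩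
  · obtain ⟨haR, hbR⟩ := hlt (a := α * Complex.exp w) (b := β * Complex.exp w')
      (le_norm_of_mem_bentCuts hrR hrS (Or.inr ⟨α, hα, hαR, w, hw, rfl⟩))
      (le_norm_of_mem_bentCuts hrR hrT (Or.inr ⟨β, hβ, hβR, w', hw', rfl⟩)) (by rw [h]; linarith)
    exact (eq_zero_of_mul_eq (v := 0) hσ hp hε hr0 hlog (hrS α hα) (hrT β hβ) hw hw' haR hbR
      (hgap α ⟨hα, hαR⟩ β ⟨hβ, hβR⟩) (by simpa using hε.le) (by simp) (by simpa using h)).2 rfl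
  · exact (hcore (v := 0) ha hb (by simpa using hε.le) (by simp) (by simpa using h)
      (by rw [h]; linarith)).2 rfl
  · have h1 : Tendsto (fun z : ℂ => Complex.log (z / p)) (𝓝 p) (𝓝 0) := by
      have : ContinuousAt (fun z : ℂ => Complex.log (z / p)) p :=
        ContinuousAt.clog (by fun_prop) (by simp [hp])
      simpa [ContinuousAt, hp] using this
    filter_upwards [h1 (ball_mem_nhds 0 hε), ball_mem_nhds p one_pos] with z hz hzp hside
    intro t ht a ha b hb hab
    have ht0 : 0 < t := by
      refine lt_of_le_of_ne ht.1 fun h => ?_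
      rw [← h, Complex.ofReal_zero, zero_mul] at hab
      rcases mul_eq_zero.mp hab with rfl | rfl
      exacts [zero_notMem_bentCuts hR0 hS0 ha, zero_notMem_bentCuts hR0 hT0 hb]
    have hzp0 : z / p ≠ 0 := fun h => by rw [h] at hside; simp at hside
    set v₀ := Complex.log (z / p) with hv₀
    have hexp : Complex.exp v₀ = z / p := Complex.exp_log hzp0
    have hv₀ε : |v₀.im| ≤ ε :=
      (Complex.abs_im_le_norm _).trans (mem_ball_zero_iff.mp hz).le
    have hsign : 0 ≤ σ * v₀.im := by
      have hneg : -σ = 1 ∨ -σ = -1 := by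
        rcases hσ with rfl | rfl <;> norm_num
      rcases sign_im_log hneg (v := z / p) (by linarith) with h | h
      · linarith
      · rw [h] at hside; simp at hside
    have hz1 : ‖z‖ ≤ ‖p‖ + 1 := by
      have := norm_add_le p (z - p)
      rw [add_sub_cancel] at this
      linarith [(mem_ball_iff_norm.mp hzp).le]
    have h5 := (hcore (v := v₀ + (Real.log t : ℂ)) ha hb (by simpa using hv₀ε)
      (by simpa using hsign) (by
        rw [hab, Complex.exp_add, hexp, ← Complex.ofReal_exp, Real.exp_log ht0]
        field_simp) (by
        rw [hab, norm_mul, Complex.norm_real, Real.norm_of_nonneg ht.1]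
        nlinarith [ht.2, norm_nonneg z])).1
    have h6 : v₀.im = 0 := by simpa using h5
    have h7 : (z / p).im = 0 := by rw [← hexp, Complex.exp_im, h6]; simp
    rw [h7] at hside
    simp at hside

end Separation

/-! ### Decomposition into slit integrals and a regular part. -/

section Decomposition

variable {σ ε R : ℝ} {S T : Set ℂ} {s : ℤˣ}

theorem real_mem_cutLog (hε : 0 < ε) {x : ℝ} (hx : x ∈ Icc 0 ε) : (x : ℂ) ∈ cutLog σ ε := by
  refine ⟨by simpa using hx.1, by simp, ?_, ?_⟩
  · simp only [Complex.ofReal_im, Complex.ofReal_re, mul_zero, zero_add]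
    nlinarith [mul_nonneg (sq_nonneg ε) hx.1]
  · simp only [Complex.ofReal_im, Complex.ofReal_re, mul_zero, zero_add]
    nlinarith [mul_le_mul_of_nonneg_left hx.2 (sq_nonneg ε)]

theorem mul_exp_mem_bentCuts (hε : 0 < ε) {α : ℂ} (hα : α ∈ S) (hαR : ‖α‖ < R) {x : ℝ}
    (hx : x ∈ Icc 0 ε) : α * Complex.exp x ∈ bentCuts σ ε R S :=
  Or.inr ⟨α, hα, hαR, x, real_mem_cutLog hε hx, rfl⟩

theorem subset_bentCuts (hε : 0 < ε) : S ⊆ bentCuts σ ε R S := fun α hα => by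
  by_cases hαR : ‖α‖ < R
  · simpa using mul_exp_mem_bentCuts (σ := σ) hε hα hαR (x := 0) ⟨le_rfl, hε.le⟩
  · exact Or.inl (not_lt.mp hαR)

/-- The part of a function that is regular at the starting points of the bent cuts. -/
theorem exists_regular_decomposition (hσ : (((s : ℤ) : ℝ)) = σ) {F : PowerSeries ℂ} {P : ℂ → ℂ}
    {f : ℂ → ℂ → ℂ} (hF : HasIsolatedSingularities s F S P f)
    (hint : ∀ α ∈ S, IsIntegrableSingularity α (f α)) (hR : 0 < R) {I : Finset ℂ}
    (hI : ∀ α, α ∈ I ↔ α ∈ S ∧ ‖α‖ < R) :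
    ∃ (ρ : ℝ) (D : ℂ → ℂ → ℂ), ρ ≤ 0 ∧ (∀ α ∈ I, DifferentiableOn ℂ (D α) (halfPlane ρ) ∧
      Vanishes (D α) ∧ ∀ ζ ∈ halfPlane ρ, monDelta (f α) ζ = theta (D α) ζ) ∧
      ∀ᶠ ε in 𝓝[>] (0 : ℝ), ∀ τ, 0 < τ → τ ≤ ε → Real.log (Real.exp τ - 1) < ρ →
        ∃ (F' : ℂ → ℂ) (K : Set ℂ) (G : ℂ → ℂ), DifferentiableOn ℂ F' (bentCuts σ ε R S)ᶜ ∧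
          HasTaylor (fun k => PowerSeries.coeff k F) F' ∧ IsClosed K ∧ K ⊆ bentCuts σ ε R S ∧
          (∀ α ∈ I, α ∉ K) ∧ DifferentiableOn ℂ G Kᶜ ∧
          HasTaylor (fun k => PowerSeries.coeff k F -
            ∑ α ∈ I, k * (slitCoeff 0 τ (radial (D α)) k * (α ^ k)⁻¹)) G := by
  classical
  have hσ' : σ = 1 ∨ σ = -1 := by
    rcases Int.units_eq_one_or s with rfl | rfl
    · left; simpa using hσ.symm
    · right; simpa using hσ.symm
  have hloc : ∀ α ∈ I, ∃ ρ, DifferentiableOn ℂ (f α) (halfPlane ρ) := fun α hα => by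
    obtain ⟨ρ, h, -⟩ := hF.localBranch α ((hI α).mp hα).1
    exact ⟨ρ, h⟩
  choose! ρf hρf using hloc
  obtain ⟨ρ, hρ⟩ := (insert 0 (I.image ρf)).bddBelow
  have hρ0 : ρ ≤ 0 := hρ (Finset.mem_insert_self _ _)
  have hf : ∀ α ∈ I, DifferentiableOn ℂ (f α) (halfPlane ρ) := fun α hα =>
    (hρf α hα).mono (halfPlane_mono (hρ (Finset.mem_insert_of_mem (Finset.mem_image_of_mem _ hα))))
  have h0 : ∀ α ∈ I, α ≠ 0 := fun α hα h => hF.zero_notMem (h ▸ ((hI α).mp hα).1)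
  have hfv : ∀ α ∈ I, Vanishes fun ζ => Complex.exp ζ * f α ζ := fun α hα =>
    (isIntegrableSingularity_iff (h0 α hα)).mp (hint α ((hI α).mp hα).1)
  have hDex : ∀ α ∈ I, ∃ D : ℂ → ℂ, DifferentiableOn ℂ D (halfPlane ρ) ∧ Vanishes D ∧
      ∀ ζ ∈ halfPlane ρ, monDelta (f α) ζ = theta D ζ := fun α hα =>
    hasVanishingPrimitive_monDelta hρ0 (hf α hα) (hfv α hα)
  choose! D hD using hDex
  refine ⟨ρ, D, hρ0, hD, ?_⟩
  filter_upwards [exists_bent_extension hσ hF hR,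
    eventually_gap_finite (finite_inter_ball hF.finite_inter R), self_mem_nhdsWithin]
    with ε hext hgap hε τ hτ hτε hτρ
  obtain ⟨F', hF'd, hF'a, hF'b⟩ := hext
  have hε0 : 0 < ε := hε
  have key := exists_regular_part
    (isClosed_bentCuts hσ' hF.finite_inter hF.zero_notMem)
    (zero_notMem_bentCuts hR hF.zero_notMem) hF'd hF'a (I := I) (f := f) (D := D) (ρ := ρ) (τ := τ)
    (fun α hα x hx => mul_exp_mem_bentCuts hε0 ((hI α).mp hα).1 ((hI α).mp hα).2
      ⟨hx.1, hx.2.trans hτε⟩)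
    (fun α hα β hβ x hx h => ?_) hf hfv (fun α hα => (hD α hα).1) (fun α hα => (hD α hα).2.1)
    (fun α hα ζ hζ => ((hD α hα).2.2 ζ hζ).symm) hτ hτρ
    (fun α hα => hF'b α ((hI α).mp hα).1 ((hI α).mp hα).2)
  · obtain ⟨K, G, h1, h2, h3, h4, h5⟩ := key
    exact ⟨F', K, G, hF'd, hF'a, h1, h2, h3, h4, h5⟩
  · have h6 := (hgap β ((hI β).mp hβ) α ((hI α).mp hα) x (by
      rw [h, mul_div_cancel_left₀ _ (h0 β hβ)]) (by simpa using hε0.le)).2 (by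
        rw [Complex.ofReal_re, abs_of_nonneg hx.1]
        linarith [hx.2])
    rw [Complex.ofReal_re] at h6
    simpa [h6] using h

end Decomposition

/-! ### The Hadamard product near a point. -/

section Central

variable {s : ℤˣ} {σ : ℝ} {F G : PowerSeries ℂ} {S T : Set ℂ} {P Q : ℂ → ℂ} {f g : ℂ → ℂ → ℂ}

/-- Local structure of a Hadamard product at `p ≠ 0`. -/
theorem exists_local_structure (hσ : (((s : ℤ) : ℝ)) = σ) (hF : HasIsolatedSingularities s F S P f)
    (hfi : ∀ α ∈ S, IsIntegrableSingularity α (f α)) (hG : HasIsolatedSingularities s G T Q g)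
    (hgi : ∀ β ∈ T, IsIntegrableSingularity β (g β)) {p : ℂ} (hp : p ≠ 0) {H : ℂ → ℂ}
    (hH : HasTaylor (fun k => PowerSeries.coeff k F * PowerSeries.coeff k G) H)
    (hHa : ∀ z, (∀ t ∈ Icc (0 : ℝ) 1, ∀ α ∈ S, ∀ β ∈ T, α * β ≠ t * z) → AnalyticAt ℂ H z) :
    ∃ (X : Finset (ℂ × ℂ)) (ρ : ℝ) (K : ℂ → ℂ) (Θ : ℂ × ℂ → ℂ → ℂ),
      (∀ x, x ∈ X ↔ x.1 ∈ S ∧ x.2 ∈ T ∧ x.1 * x.2 = p) ∧ ρ ≤ 0 ∧ AnalyticAt ℂ K p ∧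
      (∀ x ∈ X, HasVanishingPrimitive ρ (monDelta (f x.1)) ∧
        HasVanishingPrimitive ρ (monDelta (g x.2)) ∧ DifferentiableOn ℂ (Θ x) (halfPlane ρ) ∧
        Vanishes (fun ζ => Complex.exp ζ * Θ x ζ) ∧
        ∀ ζ ∈ halfPlane ρ, monDelta (Θ x) ζ = conv (monDelta (f x.1)) (monDelta (g x.2)) ζ) ∧
      ∀ᶠ z in 𝓝 p, 0 < σ * (z / p).im →
        H z = K z + ∑ x ∈ X, Θ x (Complex.log (1 - z / p)) := by
  classical
  have hσ' : σ = 1 ∨ σ = -1 := by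
    rcases Int.units_eq_one_or s with rfl | rfl
    · left; simpa using hσ.symm
    · right; simpa using hσ.symm
  obtain ⟨R, hR, hpR, hsep⟩ := eventually_separated hσ' hF.finite_inter hF.zero_notMem
    hG.finite_inter hG.zero_notMem hp
  set I := (finite_inter_ball hF.finite_inter R).toFinset with hIdef
  set J := (finite_inter_ball hG.finite_inter R).toFinset with hJdef
  have hI : ∀ α, α ∈ I ↔ α ∈ S ∧ ‖α‖ < R := fun α => by simp [hIdef]
  have hJ : ∀ β, β ∈ J ↔ β ∈ T ∧ ‖β‖ < R := fun β => by simp [hJdef]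
  obtain ⟨ρ₁, D₁, hρ₁, hD₁, hdec₁⟩ := exists_regular_decomposition hσ hF hfi hR hI
  obtain ⟨ρ₂, D₂, hρ₂, hD₂, hdec₂⟩ := exists_regular_decomposition hσ hG hgi hR hJ
  obtain ⟨ε, hsep, hdec₁, hdec₂, hε⟩ :=
    (hsep.and (hdec₁.and (hdec₂.and self_mem_nhdsWithin))).exists
  replace hε : 0 < ε := hε
  set ρ := min ρ₁ ρ₂ with hρdef
  have hρ0 : ρ ≤ 0 := (min_le_left _ _).trans hρ₁
  -- The slits must lie in the straight initial part of the cuts and in the discs where the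
  -- primitives `D` live; `log (1 + exp (ρ - 1))` is the value with `log (exp τ - 1) = ρ - 1`.
  obtain ⟨τ, hτ, hτε, hτρ⟩ : ∃ τ, 0 < τ ∧ τ ≤ ε ∧ Real.log (Real.exp τ - 1) < ρ := by
    have h1 : 0 < Real.log (1 + Real.exp (ρ - 1)) :=
      Real.log_pos (by linarith [Real.exp_pos (ρ - 1)])
    refine ⟨min ε (Real.log (1 + Real.exp (ρ - 1))), lt_min hε h1, min_le_left _ _, ?_⟩
    have h2 := log_exp_sub_one_le (lt_min hε h1) (min_le_right ε (Real.log (1 + Real.exp (ρ - 1))))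
    rw [Real.exp_log (by positivity), add_sub_cancel_left, Real.log_exp] at h2
    linarith
  set x₀ := Real.log (Real.exp τ - 1) with hx₀
  obtain ⟨F', K₁, F₁, hF', hF'a, hK₁, hK₁A, hIK₁, hF₁, hF₁a⟩ :=
    hdec₁ τ hτ hτε (hτρ.trans_le (min_le_left _ _))
  obtain ⟨G', K₂, G₁, hG', hG'a, hK₂, hK₂B, hJK₂, hG₁, hG₁a⟩ :=
    hdec₂ τ hτ hτε (hτρ.trans_le (min_le_right _ _))
  have hD₁' : ∀ α ∈ I, DifferentiableOn ℂ (D₁ α) (halfPlane ρ) := fun α hα =>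
    (hD₁ α hα).1.mono (halfPlane_mono (min_le_left _ _))
  have hD₂' : ∀ β ∈ J, DifferentiableOn ℂ (D₂ β) (halfPlane ρ) := fun β hβ =>
    (hD₂ β hβ).1.mono (halfPlane_mono (min_le_right _ _))
  have hA0 : (0 : ℂ) ∉ bentCuts σ ε R S := zero_notMem_bentCuts hR hF.zero_notMem
  have hB0 : (0 : ℂ) ∉ bentCuts σ ε R T := zero_notMem_bentCuts hR hG.zero_notMem
  have hA := isClosed_bentCuts (ε := ε) (R := R) hσ' hF.finite_inter hF.zero_notMem
  have hB := isClosed_bentCuts (ε := ε) (R := R) hσ' hG.finite_inter hG.zero_notMem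
  -- the product of the regular part of the first factor with the second factor
  obtain ⟨H₁, hH₁, hH₁a⟩ := exists_hadamard hB hB0 hK₁ (fun h => hA0 (hK₁A h))
    (continuous_spiral σ ε).continuousOn (spiral_zero σ ε) (spiral_one σ ε)
    (curveStar_bentCuts hσ' hR hG.zero_notMem) hG' hF₁ hG'a hF₁a
  -- the products of the Cauchy integrals with the regular part of the second factor
  have hpart : ∀ α ∈ I, ∃ H₂ : ℂ → ℂ, (∀ z, (∀ a ∈ bentCuts σ ε R S, ∀ b ∈ K₂, a * b ≠ z) →
      AnalyticAt ℂ H₂ z) ∧ HasTaylor (fun k =>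
        (k * (slitCoeff 0 τ (radial (D₁ α)) k * (α ^ k)⁻¹)) * (PowerSeries.coeff k G -
          ∑ β ∈ J, k * (slitCoeff 0 τ (radial (D₂ β)) k * (β ^ k)⁻¹))) H₂ := fun α hα => by
    have hα' := (hI α).mp hα
    have hα0 : α ≠ 0 := fun h => hF.zero_notMem (h ▸ hα'.1)
    have hi := intervalIntegrable_radial (hD₁' α hα) (hD₁ α hα).2.1 hτ.le hτρ
    refine exists_hadamard hA hA0 hK₂ (fun h => hB0 (hK₂B h))
      (continuous_spiral σ ε).continuousOn (spiral_zero σ ε) (spiral_one σ ε)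
      (curveStar_bentCuts hσ' hR hF.zero_notMem) (fun z hz => ?_) hG₁
      (hasTaylor_euler_slitAt le_rfl hτ.le hi α) hG₁a
    refine (analyticAt_euler (analyticAt_slitAt hτ.le hi ?_)).differentiableAt.differentiableWithinAt
    rintro ⟨x, hx, h1⟩
    refine hz ?_
    have h2 : z = α * Complex.exp x := by
      simp only at h1
      rw [h1, mul_div_cancel₀ _ hα0]
    rw [h2]
    exact mul_exp_mem_bentCuts hε hα'.1 hα'.2 ⟨hx.1, hx.2.trans hτε⟩
  choose! H₂ hH₂ hH₂a using hpart
  -- the products of two Cauchy integrals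
  have hprod : ∀ α ∈ I, ∀ β ∈ J, ∃ (C E : ℂ → ℂ) (Ψ : ℝ → ℂ), DifferentiableOn ℂ C (halfPlane ρ) ∧
      Vanishes C ∧ DifferentiableOn ℂ E (halfPlane ρ) ∧ Vanishes E ∧
      (∀ ζ ∈ halfPlane ρ, theta C ζ = E ζ) ∧
      (∀ ζ ∈ halfPlane ρ, conv (monDelta (f α)) (monDelta (g β)) ζ = theta E ζ) ∧
      IntervalIntegrable Ψ volume τ (2 * τ) ∧
      ∀ k, slitCoeff 0 τ (radial (D₁ α)) k * slitCoeff 0 τ (radial (D₂ β)) k =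
        slitCoeff 0 τ (radial C) k + slitCoeff τ (2 * τ) Ψ k := fun α hα β hβ => by
    obtain ⟨C, E, h1, h2, h3, h4, h5, h6, h7⟩ := exists_conv_primitives hρ0 (hD₁' α hα)
      (hD₁ α hα).2.1 (hD₂' β hβ) (hD₂ β hβ).2.1
    obtain ⟨Ψ, h8, h9⟩ := exists_slit_mul hτ hτρ (hD₁' α hα) (hD₁ α hα).2.1 (hD₂' β hβ)
      (hD₂ β hβ).2.1 h5
    refine ⟨C, E, Ψ, h1, h2, h3, h4, h6, fun ζ hζ => ?_, h8, h9⟩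
    rw [← (h7 ζ hζ).2]
    exact conv_congr hρ0
      (fun w hw => (hD₁ α hα).2.2 w (halfPlane_mono (min_le_left _ _) hw))
      (fun w hw => (hD₂ β hβ).2.2 w (halfPlane_mono (min_le_right _ _) hw)) hζ
  choose! C E Ψ hCd hCv hEd hEv hCE hconv hΨ hcoeff using hprod
  set V : ℂ × ℂ → ℂ → ℂ := fun x => euler (euler (slitAt (x.1 * x.2) 0 τ (radial (C x.1 x.2))))
    with hV
  set W : ℂ × ℂ → ℂ → ℂ := fun x => euler (euler (slitAt (x.1 * x.2) τ (2 * τ) (Ψ x.1 x.2)))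
    with hW
  have hCi : ∀ x ∈ I ×ˢ J, IntervalIntegrable (radial (C x.1 x.2)) volume 0 τ := fun x hx => by
    obtain ⟨h1, h2⟩ := Finset.mem_product.mp hx
    exact intervalIntegrable_radial (hCd _ h1 _ h2) (hCv _ h1 _ h2) hτ.le hτρ
  have hmem : ∀ x ∈ I ×ˢ J, (x.1 ∈ S ∧ ‖x.1‖ < R) ∧ x.2 ∈ T ∧ ‖x.2‖ < R := fun x hx =>
    ⟨(hI _).mp (Finset.mem_product.mp hx).1, (hJ _).mp (Finset.mem_product.mp hx).2⟩
  have hne0 : ∀ x ∈ I ×ˢ J, x.1 * x.2 ≠ 0 := fun x hx => mul_ne_zero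
    (fun h => hF.zero_notMem (h ▸ (hmem x hx).1.1)) (fun h => hG.zero_notMem (h ▸ (hmem x hx).2.1))
  have hVa : ∀ x ∈ I ×ˢ J, ∀ z, (∀ y ∈ Icc 0 τ, x.1 * x.2 * Complex.exp (y : ℝ) ≠ z) →
      AnalyticAt ℂ (V x) z := fun x hx z hz => by
    refine analyticAt_euler (analyticAt_euler (analyticAt_slitAt hτ.le (hCi x hx) ?_))
    rintro ⟨y, hy, h1⟩
    refine hz y hy ?_
    simp only at h1
    rw [h1, mul_div_cancel₀ _ (hne0 x hx)]
  have hWa : ∀ x ∈ I ×ˢ J, ∀ z, (∀ y ∈ Icc τ (2 * τ), x.1 * x.2 * Complex.exp (y : ℝ) ≠ z) →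
      AnalyticAt ℂ (W x) z := fun x hx z hz => by
    obtain ⟨i1, i2⟩ := Finset.mem_product.mp hx
    refine analyticAt_euler (analyticAt_euler (analyticAt_slitAt (by linarith) (hΨ _ i1 _ i2) ?_))
    rintro ⟨y, hy, h1⟩
    refine hz y hy ?_
    simp only at h1
    rw [h1, mul_div_cancel₀ _ (hne0 x hx)]
  -- A point of a product slit is a product of two cut points at half the parameter, so separation
  -- also controls the slits, up to `2 τ ≤ 2 ε`.
  have hhalf : ∀ α β : ℂ, ∀ y : ℝ, α * β * Complex.exp (y : ℝ) =
      α * Complex.exp (y / 2 : ℝ) * (β * Complex.exp (y / 2 : ℝ)) := fun α β y => by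
    have : Complex.exp (y : ℝ) = Complex.exp (y / 2 : ℝ) * Complex.exp (y / 2 : ℝ) := by
      rw [← Complex.exp_add]; congr 1; push_cast; ring
    rw [this]; ring
  have hy2 : ∀ y ∈ Icc 0 (2 * τ), y / 2 ∈ Icc 0 ε := fun y hy =>
    ⟨by linarith [hy.1], by linarith [hy.2]⟩
  -- comparison along radial segments
  set K : ℂ → ℂ := fun z => H₁ z + ∑ α ∈ I, H₂ α z + ∑ x ∈ I ×ˢ J, W x z +
    ∑ x ∈ (I ×ˢ J).filter (fun x => ¬ x.1 * x.2 = p), V x z with hK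
  set X := (I ×ˢ J).filter (fun x => x.1 * x.2 = p) with hX
  have hXIJ : ∀ x ∈ X, x ∈ I ×ˢ J := fun x hx => (Finset.mem_filter.mp hx).1
  have htaylor : HasTaylor (fun k => PowerSeries.coeff k F * PowerSeries.coeff k G)
      fun z => H₁ z + ∑ α ∈ I, H₂ α z + ∑ x ∈ I ×ˢ J, (V x z + W x z) := by
    have h1 := (hH₁a.add (hasTaylor_sum hH₂a)).add (hasTaylor_sum (s := I ×ˢ J) fun x hx =>
      ((hasTaylor_euler_slitAt le_rfl hτ.le (hCi x hx) (x.1 * x.2)).euler.add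
        (hasTaylor_euler_slitAt hτ.le (by linarith) (hΨ _ (Finset.mem_product.mp hx).1 _
          (Finset.mem_product.mp hx).2) (x.1 * x.2)).euler))
    refine Eq.mp ?_ h1
    congr 1
    funext k
    -- The Hadamard product of two Euler derivatives is the second Euler derivative of the Hadamard
    -- product: each operator contributes a factor `k`.
    have h2 : ∀ x ∈ I ×ˢ J, (k : ℂ) * (k * (slitCoeff 0 τ (radial (C x.1 x.2)) k *
        ((x.1 * x.2) ^ k)⁻¹)) + k * (k * (slitCoeff τ (2 * τ) (Ψ x.1 x.2) k *
          ((x.1 * x.2) ^ k)⁻¹)) =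
        (k * (slitCoeff 0 τ (radial (D₁ x.1)) k * (x.1 ^ k)⁻¹)) *
          (k * (slitCoeff 0 τ (radial (D₂ x.2)) k * (x.2 ^ k)⁻¹)) := fun x hx => by
      have h3 := hcoeff _ (Finset.mem_product.mp hx).1 _ (Finset.mem_product.mp hx).2 k
      rw [mul_pow, mul_inv]
      linear_combination (-((k : ℂ) * k * (x.1 ^ k)⁻¹ * (x.2 ^ k)⁻¹)) * h3
    have h4 : ∀ u v : ℂ → ℂ, ∑ x ∈ I ×ˢ J, u x.1 * v x.2 = (∑ α ∈ I, u α) * ∑ β ∈ J, v β :=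
      fun u v => by rw [Finset.sum_product, Finset.sum_mul_sum]
    rw [Finset.sum_congr rfl h2, h4 (fun α => k * (slitCoeff 0 τ (radial (D₁ α)) k * (α ^ k)⁻¹))
      (fun β => k * (slitCoeff 0 τ (radial (D₂ β)) k * (β ^ k)⁻¹)), ← Finset.sum_mul]
    ring
  refine ⟨X, x₀, K, fun x => theta (theta (cauchySolution (C x.1 x.2) x₀)), fun x => ?_,
    hτρ.le.trans hρ0, ?_, fun x hx => ?_, ?_⟩
  · rw [hX, Finset.mem_filter, Finset.mem_product, hI, hJ]
    constructor
    · rintro ⟨⟨h1, h2⟩, h3⟩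
      exact ⟨h1.1, h2.1, h3⟩
    · rintro ⟨h1, h2, h3⟩
      have h4 := hpR _ h1 _ h2 h3
      exact ⟨⟨⟨h1, h4.1⟩, h2, h4.2⟩, h3⟩
  · refine ((AnalyticAt.add ?_ ?_).add ?_).add ?_
    · refine hH₁ p fun b hb a ha h => ?_
      have h1 := (hsep.mem a (hK₁A ha) b hb (by rw [← h]; ring)).1
      exact hIK₁ a ((hI a).mpr h1) ha
    · refine Finset.analyticAt_fun_sum _ fun α hα => hH₂ α hα p fun a ha b hb h => ?_
      have h1 := (hsep.mem a ha b (hK₂B hb) h).2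
      exact hJK₂ b ((hJ b).mpr h1) hb
    · refine Finset.analyticAt_fun_sum _ fun x hx => hWa x hx p fun y hy h => ?_
      obtain ⟨h1, h2⟩ := hmem x hx
      have h3 := hy2 y ⟨hτ.le.trans hy.1, hy.2⟩
      rw [hhalf] at h
      have h4 := (hsep.eq_zero _ h1.1 h1.2 _ h2.1 h2.2 _ (real_mem_cutLog hε h3) _
        (real_mem_cutLog hε h3) h).1
      rw [Complex.ofReal_eq_zero] at h4
      linarith [hy.1]
    · refine Finset.analyticAt_fun_sum _ fun x hx => ?_
      obtain ⟨hx, hxp⟩ := Finset.mem_filter.mp hx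
      refine hVa x hx p fun y hy h => hxp ?_
      obtain ⟨h1, h2⟩ := hmem x hx
      have h3 := hy2 y ⟨hy.1, by linarith [hy.2]⟩
      rw [hhalf] at h
      have h4 := (hsep.eq_zero _ h1.1 h1.2 _ h2.1 h2.2 _ (real_mem_cutLog hε h3) _
        (real_mem_cutLog hε h3) h).1
      rw [h4, Complex.exp_zero, mul_one, mul_one] at h
      exact h
  · obtain ⟨h1, h2⟩ := Finset.mem_product.mp (hXIJ x hx)
    have h3 := theta_theta_cauchySolution (hCd _ h1 _ h2) (hCv _ h1 _ h2) (hEd _ h1 _ h2)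
      (hEv _ h1 _ h2) (hCE _ h1 _ h2) hτρ
    have hx₁ : x₀ ≤ ρ₁ := hτρ.le.trans (min_le_left _ _)
    have hx₂ : x₀ ≤ ρ₂ := hτρ.le.trans (min_le_right _ _)
    refine ⟨HasVanishingPrimitive.mono ⟨_, hD₁ _ h1⟩ hx₁,
      HasVanishingPrimitive.mono ⟨_, hD₂ _ h2⟩ hx₂, h3.1, h3.2.1, fun ζ hζ => ?_⟩
    rw [hconv _ h1 _ h2 ζ (halfPlane_mono hτρ.le hζ)]
    exact h3.2.2 ζ hζ
  · have hlim : Tendsto (fun z : ℂ => 1 - z / p) (𝓝 p) (𝓝 0) := by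
      have : ContinuousAt (fun z : ℂ => 1 - z / p) p := by fun_prop
      simpa [ContinuousAt, hp] using this
    filter_upwards [hsep.side, hlim (ball_mem_nhds (0 : ℂ) (Real.exp_pos x₀))] with z hz hz0 hside
    replace hz := hz hside
    have h1 : H z = H₁ z + ∑ α ∈ I, H₂ α z + ∑ x ∈ I ×ˢ J, (V x z + W x z) := by
      -- The pieces `H₁` and `H₂` were constructed along spirals, but the comparison with the
      -- principal branch runs along the straight segment, on which `hsep.side` makes all of them
      -- holomorphic.
      refine eq_of_hasTaylor hH htaylor (c := fun t : ℝ => (t : ℂ)) (by fun_prop) (by simp)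
        (by simp) (fun t ht => hHa _ fun t' ht' α hα β hβ h => ?_) fun t ht => ?_
      · refine hz (t' * t) ⟨mul_nonneg ht'.1 ht.1, mul_le_one₀ ht'.2 ht.1 ht.2⟩ α
          (subset_bentCuts hε hα) β (subset_bentCuts hε hβ) ?_
        rw [h]; push_cast; ring
      · have hxy : ∀ x ∈ I ×ˢ J, ∀ y ∈ Icc 0 (2 * τ), x.1 * x.2 * Complex.exp (y : ℝ) ≠ t * z := by
          intro x hx y hy h
          obtain ⟨h1, h2⟩ := hmem x hx
          rw [hhalf] at h
          exact hz t ht _ (mul_exp_mem_bentCuts hε h1.1 h1.2 (hy2 y hy)) _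
            (mul_exp_mem_bentCuts hε h2.1 h2.2 (hy2 y hy)) h
        refine (AnalyticAt.add ?_ ?_).add ?_
        · refine hH₁ _ fun b hb a ha h => hz t ht a (hK₁A ha) b hb (by rw [← h]; ring)
        · exact Finset.analyticAt_fun_sum _ fun α hα => hH₂ α hα _ fun a ha b hb h =>
            hz t ht a ha b (hK₂B hb) h
        · exact Finset.analyticAt_fun_sum _ fun x hx =>
            (hVa x hx _ fun y hy => hxy x hx y ⟨hy.1, by linarith [hy.2]⟩).add
              (hWa x hx _ fun y hy => hxy x hx y ⟨hτ.le.trans hy.1, hy.2⟩)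
    have hne : 1 - z / p ≠ 0 := fun h => by
      rw [← sub_eq_zero.mp h] at hside; simp at hside
    have hexp := Complex.exp_log hne
    have hch : chart p (Complex.log (1 - z / p)) = z := by
      rw [chart, hexp]; field_simp; ring
    have hstrip : Complex.log (1 - z / p) ∈
        {ζ : ℂ | ζ.re < Real.log (Real.exp τ - 1) ∧ |ζ.im| < Real.pi} := by
      refine ⟨?_, ?_⟩
      · rw [Complex.log_re, ← hx₀, Real.log_lt_iff_lt_exp (norm_pos_iff.mpr hne)]
        exact mem_ball_zero_iff.mp hz0
      · rw [Complex.log_im]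
        refine abs_lt.mpr ⟨Complex.neg_pi_lt_arg _, Complex.arg_lt_pi_iff.mpr (Or.inr fun h => ?_)⟩
        rw [Complex.sub_im, Complex.one_im, zero_sub, neg_eq_zero] at h
        rw [h] at hside; simp at hside
    have hVθ : ∀ x ∈ X, V x z =
        theta (theta (cauchySolution (C x.1 x.2) x₀)) (Complex.log (1 - z / p)) := fun x hx => by
      obtain ⟨i1, i2⟩ := Finset.mem_product.mp (hXIJ x hx)
      have h2 := euler_euler_slitAt_chart hp (hCd _ i1 _ i2) (hCv _ i1 _ i2) hτ hτρ _ hstrip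
      rw [hch] at h2
      rw [← h2, hV]
      simp only [(Finset.mem_filter.mp hx).2]
    rw [h1, Finset.sum_add_distrib, ← Finset.sum_filter_add_sum_filter_not (I ×ˢ J)
      (fun x => x.1 * x.2 = p) (fun x => V x z), Finset.sum_congr rfl hVθ]
    simp only [hK]
    ring

end Central

/-! ### Two factors. -/

section TwoFactors

variable {s : ℤˣ} {F G : PowerSeries ℂ} {S T : Set ℂ} {P Q : ℂ → ℂ} {f g : ℂ → ℂ → ℂ}

theorem exists_chart_of_eventually {γ : ℂ} (hγ : γ ≠ 0) {q : ℂ → Prop} (h : ∀ᶠ z in 𝓝 γ, q z) :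
    ∃ ρ : ℝ, ∀ ζ : ℂ, ζ.re < ρ → q (chart γ ζ) := by
  obtain ⟨δ, hδ, hq⟩ := Metric.eventually_nhds_iff_ball.mp h
  have hγ' : 0 < ‖γ‖ := norm_pos_iff.mpr hγ
  refine ⟨Real.log (δ / ‖γ‖), fun ζ hζ => hq _ ?_⟩
  rw [Real.lt_log_iff_exp_lt (by positivity), lt_div_iff₀ hγ'] at hζ
  have : chart γ ζ - γ = -(γ * Complex.exp ζ) := by rw [chart]; ring
  rw [mem_ball_iff_norm, this, norm_neg, norm_mul, Complex.norm_exp]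
  linarith

theorem chart_add_period (γ ζ : ℂ) : chart γ (ζ + 2 * Real.pi * Complex.I) = chart γ ζ := by
  rw [chart, chart, Complex.exp_periodic ζ]

/-- The principal branch of a Hadamard product. -/
theorem exists_principal_hadamard (hF : HasIsolatedSingularities s F S P f)
    (hG : HasIsolatedSingularities s G T Q g) :
    ∃ H : ℂ → ℂ, HasTaylor (fun k => PowerSeries.coeff k F * PowerSeries.coeff k G) H ∧
      ∀ z, (∀ t ∈ Icc (0 : ℝ) 1, ∀ α ∈ S, ∀ β ∈ T, α * β ≠ t * z) → AnalyticAt ℂ H z := by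
  have hcl : ∀ {S : Set ℂ}, (∀ R : ℝ, (S ∩ closedBall 0 R).Finite) → IsClosed (starDomain S)ᶜ :=
    fun hS => (isOpen_starDomain (isClosed_of_finite_inter hS)).isClosed_compl
  have h0 : ∀ {S : Set ℂ}, (0 : ℂ) ∉ S → (0 : ℂ) ∉ (starDomain S)ᶜ := fun hS h =>
    h fun t _ => by simpa using hS
  have hex : ∀ {S : Set ℂ} {z : ℂ}, z ∈ (starDomain S)ᶜ → ∃ t ∈ Icc (0 : ℝ) 1, (t : ℂ) * z ∈ S :=
    fun {S z} hz => by simpa [starDomain, and_assoc] using hz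
  obtain ⟨H, hH, hHa⟩ := exists_hadamard (hcl hF.finite_inter) (h0 hF.zero_notMem)
    (hcl hG.finite_inter) (h0 hG.zero_notMem) (c := fun t : ℝ => (t : ℂ)) (by fun_prop) (by simp)
    (by simp) (fun t ht z hz => by
      obtain ⟨t', ht', h⟩ := hex hz
      refine fun hz' => hz' (t' * t) ⟨mul_nonneg ht'.1 ht.1, mul_le_one₀ ht'.2 ht.1 ht.2⟩ ?_
      rwa [Complex.ofReal_mul, mul_assoc])
    (by rw [compl_compl]; exact hF.principal.differentiableOn)
    (by rw [compl_compl]; exact hG.principal.differentiableOn)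
    hF.principal.hasSum hG.principal.hasSum
  refine ⟨H, hHa, fun z hz => hH z fun a ha b hb hab => ?_⟩
  obtain ⟨t, ht, hta⟩ := hex ha
  obtain ⟨t', ht', htb⟩ := hex hb
  refine hz (t * t') ⟨mul_nonneg ht.1 ht'.1, mul_le_one₀ ht.2 ht'.1 ht'.2⟩ _ hta _ htb ?_
  rw [← hab]; push_cast; ring

/-- The set of products of two sets. -/
def mulSet (S T : Set ℂ) : Set ℂ := {γ | ∃ α ∈ S, ∃ β ∈ T, α * β = γ}

theorem finite_mulSet (hS : ∀ R : ℝ, (S ∩ closedBall 0 R).Finite) (hS0 : (0 : ℂ) ∉ S)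
    (hT : ∀ R : ℝ, (T ∩ closedBall 0 R).Finite) (hT0 : (0 : ℂ) ∉ T) (R : ℝ) :
    (mulSet S T ∩ closedBall 0 R).Finite := by
  obtain ⟨r₁, hr₁, hrS⟩ := exists_norm_lower_bound hS hS0
  obtain ⟨r₂, hr₂, hrT⟩ := exists_norm_lower_bound hT hT0
  refine (((hS (R / r₂)).prod (hT (R / r₁))).image fun x => x.1 * x.2).subset ?_
  rintro _ ⟨⟨α, hα, β, hβ, rfl⟩, h⟩
  rw [mem_closedBall_zero_iff, norm_mul] at h
  refine ⟨(α, β), ⟨⟨hα, ?_⟩, hβ, ?_⟩, rfl⟩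
  · rw [mem_closedBall_zero_iff, le_div_iff₀ hr₂]
    nlinarith [hrT β hβ, norm_nonneg α]
  · rw [mem_closedBall_zero_iff, le_div_iff₀ hr₁]
    nlinarith [hrS α hα, norm_nonneg β]

/-- The Hadamard product of two germs with isolated integrable singularities. -/
theorem hasIsolatedSingularities_hadamard (hF : HasIsolatedSingularities s F S P f)
    (hfi : ∀ α ∈ S, IsIntegrableSingularity α (f α)) (hG : HasIsolatedSingularities s G T Q g)
    (hgi : ∀ β ∈ T, IsIntegrableSingularity β (g β)) :
    ∃ (H : ℂ → ℂ) (h : ℂ → ℂ → ℂ),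
      HasIsolatedSingularities s
        (PowerSeries.mk fun k => PowerSeries.coeff k F * PowerSeries.coeff k G) (mulSet S T) H h ∧
      (∀ γ ∈ mulSet S T, IsIntegrableSingularity γ (h γ)) ∧
      ∀ γ ∈ mulSet S T, ∃ (X : Finset (ℂ × ℂ)) (ρ : ℝ), ρ ≤ 0 ∧
        (∀ x, x ∈ X ↔ x.1 ∈ S ∧ x.2 ∈ T ∧ x.1 * x.2 = γ) ∧
        (∀ x ∈ X, HasVanishingPrimitive ρ (monDelta (f x.1)) ∧
          HasVanishingPrimitive ρ (monDelta (g x.2))) ∧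
        ∀ ζ ∈ halfPlane ρ, monDelta (h γ) ζ =
          ∑ x ∈ X, conv (monDelta (f x.1)) (monDelta (g x.2)) ζ := by
  obtain ⟨H, hH, hHa⟩ := exists_principal_hadamard hF hG
  have h0 : (0 : ℂ) ∉ mulSet S T := by
    rintro ⟨α, hα, β, hβ, h⟩
    rcases mul_eq_zero.mp h with rfl | rfl
    exacts [hF.zero_notMem hα, hG.zero_notMem hβ]
  have hloc : ∀ γ ∈ mulSet S T, ∃ h : ℂ → ℂ, IsLocalBranch s H γ h ∧
      IsIntegrableSingularity γ h ∧ ∃ (X : Finset (ℂ × ℂ)) (ρ : ℝ), ρ ≤ 0 ∧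
        (∀ x, x ∈ X ↔ x.1 ∈ S ∧ x.2 ∈ T ∧ x.1 * x.2 = γ) ∧
        (∀ x ∈ X, HasVanishingPrimitive ρ (monDelta (f x.1)) ∧
          HasVanishingPrimitive ρ (monDelta (g x.2))) ∧
        ∀ ζ ∈ halfPlane ρ, monDelta h ζ =
          ∑ x ∈ X, conv (monDelta (f x.1)) (monDelta (g x.2)) ζ := by
    intro γ hγ
    have hγ0 : γ ≠ 0 := fun h => h0 (h ▸ hγ)
    obtain ⟨X, ρ, K, Θ, hX, hρ, hK, hΘ, hHK⟩ :=
      exists_local_structure rfl hF hfi hG hgi hγ0 hH hHa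
    obtain ⟨ρ₁, hρ₁⟩ := exists_chart_of_eventually hγ0 (hHK.and hK.eventually_analyticAt)
    -- The regular part `K` is pulled back by the periodic chart, so it has no monodromy; all of it
    -- comes from the `Θ x`.
    refine ⟨fun ζ => K (chart γ ζ) + ∑ x ∈ X, Θ x ζ, ⟨min ρ ρ₁, ?_, fun ζ hζ him hside => ?_⟩, ?_,
      X, ρ, hρ, hX, fun x hx => ⟨(hΘ x hx).1, (hΘ x hx).2.1⟩, fun ζ hζ => ?_⟩
    · refine DifferentiableOn.add (fun ζ hζ => ?_) (DifferentiableOn.fun_sum fun x hx => ?_)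
      · exact (AnalyticAt.fun_comp (g := K) (f := chart γ)
          (hρ₁ ζ (lt_of_lt_of_le hζ (min_le_right _ _))).2
          (analyticAt_chart γ ζ)).differentiableAt.differentiableWithinAt
      · exact (hΘ x hx).2.2.1.mono (halfPlane_mono (min_le_left _ _))
    · have h1 := (hρ₁ ζ (lt_of_lt_of_le hζ (min_le_right _ _))).1 hside
      rwa [chart_div hγ0, sub_sub_cancel, Complex.log_exp (abs_lt.mp him).1 (abs_lt.mp him).2.le]
        at h1
    · rw [isIntegrableSingularity_iff hγ0]
      have h1 : Vanishes fun ζ => K (chart γ ζ) * Complex.exp ζ := by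
        refine vanishes_exp.mul_bounded fun M => ?_
        obtain ⟨ρ₂, hρ₂⟩ := exists_chart_of_eventually hγ0
          (hK.continuousAt.norm.eventually_lt_const (lt_add_one ‖K γ‖))
        exact ⟨‖K γ‖ + 1, ρ₂ - 1, fun ζ h _ => (hρ₂ ζ (by linarith)).le⟩
      have h2 := h1.add (vanishes_sum X fun x hx => (hΘ x hx).2.2.2.1)
      refine h2.congr (ρ := 0) fun ζ _ => ?_
      rw [mul_add, Finset.mul_sum, mul_comm (K _)]
    · rw [← Finset.sum_congr rfl fun x hx => (hΘ x hx).2.2.2.2 ζ hζ]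
      simp only [monDelta, monSigma, chart_add_period, Finset.sum_sub_distrib]
      ring
  choose! h hh using hloc
  refine ⟨H, h, ⟨h0, finite_mulSet hF.finite_inter hF.zero_notMem hG.finite_inter hG.zero_notMem,
    ⟨fun z hz => ?_, ?_⟩, fun p hp hpn => ?_, fun γ hγ => (hh γ hγ).1⟩, fun γ hγ => (hh γ hγ).2.1,
    fun γ hγ => (hh γ hγ).2.2⟩
  · exact (hHa z fun t ht α hα β hβ hab =>
      hz t ht ⟨α, hα, β, hβ, hab⟩).differentiableAt.differentiableWithinAt
  · simp only [PowerSeries.coeff_mk]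
    exact hH
  · obtain ⟨X, ρ, K, Θ, hX, -, hK, -, hHK⟩ := exists_local_structure rfl hF hfi hG hgi hp hH hHa
    refine ⟨K, hK, ?_⟩
    -- Off the product set there are no factorizations, and the local structure reduces to the
    -- holomorphic `K`.
    have hX0 : X = ∅ := Finset.eq_empty_of_forall_notMem fun x hx =>
      hpn ⟨x.1, ((hX x).mp hx).1, x.2, ((hX x).mp hx).2⟩
    simpa [hX0] using hHK

end TwoFactors

/-! ### Iterated convolutions and turns. -/

section Iterated

variable {ρ : ℝ}

theorem IterConvConverges.mono {ρ' : ℝ} (hρ : ρ' ≤ ρ) : ∀ {n : ℕ} {g : Fin (n + 1) → ℂ → ℂ},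
    IterConvConverges n g ρ → IterConvConverges n g ρ'
  | 0, _, _ => trivial
  | _ + 1, _, h => ⟨IterConvConverges.mono hρ h.1, fun ζ hζ => h.2 ζ (hζ.trans_le hρ)⟩

theorem monSigma_iterate (g : ℂ → ℂ) (k : ℕ) (ζ : ℂ) :
    (monSigma^[k] g) ζ = g (ζ + k * (2 * Real.pi * Complex.I)) := by
  induction k generalizing ζ with
  | zero => simp
  | succ k ih =>
    rw [Function.iterate_succ_apply', monSigma, ih]
    push_cast
    ring_nf

theorem monDelta_monSigma_iterate (g : ℂ → ℂ) (k : ℕ) :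
    monDelta (monSigma^[k] g) = monSigma^[k] (monDelta g) := by
  funext ζ
  simp only [monDelta, monSigma, monSigma_iterate]
  ring_nf

theorem iterConv_monSigma : ∀ (n : ℕ) (g : Fin (n + 1) → ℂ → ℂ),
    iterConv n (fun j => monSigma (g j)) = monSigma (iterConv n g)
  | 0, _ => rfl
  | n + 1, g => by
    rw [iterConv, iterConv, iterConv_monSigma n, conv_monSigma]

theorem iterConvConverges_monSigma : ∀ (n : ℕ) (g : Fin (n + 1) → ℂ → ℂ),
    IterConvConverges n g ρ → IterConvConverges n (fun j => monSigma (g j)) ρ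
  | 0, _, _ => trivial
  | n + 1, g, h => ⟨iterConvConverges_monSigma n _ h.1, fun ζ hζ => by
      rw [iterConv_monSigma n fun j => g j.castSucc, convConverges_monSigma]
      exact h.2 _ (by simpa using hζ)⟩

theorem iterConv_monSigma_iterate (n : ℕ) (g : Fin (n + 1) → ℂ → ℂ) (k : ℕ) :
    iterConv n (fun j => monSigma^[k] (g j)) = monSigma^[k] (iterConv n g) := by
  induction k with
  | zero => rfl
  | succ k ih => simp only [Function.iterate_succ_apply', iterConv_monSigma, ih]

theorem iterConvConverges_monSigma_iterate {n : ℕ} {g : Fin (n + 1) → ℂ → ℂ}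
    (h : IterConvConverges n g ρ) (k : ℕ) :
    IterConvConverges n (fun j => monSigma^[k] (g j)) ρ := by
  induction k with
  | zero => exact h
  | succ k ih =>
    simp only [Function.iterate_succ_apply']
    exact iterConvConverges_monSigma n _ ih

end Iterated

/-! ### Induction on the number of factors. -/

section Families

variable {s : ℤˣ}

/-- The monodromy of the continuation `h` of a Hadamard product around `γ` is the sum of the
iterated convolutions over the factorizations of `γ`. -/
def HasConvMonodromy (n : ℕ) (S : Fin (n + 1) → Set ℂ) (f : Fin (n + 1) → ℂ → ℂ → ℂ)
    (h : ℂ → ℂ) (γ : ℂ) : Prop :=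
  ∃ (N : Finset (Fin (n + 1) → ℂ)) (ρ : ℝ), ρ ≤ 0 ∧ (∀ a, a ∈ N ↔ a ∈ factorizations S γ) ∧
    (∀ a ∈ N, IterConvConverges n (fun j => monDelta (f j (a j))) ρ ∧
      HasVanishingPrimitive ρ (iterConv n fun j => monDelta (f j (a j)))) ∧
    ∀ ζ ∈ halfPlane ρ, monDelta h ζ = ∑ a ∈ N, iterConv n (fun j => monDelta (f j (a j))) ζ

theorem mem_factorizations_castSucc {n : ℕ} {S : Fin (n + 2) → Set ℂ} {b : Fin (n + 2) → ℂ}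
    {γ : ℂ} : b ∈ factorizations S γ ↔
      ((fun j => b j.castSucc) ∈ factorizations (fun j => S j.castSucc) (∏ j : Fin (n + 1), b j.castSucc)) ∧
        b (Fin.last (n + 1)) ∈ S (Fin.last (n + 1)) ∧
        (∏ j : Fin (n + 1), b j.castSucc) * b (Fin.last (n + 1)) = γ := by
  simp only [factorizations, mem_ofPred_eq, Fin.prod_univ_castSucc (n := n + 1), and_true]
  rw [Fin.forall_fin_succ']
  tauto

theorem productSet_succ {n : ℕ} (S : Fin (n + 2) → Set ℂ) :
    productSet S = mulSet (productSet fun j => S j.castSucc) (S (Fin.last (n + 1))) := by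
  ext γ
  constructor
  · rintro ⟨b, hb⟩
    obtain ⟨h1, h2, h3⟩ := mem_factorizations_castSucc.mp hb
    exact ⟨_, ⟨_, h1⟩, _, h2, h3⟩
  · rintro ⟨δ, ⟨a, ha⟩, β, hβ, h⟩
    have h1 : ∏ j, a j = δ := ha.2
    refine ⟨Fin.snoc (α := fun _ => ℂ) a β, mem_factorizations_castSucc.mpr ?_⟩
    simp only [Fin.snoc_castSucc, Fin.snoc_last, h1]
    exact ⟨ha, hβ, h⟩

theorem hadamardProd_succ {n : ℕ} (F : Fin (n + 2) → PowerSeries ℂ) :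
    hadamardProd F = PowerSeries.mk fun k =>
      PowerSeries.coeff k (hadamardProd fun j => F j.castSucc) *
        PowerSeries.coeff k (F (Fin.last (n + 1))) := by
  ext k
  simp only [hadamardProd, PowerSeries.coeff_mk, Fin.prod_univ_castSucc (n := n + 1)]

theorem hasConvMonodromy_zero {S : Fin 1 → Set ℂ} {f : Fin 1 → ℂ → ℂ → ℂ} {P : ℂ → ℂ} {γ : ℂ}
    (hγ0 : γ ≠ 0) (hγ : γ ∈ S 0) (hf : IsLocalBranch s P γ (f 0 γ))
    (hi : IsIntegrableSingularity γ (f 0 γ)) : HasConvMonodromy 0 S f (f 0 γ) γ := by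
  obtain ⟨ρ, hd, -⟩ := hf
  refine ⟨{fun _ => γ}, min ρ 0, min_le_right _ _, fun a => ?_, fun a ha => ?_, fun ζ _ => ?_⟩
  · rw [Finset.mem_singleton]
    constructor
    · rintro rfl
      refine ⟨fun j => ?_, by simp⟩
      rwa [(Fin.eq_zero j : j = 0)]
    · rintro ⟨-, h⟩
      funext j
      rw [(Fin.eq_zero j : j = 0)]
      simpa using h
  · rw [Finset.mem_singleton] at ha
    subst ha
    exact ⟨trivial, hasVanishingPrimitive_monDelta (min_le_right _ _)
      (hd.mono (halfPlane_mono (min_le_left _ _))) ((isIntegrableSingularity_iff hγ0).mp hi)⟩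
  · rw [Finset.sum_singleton]
    rfl

/-- A factorization of `γ` is a pair `(δ, β)` with `δ β = γ` together with a factorization of `δ`.
The formula for the monodromy at each `δ` is inserted into the two-factor formula and expanded by
linearity in the first argument. -/
theorem hasConvMonodromy_succ {n : ℕ} {S : Fin (n + 2) → Set ℂ} {f : Fin (n + 2) → ℂ → ℂ → ℂ}
    {h' : ℂ → ℂ → ℂ} (hh' : ∀ γ ∈ productSet (fun j => S j.castSucc),
      HasConvMonodromy n (fun j => S j.castSucc) (fun j => f j.castSucc) (h' γ) γ)
    {h : ℂ → ℂ} {γ : ℂ} {X : Finset (ℂ × ℂ)} {ρ : ℝ} (hρ : ρ ≤ 0)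
    (hX : ∀ x, x ∈ X ↔ x.1 ∈ productSet (fun j => S j.castSucc) ∧ x.2 ∈ S (Fin.last (n + 1)) ∧
      x.1 * x.2 = γ)
    (hv : ∀ x ∈ X, HasVanishingPrimitive ρ (monDelta (h' x.1)) ∧
      HasVanishingPrimitive ρ (monDelta (f (Fin.last (n + 1)) x.2)))
    (hm : ∀ ζ ∈ halfPlane ρ, monDelta h ζ =
      ∑ x ∈ X, conv (monDelta (h' x.1)) (monDelta (f (Fin.last (n + 1)) x.2)) ζ) :
    HasConvMonodromy (n + 1) S f h γ := by
  classical
  choose! N ρ' hρ' hN hconv hmon using hh'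
  obtain ⟨ρ₀, hρ₀⟩ := (insert ρ (X.image fun x => ρ' x.1)).bddBelow
  have h1 : ρ₀ ≤ ρ := hρ₀ (Finset.mem_insert_self _ _)
  have h2 : ∀ x ∈ X, ρ₀ ≤ ρ' x.1 := fun x hx =>
    hρ₀ (Finset.mem_insert_of_mem (Finset.mem_image_of_mem _ hx))
  have h0 : ρ₀ ≤ 0 := h1.trans hρ
  set snoc : (Σ _ : ℂ × ℂ, Fin (n + 1) → ℂ) → (Fin (n + 2) → ℂ) := fun y =>
    Fin.snoc (α := fun _ => ℂ) y.2 y.1.2 with hsnoc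
  have hcs : ∀ (y : Σ _ : ℂ × ℂ, Fin (n + 1) → ℂ) (j : Fin (n + 1)), snoc y j.castSucc = y.2 j :=
    fun y j => by simp [hsnoc]
  have hla : ∀ y, snoc y (Fin.last (n + 1)) = y.1.2 := fun y => by simp [hsnoc]
  have hmem : ∀ y ∈ X.sigma fun x => N x.1, y.1 ∈ X ∧ y.2 ∈ N y.1.1 ∧ ∏ j, y.2 j = y.1.1 :=
    fun y hy => by
      obtain ⟨i1, i2⟩ := Finset.mem_sigma.mp hy
      exact ⟨i1, i2, ((hN _ ((hX _).mp i1).1 _).mp i2).2⟩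
  have hinj : Set.InjOn snoc (X.sigma fun x => N x.1) := by
    intro y hy y' hy' heq
    have e1 : y.2 = y'.2 := funext fun j => by rw [← hcs, ← hcs, heq]
    have e2 : y.1.2 = y'.1.2 := by rw [← hla, ← hla, heq]
    -- The intermediate product `δ` is not recorded by `snoc`, but it is the product of the first
    -- entries.
    have e3 : y.1.1 = y'.1.1 := by rw [← (hmem y hy).2.2, ← (hmem y' hy').2.2, e1]
    obtain ⟨⟨a, b⟩, c⟩ := y
    obtain ⟨⟨a', b'⟩, c'⟩ := y'
    simp only at e1 e2 e3
    rw [e1, e2, e3]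
  have hterm : ∀ y : Σ _ : ℂ × ℂ, Fin (n + 1) → ℂ,
      (iterConv (n + 1) fun j => monDelta (f j (snoc y j))) =
        conv (iterConv n fun j => monDelta (f j.castSucc (y.2 j)))
          (monDelta (f (Fin.last (n + 1)) y.1.2)) := fun y => by
    simp only [iterConv, hcs, hla]
  have hcv : ∀ x ∈ X, ∀ a ∈ N x.1,
      HasVanishingPrimitive ρ₀ (iterConv n fun j => monDelta (f j.castSucc (a j))) :=
    fun x hx a ha => (hconv _ ((hX x).mp hx).1 a ha).2.mono (h2 x hx)
  have hlv : ∀ x ∈ X, HasVanishingPrimitive ρ₀ (monDelta (f (Fin.last (n + 1)) x.2)) :=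
    fun x hx => (hv x hx).2.mono h1
  refine ⟨(X.sigma fun x => N x.1).image snoc, ρ₀, h0, fun b => ?_, fun b hb => ?_,
    fun ζ hζ => ?_⟩
  · rw [Finset.mem_image, mem_factorizations_castSucc]
    constructor
    · rintro ⟨y, hy, rfl⟩
      obtain ⟨i1, i2, i3⟩ := hmem y hy
      obtain ⟨j1, j2, j3⟩ := (hX _).mp i1
      simp only [hcs, hla, i3]
      exact ⟨(hN _ j1 _).mp i2, j2, j3⟩
    · rintro ⟨i1, i2, i3⟩
      refine ⟨⟨(∏ j : Fin (n + 1), b j.castSucc, b (Fin.last (n + 1))), fun j => b j.castSucc⟩,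
        Finset.mem_sigma.mpr ⟨(hX _).mpr ⟨⟨_, i1⟩, i2, i3⟩, (hN _ ⟨_, i1⟩ _).mpr i1⟩, ?_⟩
      funext j
      refine Fin.lastCases ?_ (fun j => ?_) j
      · rw [hla]
      · rw [hcs]
  · obtain ⟨y, hy, rfl⟩ := Finset.mem_image.mp hb
    obtain ⟨i1, i2, i3⟩ := hmem y hy
    have k1 := hcv _ i1 _ i2
    have k2 := hlv _ i1
    rw [hterm]
    refine ⟨⟨?_, ?_⟩, k1.conv h0 k2⟩
    · simp only [hcs]
      exact (hconv _ ((hX _).mp i1).1 _ i2).1.mono (h2 _ i1)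
    · simp only [hcs, hla]
      exact k1.convConverges h0 k2
  · rw [hm ζ (halfPlane_mono h1 hζ), Finset.sum_image hinj, Finset.sum_sigma]
    refine Finset.sum_congr rfl fun x hx => ?_
    have hx' := (hX x).mp hx
    simp only [hterm]
    rw [conv_congr h0 (fun w hw => hmon _ hx'.1 w (halfPlane_mono (h2 x hx) hw))
      (fun w _ => rfl) hζ]
    exact conv_sum fun a ha => (hcv x hx a ha).convConverges h0 (hlv x hx) ζ hζ

/-- Hadamard products of finitely many germs with isolated integrable singularities. -/
theorem exists_hasConvMonodromy : ∀ (n : ℕ) (F : Fin (n + 1) → PowerSeries ℂ)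
    (S : Fin (n + 1) → Set ℂ) (P : Fin (n + 1) → ℂ → ℂ) (f : Fin (n + 1) → ℂ → ℂ → ℂ),
    (∀ j, HasIsolatedSingularities s (F j) (S j) (P j) (f j)) →
    (∀ j, ∀ α ∈ S j, IsIntegrableSingularity α (f j α)) →
    ∃ (H : ℂ → ℂ) (h : ℂ → ℂ → ℂ),
      HasIsolatedSingularities s (hadamardProd F) (productSet S) H h ∧
      (∀ γ ∈ productSet S, IsIntegrableSingularity γ (h γ)) ∧
      ∀ γ ∈ productSet S, HasConvMonodromy n S f (h γ) γ
  | 0, F, S, P, f, hiso, hint => by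
    have hF : hadamardProd F = F 0 := by
      ext k
      simp [hadamardProd]
    have hS : productSet S = S 0 := by
      ext γ
      constructor
      · rintro ⟨a, ha, h⟩
        have : a 0 = γ := by simpa using h
        exact this ▸ ha 0
      · intro h
        refine ⟨fun _ => γ, fun j => ?_, by simp⟩
        rwa [(Fin.eq_zero j : j = 0)]
    rw [hF, hS]
    exact ⟨P 0, f 0, hiso 0, hint 0, fun γ hγ => hasConvMonodromy_zero
      (fun h => (hiso 0).zero_notMem (h ▸ hγ)) hγ ((hiso 0).localBranch γ hγ) (hint 0 γ hγ)⟩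
  | n + 1, F, S, P, f, hiso, hint => by
    obtain ⟨H', h', hH', hi', hm'⟩ := exists_hasConvMonodromy n (fun j => F j.castSucc)
      (fun j => S j.castSucc) (fun j => P j.castSucc) (fun j => f j.castSucc)
      (fun j => hiso j.castSucc) (fun j => hint j.castSucc)
    obtain ⟨H, h, hH, hi, hm⟩ := hasIsolatedSingularities_hadamard hH' hi'
      (hiso (Fin.last (n + 1))) (hint (Fin.last (n + 1)))
    rw [hadamardProd_succ, productSet_succ]
    refine ⟨H, h, hH, hi, fun γ hγ => ?_⟩
    obtain ⟨X, ρ, hρ, hX, hv, hmon⟩ := hm γ hγ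
    exact hasConvMonodromy_succ hm' hρ hX hv hmon

end Families

end HadamardMonodromy

/-! ### Powers of the monodromy. -/

theorem mainTheorem3 (s : ℤˣ) (n : ℕ) (F : Fin (n + 1) → PowerSeries ℂ)
    (S : Fin (n + 1) → Set ℂ) (P : Fin (n + 1) → ℂ → ℂ) (f : Fin (n + 1) → ℂ → ℂ → ℂ)
    (hiso : ∀ j, HadamardMonodromy.HasIsolatedSingularities s (F j) (S j) (P j) (f j))
    (hint : ∀ j, ∀ α ∈ S j, HadamardMonodromy.IsIntegrableSingularity α (f j α)) :
    ∃ (H : ℂ → ℂ) (h : ℂ → ℂ → ℂ),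
      HadamardMonodromy.HasIsolatedSingularities s (HadamardMonodromy.hadamardProd F)
        (HadamardMonodromy.productSet S) H h ∧
      ∀ γ ∈ HadamardMonodromy.productSet S,
        (HadamardMonodromy.factorizations S γ).Finite ∧
        ∃ ρ : ℝ,
          (∀ k : ℕ, ∀ a ∈ HadamardMonodromy.factorizations S γ,
            HadamardMonodromy.IterConvConverges n
              (fun j => HadamardMonodromy.monDelta (HadamardMonodromy.monSigma^[k] (f j (a j))))
              ρ) ∧
          ∀ N : ℕ, 1 ≤ N → ∀ ζ : ℂ, ζ.re < ρ →
            (HadamardMonodromy.monSigma^[N] (h γ)) ζ - h γ ζ =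
              ∑ k ∈ Finset.range N, ∑ᶠ a ∈ HadamardMonodromy.factorizations S γ,
                HadamardMonodromy.iterConv n
                  (fun j =>
                    HadamardMonodromy.monDelta (HadamardMonodromy.monSigma^[k] (f j (a j)))) ζ := by
  obtain ⟨H, h, hH, -, hm⟩ := HadamardMonodromy.exists_hasConvMonodromy n F S P f hiso hint
  refine ⟨H, h, hH, fun γ hγ => ?_⟩
  obtain ⟨A, ρ, -, hA, hconv, hmon⟩ := hm γ hγ
  have hset : HadamardMonodromy.factorizations S γ = (A : Set (Fin (n + 1) → ℂ)) := by
    ext a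
    exact (hA a).symm
  refine ⟨hset ▸ A.finite_toSet, ρ, fun k a ha => ?_, fun N _ ζ hζ => ?_⟩
  · simp only [HadamardMonodromy.monDelta_monSigma_iterate]
    exact HadamardMonodromy.iterConvConverges_monSigma_iterate (hconv a ((hA a).mpr ha)).1 k
  -- `Σ^N - Id` telescopes into the sum of `Σ^k Δ`. The shift by `2 π i k` preserves `Re ζ`, so the
  -- half plane found for one turn serves for every `k`.
  · have h1 := Finset.sum_range_sub (fun k => (HadamardMonodromy.monSigma^[k] (h γ)) ζ) N
    simp only [Function.iterate_zero, id_eq] at h1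
    rw [← h1]
    refine Finset.sum_congr rfl fun k _ => ?_
    have h2 : (HadamardMonodromy.monSigma^[k + 1] (h γ)) ζ -
        (HadamardMonodromy.monSigma^[k] (h γ)) ζ =
        (HadamardMonodromy.monSigma^[k] (HadamardMonodromy.monDelta (h γ))) ζ := by
      rw [← HadamardMonodromy.monDelta_monSigma_iterate, Function.iterate_succ_apply']
      rfl
    rw [h2, HadamardMonodromy.monSigma_iterate, hmon _ (by simpa [HadamardMonodromy.halfPlane]),
      hset, finsum_mem_coe_finset]
    refine Finset.sum_congr rfl fun a _ => ?_
    simp only [HadamardMonodromy.monDelta_monSigma_iterate]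
    rw [HadamardMonodromy.iterConv_monSigma_iterate, HadamardMonodromy.monSigma_iterate]
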